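/- **Setting.** Types are $\mathsf{Fin}\langle N\rangle$ with $N\ge 1$ and value set $\{0,\dots,N-1\}$; $\mathsf{Bool}=\mathsf{Fin}\langle 2\rangle$. A typing context $\Gamma$ is a finite list of distinct typed variables, $\Sigma_\Gamma$ is the set of labelled tuples of values, $\mathcal H_\Gamma=\mathbb C^{\Sigma_\Gamma}$, and ";" is concatenation. *Source language Cpl.* Statements are $x\leftarrow E$, $S_1;S_2$, $\vec y\leftarrow f(\vec x)$ and $b\leftarrow\mathtt{any}[f](\vec x)$. Expressions $E$ are built from variables, constants, not, $=$, $<$, $+$ (modulo $N$), and, or. A function context $\Phi$ is a list of distinctly named functions, each either declared (only typed inputs and outputs) or defined (distinct typed parameters, a well-typed body, a tuple of distinct returned variables computed in the body); a function may only call functions defined before it. $\Phi;\Gamma\vdash S:\Gamma'$ means that $S$ is well typed and extends $\Gamma$ to $\Gamma'$: assigned variables are new, types match, and no variable is passed twice in the argument list $\vec x$ of one call; in $\mathtt{any}[f](\vec x)$, $f$ returns one $\mathsf{Bool}$ and $\vec x$ are all its arguments but the last. Given an interpretation $\hat F$ of each declared function by a function on values of its input types, $S$ with $\Phi;\Gamma_{\rm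 in}\vdash S:\Gamma_{\rm in};\Gamma_{\rm out}$ has the evident semantics $[\![S]\!]:\Sigma_{\Gamma_{\rm in}}\to\Sigma_{\Gamma_{\rm out}}$, where $b\leftarrow\mathtt{any}[f](\vec x)$ sets $b=1$ iff $f(\vec x,v)=1$ for some value $v$ of the last argument, and otherwise $b=0$. *Target language BlockQpl (unitary part).* Statements are skip, application of a unitary to distinct variables, $W_1;W_2$, and calls of a procedure $g$ or of $g^\dagger$ on distinct variables. The unitaries are $X,Z,H$, CNOT, $\mathsf{Unif}_N$ (the Fourier transform $\mathrm{QFT}_N$), $\mathsf{Refl}_0=2|0\rangle\langle0|-I$, embeddings $|\sigma\rangle|w\rangle\mapsto|\sigma\rangle|w+E(\sigma)\rangle$ of expressions, adjoints and controlled versions. A procedure is defined (distinct arguments, body) or declared (arguments, cost). Procedures may only call earlier ones. Given unitaries for the declared procedures, each well-typed $W$ denotes a unitary on $\mathcal H_\Gamma$. For $f:\Sigma_{\Gamma_{\rm in}}\to\Sigma_{\Gamma_{\rm out}}$ let $\mathsf{Embed}[f]|\sigma\rangle|\omega\rangle=|\sigma\rangle|\omega\oplus f(\sigma)\rangle$,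 with componentwise addition modulo the sizes of the types. *Compilation.* $\mathrm{UCompile}[\delta](S)=(W,\Gamma_{\rm aux},\Pi)$, with fresh auxiliary variables $\Gamma_{\rm aux}$ and generated procedures $\Pi$, is defined by recursion, together with $\mathrm{UCompileFun}[\delta](f)$, which gives a procedure that may leave garbage in its workspace. - A declared $f$ becomes a declared procedure on its inputs and outputs. A defined $f$ becomes the procedure whose body is the compilation of the body of $f$ with precision $\delta$. - $x\leftarrow E$ becomes the embedding of $E$. $S_1;S_2$ becomes $W_1;W_2$, with both parts compiled with precision $\delta/2$. - $\vec y\leftarrow f(\vec x)$ becomes a call of $\mathsf{Clean}[g]$: call $g$, add its outputs to $\vec y$, call $g^\dagger$, where $g=\mathrm{UCompileFun}[\delta/2](f)$. - $b\leftarrow\mathtt{any}[f](\vec x)$, with search space $\mathsf{Fin}\langle N\rangle$, becomes a call of the search procedure $\mathsf{UAny}$ with norm error $\delta_s=\delta/2$ for the predicate $g=\mathrm{UCompileFun}[\delta_p/2](f)$, where $\delta_p=(\delta-\delta_s)/Q$, $Q=2N_gN_r$, $N_g=\lceil\frac\pi4\sqrt N\rceil$ and $N_r=\lceil\ln(\delta_s^2/4)/\ln(1-0.37)\rceil$.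 $\mathsf{UAny}$ computes a bit $b''$, adds it to $b$ and uncomputes. To compute $b''$, it makes $N_r$ runs of Grover search, each with its own registers $\mathsf{xs}:\mathsf{Fin}\langle N\rangle$, $\mathsf{ok}:\mathsf{Bool}$, $n:\mathsf{Fin}\langle N_g\rangle$, and then adds the disjunction of the bits $\mathsf{ok}$ to $b''$. One run puts $n$ and $\mathsf{xs}$ into uniform superposition and $\mathsf{ok}$ into $|-\rangle$. For $l=1,\dots,N_g-1$ it then applies the predicate to $(\mathsf{xs},\mathsf{ok})$ controlled on $n<l$, followed by $\mathsf{Unif}_N\,\mathsf{Refl}_0\,\mathsf{Unif}_N^\dagger$ on $\mathsf{xs}$. It then undoes the preparation of $n$ and $\mathsf{ok}$, and writes the predicate of $\mathsf{xs}$ to $\mathsf{ok}$. Each use of the predicate is a controlled $\mathsf{Clean}[g]$, in which the copy of the output is controlled. **Theorem (Unitary Compilation preserves Semantics).** Let $\Phi$ be a well-formed function context, $\hat F$ an interpretation of its declared functions, $S$ a Cpl statement with $\Phi;\Gamma_{\rm in}\vdash S:\Gamma_{\rm in};\Gamma_{\rm out}$, and $\delta\in(0,1]$. Then $\mathrm{UCompile}[\delta](S)=(W,\Gamma_{\rm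 aux},\Pi)$ is defined, $\Gamma_{\rm aux}$ is disjoint from $\Gamma_{\rm in};\Gamma_{\rm out}$, $\Pi$ is well typed, and $W$ is well typed under $\Pi$ and $\Gamma_{\rm in};\Gamma_{\rm out};\Gamma_{\rm aux}$. Let $U$ be the semantics of $W$, where each declared procedure $f$ is interpreted as $\mathsf{Embed}[\hat F(f)]$. Then $U$ is unitary and $$\Bigl\|\,U\,\bigl(I_{\Gamma_{\rm in}}\otimes|0\rangle_{\Gamma_{\rm out};\Gamma_{\rm aux}}\bigr)-\bigl(\mathsf{Embed}[\,[\![S]\!]\,]\otimes I_{\Gamma_{\rm aux}}\bigr)\bigl(I_{\Gamma_{\rm in}}\otimes|0\rangle_{\Gamma_{\rm out};\Gamma_{\rm aux}}\bigr)\Bigr\|\le\delta$$ in operator norm. -/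

import Mathlib

namespace Traq

/-! ## Types, contexts and states -/

/-- Variable names. -/
abbrev Var := ℕ

/-- Names of source-language functions. -/
abbrev FName := ℕ

/-- The type `Fin<N>` (with `N ≥ 1`) is represented by `N`; its values are `0, …, N - 1`. -/
abbrev Ty := ℕ+

/-- `Bool` is `Fin<2>`. -/
abbrev boolTy : Ty := 2

/-- A typing context: a finite list of typed variables.  It is a mapping when the names are distinct,
and concatenation of contexts is `++`. -/
abbrev Ctx := List (Var × Ty)

/-- The variables of a context, in order. -/
def Ctx.keys (Γ : Ctx) : List Var := Γ.map Prod.fst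

/-- The types of a context, in order. -/
def Ctx.tys (Γ : Ctx) : List Ty := Γ.map Prod.snd

/-- The type `Γ[x]`, if `x ∈ Γ`. -/
def Ctx.get (Γ : Ctx) (x : Var) : Option Ty := List.lookup x Γ

/-- The number of values of a variable; a variable outside of the context has the only value `0`. -/
def Ctx.dim (Γ : Ctx) (x : Var) : ℕ := (((Ctx.get Γ x).getD 1 : Ty) : ℕ)

/-- The context `{k : T₀, k + 1 : T₁, …}` with consecutive names. -/
def Ctx.consec (k : ℕ) : List Ty → Ctx
  | [] => []
  | T :: Ts => (k, T) :: Ctx.consec (k + 1) Ts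

/-- A number that is larger than all names in a context. -/
def Ctx.fresh (Γ : Ctx) : ℕ := (Ctx.keys Γ).foldr max 0 + 1

/-- Environments: raw assignments of values to all names. -/
abbrev Env := Var → ℕ

/-- Simultaneous update of `xs` to `vs`. -/
def Env.set (σ : Env) (xs : List Var) (vs : List ℕ) : Env :=
  fun x => ((xs.zip vs).lookup x).getD (σ x)

/-- The value space `Σ_Γ`.  A labelled tuple over `Γ` is represented by its extension by `0`
to all names. -/
def State (Γ : Ctx) : Type := {σ : Env // ∀ x, σ x < Ctx.dim Γ x}

theorem Ctx.dim_pos (Γ : Ctx) (x : Var) : 0 < Ctx.dim Γ x := PNat.pos _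

theorem Ctx.dim_of_not_mem (Γ : Ctx) (x : Var) (h : x ∉ Ctx.keys Γ) : Ctx.dim Γ x = 1 := by
  have : Ctx.get Γ x = none := by
    unfold Ctx.get
    rw [List.lookup_eq_none_iff]
    intro p hp
    simp only [ne_eq, bne_iff_ne]
    rintro rfl
    exact h (List.mem_map_of_mem (f := Prod.fst) hp)
  simp [Ctx.dim, this]

/-- The restriction of an environment to a context.  (Values are reduced into their range, which has
no effect on environments that respect the context.) -/
def State.ofEnv (Γ : Ctx) (σ : Env) : State Γ :=
  ⟨fun x => σ x % Ctx.dim Γ x, fun x => Nat.mod_lt _ (Ctx.dim_pos Γ x)⟩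

instance State.finite (Γ : Ctx) : Finite (State Γ) := by
  refine Finite.of_injective
    (β := (x : {x // x ∈ Ctx.keys Γ}) → Fin (Ctx.dim Γ x.1))
    (fun σ x => ⟨σ.1 x.1, σ.2 x.1⟩) ?_
  intro σ τ h
  apply Subtype.ext
  funext x
  by_cases hx : x ∈ Ctx.keys Γ
  · have := congrFun h ⟨x, hx⟩
    simpa using this
  · have h1 := σ.2 x
    have h2 := τ.2 x
    rw [Ctx.dim_of_not_mem Γ x hx] at h1 h2
    omega

noncomputable instance State.fintype (Γ : Ctx) : Fintype (State Γ) := Fintype.ofFinite _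

noncomputable instance State.decEq (Γ : Ctx) : DecidableEq (State Γ) := Classical.decEq _

/-! ## Expressions (shared by both languages) -/

inductive Bop
  | eq | lt | add | and | or

inductive Expr
  | var (x : Var)
  | const (v : ℕ) (T : Ty)
  | not (E : Expr)
  | bin (o : Bop) (E₁ E₂ : Expr)

/-- The typing judgement `Γ ⊢ E : T` holds iff `E.type Γ = some T`. -/
def Expr.type (Γ : Ctx) : Expr → Option Ty
  | .var x => Ctx.get Γ x
  | .const v T => if v < (T : ℕ) then some T else none
  | .not E => if E.type Γ = some boolTy then some boolTy else none
  | .bin .eq E₁ E₂ | .bin .lt E₁ E₂ =>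
      if (E₁.type Γ).isSome ∧ E₁.type Γ = E₂.type Γ then some boolTy else none
  | .bin .add E₁ E₂ => if E₁.type Γ = E₂.type Γ then E₁.type Γ else none
  | .bin .and E₁ E₂ | .bin .or E₁ E₂ =>
      if E₁.type Γ = some boolTy ∧ E₂.type Γ = some boolTy then some boolTy else none

/-- The value `⟦E⟧(σ)`.  Addition on `Fin<N>` is modulo `N`. -/
def Expr.eval (Γ : Ctx) (σ : Env) : Expr → ℕ
  | .var x => σ x
  | .const v _ => v
  | .not E => 1 - E.eval Γ σ
  | .bin .eq E₁ E₂ => if E₁.eval Γ σ = E₂.eval Γ σ then 1 else 0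
  | .bin .lt E₁ E₂ => if E₁.eval Γ σ < E₂.eval Γ σ then 1 else 0
  | .bin .add E₁ E₂ => (E₁.eval Γ σ + E₂.eval Γ σ) % (((E₁.type Γ).getD 1 : Ty) : ℕ)
  | .bin .and E₁ E₂ => if E₁.eval Γ σ = 1 ∧ E₂.eval Γ σ = 1 then 1 else 0
  | .bin .or E₁ E₂ => if E₁.eval Γ σ = 1 ∨ E₂.eval Γ σ = 1 then 1 else 0

/-- The variables of an expression, without repetitions. -/
def Expr.vars : Expr → List Var
  | .var x => [x]
  | .const _ _ => []
  | .not E => E.vars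
  | .bin _ E₁ E₂ => E₁.vars ∪ E₂.vars

/-! ## The source language Cpl -/

/-- Statements: `x ← E`, `S₁; S₂`, `ys ← f(xs)` and `b ← any[f](xs)`. -/
inductive Stmt
  | assign (x : Var) (E : Expr)
  | seq (S₁ S₂ : Stmt)
  | call (ys : List Var) (f : FName) (xs : List Var)
  | any (b : Var) (f : FName) (xs : List Var)

/-- Functions: definitions (typed parameters, return types, body, returned variables) and
declarations (input and output types). -/
inductive Fun
  | defn (params : Ctx) (retTys : List Ty) (body : Stmt) (rets : List Var)
  | decl (inTys outTys : List Ty)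

def Fun.inCtx : Fun → Ctx
  | .defn params _ _ _ => params
  | .decl inTys _ => Ctx.consec 0 inTys

def Fun.outCtx : Fun → Ctx
  | .defn _ retTys _ rets => rets.zip retTys
  | .decl inTys outTys => Ctx.consec inTys.length outTys

def Fun.inTys (F : Fun) : List Ty := Ctx.tys F.inCtx

def Fun.outTys (F : Fun) : List Ty := Ctx.tys F.outCtx

/-- A function context: the functions of a program, the most recent definition first.  A function
may only call functions that were defined before it, i.e. that are in the tail behind it. -/
abbrev FunCtx := List (FName × Fun)

/-- The typing judgement `Φ; Γ ⊢ S : Γ'` holds iff `S.type Φ Γ = some Γ'`.  The output context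
is the input context followed by the newly assigned variables.  In a call, no variable is
passed twice (arguments are quantum variables after compilation). -/
def Stmt.type (Φ : FunCtx) : Ctx → Stmt → Option Ctx
  | Γ, .assign x E =>
      if x ∉ Ctx.keys Γ then (E.type Γ).map (fun T => Γ ++ [(x, T)]) else none
  | Γ, .seq S₁ S₂ => (S₁.type Φ Γ).bind (fun Γ' => S₂.type Φ Γ')
  | Γ, .call ys f xs =>
      (Φ.lookup f).bind fun F =>
        if ys.Nodup ∧ (∀ y ∈ ys, y ∉ Ctx.keys Γ) ∧ ys.length = F.outTys.length ∧
            xs.Nodup ∧ xs.map (Ctx.get Γ) = F.inTys.map some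
        then some (Γ ++ ys.zip F.outTys) else none
  | Γ, .any b f xs =>
      (Φ.lookup f).bind fun F =>
        if b ∉ Ctx.keys Γ ∧ F.outTys = [boolTy] ∧ F.inTys ≠ [] ∧
            xs.Nodup ∧ xs.map (Ctx.get Γ) = F.inTys.dropLast.map some
        then some (Γ ++ [(b, boolTy)]) else none

/-- A function is well formed with respect to the functions defined before it: parameters are
distinct, the body is well typed, and the returned variables are distinct variables computed by
the body, of the return types. -/
def Fun.WF (Φ : FunCtx) : Fun → Prop
  | .defn params retTys body rets =>
      (Ctx.keys params).Nodup ∧ rets.Nodup ∧ (∀ y ∈ rets, y ∉ Ctx.keys params) ∧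
      ∃ Γ', body.type Φ params = some Γ' ∧ rets.map (Ctx.get Γ') = retTys.map some
  | .decl _ _ => True

/-- A function context is well formed if the names are distinct and every function is well formed
with respect to the functions defined before it. -/
def FunCtx.WF : FunCtx → Prop
  | [] => True
  | (f, F) :: Φ => f ∉ Φ.map Prod.fst ∧ F.WF Φ ∧ FunCtx.WF Φ

/-- An interpretation context: it assigns to the name of a declared function a function from the
values of its inputs to the values of its outputs. -/
abbrev Interp := FName → (Ωin Ωout : Ctx) → State Ωin → State Ωout

/-- Execution of a statement, given the semantics `ρ` of the functions.  For a well-typed statement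
the result on `σ ∈ Σ_Γ` is the concatenation of `σ` with the newly assigned variables. -/
def Stmt.exec (Φ : FunCtx) (ρ : FName → List ℕ → List ℕ) : Ctx → Stmt → Env → Env
  | Γ, .assign x E, σ => Env.set σ [x] [E.eval Γ σ]
  | Γ, .seq S₁ S₂, σ => S₂.exec Φ ρ ((S₁.type Φ Γ).getD Γ) (S₁.exec Φ ρ Γ σ)
  | _, .call ys f xs, σ => Env.set σ ys (ρ f (xs.map σ))
  | _, .any b f xs, σ =>
      let N : ℕ := ((((Φ.lookup f).bind fun F => F.inTys.getLast?).getD 1 : Ty) : ℕ)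
      open Classical in
      Env.set σ [b] [if ∃ v, v < N ∧ ρ f (xs.map σ ++ [v]) = [1] then 1 else 0]

/-- The function from argument values to result values computed by a source function. -/
def FunCtx.sem (F : Interp) : FunCtx → FName → List ℕ → List ℕ
  | [], _, _ => []
  | (h, G) :: Φ, f, vs =>
      if f = h then
        match G with
        | .defn params _ body rets =>
            rets.map (body.exec Φ (FunCtx.sem F Φ) params (Env.set 0 (Ctx.keys params) vs))
        | .decl _ _ =>
            (Ctx.keys G.outCtx).map
              (F f G.inCtx G.outCtx (State.ofEnv _ (Env.set 0 (Ctx.keys G.inCtx) vs))).1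
      else FunCtx.sem F Φ f vs

/-- The denotational semantics `⟦S⟧ : Σ_Γin → Σ_Γout` of a statement with
`Φ; Γin ⊢ S : Γin; Γout`. -/
def Stmt.den (Φ : FunCtx) (F : Interp) (Γin Γout : Ctx) (S : Stmt) (σ : State Γin) : State Γout :=
  State.ofEnv Γout (S.exec Φ (FunCtx.sem F Φ) Γin σ.1)

/-! ## The target language BlockQpl, unitary fragment -/

inductive UOp
  | X | Z | H | CNOT
  | embed (xs : List Var) (E : Expr)
  | unif (T : Ty)
  | refl0 (T : Ty)
  | adj (U : UOp)
  | ctrl (U : UOp)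

inductive PName
  | source (f : FName)
  | gen (i : ℕ)
  deriving DecidableEq

inductive UStmt
  | skip
  | app (qs : List Var) (U : UOp)
  | seq (W₁ W₂ : UStmt)
  | call (g : PName) (qs : List Var)
  | callAdj (g : PName) (qs : List Var)

/-- Unitary procedures: definitions, and declarations with their cost. -/
inductive UProc
  | defn (Ω : Ctx) (W : UStmt)
  | decl (Ω : Ctx) (tick : ℕ)

def UProc.args : UProc → Ctx
  | .defn Ω _ => Ω
  | .decl Ω _ => Ω

/-- A procedure context, the most recent definition first. -/
abbrev ProcCtx := List (PName × UProc)

/-- The typing judgement `U : (T₁, …, T_k)`. -/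
def UOp.WT : UOp → List Ty → Prop
  | .X, Ts | .Z, Ts | .H, Ts => Ts = [boolTy]
  | .CNOT, Ts => Ts = [boolTy, boolTy]
  | .embed xs E, Ts => xs.Nodup ∧
      ∃ Ts' T, Ts = Ts' ++ [T] ∧ xs.length = Ts'.length ∧ E.type (xs.zip Ts') = some T
  | .unif T, Ts | .refl0 T, Ts => Ts = [T]
  | .adj U, Ts => U.WT Ts
  | .ctrl U, Ts => ∃ Ts', Ts = boolTy :: Ts' ∧ U.WT Ts'

/-- The typing judgement `Π; Γ ⊢ W`.  The variables that an operation acts on are distinct. -/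
def UStmt.WT (Q : ProcCtx) (Γ : Ctx) : UStmt → Prop
  | .skip => True
  | .app qs U => qs.Nodup ∧ ∃ Ts, qs.map (Ctx.get Γ) = Ts.map some ∧ U.WT Ts
  | .seq W₁ W₂ => W₁.WT Q Γ ∧ W₂.WT Q Γ
  | .call g qs | .callAdj g qs => qs.Nodup ∧
      ∃ G, Q.lookup g = some G ∧ qs.map (Ctx.get Γ) = (Ctx.tys G.args).map some

/-- Every procedure has distinct arguments and a body that is well typed with respect to the
procedures defined before it. -/
def ProcCtx.WT : ProcCtx → Prop
  | [] => True
  | (_, G) :: Q => (Ctx.keys G.args).Nodup ∧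
      (match G with
        | .defn Ω W => W.WT Q Ω
        | .decl _ _ => True) ∧ ProcCtx.WT Q

/-- Operators on `H_Γ`, as matrices in the standard basis, which is labelled by `Σ_Γ`. -/
abbrev Op (Γ : Ctx) := Matrix (State Γ) (State Γ) ℂ

open Classical in
/-- The operator `U_qs` on `H_Γ` obtained by letting the operator `U`, on variables `Ω`, act on the
variables `qs` of `Γ` (in the same order), and the identity on all others. -/
noncomputable def Op.at (Γ : Ctx) (qs : List Var) (Ω : Ctx) (U : Op Ω) : Op Γ :=
  Matrix.of fun τ σ =>
    if ∀ x, x ∉ qs → τ.1 x = σ.1 x then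
      U (State.ofEnv Ω (Env.set 0 (Ctx.keys Ω) (qs.map τ.1)))
        (State.ofEnv Ω (Env.set 0 (Ctx.keys Ω) (qs.map σ.1)))
    else 0

open Classical in
/-- The unitary embedding `|σ⟩|ω⟩ ↦ |σ⟩|ω ⊕ f(σ)⟩` of `f : Σ_Γin → Σ_Γout`, extended by the
identity to a context `Γ` that contains `Γin; Γout`. -/
noncomputable def Op.embed (Γ Γin Γout : Ctx) (f : State Γin → State Γout) : Op Γ :=
  Matrix.of fun τ σ =>
    if τ.1 = fun x =>
        if x ∈ Ctx.keys Γout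
        then (σ.1 x + (f (State.ofEnv Γin σ.1)).1 x) % Ctx.dim Γout x
        else σ.1 x
    then 1 else 0

open Classical in
/-- The semantics of a unitary operator of type `Ts`, on variables `0, 1, …` of these types. -/
noncomputable def UOp.sem : UOp → (Ts : List Ty) → Op (Ctx.consec 0 Ts)
  | .X, _ => Matrix.of fun τ σ => if τ.1 0 + σ.1 0 = 1 then 1 else 0
  | .Z, _ => Matrix.of fun τ σ => if τ.1 0 = σ.1 0 then (-1) ^ σ.1 0 else 0
  | .H, _ => Matrix.of fun τ σ => (1 / (Real.sqrt 2 : ℂ)) * (-1) ^ (τ.1 0 * σ.1 0)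
  | .CNOT, _ => Matrix.of fun τ σ =>
      if τ.1 0 = σ.1 0 ∧ τ.1 1 = (σ.1 1 + σ.1 0) % 2 then 1 else 0
  | .embed xs E, Ts => Matrix.of fun τ σ =>
      if τ.1 = Env.set σ.1 [xs.length]
          [(σ.1 xs.length +
            E.eval (xs.zip Ts) (Env.set 0 xs ((List.range xs.length).map σ.1))) %
              Ctx.dim (Ctx.consec 0 Ts) xs.length]
      then 1 else 0
  | .unif T, _ => Matrix.of fun τ σ =>
      (1 / (Real.sqrt (T : ℕ) : ℂ)) *
        Complex.exp (2 * Real.pi * Complex.I * (τ.1 0 : ℂ) * (σ.1 0 : ℂ) / ((T : ℕ) : ℂ))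
  | .refl0 _, _ => Matrix.of fun τ σ =>
      (if τ.1 0 = 0 ∧ σ.1 0 = 0 then 2 else 0) - (if τ.1 0 = σ.1 0 then 1 else 0)
  | .adj U, Ts => (U.sem Ts).conjTranspose
  | .ctrl U, Ts => Matrix.of fun τ σ =>
      if τ.1 0 = σ.1 0 then
        if σ.1 0 = 1 then
          U.sem Ts.tail (State.ofEnv _ fun i => τ.1 (i + 1)) (State.ofEnv _ fun i => σ.1 (i + 1))
        else if τ = σ then 1 else 0
      else 0

/-- The semantics of a unitary statement on `H_Γ`, given the semantics of the procedures. -/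
noncomputable def UStmt.sem (ρ : PName → Option (Σ Ω : Ctx, Op Ω)) (Γ : Ctx) : UStmt → Op Γ
  | .skip => 1
  | .app qs U =>
      let Ts := qs.map fun q => (Ctx.get Γ q).getD 1
      Op.at Γ qs (Ctx.consec 0 Ts) (U.sem Ts)
  | .seq W₁ W₂ => W₂.sem ρ Γ * W₁.sem ρ Γ
  | .call g qs =>
      match ρ g with
      | some P => Op.at Γ qs P.1 P.2
      | none => 1
  | .callAdj g qs =>
      match ρ g with
      | some P => (Op.at Γ qs P.1 P.2).conjTranspose
      | none => 1

/-- A unitary interpretation context: the operators of declared procedures. -/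
abbrev UInterp := PName → (Ω : Ctx) → Op Ω

/-- The semantics of the procedures in a procedure context. -/
noncomputable def ProcCtx.sem (V : UInterp) : ProcCtx → PName → Option (Σ Ω : Ctx, Op Ω)
  | [], _ => none
  | (h, G) :: Q, g =>
      if g = h then
        match G with
        | .defn Ω W => some ⟨Ω, W.sem (ProcCtx.sem V Q) Ω⟩
        | .decl Ω _ => some ⟨Ω, V g Ω⟩
      else ProcCtx.sem V Q g

/-- The unitary interpretation context given by the unitary embeddings of the interpretations of the
declared source functions. -/
noncomputable def unitaryInterp (Φ : FunCtx) (F : Interp) : UInterp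
  | .source f, Ω =>
      match Φ.lookup f with
      | some G => Op.embed Ω G.inCtx G.outCtx (F f G.inCtx G.outCtx)
      | none => 1
  | .gen _, _ => 1

/-- The syntactic inverse of a unitary statement. -/
def UStmt.inv : UStmt → UStmt
  | .skip => .skip
  | .app qs U => .app qs (.adj U)
  | .seq W₁ W₂ => .seq W₂.inv W₁.inv
  | .call g qs => .callAdj g qs
  | .callAdj g qs => .call g qs

/-- `with W₁ do W₂`. -/
def UStmt.withDo (W₁ W₂ : UStmt) : UStmt := .seq W₁ (.seq W₂ W₁.inv)

/-- The sequence of a list of statements. -/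
def UStmt.seqs (Ws : List UStmt) : UStmt := Ws.foldr .seq .skip

/-! ## Unitary compilation -/

/-- The result of compiling a source function: a procedure `name` with arguments `ins ++ rest`,
where `outs`, the outputs, are part of `rest`; and all procedures generated so far. -/
structure CFun where
  name : PName
  ins : Ctx
  outs : Ctx
  rest : Ctx
  procs : ProcCtx

/-- The copies of `outs` used by the compute-uncompute pattern, with names from `k` on. -/
def copyCtx (k : ℕ) (outs : Ctx) : Ctx := Ctx.consec k (Ctx.tys outs)

/-- `Clean[g, outs → copies]`: compute, copy the outputs, uncompute. -/
def cleanProc (c : CFun) : UProc :=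
  let Ω := c.ins ++ c.rest
  let Ω' := copyCtx (Ctx.fresh Ω) c.outs
  .defn (Ω ++ Ω')
    (.seq (.call c.name (Ctx.keys Ω))
      (.seq
        (.seqs (((Ctx.keys c.outs).zip (Ctx.keys Ω')).map fun p =>
          .app [p.1, p.2] (.embed [0] (.var 0))))
        (.callAdj c.name (Ctx.keys Ω))))

/-- `CtrlClean[g, outs → copies]`: the same with a controlled copy; the control comes first. -/
def ctrlCleanProc (c : CFun) : UProc :=
  let Ω := c.ins ++ c.rest
  let q := Ctx.fresh Ω
  let Ω' := copyCtx (q + 1) c.outs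
  .defn ((q, boolTy) :: (Ω ++ Ω'))
    (.seq (.call c.name (Ctx.keys Ω))
      (.seq
        (.seqs (((Ctx.keys c.outs).zip (Ctx.keys Ω')).map fun p =>
          .app [q, p.1, p.2] (.ctrl (.embed [0] (.var 0)))))
        (.callAdj c.name (Ctx.keys Ω))))

/-- The Grover iteration counts are drawn from `0, …, groverIters N - 1`. -/
noncomputable def groverIters (N : ℕ) : ℕ := ⌈Real.pi / 4 * Real.sqrt N⌉₊

/-- The number of repetitions for failure probability `δ ^ 2 / 4`.  One run finds an element with
probability more than `0.37` if there is one. -/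
noncomputable def groverRuns (δ : ℝ) : ℕ := ⌈Real.log (δ ^ 2 / 4) / Real.log (1 - 0.37)⌉₊

/-- The number of calls of the predicate made by the search with norm error `δ`. -/
noncomputable def anyQueries (N : ℕ) (δ : ℝ) : ℕ := 2 * (groverIters N * groverRuns δ)

/-- `x₀ or x₁ or … or x_{n-1}`. -/
def orExpr (n : ℕ) : Expr :=
  (List.range n).foldr (fun i E => .bin .or (.var i) E) (.const 0 boolTy)

/-- One run of Grover search with a uniformly random number of iterations, for the predicate
`cg(c, ins, xs, rest, ok)`, controlled on `c`.  The iteration with index `l` is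
active iff `n < l`. -/
noncomputable def searchRun (cg : PName) (ins rest : List Var) (N : Ty) (c xs ok n : Var) : UStmt :=
  let Ng : Ty := (groverIters N).toPNat'
  let callCg : UStmt := .call cg ([c] ++ ins ++ [xs] ++ rest ++ [ok])
  let guard (l : ℕ) : UStmt :=
    .app [n, c] (.embed [0] (.bin .lt (.var 0) (.const l Ng)))
  .seq
    (.withDo
      (.seqs [.app [n] (.unif Ng), .app [ok] .X, .app [ok] .H])
      (.seq (.app [xs] (.unif N))
        (.seqs ((List.range ((Ng : ℕ) - 1)).map fun i =>
          .seqs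
            [guard (i + 1), callCg,
              .app [xs] (.adj (.unif N)), .app [xs] (.refl0 N), .app [xs] (.unif N),
              guard (i + 1)]))))
    (.withDo (.app [c] .X) callCg)

/-- The search procedure `UAny` for a compiled predicate `c`, over its last input, of type `N`.
The result consists of the name of the procedure, its arguments after the inputs and
the output bit, and the generated procedures. -/
noncomputable def uAny (c : CFun) (N : Ty) (δ : ℝ) : PName × Ctx × ProcCtx :=
  let k := Ctx.fresh (c.ins ++ c.rest)
  let ins := c.ins.dropLast
  let L := c.procs.length
  let R := groverRuns δ
  let Ng : Ty := (groverIters N).toPNat'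
  let b' : Var := k
  let b'' : Var := k + 1
  let ctl : Var := k + 2
  let xs (j : ℕ) : Var := k + 3 + 3 * j
  let ok (j : ℕ) : Var := k + 4 + 3 * j
  let n (j : ℕ) : Var := k + 5 + 3 * j
  let aux : Ctx := c.rest ++
    (List.range R).flatMap (fun j => [(xs j, N), (ok j, boolTy), (n j, Ng)]) ++ [(ctl, boolTy)]
  let cg : PName := .gen L
  let dirty : PName := .gen (L + 1)
  let gs : PName := .gen (L + 2)
  let dirtyCall : UStmt := .call dirty (Ctx.keys ins ++ [b''] ++ Ctx.keys aux)
  (gs, (b'', boolTy) :: aux,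
    (gs, .defn (ins ++ [(b', boolTy)] ++ [(b'', boolTy)] ++ aux)
        (.withDo dirtyCall (.app [b'', b'] .CNOT))) ::
    (dirty, .defn (ins ++ [(b'', boolTy)] ++ aux)
        (.seq
          (.seqs ((List.range R).map fun j =>
            searchRun cg (Ctx.keys ins) (Ctx.keys c.rest) N ctl (xs j) (ok j) (n j)))
          (.app ((List.range R).map ok ++ [b'']) (.embed (List.range R) (orExpr R))))) ::
    (cg, ctrlCleanProc c) :: c.procs)

/-- Unitary compilation of statements, given the compilation `cf` of functions.  Auxiliary variables
are named from `k` on, and new procedures are added to `Q`. -/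
noncomputable def Stmt.compile (Φ : FunCtx) (cf : FName → ℝ → ProcCtx → Option CFun) :
    Stmt → ℝ → ℕ → ProcCtx → Option (UStmt × Ctx × ProcCtx)
  | .assign x E, _, _, Q => some (.app (E.vars ++ [x]) (.embed E.vars E), [], Q)
  | .seq S₁ S₂, δ, k, Q =>
      (S₁.compile Φ cf (δ / 2) k Q).bind fun r₁ =>
        (S₂.compile Φ cf (δ / 2) (k + r₁.2.1.length) r₁.2.2).bind fun r₂ =>
          some (.seq r₁.1 r₂.1, r₁.2.1 ++ r₂.2.1, r₂.2.2)
  | .call ys f xs, δ, k, Q =>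
      (cf f (δ / 2) Q).bind fun c =>
        let g : PName := .gen c.procs.length
        let aux := Ctx.consec k (Ctx.tys c.rest)
        some (.call g (xs ++ Ctx.keys aux ++ ys), aux, (g, cleanProc c) :: c.procs)
  | .any b f xs, δ, k, Q =>
      ((Φ.lookup f).bind fun F => F.inTys.getLast?).bind fun N =>
        let δs := δ / 2
        let δp := (δ - δs) / anyQueries N δs
        (cf f (δp / 2) Q).bind fun c =>
          let r := uAny c N δs
          let aux := Ctx.consec k (Ctx.tys r.2.1)
          some (.call r.1 (xs ++ [b] ++ Ctx.keys aux), aux, r.2.2)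

/-- Unitary compilation of functions; `tick f` is the cost of a query to a declared function `f`. -/
noncomputable def FunCtx.compile (tick : FName → ℕ) : FunCtx → FName → ℝ → ProcCtx → Option CFun
  | [], _, _, _ => none
  | (h, F) :: Φ, f, δ, Q =>
      if f = h then
        match F with
        | .decl _ _ =>
            some ⟨.source f, F.inCtx, F.outCtx, F.outCtx,
              (.source f, .decl (F.inCtx ++ F.outCtx) (tick f)) :: Q⟩
        | .defn params _ body _ =>
            (body.type Φ params).bind fun Γ' =>
              (body.compile Φ (FunCtx.compile tick Φ) δ (Ctx.fresh Γ') Q).bind fun r =>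
                let g : PName := .gen r.2.2.length
                some ⟨g, params, F.outCtx, Γ'.drop params.length ++ r.2.1,
                  (g, .defn (Γ' ++ r.2.1) r.1) :: r.2.2⟩
      else FunCtx.compile tick Φ f δ Q

/-- Unitary compilation `(W, Γaux, Π)` of a statement with precision `δ`. -/
noncomputable def UCompile (tick : FName → ℕ) (Φ : FunCtx) (Γ : Ctx) (δ : ℝ) (S : Stmt) :
    Option (UStmt × Ctx × ProcCtx) :=
  (S.type Φ Γ).bind fun Γ' => S.compile Φ (FunCtx.compile tick Φ) δ (Ctx.fresh Γ') []

/-! ## Distance -/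

open Classical in
/-- The isometry `I_Γ₀ ⊗ |0⟩ : H_Γ₀ → H_Γ` for a context `Γ` that contains `Γ₀`. -/
noncomputable def zeroInit (Γ Γ₀ : Ctx) : Matrix (State Γ) (State Γ₀) ℂ :=
  Matrix.of fun τ σ => if τ.1 = σ.1 then 1 else 0

open scoped Matrix.Norms.L2Operator in
/-- The distance `‖U (I_Γ₀ ⊗ |0⟩) - U' (I_Γ₀ ⊗ |0⟩)‖` in operator norm, where all variables of `Γ`
outside of `Γ₀` are initialised to zero. -/
noncomputable def unitaryDist (Γ Γ₀ : Ctx) (U U' : Op Γ) : ℝ :=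
  ‖U * zeroInit Γ Γ₀ - U' * zeroInit Γ Γ₀‖

end Traq

namespace Traq

open Matrix

/-! ## Environments -/

/-! The ideal behaviour of a compiled statement is taken to be the basis map `pushOp` of
`Stmt.exec`, which overwrites the newly assigned variables. Such a map is not injective, but on
vectors in which the overwritten variables are zero it is injective and hence isometric (`Only.vn`),
and there it agrees with the unitary embedding of the semantics (`embedMap_den`). Correctness is
therefore expressed by `ApproxOp Γ Z A B ε`: `‖Aψ - Bψ‖ ≤ ε‖ψ‖` for all `ψ` that vanish unless the
variables in `Z` are zero. The notion passes to larger contexts fibre by fibre (`Match.at_approx`),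
so a procedure is analysed on its own arguments and can then be called anywhere.

Errors of consecutive steps add up, because the real operators are unitary and the ideal ones keep
norms and the required zeros (`Hyb.mul`, `Compiled.seq`). A compiled function may leave garbage,
which compute-copy-uncompute removes. To compare `Aᴴ C A ψ` with the ideal result `φ`, apply `A` to
both: it remains to know `A` on `ψ` and on `φ`, so the error of `A` is paid twice (`vn_conj_le`,
`uncompute_le`). This is why calls compile the function with half of the precision.

For `any`, the search is first studied with an ideal predicate. Phase kickback on the output bit and
the reflection about the uniform superposition give the state of a run in closed form
(`SearchVars.rep_step`). For each value of the counter its amplitudes are those of Grover search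
after a known number of active iterations, that is, of a rotation by `2θ` with `sin θ = √(t/N)`
(`amp_eq`). With `M` equally likely iteration counts, the failure probability is `1/2 + sin(4Mθ) /
(4M sin 2θ)`, where no element fails if all are solutions, and it is at most `0.63` for the chosen
`M` (`grover_failure`). Hence `R` runs all fail with amplitude at most `√0.63 ^ R`, which is at most
`δs / 2`, whereas without a solution no run ever succeeds. A wrong bit costs at most twice its
amplitude, so the ideal search has error `δs` (`RunVars.search_approx`, `vn_flip_sub_le`,
`search_clean`).

The real predicate is then substituted by a hybrid argument. It is used `N_g` times in each of `N_r`
runs, and everything is run once more for the uncomputation, which makes `Q = 2 N_g N_r` uses. Each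
use has error `δp`, namely twice the precision `δp / 2` of the compiled predicate, so the total is
`Q δp + δs = δ`.

The whole is an induction along the function context (`FunCtx.correct`) with an inner induction over
statements (`Stmt.compiled`). The invariant `Inv` guarantees that adding procedures never changes
the meaning of earlier ones. Finally, the initialisation isometry produces exactly vectors with the
required zeros (`unitaryDist_le`). -/

theorem Env.set_nil (σ : Env) (vs : List ℕ) : Env.set σ [] vs = σ := by
  funext x; simp [Env.set]

theorem Env.set_cons (σ : Env) (x : Var) (xs : List Var) (v : ℕ) (vs : List ℕ) (y : Var) :
    Env.set σ (x :: xs) (v :: vs) y = if y = x then v else Env.set σ xs vs y := by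
  by_cases h : y = x
  · simp [Env.set, h]
  · have h' : (y == x) = false := by simpa using h
    simp [Env.set, List.lookup, h, h']

theorem Env.set_singleton (σ : Env) (x : Var) (v : ℕ) :
    Env.set σ [x] [v] = Function.update σ x v := by
  funext y
  rw [Env.set_cons, Env.set_nil]
  by_cases h : y = x
  · subst h; simp
  · simp [h]

theorem Env.set_of_not_mem (σ : Env) {xs : List Var} (vs : List ℕ) {x : Var} (h : x ∉ xs) :
    Env.set σ xs vs x = σ x := by
  induction xs generalizing vs with
  | nil => simp [Env.set_nil]
  | cons a xs ih =>
    cases vs with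
    | nil => simp [Env.set]
    | cons v vs =>
      rw [Env.set_cons]
      simp only [List.mem_cons, not_or] at h
      rw [if_neg h.1, ih vs h.2]

theorem Env.map_set (σ : Env) {xs : List Var} {vs : List ℕ} (hx : xs.Nodup)
    (hl : xs.length = vs.length) : xs.map (Env.set σ xs vs) = vs := by
  induction xs generalizing vs with
  | nil => cases vs <;> simp_all
  | cons a xs ih =>
    cases vs with
    | nil => simp at hl
    | cons v vs =>
      rw [List.nodup_cons] at hx
      simp only [List.length_cons, Nat.add_right_cancel_iff] at hl
      rw [List.map_cons, Env.set_cons, if_pos rfl]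
      congr 1
      conv_rhs => rw [← ih hx.2 hl]
      apply List.map_congr_left
      intro y hy
      rw [Env.set_cons, if_neg]
      rintro rfl
      exact hx.1 hy

theorem Env.set_map (σ τ : Env) (xs : List Var) (x : Var) :
    Env.set σ xs (xs.map τ) x = if x ∈ xs then τ x else σ x := by
  induction xs with
  | nil => simp [Env.set_nil]
  | cons a xs ih =>
    rw [List.map_cons, Env.set_cons, ih]
    by_cases h : x = a
    · simp [h]
    · simp [h]

theorem Env.set_map_self (σ : Env) (xs : List Var) : Env.set σ xs (xs.map σ) = σ := by
  funext x; rw [Env.set_map]; simp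

theorem Env.set_append (σ : Env) (xs ys : List Var) (vs ws : List ℕ) (h : xs.length = vs.length)
    (x : Var) : Env.set σ (xs ++ ys) (vs ++ ws) x =
      if x ∈ xs then Env.set σ xs vs x else Env.set σ ys ws x := by
  induction xs generalizing vs with
  | nil => cases vs <;> simp_all
  | cons a xs ih =>
    cases vs with
    | nil => simp at h
    | cons v vs =>
      simp only [List.length_cons, Nat.add_right_cancel_iff] at h
      rw [List.cons_append, List.cons_append, Env.set_cons, Env.set_cons, ih vs h]
      by_cases hx : x = a <;> simp [hx]

theorem Env.set_mem_congr (σ τ : Env) {xs : List Var} {vs : List ℕ} (h : xs.length = vs.length)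
    {x : Var} (hx : x ∈ xs) : Env.set σ xs vs x = Env.set τ xs vs x := by
  induction xs generalizing vs with
  | nil => simp at hx
  | cons a xs ih =>
    cases vs with
    | nil => simp at h
    | cons v vs =>
      simp only [List.length_cons, Nat.add_right_cancel_iff] at h
      rw [Env.set_cons, Env.set_cons]
      by_cases hxa : x = a
      · simp [hxa]
      · rw [if_neg hxa, if_neg hxa]
        exact ih h (by simpa [hxa] using hx)

/-! ## Contexts -/

/-- The environments that respect a context. -/
def Valid (Γ : Ctx) (e : Env) : Prop := ∀ x, e x < Ctx.dim Γ x

theorem State.ofEnv_val {Γ : Ctx} {e : Env} (h : Valid Γ e) : (State.ofEnv Γ e).1 = e := by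
  funext x; exact Nat.mod_eq_of_lt (h x)

theorem State.valid {Γ : Ctx} (σ : State Γ) : Valid Γ σ.1 := σ.2

theorem State.ofEnv_self {Γ : Ctx} (σ : State Γ) : State.ofEnv Γ σ.1 = σ :=
  Subtype.ext (State.ofEnv_val σ.2)

theorem valid_zero (Γ : Ctx) : Valid Γ 0 := fun x => Ctx.dim_pos Γ x

theorem Valid.update {Γ : Ctx} {e : Env} (h : Valid Γ e) {x : Var} {v : ℕ}
    (hv : v < Ctx.dim Γ x) : Valid Γ (Function.update e x v) := by
  intro y
  by_cases hy : y = x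
  · subst hy; simpa using hv
  · simpa [hy] using h y

/-- A variable outside of the context has one value only. Environments that respect `Γ` are thus
determined by the variables of `Γ`, although they are functions on all names. -/
theorem Valid.eq_zero {Γ : Ctx} {e : Env} (h : Valid Γ e) {x : Var} (hx : x ∉ Ctx.keys Γ) :
    e x = 0 := by
  have := h x
  rw [Ctx.dim_of_not_mem Γ x hx] at this
  omega

theorem Ctx.dim_of_get {Γ : Ctx} {x : Var} {T : Ty} (h : Ctx.get Γ x = some T) :
    Ctx.dim Γ x = T := by simp [Ctx.dim, h]

theorem Ctx.get_nil (x : Var) : Ctx.get [] x = none := rfl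

theorem Ctx.get_cons (p : Var × Ty) (Γ : Ctx) (x : Var) :
    Ctx.get (p :: Γ) x = if x = p.1 then some p.2 else Ctx.get Γ x := by
  obtain ⟨a, T⟩ := p
  unfold Ctx.get
  by_cases h : x = a
  · simp [List.lookup, h]
  · have h' : (x == a) = false := by simpa using h
    simp [List.lookup, h, h']

theorem Ctx.keys_append (Γ Δ : Ctx) : Ctx.keys (Γ ++ Δ) = Ctx.keys Γ ++ Ctx.keys Δ :=
  List.map_append

theorem Ctx.tys_append (Γ Δ : Ctx) : Ctx.tys (Γ ++ Δ) = Ctx.tys Γ ++ Ctx.tys Δ :=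
  List.map_append

@[simp] theorem Ctx.keys_nil : Ctx.keys [] = [] := rfl
@[simp] theorem Ctx.tys_nil : Ctx.tys [] = [] := rfl
@[simp] theorem Ctx.keys_cons (p : Var × Ty) (Γ : Ctx) :
    Ctx.keys (p :: Γ) = p.1 :: Ctx.keys Γ := rfl
@[simp] theorem Ctx.tys_cons (p : Var × Ty) (Γ : Ctx) :
    Ctx.tys (p :: Γ) = p.2 :: Ctx.tys Γ := rfl

theorem Ctx.length_keys (Γ : Ctx) : (Ctx.keys Γ).length = Γ.length := List.length_map _
theorem Ctx.length_tys (Γ : Ctx) : (Ctx.tys Γ).length = Γ.length := List.length_map _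

theorem Ctx.get_eq_none {Γ : Ctx} {x : Var} : Ctx.get Γ x = none ↔ x ∉ Ctx.keys Γ := by
  induction Γ with
  | nil => simp [Ctx.get_nil]
  | cons p Γ ih =>
    rw [Ctx.get_cons, Ctx.keys_cons]
    by_cases h : x = p.1 <;> simp [h, ih]

theorem Ctx.get_append (Γ Δ : Ctx) (x : Var) :
    Ctx.get (Γ ++ Δ) x = if x ∈ Ctx.keys Γ then Ctx.get Γ x else Ctx.get Δ x := by
  induction Γ with
  | nil => simp
  | cons p Γ ih =>
    rw [List.cons_append, Ctx.get_cons, Ctx.get_cons, ih, Ctx.keys_cons]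
    by_cases h : x = p.1 <;> simp [h]

theorem Ctx.mem_keys_of_get {Γ : Ctx} {x : Var} {T : Ty} (h : Ctx.get Γ x = some T) :
    x ∈ Ctx.keys Γ := by
  by_contra hx
  rw [Ctx.get_eq_none.2 hx] at h
  cases h

theorem Ctx.exists_get {Γ : Ctx} {x : Var} (h : x ∈ Ctx.keys Γ) : ∃ T, Ctx.get Γ x = some T := by
  rw [← Option.isSome_iff_exists, Option.isSome_iff_ne_none, Ne, Ctx.get_eq_none]
  exact fun h' => h' h

theorem Ctx.map_get_keys {Γ : Ctx} (h : (Ctx.keys Γ).Nodup) :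
    (Ctx.keys Γ).map (Ctx.get Γ) = (Ctx.tys Γ).map some := by
  induction Γ with
  | nil => rfl
  | cons p Γ ih =>
    rw [Ctx.keys_cons, List.nodup_cons] at h
    rw [Ctx.keys_cons, Ctx.tys_cons, List.map_cons, List.map_cons, ← ih h.2, Ctx.get_cons,
      if_pos rfl]
    congr 1
    apply List.map_congr_left
    intro y hy
    rw [Ctx.get_cons, if_neg]
    rintro rfl
    exact h.1 hy

/-- `Δ` is a sub-context of `Γ`. -/
def Ctx.Sub (Δ Γ : Ctx) : Prop := ∀ x T, Ctx.get Δ x = some T → Ctx.get Γ x = some T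

theorem Ctx.Sub.refl (Γ : Ctx) : Ctx.Sub Γ Γ := fun _ _ h => h

theorem Ctx.Sub.trans {Γ Δ Θ : Ctx} (h : Ctx.Sub Γ Δ) (h' : Ctx.Sub Δ Θ) : Ctx.Sub Γ Θ :=
  fun x T hx => h' x T (h x T hx)

theorem Ctx.sub_append_left (Γ Δ : Ctx) : Ctx.Sub Γ (Γ ++ Δ) := fun x T h => by
  rw [Ctx.get_append, if_pos (Ctx.mem_keys_of_get h), h]

theorem Ctx.sub_append_right {Γ Δ : Ctx} (h : ∀ x ∈ Ctx.keys Δ, x ∉ Ctx.keys Γ) :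
    Ctx.Sub Δ (Γ ++ Δ) := fun x T hx => by
  rw [Ctx.get_append, if_neg (h x (Ctx.mem_keys_of_get hx)), hx]

theorem Ctx.Sub.map_get {Δ Γ : Ctx} (h : Ctx.Sub Δ Γ) {xs : List Var} {Ts : List Ty}
    (hx : xs.map (Ctx.get Δ) = Ts.map some) : xs.map (Ctx.get Γ) = Ts.map some := by
  rw [← hx]
  apply List.map_congr_left
  intro x hxs
  have : Ctx.get Δ x ∈ Ts.map some := hx ▸ List.mem_map_of_mem hxs
  obtain ⟨T, _, hT⟩ := List.mem_map.1 this
  rw [← hT]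
  exact h x T hT.symm

theorem Ctx.Sub.map_keys {Δ Γ : Ctx} (h : Ctx.Sub Δ Γ) (hn : (Ctx.keys Δ).Nodup) :
    (Ctx.keys Δ).map (Ctx.get Γ) = (Ctx.tys Δ).map some :=
  h.map_get (Ctx.map_get_keys hn)

theorem Ctx.Sub.dim {Δ Γ : Ctx} (h : Ctx.Sub Δ Γ) {x : Var} (hx : x ∈ Ctx.keys Δ) :
    Ctx.dim Γ x = Ctx.dim Δ x := by
  obtain ⟨T, hT⟩ := Ctx.exists_get hx
  rw [Ctx.dim_of_get hT, Ctx.dim_of_get (h x T hT)]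

theorem mem_keys_of_map_get {Γ : Ctx} {xs : List Var} {Ts : List Ty}
    (h : xs.map (Ctx.get Γ) = Ts.map some) {x : Var} (hx : x ∈ xs) : x ∈ Ctx.keys Γ := by
  have : Ctx.get Γ x ∈ Ts.map some := h ▸ List.mem_map_of_mem hx
  obtain ⟨T, _, hT⟩ := List.mem_map.1 this
  exact Ctx.mem_keys_of_get hT.symm

theorem Ctx.lt_fresh {Γ : Ctx} {x : Var} (h : x ∈ Ctx.keys Γ) : x < Ctx.fresh Γ := by
  unfold Ctx.fresh
  generalize Ctx.keys Γ = l at h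
  induction l with
  | nil => simp at h
  | cons a l ih =>
    rw [List.foldr_cons]
    rcases List.mem_cons.1 h with rfl | h
    · exact Nat.lt_succ_of_le (le_max_left _ _)
    · exact lt_of_lt_of_le (ih h) (Nat.succ_le_succ (le_max_right _ _))

theorem Ctx.tys_consec (k : ℕ) (Ts : List Ty) : Ctx.tys (Ctx.consec k Ts) = Ts := by
  induction Ts generalizing k with
  | nil => rfl
  | cons T Ts ih => simp [Ctx.consec, ih]

theorem Ctx.keys_consec (k : ℕ) (Ts : List Ty) :
    Ctx.keys (Ctx.consec k Ts) = List.range' k Ts.length := by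
  induction Ts generalizing k with
  | nil => rfl
  | cons T Ts ih => simp [Ctx.consec, ih, List.range'_succ]

theorem Ctx.length_consec (k : ℕ) (Ts : List Ty) : (Ctx.consec k Ts).length = Ts.length := by
  rw [← Ctx.length_tys, Ctx.tys_consec]

theorem Ctx.mem_keys_consec {k : ℕ} {Ts : List Ty} {x : Var} :
    x ∈ Ctx.keys (Ctx.consec k Ts) ↔ k ≤ x ∧ x < k + Ts.length := by
  rw [Ctx.keys_consec, List.mem_range'_1]

theorem Ctx.nodup_consec (k : ℕ) (Ts : List Ty) : (Ctx.keys (Ctx.consec k Ts)).Nodup := by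
  rw [Ctx.keys_consec]; exact List.nodup_range'

theorem Ctx.consec_append (k : ℕ) (Ts Us : List Ty) :
    Ctx.consec k (Ts ++ Us) = Ctx.consec k Ts ++ Ctx.consec (k + Ts.length) Us := by
  induction Ts generalizing k with
  | nil => simp [Ctx.consec]
  | cons T Ts ih =>
    simp only [List.cons_append, Ctx.consec, ih, List.length_cons]
    rw [Nat.add_assoc, Nat.add_comm 1]

theorem Ctx.keys_zip {xs : List Var} {Ts : List Ty} (h : xs.length ≤ Ts.length) :
    Ctx.keys (xs.zip Ts) = xs := List.map_fst_zip h

theorem Ctx.tys_zip {xs : List Var} {Ts : List Ty} (h : Ts.length ≤ xs.length) :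
    Ctx.tys (xs.zip Ts) = Ts := List.map_snd_zip h

theorem Ctx.get_zip_of_map_get {Γ : Ctx} {xs : List Var} {Ts : List Ty}
    (h : xs.map (Ctx.get Γ) = Ts.map some) {x : Var} (hx : x ∈ xs) :
    Ctx.get (xs.zip Ts) x = Ctx.get Γ x := by
  induction xs generalizing Ts with
  | nil => simp at hx
  | cons a xs ih =>
    cases Ts with
    | nil => simp at h
    | cons T Ts =>
      simp only [List.map_cons, List.cons.injEq] at h
      rw [List.zip_cons_cons, Ctx.get_cons]
      by_cases hxa : x = a
      · subst hxa; simp [h.1]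
      · simp only [hxa, if_false]
        exact ih h.2 (by simpa [hxa] using hx)

theorem length_eq_of_map_get {Γ : Ctx} {xs : List Var} {Ts : List Ty}
    (h : xs.map (Ctx.get Γ) = Ts.map some) : xs.length = Ts.length := by
  simpa using congrArg List.length h

/-! ## Matching lists of variables with contexts -/

/-- The variables `qs` of `Γ` can be substituted for the variables of `Ω`. -/
structure Match (Γ : Ctx) (qs : List Var) (Ω : Ctx) : Prop where
  nodup : qs.Nodup
  keys_nodup : (Ctx.keys Ω).Nodup
  types : qs.map (Ctx.get Γ) = (Ctx.tys Ω).map some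

/-- The environment for `Ω` given by the values of `qs`. -/
def pull (qs : List Var) (Ω : Ctx) (σ : Env) : Env := Env.set 0 (Ctx.keys Ω) (qs.map σ)

/-- Overwriting the variables `qs` by the values of an environment for `Ω`. -/
def put (qs : List Var) (Ω : Ctx) (σ e : Env) : Env := Env.set σ qs ((Ctx.keys Ω).map e)

namespace Match

variable {Γ : Ctx} {qs : List Var} {Ω : Ctx}

theorem length_eq (h : Match Γ qs Ω) : qs.length = (Ctx.keys Ω).length := by
  rw [length_eq_of_map_get h.types, Ctx.length_keys, Ctx.length_tys]

theorem map_pull (h : Match Γ qs Ω) (σ : Env) : (Ctx.keys Ω).map (pull qs Ω σ) = qs.map σ :=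
  Env.map_set _ h.keys_nodup (by rw [List.length_map, h.length_eq])

theorem map_put (h : Match Γ qs Ω) (σ e : Env) : qs.map (put qs Ω σ e) = (Ctx.keys Ω).map e :=
  Env.map_set _ h.nodup (by rw [List.length_map, h.length_eq])

theorem dims (h : Match Γ qs Ω) : qs.map (Ctx.dim Γ) = (Ctx.keys Ω).map (Ctx.dim Ω) := by
  have h1 := h.types.trans (Ctx.map_get_keys h.keys_nodup).symm
  have := congrArg (List.map fun o : Option Ty => ((o.getD 1 : Ty) : ℕ)) h1
  rw [List.map_map, List.map_map] at this
  exact this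

theorem forall₂ (h : Match Γ qs Ω) {P : Var → Var → Prop}
    (hP : ∀ p ∈ qs.zip (Ctx.keys Ω), P p.1 p.2) : List.Forall₂ P qs (Ctx.keys Ω) := by
  rw [List.forall₂_iff_zip]
  exact ⟨h.length_eq, fun {a b} hab => hP (a, b) hab⟩

/-- Corresponding variables are always described as pairs in a zip rather than by positions.
Equalities of mapped lists are used pair by pair through this lemma. -/
theorem zip_map {α : Type*} {xs ys : List Var} {f g : Var → α} (hm : xs.map f = ys.map g) {a b : Var}
    (hab : (a, b) ∈ xs.zip ys) : f a = g b := by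
  induction xs generalizing ys with
  | nil => simp at hab
  | cons x xs ih =>
    cases ys with
    | nil => simp at hab
    | cons y ys =>
      simp only [List.map_cons, List.cons.injEq] at hm
      rw [List.zip_cons_cons, List.mem_cons] at hab
      rcases hab with hab | hab
      · cases hab; exact hm.1
      · exact ih hm.2 hab

theorem exists_zip_right (h : Match Γ qs Ω) {x : Var} (hx : x ∈ Ctx.keys Ω) :
    ∃ q, (q, x) ∈ qs.zip (Ctx.keys Ω) := by
  have := List.map_snd_zip (l₁ := qs) (l₂ := Ctx.keys Ω) h.length_eq.ge
  rw [← this] at hx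
  obtain ⟨⟨q, y⟩, hp, rfl⟩ := List.mem_map.1 hx
  exact ⟨q, hp⟩

theorem exists_zip_left (h : Match Γ qs Ω) {q : Var} (hq : q ∈ qs) :
    ∃ x, (q, x) ∈ qs.zip (Ctx.keys Ω) := by
  have := List.map_fst_zip (l₁ := qs) (l₂ := Ctx.keys Ω) h.length_eq.le
  rw [← this] at hq
  obtain ⟨⟨q, y⟩, hp, rfl⟩ := List.mem_map.1 hq
  exact ⟨y, hp⟩

theorem pull_of_zip (h : Match Γ qs Ω) (σ : Env) {q x : Var}
    (hp : (q, x) ∈ qs.zip (Ctx.keys Ω)) : pull qs Ω σ x = σ q :=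
  (zip_map (h.map_pull σ).symm hp).symm

theorem put_of_zip (h : Match Γ qs Ω) (σ e : Env) {q x : Var}
    (hp : (q, x) ∈ qs.zip (Ctx.keys Ω)) : put qs Ω σ e q = e x :=
  zip_map (h.map_put σ e) hp

theorem valid_pull (h : Match Γ qs Ω) {σ : Env} (hσ : Valid Γ σ) : Valid Ω (pull qs Ω σ) := by
  intro x
  by_cases hx : x ∈ Ctx.keys Ω
  · obtain ⟨q, hq⟩ := h.exists_zip_right hx
    rw [h.pull_of_zip σ hq, ← zip_map h.dims hq]
    exact hσ q
  · rw [pull, Env.set_of_not_mem _ _ hx]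
    exact Ctx.dim_pos _ _

theorem valid_put (h : Match Γ qs Ω) {σ e : Env} (hσ : Valid Γ σ) (he : Valid Ω e) :
    Valid Γ (put qs Ω σ e) := by
  intro x
  by_cases hx : x ∈ qs
  · obtain ⟨q, hq⟩ := h.exists_zip_left hx
    rw [h.put_of_zip σ e hq, zip_map h.dims hq]
    exact he q
  · rw [put, Env.set_of_not_mem _ _ hx]
    exact hσ x

theorem pull_put (h : Match Γ qs Ω) (σ : Env) {e : Env} (he : Valid Ω e) :
    pull qs Ω (put qs Ω σ e) = e := by
  rw [pull, h.map_put]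
  funext x
  rw [Env.set_map]
  split_ifs with hx
  · rfl
  · exact (he.eq_zero hx).symm

theorem put_pull (h : Match Γ qs Ω) (σ : Env) : put qs Ω σ (pull qs Ω σ) = σ := by
  rw [put, h.map_pull, Env.set_map_self]

theorem put_put (h : Match Γ qs Ω) (σ e e' : Env) :
    put qs Ω (put qs Ω σ e) e' = put qs Ω σ e' := by
  funext x
  by_cases hx : x ∈ qs
  · exact Env.set_mem_congr _ _ (by rw [List.length_map, h.length_eq]) hx
  · simp only [put, Env.set_of_not_mem _ _ hx]

theorem put_congr_iff (h : Match Γ qs Ω) (σ τ e : Env) :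
    put qs Ω τ e = put qs Ω σ e ↔ ∀ x, x ∉ qs → τ x = σ x := by
  constructor
  · intro hp x hx
    have := congrFun hp x
    rwa [put, put, Env.set_of_not_mem _ _ hx, Env.set_of_not_mem _ _ hx] at this
  · intro hp
    funext x
    by_cases hx : x ∈ qs
    · exact Env.set_mem_congr _ _ (by rw [List.length_map, h.length_eq]) hx
    · simp only [put, Env.set_of_not_mem _ _ hx, hp x hx]

/-- An environment is the same as its part off `qs` together with its values on `qs`. The two
conditions on the right are those that appear in the entries of `Op.at`. -/
theorem eq_put_iff (h : Match Γ qs Ω) (σ τ : Env) {e : Env} (he : Valid Ω e) :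
    τ = put qs Ω σ e ↔ (∀ x, x ∉ qs → τ x = σ x) ∧ pull qs Ω τ = e := by
  constructor
  · rintro rfl
    exact ⟨fun x hx => Env.set_of_not_mem _ _ hx, h.pull_put σ he⟩
  · rintro ⟨h1, rfl⟩
    rw [← (h.put_congr_iff σ τ _).2 h1, h.put_pull]

end Match

theorem put_of_not_mem {qs : List Var} {Ω : Ctx} (σ e : Env) {x : Var} (hx : x ∉ qs) :
    put qs Ω σ e x = σ x := Env.set_of_not_mem _ _ hx

theorem Match.keys {Γ Ω : Ctx} (h : Ctx.Sub Ω Γ) (hn : (Ctx.keys Ω).Nodup) :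
    Match Γ (Ctx.keys Ω) Ω := ⟨hn, hn, h.map_keys hn⟩

theorem Match.consec {Γ : Ctx} {qs : List Var} {Ts : List Ty} (hn : qs.Nodup)
    (h : qs.map (Ctx.get Γ) = Ts.map some) (k : ℕ) : Match Γ qs (Ctx.consec k Ts) :=
  ⟨hn, Ctx.nodup_consec _ _, by rw [Ctx.tys_consec, h]⟩

/-! ## Vectors and norms -/

section Norm
variable {ι : Type*} [Fintype ι]

/-- The `ℓ²` norm of a vector. -/
noncomputable def vn (ψ : ι → ℂ) : ℝ := ‖(WithLp.toLp 2 ψ : EuclideanSpace ℂ ι)‖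

theorem vn_sq (ψ : ι → ℂ) : vn ψ ^ 2 = ∑ i, ‖ψ i‖ ^ 2 := EuclideanSpace.norm_sq_eq _

theorem vn_nonneg (ψ : ι → ℂ) : 0 ≤ vn ψ := norm_nonneg _

theorem vn_zero : vn (0 : ι → ℂ) = 0 := norm_zero

theorem vn_sub_le (ψ φ : ι → ℂ) : vn (ψ - φ) ≤ vn ψ + vn φ := norm_sub_le _ _

theorem vn_sub_comm (ψ φ : ι → ℂ) : vn (ψ - φ) = vn (φ - ψ) := norm_sub_rev _ _

theorem vn_sub_le_sub_add_sub (ψ φ χ : ι → ℂ) : vn (ψ - χ) ≤ vn (ψ - φ) + vn (φ - χ) :=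
  norm_sub_le_norm_sub_add_norm_sub _ _ _

theorem vn_le_of_sq_le {ψ : ι → ℂ} {c : ℝ} (hc : 0 ≤ c) (h : ∑ i, ‖ψ i‖ ^ 2 ≤ c ^ 2) :
    vn ψ ≤ c := by
  rw [← vn_sq] at h
  exact le_of_sq_le_sq h hc
where
  le_of_sq_le_sq {a b : ℝ} (h : a ^ 2 ≤ b ^ 2) (hb : 0 ≤ b) : a ≤ b := by nlinarith

theorem vn_le_vn {κ : Type*} [Fintype κ] {ψ : ι → ℂ} {φ : κ → ℂ}
    (h : ∑ i, ‖ψ i‖ ^ 2 ≤ ∑ i, ‖φ i‖ ^ 2) : vn ψ ≤ vn φ :=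
  vn_le_of_sq_le (vn_nonneg _) (by rwa [vn_sq])

theorem vn_mono {ψ φ : ι → ℂ} (h : ∀ i, ‖ψ i‖ ≤ ‖φ i‖) : vn ψ ≤ vn φ :=
  vn_le_vn (Finset.sum_le_sum fun i _ => by
    have := h i
    gcongr)

variable [DecidableEq ι]

theorem vn_unitary {U : Matrix ι ι ℂ} (hU : U ∈ unitaryGroup ι ℂ) (ψ : ι → ℂ) :
    vn (U *ᵥ ψ) = vn ψ := by
  have h1 : ∀ φ : ι → ℂ, ((vn φ ^ 2 : ℝ) : ℂ) = star φ ⬝ᵥ φ := by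
    intro φ
    rw [vn_sq, dotProduct, Complex.ofReal_sum]
    refine Finset.sum_congr rfl fun i _ => ?_
    rw [Pi.star_apply, Complex.star_def, Complex.conj_mul']
    push_cast; rfl
  have h2 : vn (U *ᵥ ψ) ^ 2 = vn ψ ^ 2 := by
    have : ((vn (U *ᵥ ψ) ^ 2 : ℝ) : ℂ) = ((vn ψ ^ 2 : ℝ) : ℂ) := by
      rw [h1, h1, star_mulVec, dotProduct_mulVec, vecMul_vecMul, ← star_eq_conjTranspose,
        mem_unitaryGroup_iff'.1 hU, vecMul_one]
    exact_mod_cast this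
  exact (sq_eq_sq₀ (vn_nonneg _) (vn_nonneg _)).1 h2

theorem conjTranspose_mem_unitaryGroup {U : Matrix ι ι ℂ} (hU : U ∈ unitaryGroup ι ℂ) :
    Uᴴ ∈ unitaryGroup ι ℂ := by
  rw [← star_eq_conjTranspose]
  exact Unitary.star_mem hU

theorem unitary_conj_mul {U : Matrix ι ι ℂ} (hU : U ∈ unitaryGroup ι ℂ) : Uᴴ * U = 1 :=
  mem_unitaryGroup_iff'.1 hU

theorem unitary_mul_conj {U : Matrix ι ι ℂ} (hU : U ∈ unitaryGroup ι ℂ) : U * Uᴴ = 1 :=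
  mem_unitaryGroup_iff.1 hU

/-- Compute, act, uncompute: if `A` approximates `B` on `ψ` and on the ideal result `φ`, then the
errors add up. -/
theorem vn_conj_le {A C : Matrix ι ι ℂ} (hA : A ∈ unitaryGroup ι ℂ) (hC : C ∈ unitaryGroup ι ℂ)
    (B : Matrix ι ι ℂ) (ψ φ : ι → ℂ) {ε₁ ε₂ : ℝ} (h1 : vn (A *ᵥ ψ - B *ᵥ ψ) ≤ ε₁)
    (h2 : vn (A *ᵥ φ - C *ᵥ B *ᵥ ψ) ≤ ε₂) :
    vn ((Aᴴ * (C * A)) *ᵥ ψ - φ) ≤ ε₁ + ε₂ := by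
  -- Applying the unitary `A` cancels the uncomputation and leaves `C A ψ - A φ`, so `Aᴴ` itself
  -- never has to be approximated.
  rw [← vn_unitary hA]
  have : A *ᵥ ((Aᴴ * (C * A)) *ᵥ ψ - φ) = C *ᵥ A *ᵥ ψ - A *ᵥ φ := by
    rw [mulVec_sub, mulVec_mulVec, ← Matrix.mul_assoc, unitary_mul_conj hA, Matrix.one_mul,
      mulVec_mulVec]
  rw [this]
  refine (vn_sub_le_sub_add_sub _ (C *ᵥ B *ᵥ ψ) _).trans (add_le_add ?_ ?_)
  · rw [← mulVec_sub, vn_unitary hC]; exact h1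
  · rwa [vn_sub_comm]

end Norm

theorem State.eq_iff {Γ : Ctx} {σ τ : State Γ} : σ = τ ↔ σ.1 = τ.1 := Subtype.ext_iff

/-! ## Basis maps -/

open Classical in
/-- The operator `|σ⟩ ↦ |h(σ)⟩`. -/
noncomputable def pushOp (Γ : Ctx) (h : Env → Env) : Op Γ :=
  Matrix.of fun τ σ => if τ.1 = h σ.1 then 1 else 0

/-- The map `h` preserves the environments that respect `Γ`. -/
def Pres (Γ : Ctx) (h : Env → Env) : Prop := ∀ e, Valid Γ e → Valid Γ (h e)

theorem pushOp_congr {Γ : Ctx} {h h' : Env → Env} (hh : ∀ e, Valid Γ e → h e = h' e) :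
    pushOp Γ h = pushOp Γ h' := by
  ext τ σ
  rw [pushOp, pushOp, of_apply, of_apply, hh σ.1 σ.2]

open Classical in
theorem pushOp_mulVec {Γ : Ctx} (h : Env → Env) (ψ : State Γ → ℂ) (τ : State Γ) :
    (pushOp Γ h *ᵥ ψ) τ = ∑ σ : State Γ, if τ.1 = h σ.1 then ψ σ else 0 := by
  simp only [pushOp, mulVec, dotProduct, of_apply, ite_mul, one_mul, zero_mul]

/-- An involution of the environments that respect `Γ`. -/
structure Invol (Γ : Ctx) (h : Env → Env) : Prop where
  pres : Pres Γ h
  invol : ∀ e, Valid Γ e → h (h e) = e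

/-- Pushing forward along an involution is pulling back along the same map, so coefficients can be
read off without a sum. -/
theorem Invol.mulVec {Γ : Ctx} {h : Env → Env} (hh : Invol Γ h) (ψ : State Γ → ℂ) (τ : State Γ) :
    (pushOp Γ h *ᵥ ψ) τ = ψ (State.ofEnv Γ (h τ.1)) := by
  rw [pushOp_mulVec, Finset.sum_eq_single (State.ofEnv Γ (h τ.1))]
  · rw [State.ofEnv_val (hh.pres _ τ.2), hh.invol _ τ.2, if_pos rfl]
  · intro σ _ hσ
    rw [if_neg]
    intro hτ
    apply hσ
    rw [hτ, hh.invol _ σ.2, State.ofEnv_self]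
  · simp

theorem pushOp_mul {Γ : Ctx} {h h' : Env → Env} (hp : Pres Γ h) :
    pushOp Γ h' * pushOp Γ h = pushOp Γ (fun e => h' (h e)) := by
  ext τ σ
  simp only [pushOp, Matrix.mul_apply, of_apply, mul_ite, mul_one, mul_zero]
  rw [Finset.sum_eq_single (State.ofEnv Γ (h σ.1))]
  · rw [State.ofEnv_val (hp _ σ.2)]; simp
  · intro ρ _ hρ
    rw [if_neg]
    intro h2
    exact hρ (by rw [← h2, State.ofEnv_self])
  · simp

theorem pushOp_id {Γ : Ctx} : pushOp Γ (fun e => e) = 1 := by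
  ext τ σ
  classical
  rw [pushOp, of_apply, Matrix.one_apply]
  simp only [State.eq_iff]

theorem pushOp_unitary {Γ : Ctx} {h : Env → Env} (hp : Pres Γ h)
    (hi : ∀ e e', Valid Γ e → Valid Γ e' → h e = h e' → e = e') :
    pushOp Γ h ∈ unitaryGroup (State Γ) ℂ := by
  rw [mem_unitaryGroup_iff']
  ext τ σ
  simp only [star_eq_conjTranspose, Matrix.mul_apply, conjTranspose_apply, pushOp, of_apply,
    Matrix.one_apply]
  rw [Finset.sum_eq_single (State.ofEnv Γ (h τ.1))]
  · rw [State.ofEnv_val (hp _ τ.2)]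
    by_cases hτ : τ = σ
    · subst hτ; simp
    · rw [if_neg hτ, if_neg (fun h' => hτ (Subtype.ext (hi _ _ τ.2 σ.2 h')))]
      simp
  · intro ρ _ hρ
    rw [if_neg (fun h2 : ρ.1 = h τ.1 => hρ (by rw [← h2, State.ofEnv_self]))]
    simp
  · simp

theorem Invol.unitary {Γ : Ctx} {h : Env → Env} (hh : Invol Γ h) :
    pushOp Γ h ∈ unitaryGroup (State Γ) ℂ :=
  pushOp_unitary hh.pres fun e e' he he' h1 => by
    rw [← hh.invol e he, h1, hh.invol e' he']

/-- The vector `ψ` is supported on the states in which the variables in `Z` are zero. -/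
def ZeroOn {Γ : Ctx} (Z : Set Var) (ψ : State Γ → ℂ) : Prop :=
  ∀ σ : State Γ, ψ σ ≠ 0 → ∀ z ∈ Z, σ.1 z = 0

theorem ZeroOn.mono {Γ : Ctx} {Z Z' : Set Var} {ψ : State Γ → ℂ} (h : ZeroOn Z ψ) (hZ : Z' ⊆ Z) :
    ZeroOn Z' ψ := fun σ hσ z hz => h σ hσ z (hZ hz)

theorem ZeroOn.pushOp {Γ : Ctx} {Z Z' : Set Var} {h : Env → Env} {ψ : State Γ → ℂ}
    (hψ : ZeroOn Z ψ)
    (hh : ∀ e, Valid Γ e → (∀ z ∈ Z, e z = 0) → ∀ z ∈ Z', h e z = 0) :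
    ZeroOn Z' (pushOp Γ h *ᵥ ψ) := by
  intro τ hτ z hz
  rw [pushOp_mulVec] at hτ
  obtain ⟨σ, _, hσ⟩ := Finset.exists_ne_zero_of_sum_ne_zero hτ
  split_ifs at hσ with h1
  · rw [h1]; exact hh _ σ.2 (hψ σ hσ) z hz
  · exact absurd rfl hσ

theorem pushOp_mulVec_congr {Γ : Ctx} {Z : Set Var} {h h' : Env → Env} {ψ : State Γ → ℂ}
    (hψ : ZeroOn Z ψ) (hh : ∀ e, Valid Γ e → (∀ z ∈ Z, e z = 0) → h e = h' e) :
    pushOp Γ h *ᵥ ψ = pushOp Γ h' *ᵥ ψ := by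
  funext τ
  rw [pushOp_mulVec, pushOp_mulVec]
  refine Finset.sum_congr rfl fun σ _ => ?_
  by_cases h0 : ψ σ = 0
  · simp [h0]
  · rw [hh _ σ.2 (hψ σ h0)]

/-- The map `h` preserves `Γ` and changes only variables in `Z`. -/
structure Only (Γ : Ctx) (Z : Set Var) (h : Env → Env) : Prop where
  pres : Pres Γ h
  eq : ∀ e x, x ∉ Z → h e x = e x

/-- Inside `Z` both environments are zero, and outside of `Z` they can be recovered from their
images. An overwriting map is therefore injective on the environments that matter, even if it is not
injective globally. -/
theorem Only.injOn {Γ : Ctx} {Z : Set Var} {h : Env → Env} (hh : Only Γ Z h) {e e' : Env}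
    (he : ∀ z ∈ Z, e z = 0) (he' : ∀ z ∈ Z, e' z = 0) (h1 : h e = h e') : e = e' := by
  funext x
  by_cases hx : x ∈ Z
  · rw [he x hx, he' x hx]
  · rw [← hh.eq e x hx, ← hh.eq e' x hx, h1]

/-- By `Only.injOn` the map is injective on the support of `ψ`, so the nonzero coefficients are only
moved around. This replaces unitarity for the ideal maps. -/
theorem Only.vn {Γ : Ctx} {Z : Set Var} {h : Env → Env} (hh : Only Γ Z h) {ψ : State Γ → ℂ}
    (hψ : ZeroOn Z ψ) : vn (pushOp Γ h *ᵥ ψ) = vn ψ := by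
  classical
  rw [← sq_eq_sq₀ (vn_nonneg _) (vn_nonneg _), vn_sq, vn_sq]
  set S : Finset (State Γ) := Finset.univ.filter fun σ => ψ σ ≠ 0 with hS
  have hpush : ∀ σ ∈ S, (pushOp Γ h *ᵥ ψ) (State.ofEnv Γ (h σ.1)) = ψ σ := by
    intro σ hσ
    have hσ0 := (Finset.mem_filter.1 hσ).2
    rw [pushOp_mulVec, Finset.sum_eq_single σ]
    · rw [State.ofEnv_val (hh.pres _ σ.2), if_pos rfl]
    · intro ρ _ hρ
      rw [State.ofEnv_val (hh.pres _ σ.2)]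
      by_cases hρ0 : ψ ρ = 0
      · simp [hρ0]
      · rw [if_neg]
        intro h1
        exact hρ (Subtype.ext (hh.injOn (hψ ρ hρ0) (hψ σ hσ0) h1.symm))
    · simp
  have h1 : ∑ σ, ‖ψ σ‖ ^ 2 = ∑ σ ∈ S, ‖ψ σ‖ ^ 2 := by
    symm
    apply Finset.sum_subset (Finset.subset_univ _)
    intro σ _ hσ
    simp only [hS, Finset.mem_filter, Finset.mem_univ, true_and, not_not] at hσ
    simp [hσ]
  have h2 : ∑ τ, ‖(pushOp Γ h *ᵥ ψ) τ‖ ^ 2 =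
      ∑ τ ∈ S.image fun σ => State.ofEnv Γ (h σ.1), ‖(pushOp Γ h *ᵥ ψ) τ‖ ^ 2 := by
    symm
    apply Finset.sum_subset (Finset.subset_univ _)
    intro τ _ hτ
    rw [pushOp_mulVec, Finset.sum_eq_zero]
    · simp
    · intro σ _
      by_cases hσ : ψ σ = 0
      · simp [hσ]
      · rw [if_neg]
        intro h1
        apply hτ
        rw [Finset.mem_image]
        exact ⟨σ, by simp [hS, hσ], by rw [← h1, State.ofEnv_self]⟩
  rw [h1, h2, Finset.sum_image]
  · exact Finset.sum_congr rfl fun σ hσ => by rw [hpush σ hσ]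
  · intro σ hσ ρ hρ h3
    have hσ0 := (Finset.mem_filter.1 hσ).2
    have hρ0 := (Finset.mem_filter.1 hρ).2
    have h4 := congrArg Subtype.val h3
    simp only [State.ofEnv_val (hh.pres _ σ.2), State.ofEnv_val (hh.pres _ ρ.2)] at h4
    exact Subtype.ext (hh.injOn (hψ _ hσ0) (hψ _ hρ0) h4)

/-! ## Diagonal operators -/

open Classical in
/-- The projection onto the states with a given property. -/
noncomputable def projOp (Γ : Ctx) (P : Env → Prop) : Op Γ :=
  Matrix.diagonal fun σ => if P σ.1 then 1 else 0

open Classical in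
theorem projOp_mulVec {Γ : Ctx} (P : Env → Prop) (ψ : State Γ → ℂ) (τ : State Γ) :
    (projOp Γ P *ᵥ ψ) τ = if P τ.1 then ψ τ else 0 := by
  rw [projOp, mulVec_diagonal]; split_ifs <;> simp

theorem vn_projOp_le {Γ : Ctx} (P : Env → Prop) (ψ : State Γ → ℂ) : vn (projOp Γ P *ᵥ ψ) ≤ vn ψ :=
  vn_mono fun i => by rw [projOp_mulVec]; split_ifs <;> simp

theorem ZeroOn.projOp {Γ : Ctx} {Z : Set Var} (P : Env → Prop) {ψ : State Γ → ℂ} (h : ZeroOn Z ψ) :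
    ZeroOn Z (projOp Γ P *ᵥ ψ) := by
  intro σ hσ
  rw [projOp_mulVec] at hσ
  split_ifs at hσ
  · exact h σ hσ
  · exact absurd rfl hσ

/-! ## Operators acting on some of the variables -/

section At
variable {Γ : Ctx} {qs : List Var} {Ω : Ctx}

/-- The restriction of a state. -/
noncomputable def State.pull (qs : List Var) (Ω : Ctx) (τ : State Γ) : State Ω :=
  State.ofEnv Ω (Traq.pull qs Ω τ.1)

/-- Overwriting the variables `qs` of a state. -/
noncomputable def State.put (qs : List Var) (τ : State Γ) (ω : State Ω) : State Γ :=
  State.ofEnv Γ (Traq.put qs Ω τ.1 ω.1)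

theorem Match.pull_val (h : Match Γ qs Ω) (τ : State Γ) :
    (τ.pull qs Ω).1 = Traq.pull qs Ω τ.1 := State.ofEnv_val (h.valid_pull τ.2)

theorem Match.put_val (h : Match Γ qs Ω) (τ : State Γ) (ω : State Ω) :
    (τ.put qs ω).1 = Traq.put qs Ω τ.1 ω.1 := State.ofEnv_val (h.valid_put τ.2 ω.2)

theorem Match.state_pull_put (h : Match Γ qs Ω) (τ : State Γ) (ω : State Ω) :
    (τ.put qs ω).pull qs Ω = ω :=
  Subtype.ext (by rw [h.pull_val, h.put_val, h.pull_put _ ω.2])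

theorem Match.state_put_pull (h : Match Γ qs Ω) (τ : State Γ) :
    τ.put qs (τ.pull qs Ω) = τ :=
  Subtype.ext (by rw [h.put_val, h.pull_val, h.put_pull])

theorem Match.state_put_put (h : Match Γ qs Ω) (τ : State Γ) (ω ω' : State Ω) :
    (τ.put qs ω).put qs ω' = τ.put qs ω' :=
  Subtype.ext (by rw [h.put_val, h.put_val, h.put_val, h.put_put])

theorem Match.state_eq_put_iff (h : Match Γ qs Ω) (σ τ : State Γ) (ω : State Ω) :
    σ = τ.put qs ω ↔ (∀ x, x ∉ qs → τ.1 x = σ.1 x) ∧ σ.pull qs Ω = ω := by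
  rw [State.eq_iff, State.eq_iff, h.put_val, h.pull_val, h.eq_put_iff _ _ ω.2]
  constructor <;> rintro ⟨h1, h2⟩ <;> exact ⟨fun x hx => (h1 x hx).symm, h2⟩

/-- Entries of `Op.at` vanish unless row and column agree off `qs`, so only the states `τ.put qs ω`
contribute. The algebra of `Op.at` reduces to sums over `State Ω` in this way. -/
theorem Match.at_mulVec (h : Match Γ qs Ω) (U : Op Ω) (ψ : State Γ → ℂ) (τ : State Γ) :
    (Op.at Γ qs Ω U *ᵥ ψ) τ = ∑ ω : State Ω, U (τ.pull qs Ω) ω * ψ (τ.put qs ω) := by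
  classical
  simp only [mulVec, dotProduct, Op.at, of_apply, ite_mul, zero_mul]
  rw [← Finset.sum_filter]
  refine (Finset.sum_bij (fun ω _ => τ.put qs ω) ?_ ?_ ?_ ?_).symm
  · intro ω _
    rw [Finset.mem_filter]
    exact ⟨Finset.mem_univ _, ((h.state_eq_put_iff _ _ _).1 rfl).1⟩
  · intro ω _ ω' _ he
    rw [← h.state_pull_put τ ω, he, h.state_pull_put]
  · intro σ hσ
    exact ⟨σ.pull qs Ω, Finset.mem_univ _,
      ((h.state_eq_put_iff _ _ _).2 ⟨(Finset.mem_filter.1 hσ).2, rfl⟩).symm⟩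
  · intro ω _
    change _ = U (τ.pull qs Ω) ((τ.put qs ω).pull qs Ω) * _
    rw [h.state_pull_put]

theorem Op.ext_mulVec {A B : Op Γ} (h : ∀ ψ τ, (A *ᵥ ψ) τ = (B *ᵥ ψ) τ) : A = B := by
  apply Matrix.ext_of_mulVec_single
  intro i
  funext τ
  exact h _ τ

theorem Match.at_mul (h : Match Γ qs Ω) (U V : Op Ω) :
    Op.at Γ qs Ω (U * V) = Op.at Γ qs Ω U * Op.at Γ qs Ω V := by
  apply Op.ext_mulVec
  intro ψ τ
  rw [← mulVec_mulVec, h.at_mulVec, h.at_mulVec]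
  simp only [h.at_mulVec, h.state_pull_put, h.state_put_put, Finset.mul_sum, Matrix.mul_apply,
    Finset.sum_mul]
  rw [Finset.sum_comm]
  simp only [mul_assoc]

theorem Match.at_one (h : Match Γ qs Ω) : Op.at Γ qs Ω 1 = 1 := by
  apply Op.ext_mulVec
  intro ψ τ
  rw [h.at_mulVec, one_mulVec, Finset.sum_eq_single (τ.pull qs Ω)]
  · rw [h.state_put_pull, one_apply_eq, one_mul]
  · intro ω _ hω
    rw [one_apply_ne hω.symm, zero_mul]
  · simp

theorem Op.at_conjTranspose (Γ : Ctx) (qs : List Var) (Ω : Ctx) (U : Op Ω) :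
    Op.at Γ qs Ω Uᴴ = (Op.at Γ qs Ω U)ᴴ := by
  ext τ σ
  simp only [Op.at, of_apply, conjTranspose_apply]
  by_cases h : ∀ x, x ∉ qs → τ.1 x = σ.1 x
  · rw [if_pos h, if_pos fun x hx => (h x hx).symm]
  · rw [if_neg h, if_neg fun h' => h fun x hx => (h' x hx).symm, star_zero]

theorem Match.at_unitary (h : Match Γ qs Ω) {U : Op Ω} (hU : U ∈ unitaryGroup (State Ω) ℂ) :
    Op.at Γ qs Ω U ∈ unitaryGroup (State Γ) ℂ := by
  rw [mem_unitaryGroup_iff, star_eq_conjTranspose, ← Op.at_conjTranspose, ← h.at_mul,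
    unitary_mul_conj hU, h.at_one]

theorem Match.at_pushOp (h : Match Γ qs Ω) {k : Env → Env} (hk : Pres Ω k) :
    Op.at Γ qs Ω (pushOp Ω k) =
      pushOp Γ (fun σ => Traq.put qs Ω σ (k (Traq.pull qs Ω σ))) := by
  classical
  ext τ σ
  change (if _ then (if (τ.pull qs Ω).1 = k (σ.pull qs Ω).1 then (1 : ℂ) else 0) else 0) =
    if _ then 1 else 0
  rw [h.pull_val, h.pull_val, ← ite_and]
  simp only [h.eq_put_iff σ.1 τ.1 (hk _ (h.valid_pull σ.2))]

theorem Match.pres_put (h : Match Γ qs Ω) {k : Env → Env} (hk : Pres Ω k) :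
    Pres Γ (fun σ => Traq.put qs Ω σ (k (Traq.pull qs Ω σ))) :=
  fun _ he => h.valid_put he (hk _ (h.valid_pull he))

theorem Match.at_projOp (h : Match Γ qs Ω) (P : Env → Prop) :
    Op.at Γ qs Ω (projOp Ω P) = projOp Γ (fun σ => P (Traq.pull qs Ω σ)) := by
  classical
  apply Op.ext_mulVec
  intro ψ τ
  rw [h.at_mulVec, projOp_mulVec, Finset.sum_eq_single (τ.pull qs Ω)]
  · rw [h.state_put_pull, projOp, diagonal_apply_eq, h.pull_val]
    split_ifs <;> simp
  · intro ω _ hω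
    rw [projOp, diagonal_apply_ne _ hω.symm, zero_mul]
  · simp

/-- Operators on `qs` preserve zeros of other variables. -/
theorem ZeroOn.at (h : Match Γ qs Ω) {Z : Set Var} (hZ : ∀ z ∈ Z, z ∉ qs) (U : Op Ω)
    {ψ : State Γ → ℂ} (hψ : ZeroOn Z ψ) : ZeroOn Z (Op.at Γ qs Ω U *ᵥ ψ) := by
  intro τ hτ z hz
  rw [h.at_mulVec] at hτ
  obtain ⟨ω, _, hω⟩ := Finset.exists_ne_zero_of_sum_ne_zero hτ
  have := hψ _ (right_ne_zero_of_mul hω) z hz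
  rwa [h.put_val, put_of_not_mem _ _ (hZ z hz)] at this

/-- The sum over all states, split into fibres. -/
theorem Match.sum_fibre (h : Match Γ qs Ω) {M : Type*} [AddCommMonoid M] (f : State Γ → M) :
    ∑ τ, f τ = ∑ r : {r : State Γ // ∀ q ∈ qs, r.1 q = 0}, ∑ ω : State Ω, f (r.1.put qs ω) := by
  classical
  rw [← Fintype.sum_prod_type']
  -- Each fibre has exactly one representative that is zero on `qs`, and every element of the fibre
  -- determines it.
  have h0 : ∀ r : State Γ, (∀ q ∈ qs, r.1 q = 0) → ∀ τ : State Γ,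
      (∀ x, x ∉ qs → r.1 x = τ.1 x) → τ.put qs (State.ofEnv Ω 0) = r := by
    intro r hr τ hτ
    apply Subtype.ext
    rw [h.put_val, State.ofEnv_val (valid_zero Ω)]
    symm
    rw [h.eq_put_iff _ _ (valid_zero Ω)]
    refine ⟨hτ, ?_⟩
    funext x
    rw [Traq.pull, Env.set]
    by_cases hx : x ∈ Ctx.keys Ω
    · obtain ⟨q, hq⟩ := h.exists_zip_right hx
      have := h.pull_of_zip r.1 hq
      rw [Traq.pull, Env.set] at this
      rw [this, hr q (List.of_mem_zip hq).1]; rfl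
    · have := Env.set_of_not_mem 0 (qs.map r.1) hx
      rwa [Env.set] at this
  refine (Finset.sum_bij (fun p _ => p.1.1.put qs p.2) ?_ ?_ ?_ ?_).symm
  · intro _ _; exact Finset.mem_univ _
  · rintro ⟨⟨r, hr⟩, ω⟩ _ ⟨⟨r', hr'⟩, ω'⟩ _ he
    have h1 : ω = ω' := by
      rw [← h.state_pull_put r ω]
      rw [show State.put qs r ω = State.put qs r' ω' from he, h.state_pull_put]
    have h2 : r = r' := by
      rw [← h0 r hr (r.put qs ω) ((h.state_eq_put_iff _ _ _).1 rfl).1,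
        show State.put qs r ω = State.put qs r' ω' from he,
        h0 r' hr' (r'.put qs ω') ((h.state_eq_put_iff _ _ _).1 rfl).1]
    subst h1 h2; rfl
  · intro τ _
    refine ⟨⟨⟨τ.put qs (State.ofEnv Ω 0), ?_⟩, τ.pull qs Ω⟩, Finset.mem_univ _, ?_⟩
    · intro q hq
      obtain ⟨x, hx⟩ := h.exists_zip_left hq
      rw [h.put_val, h.put_of_zip _ _ hx, State.ofEnv_val (valid_zero Ω)]; rfl
    · change State.put qs (State.put qs τ _) _ = τ
      rw [h.state_put_put, h.state_put_pull]
  · intro _ _; rfl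

/-! ## Approximation on states with zeros -/

/-- `A` and `B` differ by at most `ε` on the vectors in which the variables in `Z` are zero. -/
def ApproxOp (Γ : Ctx) (Z : Set Var) (A B : Op Γ) (ε : ℝ) : Prop :=
  ∀ ψ, ZeroOn Z ψ → vn (A *ᵥ ψ - B *ᵥ ψ) ≤ ε * vn ψ

/-- The squared norm is a sum over the fibres of `Match.sum_fibre`. On each fibre the lifted
operators act as `A` and `B` on a slice of `ψ`, and the slice inherits its zeros in `Z` from those
of `ψ` in `Z'`. -/
theorem Match.at_approx (h : Match Γ qs Ω) {Z Z' : Set Var} {A B : Op Ω} {ε : ℝ} (hε : 0 ≤ ε)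
    (hAB : ApproxOp Ω Z A B ε)
    (hZ : ∀ z ∈ Z, ∃ z' ∈ Z', (z', z) ∈ qs.zip (Ctx.keys Ω)) :
    ApproxOp Γ Z' (Op.at Γ qs Ω A) (Op.at Γ qs Ω B) ε := by
  intro ψ hψ
  apply vn_le_of_sq_le (mul_nonneg hε (vn_nonneg _))
  rw [mul_pow, vn_sq ψ, h.sum_fibre, h.sum_fibre, Finset.mul_sum]
  refine Finset.sum_le_sum fun r _ => ?_
  set φ : State Ω → ℂ := fun ω => ψ (r.1.put qs ω) with hφ
  have h1 : ∀ (U : Op Ω) (ω : State Ω), (Op.at Γ qs Ω U *ᵥ ψ) (r.1.put qs ω) = (U *ᵥ φ) ω := by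
    intro U ω
    rw [h.at_mulVec, h.state_pull_put]
    simp only [h.state_put_put]
    rfl
  have hz : ZeroOn Z φ := by
    intro ω hω z hz
    obtain ⟨z', hz', hp⟩ := hZ z hz
    have := hψ _ hω z' hz'
    rwa [h.put_val, h.put_of_zip _ _ hp] at this
  have h2 := hAB φ hz
  have h3 : vn (A *ᵥ φ - B *ᵥ φ) ^ 2 ≤ (ε * vn φ) ^ 2 := by
    gcongr
    exact vn_nonneg _
  rw [mul_pow, vn_sq, vn_sq] at h3
  simpa only [Pi.sub_apply, h1] using h3

theorem ApproxOp.mono {Z Z' : Set Var} {A B : Op Γ} {ε ε' : ℝ} (h : ApproxOp Γ Z A B ε)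
    (hZ : Z ⊆ Z') (hε : ε ≤ ε') : ApproxOp Γ Z' A B ε' := fun ψ hψ =>
  (h ψ (hψ.mono hZ)).trans (mul_le_mul_of_nonneg_right hε (vn_nonneg _))

/-- Replacing the ideal basis map by one with the same values. -/
theorem ApproxOp.congr_right {Z : Set Var} {A : Op Γ} {h h' : Env → Env} {ε : ℝ}
    (hA : ApproxOp Γ Z A (Traq.pushOp Γ h) ε)
    (hh : ∀ e, Valid Γ e → (∀ z ∈ Z, e z = 0) → h e = h' e) :
    ApproxOp Γ Z A (Traq.pushOp Γ h') ε := fun ψ hψ => by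
  rw [← pushOp_mulVec_congr hψ hh]; exact hA ψ hψ

theorem ApproxOp.refl {Z : Set Var} {A : Op Γ} {ε : ℝ} (hε : 0 ≤ ε) : ApproxOp Γ Z A A ε :=
  fun ψ _ => by rw [sub_self, vn_zero]; exact mul_nonneg hε (vn_nonneg _)

end At

/-! ## Expressions -/

theorem Expr.type_congr {Γ Γ' : Ctx} {E : Expr} (h : ∀ x ∈ E.vars, Ctx.get Γ x = Ctx.get Γ' x) :
    E.type Γ = E.type Γ' := by
  induction E with
  | var x => exact h x (by simp [Expr.vars])
  | const v T => rfl
  | not E ih => simp only [Expr.type, ih h]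
  | bin o E₁ E₂ ih₁ ih₂ =>
    have h1 := ih₁ fun x hx => h x (List.mem_union_left hx _)
    have h2 := ih₂ fun x hx => h x (List.mem_union_right _ hx)
    cases o <;> simp only [Expr.type, h1, h2]

theorem Expr.eval_congr {Γ Γ' : Ctx} {σ σ' : Env} {E : Expr}
    (h : ∀ x ∈ E.vars, Ctx.get Γ x = Ctx.get Γ' x) (hσ : ∀ x ∈ E.vars, σ x = σ' x) :
    E.eval Γ σ = E.eval Γ' σ' := by
  induction E with
  | var x => exact hσ x (by simp [Expr.vars])
  | const v T => rfl
  | not E ih => simp only [Expr.eval, ih h hσ]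
  | bin o E₁ E₂ ih₁ ih₂ =>
    have h0 := Expr.type_congr fun x (hx : x ∈ E₁.vars) => h x (List.mem_union_left hx _)
    have h1 := ih₁ (fun x hx => h x (List.mem_union_left hx _))
      (fun x hx => hσ x (List.mem_union_left hx _))
    have h2 := ih₂ (fun x hx => h x (List.mem_union_right _ hx))
      (fun x hx => hσ x (List.mem_union_right _ hx))
    cases o <;> simp only [Expr.eval, h1, h2, h0]

theorem Expr.vars_nodup (E : Expr) : E.vars.Nodup := by
  induction E with
  | var x => simp [Expr.vars]
  | const v T => simp [Expr.vars]
  | not E ih => exact ih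
  | bin o E₁ E₂ ih₁ ih₂ => exact ih₂.union _

theorem Expr.get_of_type {Γ : Ctx} {E : Expr} {T : Ty} (h : E.type Γ = some T) :
    ∀ x ∈ E.vars, x ∈ Ctx.keys Γ := by
  induction E generalizing T with
  | var x =>
    intro y hy
    rw [Expr.vars, List.mem_singleton] at hy
    subst hy
    exact Ctx.mem_keys_of_get h
  | const v T => simp [Expr.vars]
  | not E ih =>
    rw [Expr.type] at h
    split_ifs at h with h1
    exact ih h1
  | bin o E₁ E₂ ih₁ ih₂ =>
    have : ∃ T₁ T₂, E₁.type Γ = some T₁ ∧ E₂.type Γ = some T₂ := by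
      cases o <;> simp only [Expr.type] at h <;> split_ifs at h with h1
      · obtain ⟨T₁, h2⟩ := Option.isSome_iff_exists.1 h1.1
        exact ⟨T₁, T₁, h2, h1.2 ▸ h2⟩
      · obtain ⟨T₁, h2⟩ := Option.isSome_iff_exists.1 h1.1
        exact ⟨T₁, T₁, h2, h1.2 ▸ h2⟩
      · exact ⟨T, T, h, h1 ▸ h⟩
      · exact ⟨_, _, h1⟩
      · exact ⟨_, _, h1⟩
    obtain ⟨T₁, T₂, h1, h2⟩ := this
    intro x hx
    rcases List.mem_union_iff.1 hx with hx | hx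
    · exact ih₁ h1 x hx
    · exact ih₂ h2 x hx

theorem Expr.eval_lt {Γ : Ctx} {σ : Env} (hσ : Valid Γ σ) {E : Expr} {T : Ty}
    (h : E.type Γ = some T) : E.eval Γ σ < (T : ℕ) := by
  cases E with
  | var x =>
    have := hσ x
    rwa [Ctx.dim_of_get h] at this
  | const v T' =>
    rw [Expr.type] at h
    split_ifs at h with h1
    cases h; exact h1
  | not E =>
    rw [Expr.type] at h
    split_ifs at h with h1
    cases h
    rw [Expr.eval]
    exact lt_of_le_of_lt (Nat.sub_le _ _) (by decide)
  | bin o E₁ E₂ =>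
    cases o <;> simp only [Expr.type] at h <;> split_ifs at h with h1 <;>
      simp only [Expr.eval]
    · cases h; split_ifs <;> decide
    · cases h; split_ifs <;> decide
    · rw [h]; exact Nat.mod_lt _ T.pos
    · cases h; split_ifs <;> decide
    · cases h; split_ifs <;> decide

/-! ## Substitution for few variables -/

theorem pull_one (q k : Var) (T : Ty) (σ : Env) : pull [q] (Ctx.consec k [T]) σ k = σ q := by
  simp [pull, Ctx.consec, Env.set_cons]

theorem put_one (q k : Var) (T : Ty) (σ e : Env) :
    put [q] (Ctx.consec k [T]) σ e = Function.update σ q (e k) := by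
  simp [put, Ctx.consec, Env.set_singleton]

theorem put_two (a b : Var) (T U : Ty) (σ e : Env) :
    put [a, b] (Ctx.consec 0 [T, U]) σ e = fun y => if y = a then e 0 else if y = b then e 1 else σ y := by
  funext y
  simp [put, Ctx.consec, Env.set_cons, Env.set_nil]

/-! ## The gates -/

theorem valid_consec_one {T : Ty} {e e' : Env} (h : Valid (Ctx.consec 0 [T]) e)
    (h' : Valid (Ctx.consec 0 [T]) e') : e = e' ↔ e 0 = e' 0 := by
  refine ⟨fun h => h ▸ rfl, fun h0 => funext fun x => ?_⟩
  by_cases hx : x = 0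
  · subst hx; exact h0
  · have : x ∉ Ctx.keys (Ctx.consec 0 [T]) := by simpa [Ctx.consec] using hx
    rw [h.eq_zero this, h'.eq_zero this]

theorem dim_consec_one (T : Ty) : Ctx.dim (Ctx.consec 0 [T]) 0 = T :=
  Ctx.dim_of_get rfl

/-- The states of one variable. -/
def stEquiv (T : Ty) : Fin T ≃ State (Ctx.consec 0 [T]) where
  toFun v := ⟨Function.update 0 0 v, (valid_zero _).update (by rw [dim_consec_one]; exact v.2)⟩
  invFun σ := ⟨σ.1 0, by have := σ.2 0; rwa [dim_consec_one] at this⟩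
  left_inv v := by simp
  right_inv σ := State.eq_iff.2 ((valid_consec_one (State.valid _) σ.2).2 (by
    change Function.update (0 : Env) 0 (σ.1 0) 0 = σ.1 0
    rw [Function.update_self]))

theorem stEquiv_zero (T : Ty) (v : Fin T) : (stEquiv T v).1 0 = v := by
  change Function.update (0 : Env) 0 (v : ℕ) 0 = v
  rw [Function.update_self]

theorem UOp.sem_X : UOp.X.sem [boolTy] =
    pushOp (Ctx.consec 0 [boolTy]) (fun σ => Function.update σ 0 (1 - σ 0)) := by
  classical
  ext τ σ
  have h1 := σ.2 0
  have h2 := τ.2 0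
  rw [dim_consec_one] at h1 h2
  change _ < 2 at h1 h2
  rw [UOp.sem, pushOp, of_apply, of_apply]
  refine if_congr ?_ rfl rfl
  rw [valid_consec_one τ.2 (σ.valid.update (by rw [dim_consec_one]; change _ < 2; omega))]
  rw [Function.update_self]
  omega

theorem UOp.sem_CNOT : UOp.CNOT.sem [boolTy, boolTy] =
    pushOp (Ctx.consec 0 [boolTy, boolTy])
      (fun σ => Function.update σ 1 ((σ 1 + σ 0) % 2)) := by
  classical
  ext τ σ
  rw [UOp.sem, pushOp, of_apply, of_apply]
  refine if_congr ?_ rfl rfl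
  constructor
  · rintro ⟨h0, h1⟩
    funext x
    by_cases hx1 : x = 1
    · subst hx1; simp [h1]
    · rw [Function.update_of_ne hx1]
      by_cases hx0 : x = 0
      · subst hx0; exact h0
      · have : x ∉ Ctx.keys (Ctx.consec 0 [boolTy, boolTy]) := by simp [Ctx.consec, hx0, hx1]
        rw [τ.valid.eq_zero this, σ.valid.eq_zero this]
  · intro h
    rw [h]; simp

theorem UOp.sem_embed (xs : List Var) (E : Expr) (Ts : List Ty) : (UOp.embed xs E).sem Ts =
    pushOp (Ctx.consec 0 Ts) (fun σ => Env.set σ [xs.length]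
      [(σ xs.length + E.eval (xs.zip Ts) (Env.set 0 xs ((List.range xs.length).map σ))) %
        Ctx.dim (Ctx.consec 0 Ts) xs.length]) := rfl

theorem diagonal_unitary {ι : Type*} [Fintype ι] [DecidableEq ι] {d : ι → ℂ}
    (h : ∀ i, star (d i) * d i = 1) : Matrix.diagonal d ∈ unitaryGroup ι ℂ := by
  rw [mem_unitaryGroup_iff', star_eq_conjTranspose, diagonal_conjTranspose, diagonal_mul_diagonal,
    ← diagonal_one]
  congr 1
  funext i
  exact h i

theorem UOp.sem_refl0 (T : Ty) (Ts : List Ty) (hTs : Ts = [T]) : (UOp.refl0 T).sem Ts =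
    Matrix.diagonal fun σ => if σ.1 0 = 0 then 1 else -1 := by
  subst hTs
  ext τ σ
  simp only [UOp.sem, of_apply, diagonal_apply]
  have : τ = σ ↔ τ.1 0 = σ.1 0 := State.eq_iff.trans (valid_consec_one τ.2 σ.2)
  by_cases h : τ = σ
  · subst h
    by_cases h0 : τ.1 0 = 0 <;> simp [h0]
    norm_num
  · have h' : τ.1 0 ≠ σ.1 0 := fun h' => h (this.2 h')
    rw [if_neg h, if_neg h', if_neg (fun h2 => h' (h2.1.trans h2.2.symm)), sub_zero]

theorem UOp.sem_Z : UOp.Z.sem [boolTy] =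
    Matrix.diagonal fun σ => (-1) ^ σ.1 0 := by
  ext τ σ
  simp only [UOp.sem, of_apply, diagonal_apply]
  have : τ = σ ↔ τ.1 0 = σ.1 0 := State.eq_iff.trans (valid_consec_one τ.2 σ.2)
  by_cases h : τ = σ
  · subst h; simp
  · rw [if_neg h, if_neg fun h' => h (this.2 h')]

/-- The terms are the powers of the `N`-th root of unity `exp(2πi(b - a)/N)`. As `|b - a| < N`, it
equals `1` only for `a = b`; otherwise the geometric sum vanishes. -/
theorem sum_exp_eq (N : ℕ) (hN : 0 < N) (a b : ℕ) (ha : a < N) (hb : b < N) :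
    ∑ k : Fin N, star (Complex.exp (2 * Real.pi * Complex.I * ((k : ℕ) : ℂ) * (a : ℂ) / (N : ℂ))) *
      Complex.exp (2 * Real.pi * Complex.I * ((k : ℕ) : ℂ) * (b : ℂ) / (N : ℂ)) =
      if a = b then (N : ℂ) else 0 := by
  have hN0 : (N : ℂ) ≠ 0 := by exact_mod_cast hN.ne'
  set ω : ℂ := Complex.exp (2 * Real.pi * Complex.I * ((b : ℂ) - a) / N) with hω
  have hterm : ∀ k : ℕ,
      star (Complex.exp (2 * Real.pi * Complex.I * (k : ℂ) * (a : ℂ) / (N : ℂ))) *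
      Complex.exp (2 * Real.pi * Complex.I * (k : ℂ) * (b : ℂ) / (N : ℂ)) = ω ^ k := by
    intro k
    rw [Complex.star_def, ← Complex.exp_conj, ← Complex.exp_add, hω, ← Complex.exp_nat_mul]
    congr 1
    simp only [map_div₀, map_mul, Complex.conj_I, Complex.conj_ofReal, map_natCast, map_ofNat]
    ring
  simp only [hterm]
  rw [Fin.sum_univ_eq_sum_range (fun k => ω ^ k) N]
  by_cases hab : a = b
  · subst hab
    rw [if_pos rfl]
    have : ω = 1 := by rw [hω]; simp
    simp [this]
  · rw [if_neg hab]
    have hω1 : ω ≠ 1 := by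
      rw [hω, Ne, Complex.exp_eq_one_iff]
      rintro ⟨n, hn⟩
      have hpi : (2 * Real.pi * Complex.I : ℂ) ≠ 0 := Complex.two_pi_I_ne_zero
      have h1 : ((b : ℂ) - a) = n * N := by
        field_simp at hn
        rw [hn, mul_comm]
      have h2 : ((b : ℤ) - a) = n * N := by exact_mod_cast h1
      have h3 : n = 0 := by
        by_contra hn0
        have h4 : (N : ℤ) ≤ |n * N| := by
          rw [abs_mul, Nat.abs_cast]
          have : (1 : ℤ) ≤ |n| := Int.one_le_abs hn0
          nlinarith
        have h5 : |(b : ℤ) - a| < N := by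
          rw [abs_lt]; constructor <;> omega
        rw [h2] at h5
        omega
      rw [h3] at h2
      omega
    have hωN : ω ^ N = 1 := by
      rw [hω, ← Complex.exp_nat_mul, Complex.exp_eq_one_iff]
      refine ⟨(b : ℤ) - a, ?_⟩
      push_cast
      field_simp
    rw [geom_sum_eq hω1, hωN, sub_self, zero_div]

theorem UOp.unif_unitary (T : Ty) : (UOp.unif T).sem [T] ∈
    unitaryGroup (State (Ctx.consec 0 [T])) ℂ := by
  rw [mem_unitaryGroup_iff']
  ext τ σ
  have h1 := σ.2 0
  have h2 := τ.2 0
  rw [dim_consec_one] at h1 h2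
  have hT : (0 : ℝ) < (T : ℕ) := by exact_mod_cast T.pos
  have hs : ((Real.sqrt (T : ℕ) : ℝ) : ℂ) * ((Real.sqrt (T : ℕ) : ℝ) : ℂ) = (T : ℕ) := by
    rw [← Complex.ofReal_mul, Real.mul_self_sqrt hT.le]; simp
  have hs0 : ((Real.sqrt (T : ℕ) : ℝ) : ℂ) ≠ 0 := by
    rw [Complex.ofReal_ne_zero]; exact (Real.sqrt_pos.2 hT).ne'
  simp only [star_eq_conjTranspose, Matrix.mul_apply, conjTranspose_apply, UOp.sem, of_apply,
    Matrix.one_apply]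
  rw [← (stEquiv T).sum_comp]
  simp only [stEquiv_zero, star_mul']
  have := sum_exp_eq T T.pos _ _ h2 h1
  have hc : ∀ x y : ℂ, star (1 / ((Real.sqrt (T : ℕ) : ℝ) : ℂ)) * x *
      (1 / ((Real.sqrt (T : ℕ) : ℝ) : ℂ) * y) = (1 / (T : ℕ) : ℂ) * (x * y) := by
    intro x y
    rw [Complex.star_def, map_div₀, map_one, Complex.conj_ofReal, ← hs]
    field_simp
  simp only [hc]
  have hT0 : ((T : ℕ) : ℂ) ≠ 0 := by exact_mod_cast T.ne_zero
  have hiff : τ = σ ↔ τ.1 0 = σ.1 0 := State.eq_iff.trans (valid_consec_one τ.2 σ.2)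
  rw [← Finset.mul_sum, this]
  by_cases h : τ = σ
  · rw [if_pos h, if_pos (hiff.1 h)]
    field_simp
  · rw [if_neg h, if_neg fun h' => h (hiff.2 h'), mul_zero]

/-- The Hadamard gate is the Fourier transform on two values, so its unitarity needs no separate
computation. -/
theorem UOp.H_eq_unif : UOp.H.sem [boolTy] = (UOp.unif boolTy).sem [boolTy] := by
  ext τ σ
  have h1 := σ.2 0
  have h2 := τ.2 0
  rw [dim_consec_one] at h1 h2
  simp only [UOp.sem, of_apply]
  have hb : ((boolTy : Ty) : ℕ) = 2 := rfl
  rw [hb] at h1 h2 ⊢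
  generalize σ.1 0 = a at *
  generalize τ.1 0 = b at *
  have hpi : Complex.exp (2 * Real.pi * Complex.I / 2) = -1 := by
    rw [← Complex.exp_pi_mul_I]; congr 1; ring
  interval_cases a <;> interval_cases b <;> simp [hpi]

theorem Match.consec_succ (T : Ty) (Ts : List Ty) :
    Match (Ctx.consec 0 (T :: Ts)) (Ctx.keys (Ctx.consec 1 Ts)) (Ctx.consec 0 Ts) := by
  refine Match.consec (Ctx.nodup_consec _ _) ?_ 0
  have h : Ctx.Sub (Ctx.consec 1 Ts) (Ctx.consec 0 (T :: Ts)) := by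
    apply Ctx.sub_append_right (Γ := [(0, T)])
    intro x hx
    have := (Ctx.mem_keys_consec.1 hx).1
    simp; lia
  rw [h.map_keys (Ctx.nodup_consec _ _), Ctx.tys_consec]

theorem pull_consec_succ {T : Ty} {Ts : List Ty} {σ : Env} (h : Valid (Ctx.consec 0 (T :: Ts)) σ) :
    pull (Ctx.keys (Ctx.consec 1 Ts)) (Ctx.consec 0 Ts) σ = fun i => σ (i + 1) := by
  funext i
  have hk : (Ctx.keys (Ctx.consec 1 Ts)).map σ =
      (Ctx.keys (Ctx.consec 0 Ts)).map fun i => σ (i + 1) := by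
    rw [Ctx.keys_consec, Ctx.keys_consec, List.range'_eq_map_range, List.range'_eq_map_range,
      List.map_map, List.map_map]
    apply List.map_congr_left
    intro x _
    simp [Function.comp, add_comm]
  rw [pull, hk, Env.set_map]
  split_ifs with hi
  · rfl
  · symm
    apply h.eq_zero
    rw [Ctx.mem_keys_consec] at hi ⊢
    simp only [List.length_cons]
    lia

/-- A controlled operator, in terms of projections. -/
theorem UOp.sem_ctrl (U : UOp) (Ts : List Ty) : (UOp.ctrl U).sem (boolTy :: Ts) =
    projOp _ (fun σ => ¬ σ 0 = 1) + projOp _ (fun σ => σ 0 = 1) *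
      Op.at (Ctx.consec 0 (boolTy :: Ts)) (Ctx.keys (Ctx.consec 1 Ts)) (Ctx.consec 0 Ts)
        (U.sem Ts) := by
  classical
  ext τ σ
  have hc : (∀ x, x ∉ Ctx.keys (Ctx.consec 1 Ts) → τ.1 x = σ.1 x) ↔ τ.1 0 = σ.1 0 := by
    constructor
    · intro h
      apply h
      rw [Ctx.mem_keys_consec]; lia
    · intro h x hx
      by_cases hx0 : x = 0
      · rw [hx0, h]
      · have : x ∉ Ctx.keys (Ctx.consec 0 (boolTy :: Ts)) := by
          rw [Ctx.mem_keys_consec] at hx ⊢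
          simp only [List.length_cons]
          lia
        rw [τ.valid.eq_zero this, σ.valid.eq_zero this]
  have hat : Op.at (Ctx.consec 0 (boolTy :: Ts)) (Ctx.keys (Ctx.consec 1 Ts)) (Ctx.consec 0 Ts)
      (U.sem Ts) τ σ = if τ.1 0 = σ.1 0 then U.sem Ts (State.ofEnv _ fun i => τ.1 (i + 1))
        (State.ofEnv _ fun i => σ.1 (i + 1)) else 0 := by
    change (if _ then U.sem Ts (State.ofEnv _ (pull _ _ τ.1)) (State.ofEnv _ (pull _ _ σ.1)) else 0)
      = _
    rw [pull_consec_succ τ.2, pull_consec_succ σ.2]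
    exact if_congr hc rfl rfl
  rw [Matrix.add_apply, projOp, projOp, Matrix.diagonal_mul, hat, UOp.sem, of_apply, diagonal_apply]
  by_cases h0 : τ.1 0 = σ.1 0
  · by_cases h1 : σ.1 0 = 1
    · simp [h0, h1]
    · simp [h0, h1]
  · have h0' : τ ≠ σ := fun h => h0 (by rw [h])
    simp [h0, h0']

/-- Operators commute with projections given by other variables. -/
theorem Match.commute_projOp {Γ Ω : Ctx} {qs : List Var} (h : Match Γ qs Ω) (U : Op Ω)
    {P : Env → Prop} (hP : ∀ e e' : Env, Valid Γ e → Valid Γ e' → (∀ x, x ∉ qs → e x = e' x) → (P e ↔ P e')) :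
    Op.at Γ qs Ω U * projOp Γ P = projOp Γ P * Op.at Γ qs Ω U := by
  classical
  apply Op.ext_mulVec
  intro ψ τ
  rw [← mulVec_mulVec, ← mulVec_mulVec, projOp_mulVec, h.at_mulVec, h.at_mulVec]
  have : ∀ ω, P (τ.put qs ω).1 ↔ P τ.1 := fun ω =>
    hP _ _ (State.valid _) (State.valid _) fun x hx => by rw [h.put_val, put_of_not_mem _ _ hx]
  simp only [projOp_mulVec, this]
  split_ifs <;> simp

theorem projOp_mul_self {Γ : Ctx} (P : Env → Prop) : projOp Γ P * projOp Γ P = projOp Γ P := by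
  classical
  apply Op.ext_mulVec
  intro ψ τ
  rw [← mulVec_mulVec, projOp_mulVec, projOp_mulVec]
  split_ifs <;> rfl

theorem projOp_conjTranspose {Γ : Ctx} (P : Env → Prop) : (projOp Γ P)ᴴ = projOp Γ P := by
  rw [projOp, diagonal_conjTranspose]
  congr 1
  funext σ
  rw [Pi.star_apply]
  split_ifs <;> simp

theorem projOp_not_mul {Γ : Ctx} (P : Env → Prop) :
    projOp Γ (fun e => ¬ P e) * projOp Γ P = 0 := by
  classical
  apply Op.ext_mulVec
  intro ψ τ
  rw [← mulVec_mulVec, projOp_mulVec, projOp_mulVec, zero_mulVec]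
  split_ifs <;> simp_all

theorem projOp_not_add {Γ : Ctx} (P : Env → Prop) :
    projOp Γ (fun e => ¬ P e) + projOp Γ P = 1 := by
  classical
  apply Op.ext_mulVec
  intro ψ τ
  rw [add_mulVec, Pi.add_apply, projOp_mulVec, projOp_mulVec, one_mulVec]
  by_cases h : P τ.1 <;> simp [h]

/-- Classical gates are injective basis maps: at most one coordinate changes, either by negation or
by a shift that depends on the others. `Z` and the reflection are diagonal with signs, and the
Fourier transform is unitary by orthogonality of characters. A controlled gate has the block form
`P0 + P1 * A`, where the unitary `A` commutes with both projections. -/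
theorem UOp.sem_unitary {U : UOp} {Ts : List Ty} (h : U.WT Ts) :
    U.sem Ts ∈ unitaryGroup (State (Ctx.consec 0 Ts)) ℂ := by
  induction U generalizing Ts with
  | X =>
    cases (h : Ts = _)
    rw [UOp.sem_X]
    refine pushOp_unitary (fun e he => he.update ?_) fun e e' he he' h1 => ?_
    · rw [dim_consec_one]
      exact lt_of_le_of_lt (Nat.sub_le _ _) (by decide)
    · rw [valid_consec_one he he']
      have h2 := congrFun h1 0
      have h3 := he 0
      have h4 := he' 0
      rw [dim_consec_one] at h3 h4
      change _ < 2 at h3 h4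
      simp only [Function.update_self] at h2
      omega
  | Z =>
    cases (h : Ts = _)
    rw [UOp.sem_Z]
    apply diagonal_unitary
    intro i
    rw [star_pow, ← mul_pow]; simp
  | H =>
    cases (h : Ts = _)
    rw [UOp.H_eq_unif]
    exact UOp.unif_unitary _
  | CNOT =>
    cases (h : Ts = _)
    rw [UOp.sem_CNOT]
    have hd : Ctx.dim (Ctx.consec 0 [boolTy, boolTy]) 1 = 2 := rfl
    refine pushOp_unitary (fun e he => he.update ?_) fun e e' he he' h1 => ?_
    · rw [hd]
      exact Nat.mod_lt _ (by decide)
    · funext x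
      have h0 : e 0 = e' 0 := by simpa using congrFun h1 0
      by_cases hx : x = 1
      · subst hx
        have h2 := congrFun h1 1
        have h3 := he 1
        have h4 := he' 1
        rw [hd] at h3 h4
        simp only [Function.update_self] at h2
        omega
      · simpa [hx] using congrFun h1 x
  | embed xs E =>
    rw [UOp.sem_embed]
    simp only [Env.set_singleton]
    refine pushOp_unitary (fun e he => he.update (Nat.mod_lt _ (Ctx.dim_pos _ _)))
      fun e e' he he' h1 => ?_
    have h0 : ∀ x, x ≠ xs.length → e x = e' x := fun x hx => by simpa [hx] using congrFun h1 x
    funext x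
    by_cases hx : x = xs.length
    · subst hx
      have hr : (List.range xs.length).map e = (List.range xs.length).map e' :=
        List.map_congr_left fun y hy => h0 y (List.mem_range.1 hy).ne
      have h2 := congrFun h1 xs.length
      simp only [Function.update_self, hr] at h2
      have h3 := he xs.length
      have h4 := he' xs.length
      have h5 : e xs.length ≡ e' xs.length [MOD Ctx.dim (Ctx.consec 0 Ts) xs.length] :=
        Nat.ModEq.add_right_cancel' _ h2
      rwa [Nat.ModEq, Nat.mod_eq_of_lt h3, Nat.mod_eq_of_lt h4] at h5
    · exact h0 x hx
  | unif T =>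
    cases (h : Ts = _)
    exact UOp.unif_unitary _
  | refl0 T =>
    rw [UOp.sem_refl0 T Ts h]
    apply diagonal_unitary
    intro i
    split_ifs <;> simp
  | adj U ih => exact conjTranspose_mem_unitaryGroup (ih h)
  | ctrl U ih =>
    obtain ⟨Ts', rfl, hU⟩ := h
    rw [UOp.sem_ctrl]
    set P1 := projOp (Ctx.consec 0 (boolTy :: Ts')) (fun σ => σ 0 = 1) with hP1
    set P0 := projOp (Ctx.consec 0 (boolTy :: Ts')) (fun σ => ¬ σ 0 = 1) with hP0
    have hm := Match.consec_succ boolTy Ts'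
    set A := Op.at (Ctx.consec 0 (boolTy :: Ts')) (Ctx.keys (Ctx.consec 1 Ts')) (Ctx.consec 0 Ts')
        (U.sem Ts') with hA
    have hAu : A * Aᴴ = 1 := unitary_mul_conj (hm.at_unitary (ih hU))
    have hcomm : A * P1 = P1 * A := hm.commute_projOp _ fun e e' _ _ h => by
      have : e 0 = e' 0 := h 0 (by rw [Ctx.mem_keys_consec]; lia)
      rw [this]
    have hcomm0 : A * P0 = P0 * A := hm.commute_projOp _ fun e e' _ _ h => by
      have : e 0 = e' 0 := h 0 (by rw [Ctx.mem_keys_consec]; lia)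
      rw [this]
    have h01 : P0 * P1 = 0 := projOp_not_mul _
    have h10 : P1 * P0 = 0 := by
      have := congrArg conjTranspose h01
      rwa [conjTranspose_mul, projOp_conjTranspose, projOp_conjTranspose, conjTranspose_zero] at this
    have hs : P0 + P1 = 1 := projOp_not_add _
    rw [mem_unitaryGroup_iff, star_eq_conjTranspose, conjTranspose_add, conjTranspose_mul,
      projOp_conjTranspose, projOp_conjTranspose, ← hP1, ← hP0]
    -- The mixed terms vanish because `A` and `Aᴴ` can be moved past `P0`, which brings the
    -- orthogonal projections together.
    calc (P0 + P1 * A) * (P0 + Aᴴ * P1)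
        = P0 * P0 + P0 * Aᴴ * P1 + P1 * (A * P0) + P1 * (A * Aᴴ) * P1 := by noncomm_ring
      _ = P0 * P0 + P0 * Aᴴ * P1 + P1 * P0 * A + P1 * P1 := by
          rw [hAu, hcomm0, Matrix.mul_one, Matrix.mul_assoc P1 P0 A]
      _ = P0 + P1 := by
          have h3 : P0 * Aᴴ * P1 = 0 := by
            have h4 := congrArg conjTranspose hcomm0
            rw [conjTranspose_mul, conjTranspose_mul, projOp_conjTranspose] at h4
            rw [h4, Matrix.mul_assoc, h01, Matrix.mul_zero]
          rw [projOp_mul_self, projOp_mul_self, h3, h10, Matrix.zero_mul, add_zero, add_zero]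
      _ = 1 := hs

/-! ## Statements and procedures -/

theorem map_getD_of_map_get {Γ : Ctx} {qs : List Var} {Ts : List Ty}
    (h : qs.map (Ctx.get Γ) = Ts.map some) : (qs.map fun q => (Ctx.get Γ q).getD 1) = Ts := by
  have := congrArg (List.map fun o : Option Ty => o.getD 1) h
  rw [List.map_map, List.map_map] at this
  exact this.trans (by simp [Function.comp_def])

theorem sem_app (ρ : PName → Option (Σ Ω : Ctx, Op Ω)) {Γ : Ctx} {qs : List Var} {Ts : List Ty}
    (h : qs.map (Ctx.get Γ) = Ts.map some) (U : UOp) :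
    UStmt.sem ρ Γ (.app qs U) = Op.at Γ qs (Ctx.consec 0 Ts) (U.sem Ts) := by
  change Op.at Γ qs (Ctx.consec 0 (qs.map fun q => (Ctx.get Γ q).getD 1))
    (U.sem (qs.map fun q => (Ctx.get Γ q).getD 1)) = _
  rw [map_getD_of_map_get h]

theorem sem_call {ρ : PName → Option (Σ Ω : Ctx, Op Ω)} {g : PName} {P : Σ Ω : Ctx, Op Ω}
    (h : ρ g = some P) (Γ : Ctx) (qs : List Var) :
    UStmt.sem ρ Γ (.call g qs) = Op.at Γ qs P.1 P.2 := by
  rw [UStmt.sem, h]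

theorem sem_callAdj {ρ : PName → Option (Σ Ω : Ctx, Op Ω)} {g : PName} {P : Σ Ω : Ctx, Op Ω}
    (h : ρ g = some P) (Γ : Ctx) (qs : List Var) :
    UStmt.sem ρ Γ (.callAdj g qs) = (Op.at Γ qs P.1 P.2)ᴴ := by
  rw [UStmt.sem, h]

theorem sem_inv (ρ : PName → Option (Σ Ω : Ctx, Op Ω)) (Γ : Ctx) (W : UStmt) :
    UStmt.sem ρ Γ W.inv = (UStmt.sem ρ Γ W)ᴴ := by
  induction W with
  | skip => simp [UStmt.inv, UStmt.sem]
  | app qs U => simp only [UStmt.inv, UStmt.sem, UOp.sem, Op.at_conjTranspose]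
  | seq W₁ W₂ h₁ h₂ => simp only [UStmt.inv, UStmt.sem, conjTranspose_mul, h₁, h₂]
  | call g qs =>
    simp only [UStmt.inv, UStmt.sem]
    cases ρ g <;> simp
  | callAdj g qs =>
    simp only [UStmt.inv, UStmt.sem]
    cases ρ g <;> simp

theorem sem_withDo (ρ : PName → Option (Σ Ω : Ctx, Op Ω)) (Γ : Ctx) (W₁ W₂ : UStmt) :
    UStmt.sem ρ Γ (.withDo W₁ W₂) =
      (UStmt.sem ρ Γ W₁)ᴴ * (UStmt.sem ρ Γ W₂ * UStmt.sem ρ Γ W₁) := by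
  rw [UStmt.withDo, UStmt.sem, UStmt.sem, sem_inv, Matrix.mul_assoc]

theorem wt_inv {Q : ProcCtx} {Γ : Ctx} {W : UStmt} (h : W.WT Q Γ) : W.inv.WT Q Γ := by
  induction W with
  | skip => exact h
  | app qs U => exact h
  | seq W₁ W₂ h₁ h₂ => exact ⟨h₂ h.2, h₁ h.1⟩
  | call g qs => exact h
  | callAdj g qs => exact h

theorem wt_withDo {Q : ProcCtx} {Γ : Ctx} {W₁ W₂ : UStmt} (h₁ : W₁.WT Q Γ) (h₂ : W₂.WT Q Γ) :
    (UStmt.withDo W₁ W₂).WT Q Γ := ⟨h₁, h₂, wt_inv h₁⟩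

theorem wt_seqs {Q : ProcCtx} {Γ : Ctx} {Ws : List UStmt} (h : ∀ W ∈ Ws, W.WT Q Γ) :
    (UStmt.seqs Ws).WT Q Γ := by
  induction Ws with
  | nil => trivial
  | cons W Ws ih =>
    exact ⟨h W (by simp), ih fun W' hW' => h W' (by simp [hW'])⟩

theorem sem_seqs_nil (ρ : PName → Option (Σ Ω : Ctx, Op Ω)) (Γ : Ctx) :
    UStmt.sem ρ Γ (.seqs []) = 1 := rfl

theorem sem_seqs_cons (ρ : PName → Option (Σ Ω : Ctx, Op Ω)) (Γ : Ctx) (W : UStmt)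
    (Ws : List UStmt) :
    UStmt.sem ρ Γ (.seqs (W :: Ws)) = UStmt.sem ρ Γ (.seqs Ws) * UStmt.sem ρ Γ W := rfl

theorem sem_seqs_append (ρ : PName → Option (Σ Ω : Ctx, Op Ω)) (Γ : Ctx) (Ws Ws' : List UStmt) :
    UStmt.sem ρ Γ (.seqs (Ws ++ Ws')) =
      UStmt.sem ρ Γ (.seqs Ws') * UStmt.sem ρ Γ (.seqs Ws) := by
  induction Ws with
  | nil => simp [sem_seqs_nil]
  | cons W Ws ih => rw [List.cons_append, sem_seqs_cons, sem_seqs_cons, ih, Matrix.mul_assoc]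

/-- The interpretation `ρ` gives a unitary for every procedure in `Q`. -/
def Sound (ρ : PName → Option (Σ Ω : Ctx, Op Ω)) (Q : ProcCtx) : Prop :=
  ∀ g G, Q.lookup g = some G → (Ctx.keys G.args).Nodup ∧ ∃ U : Op G.args,
    ρ g = some ⟨G.args, U⟩ ∧ U ∈ unitaryGroup (State G.args) ℂ

theorem Sound.sem_unitary {ρ : PName → Option (Σ Ω : Ctx, Op Ω)} {Q : ProcCtx} (h : Sound ρ Q)
    {Γ : Ctx} {W : UStmt} (hW : W.WT Q Γ) : UStmt.sem ρ Γ W ∈ unitaryGroup (State Γ) ℂ := by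
  induction W with
  | skip => exact one_mem _
  | app qs U =>
    obtain ⟨hn, Ts, hT, hU⟩ := hW
    rw [sem_app ρ hT]
    exact (Match.consec hn hT 0).at_unitary (UOp.sem_unitary hU)
  | seq W₁ W₂ h₁ h₂ => exact mul_mem (h₂ hW.2) (h₁ hW.1)
  | call g qs =>
    obtain ⟨hn, G, hG, hT⟩ := hW
    obtain ⟨hk, U, hU, hu⟩ := h g G hG
    rw [sem_call hU]
    exact (Match.mk hn hk hT : Match Γ qs G.args).at_unitary hu
  | callAdj g qs =>
    obtain ⟨hn, G, hG, hT⟩ := hW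
    obtain ⟨hk, U, hU, hu⟩ := h g G hG
    rw [sem_callAdj hU]
    exact conjTranspose_mem_unitaryGroup
      ((Match.mk hn hk hT : Match Γ qs G.args).at_unitary hu)

theorem lookup_cons {α : Type*} {β : Type*} [DecidableEq α] (h : α) (G : β) (Q : List (α × β)) (g : α) :
    List.lookup g ((h, G) :: Q) = if g = h then some G else List.lookup g Q := by
  by_cases hg : g = h
  · subst hg; simp
  · have : (g == h) = false := by simpa using hg
    simp [List.lookup, hg, this]

theorem mem_of_lookup {α : Type*} {β : Type*} [DecidableEq α] {Q : List (α × β)} {g : α} {G : β}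
    (h : Q.lookup g = some G) : (g, G) ∈ Q := by
  induction Q with
  | nil => simp at h
  | cons p Q ih =>
    obtain ⟨a, b⟩ := p
    rw [lookup_cons] at h
    split_ifs at h with hg
    · cases h; subst hg; simp
    · exact List.mem_cons_of_mem _ (ih h)

theorem ProcCtx.sem_cons (V : UInterp) (h : PName) (G : UProc) (Q : ProcCtx) (g : PName) :
    ProcCtx.sem V ((h, G) :: Q) g =
      if g = h then
        match G with
        | .defn Ω W => some ⟨Ω, W.sem (ProcCtx.sem V Q) Ω⟩
        | .decl Ω _ => some ⟨Ω, V g Ω⟩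
      else ProcCtx.sem V Q g := by
  cases G <;> rfl

theorem ProcCtx.sem_cons_self (V : UInterp) (g : PName) (Ω : Ctx) (W : UStmt) (Q : ProcCtx) :
    ProcCtx.sem V ((g, .defn Ω W) :: Q) g = some ⟨Ω, W.sem (ProcCtx.sem V Q) Ω⟩ := by
  rw [ProcCtx.sem_cons, if_pos rfl]

theorem ProcCtx.sem_cons_ne (V : UInterp) {g h : PName} (hg : g ≠ h) (G : UProc) (Q : ProcCtx) :
    ProcCtx.sem V ((h, G) :: Q) g = ProcCtx.sem V Q g := by
  rw [ProcCtx.sem_cons, if_neg hg]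

theorem ProcCtx.sem_of_decl (V : UInterp) {Q : ProcCtx} {g : PName} {Ω : Ctx} {t : ℕ}
    (h : Q.lookup g = some (.decl Ω t)) : ProcCtx.sem V Q g = some ⟨Ω, V g Ω⟩ := by
  induction Q with
  | nil => simp at h
  | cons p Q ih =>
    obtain ⟨a, G⟩ := p
    rw [lookup_cons] at h
    rw [ProcCtx.sem_cons]
    split_ifs at h ⊢ with hg
    · cases h; rfl
    · exact ih h

/-- The body of a defined procedure refers to the tail of the context only, so unitarity propagates
from older to newer procedures. Declarations are the base case. -/
theorem ProcCtx.sound {V : UInterp} {Q : ProcCtx} (hQ : ProcCtx.WT Q)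
    (hV : ∀ g Ω t, (g, UProc.decl Ω t) ∈ Q → V g Ω ∈ unitaryGroup (State Ω) ℂ) :
    Sound (ProcCtx.sem V Q) Q := by
  induction Q with
  | nil => intro g G h; simp at h
  | cons p Q ih =>
    obtain ⟨a, G⟩ := p
    obtain ⟨hn, hb, hQ'⟩ := hQ
    have ih' := ih hQ' fun g Ω t hm => hV g Ω t (List.mem_cons_of_mem _ hm)
    intro g G' hG'
    rw [lookup_cons] at hG'
    rw [ProcCtx.sem_cons]
    split_ifs at hG' ⊢ with hg
    · cases hG'
      refine ⟨hn, ?_⟩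
      cases G with
      | defn Ω W => exact ⟨_, rfl, ih'.sem_unitary hb⟩
      | decl Ω t => exact ⟨_, rfl, hV g Ω t (by subst hg; simp)⟩
    · exact ih' g G' hG'

/-- The procedures of `Q` keep their meaning in `Q'`. -/
def Ext (V : UInterp) (Q Q' : ProcCtx) : Prop :=
  ∀ g G, Q.lookup g = some G →
    Q'.lookup g = some G ∧ ProcCtx.sem V Q' g = ProcCtx.sem V Q g

theorem Ext.refl (V : UInterp) (Q : ProcCtx) : Ext V Q Q := fun _ _ h => ⟨h, rfl⟩

theorem Ext.trans {V : UInterp} {Q Q' Q'' : ProcCtx} (h : Ext V Q Q') (h' : Ext V Q' Q'') :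
    Ext V Q Q'' := fun g G hG => by
  obtain ⟨h1, h2⟩ := h g G hG
  obtain ⟨h3, h4⟩ := h' g G h1
  exact ⟨h3, h4.trans h2⟩

theorem Ext.wt {V : UInterp} {Q Q' : ProcCtx} (h : Ext V Q Q') {Γ : Ctx} {W : UStmt}
    (hW : W.WT Q Γ) : W.WT Q' Γ := by
  induction W with
  | skip => exact hW
  | app qs U => exact hW
  | seq W₁ W₂ h₁ h₂ => exact ⟨h₁ hW.1, h₂ hW.2⟩
  | call g qs | callAdj g qs =>
    obtain ⟨hn, G, hG, hT⟩ := hW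
    exact ⟨hn, G, (h g G hG).1, hT⟩

theorem Ext.sem {V : UInterp} {Q Q' : ProcCtx} (h : Ext V Q Q') {Γ : Ctx} {W : UStmt}
    (hW : W.WT Q Γ) :
    UStmt.sem (ProcCtx.sem V Q') Γ W = UStmt.sem (ProcCtx.sem V Q) Γ W := by
  induction W with
  | skip => rfl
  | app qs U => rfl
  | seq W₁ W₂ h₁ h₂ => rw [UStmt.sem, UStmt.sem, h₁ hW.1, h₂ hW.2]
  | call g qs | callAdj g qs =>
    obtain ⟨hn, G, hG, hT⟩ := hW
    rw [UStmt.sem, UStmt.sem, (h g G hG).2]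

/-- A fresh name shadows nothing, so every older name keeps both its entry and its meaning. -/
theorem Ext.cons {V : UInterp} {Q : ProcCtx} {g : PName} (hg : Q.lookup g = none) (G : UProc) :
    Ext V Q ((g, G) :: Q) := by
  intro g' G' hG'
  have : g' ≠ g := by
    rintro rfl
    rw [hg] at hG'
    cases hG'
  rw [lookup_cons, if_neg this, ProcCtx.sem_cons_ne V this]
  exact ⟨hG', rfl⟩

/-! ## Applying gates -/

section Gates
variable (ρ : PName → Option (Σ Ω : Ctx, Op Ω)) {Γ : Ctx}

theorem match_one {q : Var} {T : Ty} (h : Ctx.get Γ q = some T) :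
    Match Γ [q] (Ctx.consec 0 [T]) :=
  Match.consec (by simp) (by simp [h]) 0

theorem sem_app_one {q : Var} {T : Ty} (h : Ctx.get Γ q = some T) (U : UOp) :
    UStmt.sem ρ Γ (.app [q] U) = Op.at Γ [q] (Ctx.consec 0 [T]) (U.sem [T]) :=
  sem_app ρ (by simp [h]) U

theorem sem_app_X {q : Var} (h : Ctx.get Γ q = some boolTy) :
    UStmt.sem ρ Γ (.app [q] .X) = pushOp Γ (fun σ => Function.update σ q (1 - σ q)) := by
  rw [sem_app_one ρ h, UOp.sem_X, (match_one h).at_pushOp]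
  · apply pushOp_congr
    intro e he
    rw [put_one, Function.update_self, pull_one]
  · intro e he
    refine he.update ?_
    rw [dim_consec_one]
    exact lt_of_le_of_lt (Nat.sub_le _ _) (by decide)

/-- The gate sees its operands at positions `0, …, ns.length - 1` and its target at position
`ns.length`. Written back into `Γ`, it updates `x` alone. -/
theorem sem_app_embed {vs : List Var} {x : Var} {ns : List Var} {Ts : List Ty} {T : Ty} {E : Expr}
    (hn : (vs ++ [x]).Nodup) (hv : vs.map (Ctx.get Γ) = Ts.map some)
    (hx : Ctx.get Γ x = some T) (hl : ns.length = Ts.length) :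
    UStmt.sem ρ Γ (.app (vs ++ [x]) (.embed ns E)) =
      pushOp Γ (fun σ => Function.update σ x
        ((σ x + E.eval (ns.zip Ts) (Env.set 0 ns (vs.map σ))) % (T : ℕ))) := by
  have hT : (vs ++ [x]).map (Ctx.get Γ) = (Ts ++ [T]).map some := by simp [hv, hx]
  have hm := Match.consec hn hT 0
  rw [sem_app ρ hT, UOp.sem_embed, hm.at_pushOp]
  swap
  · intro e he
    simp only [Env.set_singleton]
    exact he.update (Nat.mod_lt _ (Ctx.dim_pos _ _))
  apply pushOp_congr
  intro e he
  -- There is one name fewer than there are types, so the zip ignores the type of the target.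
  have hz : ns.zip (Ts ++ [T]) = ns.zip Ts := by
    conv_lhs => rw [show ns = ns ++ [] by simp]
    rw [List.zip_append hl]; simp
  have hk : Ctx.keys (Ctx.consec 0 (Ts ++ [T])) = List.range ns.length ++ [ns.length] := by
    rw [Ctx.keys_consec, ← List.range_eq_range', List.length_append, List.length_singleton,
      List.range_succ, hl]
  have hd : Ctx.dim (Ctx.consec 0 (Ts ++ [T])) ns.length = T := by
    apply Ctx.dim_of_get
    rw [Ctx.consec_append, Ctx.get_append, if_neg, Ctx.consec, Ctx.get_cons, if_pos]
    · simp [hl]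
    · rw [Ctx.mem_keys_consec]; lia
  have hp := hm.map_pull e
  rw [hk, List.map_append, List.map_append, List.map_singleton, List.map_singleton] at hp
  obtain ⟨hp1, hp2⟩ := List.append_inj' hp rfl
  rw [List.cons.injEq] at hp2
  rw [hz, hd, hp1, hp2.1]
  symm
  rw [hm.eq_put_iff]
  · constructor
    · intro y hy
      rw [Function.update_of_ne]
      rintro rfl
      simp at hy
    · rw [pull, hk, List.map_append, List.map_singleton, Function.update_self]
      have h1 : vs.map (Function.update e x ((e x + E.eval (ns.zip Ts) (Env.set 0 ns (vs.map e))) %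
          (T : ℕ))) = vs.map e := by
        apply List.map_congr_left
        intro y hy
        rw [Function.update_of_ne]
        rintro rfl
        rw [List.nodup_append] at hn
        exact hn.2.2 y hy y (by simp) rfl
      rw [h1]
      funext y
      rw [Env.set_append _ _ _ _ _ (by
        rw [List.length_range, List.length_map, length_eq_of_map_get hv, hl]), Env.set_singleton,
        Env.set_singleton]
      by_cases hy : y ∈ List.range ns.length
      · have hy' := List.mem_range.1 hy
        rw [if_pos hy, Function.update_of_ne (by lia), ← hp1, Env.set_map, if_pos hy]
      · rw [if_neg hy]
        by_cases hy2 : y = ns.length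
        · rw [hy2, Function.update_self, Function.update_self]
        · rw [Function.update_of_ne hy2, Function.update_of_ne hy2]
          refine ((hm.valid_pull he).eq_zero ?_).symm
          rw [hk, List.mem_append, List.mem_singleton]
          simp only [hy, hy2, or_self, not_false_eq_true]
  · rw [Env.set_singleton]
    refine (hm.valid_pull he).update ?_
    rw [hd]
    exact Nat.mod_lt _ T.pos

theorem wt_app_embed {Q : ProcCtx} {vs : List Var} {x : Var} {ns : List Var} {Ts : List Ty} {T : Ty}
    {E : Expr} (hn : (vs ++ [x]).Nodup) (hv : vs.map (Ctx.get Γ) = Ts.map some)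
    (hx : Ctx.get Γ x = some T) (hl : ns.length = Ts.length) (hns : ns.Nodup)
    (hE : E.type (ns.zip Ts) = some T) :
    UStmt.WT Q Γ (.app (vs ++ [x]) (.embed ns E)) :=
  ⟨hn, Ts ++ [T], by simp [hv, hx], hns, Ts, T, rfl, hl, hE⟩

theorem sem_app_CNOT {a b : Var} (hab : a ≠ b) (ha : Ctx.get Γ a = some boolTy)
    (hb : Ctx.get Γ b = some boolTy) :
    UStmt.sem ρ Γ (.app [a, b] .CNOT) =
      pushOp Γ (fun σ => Function.update σ b ((σ b + σ a) % 2)) := by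
  have hT : [a, b].map (Ctx.get Γ) = [boolTy, boolTy].map some := by simp [ha, hb]
  have hm := Match.consec (by simp [hab]) hT 0
  have hd : Ctx.dim (Ctx.consec 0 [boolTy, boolTy]) 1 = 2 := rfl
  rw [sem_app ρ hT, UOp.sem_CNOT, hm.at_pushOp]
  swap
  · intro e he
    exact he.update (by rw [hd]; exact Nat.mod_lt _ (by decide))
  apply pushOp_congr
  intro e he
  have h0 : pull [a, b] (Ctx.consec 0 [boolTy, boolTy]) e 0 = e a :=
    hm.pull_of_zip e (by simp [Ctx.consec])
  have h1 : pull [a, b] (Ctx.consec 0 [boolTy, boolTy]) e 1 = e b :=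
    hm.pull_of_zip e (by simp [Ctx.consec])
  rw [h0, h1, put_two]
  funext y
  by_cases hya : y = a
  · subst hya
    simp [hab, h0]
  · by_cases hyb : y = b
    · subst hyb; simp [hya]
    · simp [hya, hyb]

/-- The controlled copy of `CtrlClean` is the only use of `ctrl` by the compiler. The projection
formula `UOp.sem_ctrl` has two branches here, the copy and the identity, which combine to one
conditional basis map. -/
theorem sem_app_ctrl_copy {q a b : Var} {T : Ty} (hn : [q, a, b].Nodup)
    (hq : Ctx.get Γ q = some boolTy) (ha : Ctx.get Γ a = some T) (hb : Ctx.get Γ b = some T) :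
    UStmt.sem ρ Γ (.app [q, a, b] (.ctrl (.embed [0] (.var 0)))) =
      pushOp Γ (fun σ => Function.update σ b ((σ b + if σ q = 1 then σ a else 0) % (T : ℕ))) := by
  classical
  have hT : [q, a, b].map (Ctx.get Γ) = (boolTy :: [T, T]).map some := by simp [hq, ha, hb]
  have hm := Match.consec hn hT 0
  have hd : Ctx.dim (Ctx.consec 0 [T, T]) 1 = T := rfl
  have hsem : (UOp.embed [0] (.var 0)).sem [T, T] = pushOp (Ctx.consec 0 [T, T])
      (fun σ => Function.update σ 1 ((σ 1 + σ 0) % (T : ℕ))) := by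
    rw [UOp.sem_embed]
    apply pushOp_congr
    intro e he
    rw [Env.set_singleton]
    simp only [List.length_singleton, hd, Expr.eval, List.range_one, List.map_singleton,
      Env.set_singleton, Function.update_self]
  have hp : Pres (Ctx.consec 0 [T, T]) (fun σ => Function.update σ 1 ((σ 1 + σ 0) % (T : ℕ))) :=
    fun e he => he.update (by rw [hd]; exact Nat.mod_lt _ T.pos)
  have hc := Match.consec_succ boolTy [T, T]
  have hctrl : (UOp.ctrl (.embed [0] (.var 0))).sem (boolTy :: [T, T]) =
      pushOp (Ctx.consec 0 (boolTy :: [T, T]))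
        (fun σ => Function.update σ 2 ((σ 2 + if σ 0 = 1 then σ 1 else 0) % (T : ℕ))) := by
    rw [UOp.sem_ctrl, hsem, hc.at_pushOp hp]
    apply Op.ext_mulVec
    intro ψ τ
    have hk : ∀ e, Valid (Ctx.consec 0 (boolTy :: [T, T])) e →
        put (Ctx.keys (Ctx.consec 1 [T, T])) (Ctx.consec 0 [T, T]) e
          (Function.update (pull (Ctx.keys (Ctx.consec 1 [T, T])) (Ctx.consec 0 [T, T]) e) 1
            ((pull (Ctx.keys (Ctx.consec 1 [T, T])) (Ctx.consec 0 [T, T]) e 1 +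
              pull (Ctx.keys (Ctx.consec 1 [T, T])) (Ctx.consec 0 [T, T]) e 0) % (T : ℕ))) =
          Function.update e 2 ((e 2 + e 1) % (T : ℕ)) := by
      intro e he
      rw [pull_consec_succ he]
      change put [1, 2] _ _ _ = _
      rw [put_two]
      funext y
      by_cases hy1 : y = 1
      · subst hy1; simp
      · by_cases hy2 : y = 2
        · subst hy2; simp
        · simp [hy1, hy2]
    rw [pushOp_congr hk, add_mulVec, Pi.add_apply, ← mulVec_mulVec, projOp_mulVec, projOp_mulVec,
      pushOp_mulVec, pushOp_mulVec]
    by_cases h0 : τ.1 0 = 1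
    · rw [if_neg (not_not.2 h0), if_pos h0, zero_add]
      refine Finset.sum_congr rfl fun σ _ => if_congr ?_ rfl rfl
      constructor
      · intro h
        have : σ.1 0 = 1 := by rw [h] at h0; simpa using h0
        rw [if_pos this]; exact h
      · intro h
        have : σ.1 0 = 1 := by rw [h] at h0; simpa using h0
        rw [if_pos this] at h; exact h
    · rw [if_pos h0, if_neg h0, add_zero, Finset.sum_eq_single τ]
      · rw [if_neg h0, add_zero, if_pos]
        have := τ.2 2
        rw [show Ctx.dim (Ctx.consec 0 (boolTy :: [T, T])) 2 = T from rfl] at this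
        rw [Nat.mod_eq_of_lt this, Function.update_eq_self]
      · intro σ _ hσ
        rw [if_neg]
        intro h
        have h1 : σ.1 0 ≠ 1 := by rw [h] at h0; simpa using h0
        rw [if_neg h1, add_zero] at h
        have := σ.2 2
        rw [show Ctx.dim (Ctx.consec 0 (boolTy :: [T, T])) 2 = T from rfl] at this
        rw [Nat.mod_eq_of_lt this, Function.update_eq_self] at h
        exact hσ (State.eq_iff.2 h.symm)
      · simp
  rw [sem_app ρ hT, hctrl, hm.at_pushOp]
  swap
  · intro e he
    exact he.update (by
      rw [show Ctx.dim (Ctx.consec 0 (boolTy :: [T, T])) 2 = T from rfl]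
      exact Nat.mod_lt _ T.pos)
  apply pushOp_congr
  intro e he
  have h0 : pull [q, a, b] (Ctx.consec 0 (boolTy :: [T, T])) e 0 = e q :=
    hm.pull_of_zip e (by simp [Ctx.consec])
  have h1 : pull [q, a, b] (Ctx.consec 0 (boolTy :: [T, T])) e 1 = e a :=
    hm.pull_of_zip e (by simp [Ctx.consec])
  have h2 : pull [q, a, b] (Ctx.consec 0 (boolTy :: [T, T])) e 2 = e b :=
    hm.pull_of_zip e (by simp [Ctx.consec])
  simp only [List.nodup_cons, List.mem_cons, List.not_mem_nil, or_false, not_or,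
    List.nodup_nil, and_true, not_false_eq_true] at hn
  rw [h0, h1, h2]
  funext y
  rw [put, show Ctx.keys (Ctx.consec 0 (boolTy :: [T, T])) = [0, 1, 2] from rfl]
  simp only [List.map_cons, List.map_nil, Env.set_cons, Env.set_nil]
  by_cases hyq : y = q
  · subst hyq
    simp [hn.1.2, h0]
  · by_cases hya : y = a
    · subst hya; simp [hyq, hn.2, h1]
    · by_cases hyb : y = b
      · subst hyb; simp [hyq, hya]
      · simp [hyq, hya, hyb]

end Gates

/-! ## Amplitudes of Grover search -/

/-- The amplitudes of the solutions and of the other elements after `m` iterations of Grover search,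
in a space of size `N` with `t` solutions. -/
noncomputable def amp (N t : ℕ) : ℕ → ℝ × ℝ
  | 0 => (1 / √N, 1 / √N)
  | m + 1 =>
      let r := amp N t m
      (2 * ((N - t) * r.2 - t * r.1) / N + r.1, 2 * ((N - t) * r.2 - t * r.1) / N - r.2)

theorem amp_succ (N t m : ℕ) : amp N t (m + 1) =
    (2 * ((N - t) * (amp N t m).2 - t * (amp N t m).1) / N + (amp N t m).1,
      2 * ((N - t) * (amp N t m).2 - t * (amp N t m).1) / N - (amp N t m).2) := rfl

/-- Multiplying by the roots of the numbers of solutions and non-solutions gives orthonormal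
coordinates, in which an iteration is the rotation by `2θ`. The induction step is the addition
theorem for sine and cosine. -/
theorem amp_eq {N t : ℕ} (ht : 0 < t) (htN : t < N) {θ : ℝ} (hs : Real.sin θ = √t / √N)
    (hc : Real.cos θ = √(N - t : ℝ) / √N) (m : ℕ) :
    √t * (amp N t m).1 = Real.sin ((2 * m + 1) * θ) ∧
      √(N - t : ℝ) * (amp N t m).2 = Real.cos ((2 * m + 1) * θ) := by
  have ht' : (0 : ℝ) < t := by exact_mod_cast ht
  have hN' : (0 : ℝ) < N := by exact_mod_cast ht.trans htN
  have hd' : (0 : ℝ) < N - t := by rw [sub_pos]; exact_mod_cast htN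
  have e1 := Real.mul_self_sqrt ht'.le
  have e2 := Real.mul_self_sqrt hN'.le
  have e3 := Real.mul_self_sqrt hd'.le
  have hN0 : √(N : ℝ) ≠ 0 := (Real.sqrt_pos.2 hN').ne'
  induction m with
  | zero =>
    simp only [amp, Nat.cast_zero, mul_zero, zero_add, one_mul, hs, hc]
    constructor <;> ring
  | succ m ih =>
    obtain ⟨h1, h2⟩ := ih
    have ha : (2 * ((m + 1 : ℕ) : ℝ) + 1) * θ = (2 * m + 1) * θ + 2 * θ := by push_cast; ring
    rw [ha, Real.sin_add, Real.cos_add, Real.sin_two_mul, Real.cos_two_mul, ← h1, ← h2, hs, hc,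
      amp_succ]
    set a := √(t : ℝ)
    set b := √(N : ℝ)
    set c := √((N : ℝ) - t)
    set g := (amp N t m).1
    set h := (amp N t m).2
    have e4 : (t : ℝ) = b * b - c * c := by rw [e2, e3]; ring
    have e5 : a * a = b * b - c * c := by rw [e1, e4]
    simp only
    rw [← e3, ← e2, e4]
    constructor
    · field_simp
      ring
    · field_simp
      linear_combination (2 * c * g) * e5

/-- The sum telescopes, since `2 sin y cos((2m+1)y) = sin((2m+2)y) - sin(2my)`. -/
theorem sum_cos_odd (M : ℕ) (y : ℝ) :
    2 * Real.sin y * ∑ m ∈ Finset.range M, Real.cos ((2 * m + 1) * y) = Real.sin (2 * M * y) := by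
  induction M with
  | zero => simp
  | succ M ih =>
    rw [Finset.sum_range_succ, mul_add, ih]
    have h1 : 2 * ((M + 1 : ℕ) : ℝ) * y = (2 * M + 1) * y + y := by push_cast; ring
    have h2 : 2 * (M : ℝ) * y = (2 * M + 1) * y - y := by ring
    rw [h1, h2, Real.sin_add, Real.sin_sub]
    ring

/-- Jordan's inequality `sin z ≥ 2z/π` gives `M sin z ≥ 2`, so the right-hand side is at least
`1.04`. -/
theorem sin_large_bound {M z : ℝ} (hM : 0 < M) (hz0 : 0 < z) (hz : z ≤ Real.pi / 2)
    (h : 2 * Real.pi ≤ 2 * M * z) (x : ℝ) : Real.sin x ≤ 0.52 * M * Real.sin z := by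
  have h1 := Real.mul_le_sin hz0.le hz
  have hpi := Real.pi_pos
  have h2 : 2 ≤ M * Real.sin z := by
    have h3 : 2 ≤ M * (2 / Real.pi * z) := by
      rw [show M * (2 / Real.pi * z) = (2 * M * z) / Real.pi by ring, le_div_iff₀ hpi]
      exact h
    exact h3.trans (mul_le_mul_of_nonneg_left h1 hM.le)
  have := Real.sin_le_one x
  nlinarith

/-- This serves the case of more than half of the elements being solutions, with `z = π - 2θ`. For
`u = 2Mz` the sign of the sine settles `u ≤ π` and `sin_large_bound` settles `u ≥ 2π`; the interval
between them needs numerical estimates. -/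
theorem neg_sin_bound {M z : ℝ} (hM : 3 ≤ M) (hz0 : 0 < z) (hz : z ≤ Real.pi / 2) :
    -Real.sin (2 * M * z) ≤ 0.52 * M * Real.sin z := by
  have hpi := Real.pi_pos
  have hp1 := Real.pi_gt_d6
  have hp2 := Real.pi_lt_d6
  have hsz : 0 ≤ Real.sin z := Real.sin_nonneg_of_nonneg_of_le_pi hz0.le (by linarith)
  set u := 2 * M * z with hu
  rcases le_or_gt u Real.pi with h1 | h1
  · have : 0 ≤ Real.sin u := Real.sin_nonneg_of_nonneg_of_le_pi (by positivity) h1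
    have : 0 ≤ 0.52 * M * Real.sin z := by positivity
    linarith
  rcases le_or_gt (2 * Real.pi) u with h2 | h2
  · rw [← Real.sin_neg]
    exact sin_large_bound (by linarith) hz0 hz h2 _
  -- From `sin z ≥ z - z³/6` with `z = u/(2M)`: the cubic term is `u³/(48M²)`, which is at most
  -- `u³/432` because `M ≥ 3`.
  have hlow : 0.26 * (u - u ^ 3 / 216) ≤ 0.52 * M * Real.sin z := by
    have h3 : z - z ^ 3 / 6 ≤ Real.sin z := Real.sin_ge_sub_cube hz0.le
    have h4 : M * z ^ 3 / 6 ≤ u ^ 3 / 432 := by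
      rw [hu]
      have : 0 ≤ M * z ^ 3 * (M ^ 2 - 9) := by
        have : 0 ≤ M ^ 2 - 9 := by nlinarith
        positivity
      nlinarith
    have h5 := mul_le_mul_of_nonneg_left h3 (by linarith : 0 ≤ M)
    have h6 : M * (z - z ^ 3 / 6) = u / 2 - M * z ^ 3 / 6 := by rw [hu]; ring
    linarith
  refine le_trans ?_ hlow
  have hsv : -Real.sin u = Real.sin (u - Real.pi) := by rw [Real.sin_sub_pi]
  rw [hsv]
  -- On the three pieces, `-sin u = sin(u - π)` is bounded by `u - π`, by `sin(π/3)` and by `1`.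
  rcases le_or_gt u 4.12 with h3 | h3
  · have h4 : Real.sin (u - Real.pi) ≤ u - Real.pi := Real.sin_le (by linarith)
    have h5 : u ^ 3 ≤ u * 16.98 := by
      have h8 : u ^ 2 ≤ 16.98 := by
        have : u ≤ 4.12 := by linarith
        nlinarith
      have h9 := mul_nonneg (by linarith : 0 ≤ u) (sub_nonneg.2 h8)
      linarith
    linarith
  rcases le_or_gt u (4 * Real.pi / 3) with h4 | h4
  · have h5 : Real.sin (u - Real.pi) ≤ √3 / 2 := by
      rw [← Real.sin_pi_div_three]
      exact Real.sin_le_sin_of_le_of_le_pi_div_two (by linarith) (by linarith) (by linarith)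
    have h6 : √3 ≤ 1.74 := by
      rw [Real.sqrt_le_left (by norm_num)]; norm_num
    have h7 : u ^ 3 ≤ u * 17.6 := by
      have h8 : u ^ 2 ≤ 17.6 := by
        have : u ≤ (4 * 3.141593 / 3) := by linarith
        nlinarith
      have h9 := mul_nonneg (by linarith : 0 ≤ u) (sub_nonneg.2 h8)
      linarith
    linarith
  · have h5 := Real.sin_le_one (u - Real.pi)
    have h6 : (4.1887 : ℝ) ≤ u := by linarith
    have h7 : u ≤ 6.2832 := by linarith
    -- The lower bound increases with `u` on this range. At `4.1887`, just below `4π/3`, it is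
    -- already about `1.0006` after multiplication by `0.26`.
    have h8 : (4.1887 : ℝ) - 4.1887 ^ 3 / 216 ≤ u - u ^ 3 / 216 := by
      have : 0 ≤ (u - 4.1887) * (216 - (u ^ 2 + u * 4.1887 + 4.1887 ^ 2)) :=
        mul_nonneg (by linarith) (by nlinarith)
      nlinarith
    norm_num at h8
    linarith

theorem groverIters_eq_two {N : ℕ} (h1 : 2 ≤ N) (h2 : N ≤ 6) : groverIters N = 2 := by
  have hp1 := Real.pi_gt_d6
  have hp2 := Real.pi_lt_d6
  have hN1 : (2 : ℝ) ≤ N := by exact_mod_cast h1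
  have hN2 : (N : ℝ) ≤ 6 := by exact_mod_cast h2
  have s1 : (1.4 : ℝ) ≤ √N := by rw [Real.le_sqrt (by norm_num) (by positivity)]; linarith
  have s2 : √(N : ℝ) ≤ 2.45 := by rw [Real.sqrt_le_left (by norm_num)]; linarith
  rw [groverIters, Nat.ceil_eq_iff (by norm_num)]
  constructor
  · norm_num; nlinarith
  · norm_num; nlinarith

theorem three_le_groverIters {N : ℕ} (h : 7 ≤ N) : 3 ≤ groverIters N := by
  have hp1 := Real.pi_gt_d6
  have hN1 : (7 : ℝ) ≤ N := by exact_mod_cast h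
  have s1 : (2.64 : ℝ) ≤ √N := by rw [Real.le_sqrt (by norm_num) (by positivity)]; linarith
  rw [groverIters, Nat.add_one_le_ceil_iff]
  norm_num; nlinarith

theorem groverIters_pos {N : ℕ} (h : 0 < N) : 0 < groverIters N := by
  rw [groverIters, Nat.ceil_pos]
  have := Real.pi_pos
  positivity

/-- With a uniformly random number of iterations, Grover search fails with probability at most
`0.63`, if there is a solution. -/
theorem grover_failure {N t : ℕ} (ht : 0 < t) (htN : t ≤ N) :
    ∑ m ∈ Finset.range (groverIters N), ((N : ℝ) - t) * (amp N t m).2 ^ 2 ≤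
      0.63 * groverIters N := by
  rcases htN.eq_or_lt with rfl | htN
  · simp only [sub_self, zero_mul, Finset.sum_const_zero]
    positivity
  -- For `2 ≤ N ≤ 6` there are two possible iteration counts and the claim is a finite check. From
  -- `N = 7` on there are at least three, as `neg_sin_bound` requires.
  rcases le_or_gt N 6 with h6 | h6
  · have hN2 : 2 ≤ N := by omega
    rw [groverIters_eq_two hN2 h6, Finset.sum_range_succ, Finset.sum_range_one, amp_succ, amp]
    have hN' : (0 : ℝ) < N := by positivity
    have hs : (1 / √(N : ℝ)) ^ 2 = 1 / N := by rw [div_pow, Real.sq_sqrt hN'.le, one_pow]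
    have : ((N : ℝ) - t) * (1 / √N) ^ 2 + (N - t) *
        (2 * ((N - t) * (1 / √N) - t * (1 / √N)) / N - 1 / √N) ^ 2 =
        (N - t) / N * (1 + (1 - 4 * t / N) ^ 2) := by
      have : 2 * (((N : ℝ) - t) * (1 / √N) - t * (1 / √N)) / N - 1 / √N =
        (1 / √N) * (1 - 4 * t / N) := by field_simp; ring
      rw [this, mul_pow, hs]; ring
    simp only
    rw [this]
    clear this hs hN'
    interval_cases N <;> interval_cases t <;> norm_num
  · have ht' : (0 : ℝ) < t := by exact_mod_cast ht
    have hN' : (0 : ℝ) < N := by exact_mod_cast ht.trans htN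
    have hd' : (0 : ℝ) < N - t := by rw [sub_pos]; exact_mod_cast htN
    have hpi := Real.pi_pos
    have hsN : 0 < √(N : ℝ) := Real.sqrt_pos.2 hN'
    have hst : 0 < √(t : ℝ) := Real.sqrt_pos.2 ht'
    have hx1 : √(t : ℝ) / √N < 1 := by
      rw [div_lt_one hsN]; exact Real.sqrt_lt_sqrt ht'.le (by linarith)
    have hx0 : 0 < √(t : ℝ) / √N := div_pos hst hsN
    obtain ⟨θ, hθ⟩ : ∃ θ, θ = Real.arcsin (√(t : ℝ) / √N) := ⟨_, rfl⟩
    have hs : Real.sin θ = √t / √N := by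
      rw [hθ, Real.sin_arcsin (by linarith) hx1.le]
    have hc : Real.cos θ = √(N - t : ℝ) / √N := by
      rw [hθ, Real.cos_arcsin, div_pow, Real.sq_sqrt ht'.le, Real.sq_sqrt hN'.le, one_sub_div hN'.ne',
        Real.sqrt_div hd'.le]
    have hθ0 : 0 < θ := by rw [hθ]; exact Real.arcsin_pos.2 hx0
    have hθ1 : θ < Real.pi / 2 := by
      rw [hθ]; exact Real.arcsin_lt_pi_div_two.2 hx1
    set M := groverIters N with hMdef
    have hM3 : (3 : ℝ) ≤ M := by exact_mod_cast three_le_groverIters h6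
    have hterm : ∀ m ∈ Finset.range M, ((N : ℝ) - t) * (amp N t m).2 ^ 2 =
        1 / 2 + Real.cos ((2 * m + 1) * (2 * θ)) / 2 := by
      intro m _
      have h1 := (amp_eq ht htN hs hc m).2
      have h2 : ((N : ℝ) - t) * (amp N t m).2 ^ 2 = (√(N - t : ℝ) * (amp N t m).2) ^ 2 := by
        rw [mul_pow, Real.sq_sqrt hd'.le]
      rw [h2, h1, Real.cos_sq]
      congr 3
      ring
    rw [Finset.sum_congr rfl hterm, Finset.sum_add_distrib,
      ← Finset.sum_div (Finset.range M) fun m : ℕ => Real.cos ((2 * m + 1) * (2 * θ))]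
    simp only [Finset.sum_const, Finset.card_range, nsmul_eq_mul]
    have hsum := sum_cos_odd M (2 * θ)
    set C := ∑ m ∈ Finset.range M, Real.cos ((2 * m + 1) * (2 * θ))
    have hsy : 0 < Real.sin (2 * θ) := Real.sin_pos_of_pos_of_lt_pi (by linarith) (by linarith)
    -- The sum in question is `M/2 + C/2`, so the bound `0.63 M` means `C ≤ 0.26 M`. Multiplied by
    -- `2 sin 2θ > 0`, this is the inequality below.
    have key : Real.sin (2 * M * (2 * θ)) ≤ 0.52 * M * Real.sin (2 * θ) := by
      rcases le_or_gt (2 * θ) (Real.pi / 2) with h | h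
      -- This is where the factor `π/4` is used: `M ≥ (π/4)√N` and `θ ≥ sin θ ≥ 1/√N` give `4Mθ ≥
      -- π`. On `[π, 2π]` the sine is nonpositive, and beyond that interval `sin_large_bound`
      -- applies.
      · have h1 : Real.pi ≤ 2 * M * (2 * θ) := by
          have h2 : Real.pi / 4 * √N ≤ M := Nat.le_ceil _
          have h3 : 1 / √N ≤ θ := by
            refine le_trans ?_ (Real.sin_le hθ0.le)
            rw [hs]
            have : (1 : ℝ) ≤ √t := by
              rw [Real.one_le_sqrt]; exact_mod_cast ht
            gcongr
          calc Real.pi = 4 * (Real.pi / 4 * √N) * (1 / √N) := by field_simp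
            _ ≤ 4 * M * θ := by gcongr
            _ = _ := by ring
        rcases le_or_gt (2 * M * (2 * θ)) (2 * Real.pi) with h2 | h2
        · have h3 : Real.sin (2 * M * (2 * θ)) ≤ 0 := by
            have : 0 ≤ Real.sin (2 * M * (2 * θ) - Real.pi) :=
              Real.sin_nonneg_of_nonneg_of_le_pi (by linarith) (by linarith)
            rw [Real.sin_sub_pi] at this
            linarith
          have : 0 ≤ 0.52 * M * Real.sin (2 * θ) := by positivity
          linarith
        · exact sin_large_bound (by linarith) (by linarith) h h2.le _
      -- Replacing `2θ` by `π - 2θ` keeps `sin 2θ` and changes the sign of `sin(4Mθ)`.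
      · have h1 := neg_sin_bound hM3 (z := Real.pi - 2 * θ) (by linarith) (by linarith)
        rw [Real.sin_pi_sub] at h1
        have h2 : -Real.sin (2 * M * (Real.pi - 2 * θ)) = Real.sin (2 * M * (2 * θ)) := by
          rw [show 2 * (M : ℝ) * (Real.pi - 2 * θ) = M * (2 * Real.pi) - 2 * M * (2 * θ) by ring,
            Real.sin_nat_mul_two_pi_sub, neg_neg]
        rwa [h2] at h1
    rw [← hsum] at key
    have h7 : 2 * C ≤ 0.52 * M := by
      have h8 : Real.sin (2 * θ) * (2 * C) ≤ Real.sin (2 * θ) * (0.52 * M) := by linarith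
      exact le_of_mul_le_mul_left h8 hsy
    linarith

/-! ## Operators that move only some variables -/

/-- The operator `A` changes only variables in `V`. -/
def Local (Γ : Ctx) (V : Set Var) (A : Op Γ) : Prop :=
  ∀ τ σ, A τ σ ≠ 0 → ∀ x, x ∉ V → τ.1 x = σ.1 x

section Local
variable {Γ : Ctx} {V : Set Var} {A B : Op Γ}

theorem Local.one : Local Γ V 1 := by
  intro τ σ h x _
  by_cases hτ : τ = σ
  · rw [hτ]
  · exact absurd (one_apply_ne hτ) h

theorem Local.mul (hA : Local Γ V A) (hB : Local Γ V B) : Local Γ V (A * B) := by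
  intro τ σ h x hx
  rw [Matrix.mul_apply] at h
  obtain ⟨ρ, _, hρ⟩ := Finset.exists_ne_zero_of_sum_ne_zero h
  rw [hA τ ρ (left_ne_zero_of_mul hρ) x hx, hB ρ σ (right_ne_zero_of_mul hρ) x hx]

theorem Local.conj (hA : Local Γ V A) : Local Γ V Aᴴ := by
  intro τ σ h x hx
  rw [conjTranspose_apply, Ne, star_eq_zero] at h
  exact (hA σ τ h x hx).symm

theorem Local.at {qs : List Var} {Ω : Ctx} {U : Op Ω} (h : ∀ q ∈ qs, q ∈ V) :
    Local Γ V (Op.at Γ qs Ω U) := by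
  intro τ σ hne x hx
  simp only [Op.at, of_apply] at hne
  split_ifs at hne with h1
  · exact h1 x fun hq => hx (h x hq)
  · exact absurd rfl hne

theorem Local.pushOp {k : Env → Env} (h : ∀ e x, x ∉ V → k e x = e x) :
    Local Γ V (pushOp Γ k) := by
  intro τ σ hne x hx
  simp only [Traq.pushOp, of_apply] at hne
  split_ifs at hne with h1
  · rw [h1, h _ x hx]
  · exact absurd rfl hne

theorem Local.zeroOn (hA : Local Γ V A) {Z : Set Var} (hZ : ∀ z ∈ Z, z ∉ V) {ψ : State Γ → ℂ}
    (hψ : ZeroOn Z ψ) : ZeroOn Z (A *ᵥ ψ) := by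
  intro τ hτ z hz
  obtain ⟨σ, _, hσ⟩ := Finset.exists_ne_zero_of_sum_ne_zero hτ
  rw [hA τ σ (left_ne_zero_of_mul hσ) z (hZ z hz)]
  exact hψ σ (right_ne_zero_of_mul hσ) z hz

theorem Local.commute_projOp (hA : Local Γ V A) {P : Env → Prop}
    (hP : ∀ e e' : Env, Valid Γ e → Valid Γ e' → (∀ x, x ∉ V → e x = e' x) → (P e ↔ P e')) :
    A * projOp Γ P = projOp Γ P * A := by
  ext τ σ
  rw [projOp, Matrix.mul_diagonal, Matrix.diagonal_mul]
  by_cases h : A τ σ = 0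
  · simp [h]
  · have := hP τ.1 σ.1 τ.2 σ.2 (hA τ σ h)
    by_cases h1 : P τ.1
    · rw [if_pos h1, if_pos (this.1 h1), one_mul, mul_one]
    · rw [if_neg h1, if_neg (fun h2 => h1 (this.2 h2)), zero_mul, mul_zero]

end Local

/-- The unitary `A` approximates the unitary `B` on vectors with zeros in `Z`, and `B` preserves
these zeros. -/
structure Hyb (Γ : Ctx) (Z : Set Var) (A B : Op Γ) (ε : ℝ) : Prop where
  left : A ∈ unitaryGroup (State Γ) ℂ
  right : B ∈ unitaryGroup (State Γ) ℂ
  zero : ∀ ψ, ZeroOn Z ψ → ZeroOn Z (B *ᵥ ψ)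
  approx : ApproxOp Γ Z A B ε

theorem Hyb.refl {Γ : Ctx} {Z V : Set Var} {A : Op Γ} (hA : A ∈ unitaryGroup (State Γ) ℂ)
    (hl : Local Γ V A) (hZ : ∀ z ∈ Z, z ∉ V) : Hyb Γ Z A A 0 :=
  ⟨hA, hA, fun _ hψ => hl.zeroOn hZ hψ, ApproxOp.refl le_rfl⟩

/-- Insert `A₂ B₁` between the two products. The unitary `A₂` carries the first error along
unchanged, and `B₁` keeps the norm and the zeros that the second estimate needs. -/
theorem Hyb.mul {Γ : Ctx} {Z : Set Var} {A₁ A₂ B₁ B₂ : Op Γ} {ε₁ ε₂ : ℝ}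
    (h₂ : Hyb Γ Z A₂ B₂ ε₂) (h₁ : Hyb Γ Z A₁ B₁ ε₁) : Hyb Γ Z (A₂ * A₁) (B₂ * B₁) (ε₂ + ε₁) where
  left := mul_mem h₂.left h₁.left
  right := mul_mem h₂.right h₁.right
  zero ψ hψ := by rw [← mulVec_mulVec]; exact h₂.zero _ (h₁.zero _ hψ)
  approx ψ hψ := by
    rw [← mulVec_mulVec, ← mulVec_mulVec]
    refine (vn_sub_le_sub_add_sub _ (A₂ *ᵥ B₁ *ᵥ ψ) _).trans ?_
    rw [← mulVec_sub, vn_unitary h₂.left]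
    have h3 := h₂.approx _ (h₁.zero _ hψ)
    rw [vn_unitary h₁.right] at h3
    have h4 := h₁.approx ψ hψ
    linarith

theorem Hyb.one (Γ : Ctx) (Z : Set Var) : Hyb Γ Z 1 1 0 :=
  Hyb.refl (V := ∅) (one_mem _) Local.one fun _ _ h => h

theorem Hyb.congr {Γ : Ctx} {Z : Set Var} {A B : Op Γ} {ε ε' : ℝ} (h : Hyb Γ Z A B ε)
    (he : ε = ε') : Hyb Γ Z A B ε' := he ▸ h

/-! ## Vectors given by functions of environments -/

/-- The vector `ψ` has the coefficients given by `f`. -/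
def Rep {Γ : Ctx} (ψ : State Γ → ℂ) (f : Env → ℂ) : Prop := ∀ τ, ψ τ = f τ.1

section Rep
variable {Γ : Ctx} {ψ : State Γ → ℂ} {f : Env → ℂ}

theorem Rep.congr {f' : Env → ℂ} (h : Rep ψ f) (hf : ∀ e, Valid Γ e → f e = f' e) : Rep ψ f' :=
  fun τ => (h τ).trans (hf _ τ.2)

theorem rep_ofEnv (ψ : State Γ → ℂ) : Rep ψ fun e => ψ (State.ofEnv Γ e) := fun τ => by
  change _ = ψ (State.ofEnv Γ τ.1)
  rw [State.ofEnv_self]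

theorem Rep.push (h : Rep ψ f) {k : Env → Env} (hk : Invol Γ k) :
    Rep (pushOp Γ k *ᵥ ψ) fun e => f (k e) := fun τ => by
  rw [hk.mulVec, h, State.ofEnv_val (hk.pres _ τ.2)]

theorem Rep.gate (h : Rep ψ f) {q : Var} {T : Ty} (hq : Ctx.get Γ q = some T)
    {M : Op (Ctx.consec 0 [T])} {m : ℕ → ℕ → ℂ} (hM : ∀ τ σ, M τ σ = m (τ.1 0) (σ.1 0)) :
    Rep (Op.at Γ [q] (Ctx.consec 0 [T]) M *ᵥ ψ)
      fun e => ∑ v : Fin T, m (e q) v * f (Function.update e q v) := by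
  intro τ
  have hm := match_one hq
  rw [hm.at_mulVec, ← (stEquiv T).sum_comp]
  refine Finset.sum_congr rfl fun v _ => ?_
  rw [hM, hm.pull_val, pull_one, stEquiv_zero, h, hm.put_val, put_one, stEquiv_zero]

theorem Invol.update {q : Var} {T : Ty} (hq : Ctx.get Γ q = some T) {u : Env → ℕ}
    (hu : ∀ e, Valid Γ e → u e < (T : ℕ))
    (hi : ∀ e, Valid Γ e → u (Function.update e q (u e)) = e q) :
    Invol Γ fun e => Function.update e q (u e) where
  pres e he := he.update (by rw [Ctx.dim_of_get hq]; exact hu e he)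
  invol e he := by simp only [hi e he, Function.update_idem, Function.update_eq_self]

theorem Valid.lt {e : Env} (he : Valid Γ e) {q : Var} {T : Ty} (hq : Ctx.get Γ q = some T) :
    e q < (T : ℕ) := by
  have := he q
  rwa [Ctx.dim_of_get hq] at this

theorem Valid.lt_two {e : Env} (he : Valid Γ e) {q : Var} (hq : Ctx.get Γ q = some boolTy) :
    e q < 2 := he.lt hq

/-- Flipping a bit under a condition on the other variables. -/
theorem invol_flip {q : Var} (hq : Ctx.get Γ q = some boolTy) {b : Env → ℕ}
    (hb : ∀ e v, b (Function.update e q v) = b e) :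
    Invol Γ fun e => Function.update e q ((e q + b e) % 2) :=
  Invol.update hq (fun e _ => Nat.mod_lt _ (by decide)) fun e he => by
    have := he.lt_two hq
    rw [hb, Function.update_self]
    lia

theorem invol_not {q : Var} (hq : Ctx.get Γ q = some boolTy) :
    Invol Γ fun e => Function.update e q (1 - e q) :=
  Invol.update hq (fun e _ => lt_of_le_of_lt (Nat.sub_le _ _) (by decide)) fun e he => by
    have := he.lt_two hq
    rw [Function.update_self]
    lia

theorem Invol.conjTranspose {k : Env → Env} (h : Invol Γ k) : (pushOp Γ k)ᴴ = pushOp Γ k := by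
  have h1 : pushOp Γ k * pushOp Γ k = 1 := by
    rw [pushOp_mul h.pres, ← pushOp_id]
    exact pushOp_congr h.invol
  calc (pushOp Γ k)ᴴ = (pushOp Γ k)ᴴ * (pushOp Γ k * pushOp Γ k) := by rw [h1, Matrix.mul_one]
    _ = pushOp Γ k := by rw [← Matrix.mul_assoc, unitary_conj_mul h.unitary, Matrix.one_mul]

/-- Summation over all states, split along one variable. -/
theorem sum_update {q : Var} {T : Ty} (hq : Ctx.get Γ q = some T) (g : Env → ℝ) :
    ∑ τ : State Γ, g τ.1 =
      ∑ τ : State Γ, if τ.1 q = 0 then ∑ v : Fin T, g (Function.update τ.1 q v) else 0 := by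
  classical
  have hm := match_one hq
  rw [hm.sum_fibre, ← Finset.sum_filter]
  symm
  refine Finset.sum_bij' (fun τ hτ => ⟨τ, ?_⟩) (fun r _ => r.1) ?_ ?_ ?_ ?_ ?_
  · simpa using hτ
  · intro _ _; exact Finset.mem_univ _
  · intro r _
    simpa using r.2
  · intro _ _; rfl
  · intro _ _; rfl
  · intro τ _
    rw [← (stEquiv T).sum_comp]
    refine Finset.sum_congr rfl fun v _ => ?_
    rw [hm.put_val, put_one, stEquiv_zero]

end Rep

/-! ## Entries of the gates -/

theorem unif_entry_zero (N : ℕ) (a : ℕ) :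
    (1 / (Real.sqrt N : ℂ)) * Complex.exp (2 * Real.pi * Complex.I * (a : ℂ) * ((0 : ℕ) : ℂ) / (N : ℂ)) =
      1 / (Real.sqrt N : ℂ) := by simp

/-- Reflection about the uniform superposition. -/
theorem diffusion_entry (T : Ty) (τ σ : State (Ctx.consec 0 [T])) :
    ((UOp.unif T).sem [T] * ((UOp.refl0 T).sem [T] * ((UOp.unif T).sem [T])ᴴ)) τ σ =
      2 / (T : ℕ) - if τ.1 0 = σ.1 0 then 1 else 0 := by
  set U := (UOp.unif T).sem [T] with hU
  -- The reflection is twice the projection to the zero state minus the identity. Conjugation with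
  -- the unitary fixes the identity part and turns the projection into the one on the first column,
  -- all of whose entries are `1/√T`.
  have hR : (UOp.refl0 T).sem [T] =
      Matrix.diagonal (fun σ : State (Ctx.consec 0 [T]) => if σ.1 0 = 0 then (2 : ℂ) else 0) - 1 := by
    rw [UOp.sem_refl0 T _ rfl, ← diagonal_one, diagonal_sub]
    congr 1
    funext σ
    split_ifs <;> norm_num
  have hT : (0 : ℝ) < (T : ℕ) := by exact_mod_cast T.pos
  have hs : ((Real.sqrt (T : ℕ) : ℝ) : ℂ) * ((Real.sqrt (T : ℕ) : ℝ) : ℂ) = (T : ℕ) := by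
    rw [← Complex.ofReal_mul, Real.mul_self_sqrt hT.le]; simp
  rw [hR, Matrix.sub_mul, Matrix.one_mul, Matrix.mul_sub, unitary_mul_conj (UOp.unif_unitary T),
    Matrix.sub_apply]
  congr 1
  · rw [Matrix.mul_apply, Finset.sum_eq_single (stEquiv T ⟨0, T.pos⟩)]
    · rw [Matrix.diagonal_mul, stEquiv_zero, if_pos rfl, conjTranspose_apply, hU]
      simp only [UOp.sem, of_apply, stEquiv_zero, unif_entry_zero]
      rw [Complex.star_def, map_div₀, map_one, Complex.conj_ofReal, ← hs]
      ring
    · intro k _ hk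
      rw [Matrix.diagonal_mul, if_neg, zero_mul, mul_zero]
      intro h0
      apply hk
      rw [State.eq_iff, valid_consec_one k.2 (State.valid _), h0, stEquiv_zero]
    · simp
  · have hiff : τ = σ ↔ τ.1 0 = σ.1 0 := State.eq_iff.trans (valid_consec_one τ.2 σ.2)
    rw [Matrix.one_apply]
    by_cases h : τ = σ
    · rw [if_pos h, if_pos (hiff.1 h)]
    · rw [if_neg h, if_neg fun h' => h (hiff.2 h')]

/-! ## One run of Grover search with an ideal predicate -/

/-- The variables used by one run of the search, and a predicate that does not depend on them. -/
structure SearchVars (Γ : Ctx) (N Ng : Ty) (c xs ok n : Var) (p : Env → ℕ → Prop) : Prop where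
  get_c : Ctx.get Γ c = some boolTy
  get_xs : Ctx.get Γ xs = some N
  get_ok : Ctx.get Γ ok = some boolTy
  get_n : Ctx.get Γ n = some Ng
  nodup : [c, xs, ok, n].Nodup
  inv : ∀ (e : Env) (y : Var), y ∈ [c, xs, ok, n] → ∀ v w, p (Function.update e y w) v ↔ p e v

open Classical in
/-- The truth value of a proposition, as a number. -/
noncomputable def ind (P : Prop) : ℕ := if P then 1 else 0

theorem ind_of {P : Prop} (h : P) : ind P = 1 := if_pos h
theorem ind_not {P : Prop} (h : ¬ P) : ind P = 0 := if_neg h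
theorem ind_lt_two (P : Prop) : ind P < 2 := by unfold ind; split_ifs <;> decide

/-- The ideal controlled predicate. -/
noncomputable def oracle (c xs ok : Var) (p : Env → ℕ → Prop) (e : Env) : Env :=
  Function.update e ok ((e ok + ind (e c = 1 ∧ p e (e xs))) % 2)

open Classical in
/-- The number of solutions. -/
noncomputable def solCount (N : ℕ) (p : Env → ℕ → Prop) (e : Env) : ℕ :=
  ((Finset.range N).filter fun v => p e v).card

theorem solCount_le (N : ℕ) (p : Env → ℕ → Prop) (e : Env) : solCount N p e ≤ N := by
  classical
  exact (Finset.card_filter_le _ _).trans_eq (Finset.card_range N)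

theorem solCount_pos {N : ℕ} {p : Env → ℕ → Prop} {e : Env} (h : ∃ v, v < N ∧ p e v) :
    0 < solCount N p e := by
  classical
  obtain ⟨v, hv, hp⟩ := h
  exact Finset.card_pos.2 ⟨v, Finset.mem_filter.2 ⟨Finset.mem_range.2 hv, hp⟩⟩

open Classical in
theorem sum_ite_solCount {R : Type*} [Ring R] (N : ℕ) (p : Env → ℕ → Prop) (e : Env) (a b : R) :
    ∑ v : Fin N, (if p e v then a else b) = solCount N p e * a + (N - solCount N p e) * b := by
  rw [Fin.sum_univ_eq_sum_range (fun v => if p e v then a else b) N, Finset.sum_ite,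
    Finset.sum_const, Finset.sum_const, nsmul_eq_mul, nsmul_eq_mul]
  have h := Finset.card_filter_add_card_filter_not (s := Finset.range N) (fun v => p e v)
  rw [Finset.card_range] at h
  have h' : (((Finset.range N).filter fun v => ¬ p e v).card : R) = N - solCount N p e := by
    rw [eq_sub_iff_add_eq', solCount, ← Nat.cast_add, h]
  rw [h']; rfl

/-! ### The state of a run during the iterations -/

section Run
variable {Γ : Ctx} {N Ng : Ty} {c xs ok n : Var} {p : Env → ℕ → Prop}

theorem SearchVars.ne (S : SearchVars Γ N Ng c xs ok n p) :
    c ≠ xs ∧ c ≠ ok ∧ c ≠ n ∧ xs ≠ ok ∧ xs ≠ n ∧ ok ≠ n := by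
  have := S.nodup
  simp only [List.nodup_cons, List.mem_cons, List.not_mem_nil, or_false, not_or, not_false_eq_true,
    List.nodup_nil, and_true] at this
  tauto

theorem SearchVars.inv_c (S : SearchVars Γ N Ng c xs ok n p) (e : Env) (w v : ℕ) :
    p (Function.update e c w) v ↔ p e v := S.inv e c (by simp) v w
theorem SearchVars.inv_xs (S : SearchVars Γ N Ng c xs ok n p) (e : Env) (w v : ℕ) :
    p (Function.update e xs w) v ↔ p e v := S.inv e xs (by simp) v w
theorem SearchVars.inv_ok (S : SearchVars Γ N Ng c xs ok n p) (e : Env) (w v : ℕ) :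
    p (Function.update e ok w) v ↔ p e v := S.inv e ok (by simp) v w
theorem SearchVars.inv_n (S : SearchVars Γ N Ng c xs ok n p) (e : Env) (w v : ℕ) :
    p (Function.update e n w) v ↔ p e v := S.inv e n (by simp) v w

theorem SearchVars.invol_oracle (S : SearchVars Γ N Ng c xs ok n p) :
    Invol Γ (oracle c xs ok p) := by
  obtain ⟨-, hco, -, hxo, -, -⟩ := S.ne
  refine invol_flip S.get_ok fun e v => ?_
  simp only [S.inv_ok, Function.update_of_ne hco, Function.update_of_ne hxo]

/-- The guard: the iteration with index `l` is active iff `n < l`. -/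
def guardMap (c n : Var) (l : ℕ) (e : Env) : Env :=
  Function.update e c ((e c + if e n < l then 1 else 0) % 2)

theorem SearchVars.invol_guard (S : SearchVars Γ N Ng c xs ok n p) (l : ℕ) :
    Invol Γ (guardMap c n l) := by
  obtain ⟨-, -, hcn, -, -, -⟩ := S.ne
  refine invol_flip S.get_c fun e v => ?_
  rw [Function.update_of_ne hcn.symm]

/-- The reflection about the uniform superposition of `xs`. -/
noncomputable def diffusion (Γ : Ctx) (N : Ty) (xs : Var) : Op Γ :=
  Op.at Γ [xs] (Ctx.consec 0 [N])
    ((UOp.unif N).sem [N] * ((UOp.refl0 N).sem [N] * ((UOp.unif N).sem [N])ᴴ))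

/-- One iteration of Grover search. -/
noncomputable def groverStep (Γ : Ctx) (N : Ty) (c xs n : Var) (K : Op Γ) (l : ℕ) : Op Γ :=
  pushOp Γ (guardMap c n l) * (diffusion Γ N xs * (K * pushOp Γ (guardMap c n l)))

open Classical in
/-- The amplitude of an environment before the iteration with index `l + 1`. -/
noncomputable def stageAmp (N : ℕ) (xs n : Var) (p : Env → ℕ → Prop) (l : ℕ) (e : Env) : ℝ :=
  if p e (e xs) then (amp N (solCount N p e) (l - e n)).1 else (amp N (solCount N p e) (l - e n)).2

/-- The truncated difference `l - k` counts the iterations up to `l` that are active for the counter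
value `k`. An active iteration flips the sign of the solutions and reflects. In an inactive one no
iteration has been active so far, so the amplitudes are still uniform and the reflection fixes them.
-/
theorem amp_step (N t l k : ℕ) (b : Prop) [Decidable b] (hN : 0 < N) (hb : b ↔ k < l + 1) :
    amp N t (l + 1 - k) =
      (2 / N * (t * ((if b then -1 else 1) * (amp N t (l - k)).1) +
          (N - t) * (amp N t (l - k)).2) - (if b then -1 else 1) * (amp N t (l - k)).1,
        2 / N * (t * ((if b then -1 else 1) * (amp N t (l - k)).1) +
          (N - t) * (amp N t (l - k)).2) - (amp N t (l - k)).2) := by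
  have hN' : (N : ℝ) ≠ 0 := by exact_mod_cast hN.ne'
  by_cases h : b
  · have hk := hb.1 h
    rw [show l + 1 - k = (l - k) + 1 by omega, amp_succ, if_pos h]
    ext <;> simp only <;> field_simp <;> ring
  · have hk : ¬ k < l + 1 := fun h' => h (hb.2 h')
    rw [show l + 1 - k = 0 by omega, show l - k = 0 by omega, amp, if_neg h]
    ext <;> simp only <;> field_simp <;> ring

/-- The state of a search run is `κ (-1)^ok` times the amplitudes. -/
theorem SearchVars.rep_step (S : SearchVars Γ N Ng c xs ok n p) {F₀ : Env → ℂ}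
    (hF : ∀ e y v, y ∈ [xs, ok, n] → F₀ (Function.update e y v) = F₀ e)
    (hFc : ∀ e, e c ≠ 0 → F₀ e = 0) {ψ : State Γ → ℂ} {l : ℕ}
    (h : Rep ψ fun e => (-1) ^ e ok * (stageAmp N xs n p l e : ℂ) * F₀ e) :
    Rep (groverStep Γ N c xs n (pushOp Γ (oracle c xs ok p)) (l + 1) *ᵥ ψ)
      fun e => (-1) ^ e ok * (stageAmp N xs n p (l + 1) e : ℂ) * F₀ e := by
  classical
  obtain ⟨hcx, hco, hcn, hxo, hxn, hon⟩ := S.ne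
  rw [groverStep, ← mulVec_mulVec, ← mulVec_mulVec, ← mulVec_mulVec]
  have h1 := ((((h.push (S.invol_guard (l + 1))).push S.invol_oracle).gate S.get_xs
    (m := fun a b => 2 / (N : ℕ) - if a = b then 1 else 0) (diffusion_entry N)).push
    (S.invol_guard (l + 1)))
  refine h1.congr fun e he => ?_
  have hec := he.lt_two S.get_c
  -- `E v` is the environment whose old coefficient contributes to `e` when the reflection reads the
  -- value `v` of `xs`.
  set E : ℕ → Env := fun v => guardMap c n (l + 1)
    (oracle c xs ok p (Function.update (guardMap c n (l + 1) e) xs v)) with hE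
  have hgx : guardMap c n (l + 1) e xs = e xs := Function.update_of_ne hcx.symm _ _
  -- The two guards cancel, because `n` is not changed between them.
  have hEc : ∀ v, E v c = e c := by
    intro v
    simp only [hE, guardMap, oracle, Function.update_self, Function.update_of_ne hco,
      Function.update_of_ne hcx, Function.update_of_ne hon.symm, Function.update_of_ne hxn.symm,
      Function.update_of_ne hcn.symm]
    split_ifs <;> lia
  change ∑ v : Fin N, (2 / (N : ℕ) - if guardMap c n (l + 1) e xs = v then (1 : ℂ) else 0) *
    ((-1) ^ E v ok * (stageAmp N xs n p l (E v) : ℂ) * F₀ (E v)) = _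
  by_cases h0 : e c = 0
  swap
  · rw [hFc e h0, mul_zero]
    refine Finset.sum_eq_zero fun v _ => ?_
    rw [hFc (E v) (by rw [hEc]; exact h0), mul_zero, mul_zero]
  have hEv : ∀ v, E v = Function.update (Function.update e xs v) ok
      ((e ok + ind (e n < l + 1 ∧ p e v)) % 2) := by
    intro v
    funext y
    by_cases hyc : y = c
    · rw [hyc, hEc, Function.update_of_ne hco, Function.update_of_ne hcx]
    · simp only [hE, guardMap, Function.update_of_ne hyc, oracle]
      by_cases hyo : y = ok
      · rw [hyo, Function.update_self, Function.update_self]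
        simp only [Function.update_of_ne hxo.symm, Function.update_of_ne hcx,
          Function.update_of_ne hco.symm, Function.update_self, S.inv_xs, S.inv_c, h0, zero_add]
        by_cases hl : e n < l + 1 <;> simp [hl, ind_not]
      · rw [Function.update_of_ne hyo, Function.update_of_ne hyo]
        by_cases hyx : y = xs
        · rw [hyx, Function.update_self, Function.update_self]
        · rw [Function.update_of_ne hyx, Function.update_of_ne hyx, Function.update_of_ne hyc]
  set t := solCount N p e with ht
  set r := amp N t (l - e n) with hr
  set s : ℝ := if e n < l + 1 then -1 else 1 with hs
  -- Phase kickback: shifting `ok` by the predicate multiplies `(-1)^ok` by `-1` exactly at the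
  -- solutions, provided that the iteration is active.
  have hstage : ∀ v : ℕ, (-1 : ℂ) ^ E v ok * (stageAmp N xs n p l (E v) : ℂ) * F₀ (E v) =
      ((-1) ^ e ok * F₀ e) * (if p e v then ((s * r.1 : ℝ) : ℂ) else (r.2 : ℂ)) := by
    intro v
    have hp : ∀ w, p (E v) w ↔ p e w := fun w => by rw [hEv, S.inv_ok, S.inv_xs]
    have h3 : stageAmp N xs n p l (E v) = if p e v then r.1 else r.2 := by
      have h4 : E v xs = v := by rw [hEv, Function.update_of_ne hxo, Function.update_self]
      have h5 : E v n = e n := by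
        rw [hEv, Function.update_of_ne hon.symm, Function.update_of_ne hxn.symm]
      have h6 : solCount N p (E v) = t := by simp only [solCount, hp, ht]
      rw [stageAmp, h4, h5, h6]
      simp only [hp, hr]
    have h7 : F₀ (E v) = F₀ e := by rw [hEv, hF _ _ _ (by simp), hF _ _ _ (by simp)]
    rw [h3, h7, hEv, Function.update_self, ← neg_one_pow_eq_pow_mod_two, pow_add]
    by_cases hl : e n < l + 1 <;> by_cases hpv : p e v <;> simp [hl, hpv, hs, ind_of, ind_not] <;> ring
  simp only [hstage, hgx]
  -- The reflection `2/N - 1` is split into twice the mean over `xs` and the diagonal term.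
  rw [show (∑ v : Fin N, (2 / ((N : ℕ) : ℂ) - if e xs = v then (1 : ℂ) else 0) *
      (((-1) ^ e ok * F₀ e) * (if p e v then ((s * r.1 : ℝ) : ℂ) else (r.2 : ℂ)))) =
      ((-1) ^ e ok * F₀ e) * (2 / (N : ℕ) * (∑ v : Fin N, if p e v then ((s * r.1 : ℝ) : ℂ) else (r.2 : ℂ)) -
        if p e (e xs) then ((s * r.1 : ℝ) : ℂ) else (r.2 : ℂ)) from ?_]
  · rw [sum_ite_solCount, ← ht, stageAmp, ← ht,
      amp_step N t l (e n) (e n < l + 1) N.pos Iff.rfl, ← hr, ← hs]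
    by_cases hpx : p e (e xs) <;> simp only [hpx, if_true, if_false] <;> push_cast <;> ring
  · have hx := he.lt S.get_xs
    rw [mul_sub, Finset.mul_sum, Finset.mul_sum]
    simp only [sub_mul, Finset.sum_sub_distrib]
    congr 1
    · exact Finset.sum_congr rfl fun v _ => by ring
    · rw [Finset.sum_eq_single (⟨e xs, hx⟩ : Fin N)]
      · simp
      · intro v _ hv
        rw [if_neg, zero_mul]
        intro h4
        exact hv (Fin.ext h4.symm)
      · simp

end Run

/-! ### From the preparation of a run to its failure amplitude -/

section Run
variable {Γ : Ctx} {N Ng : Ty} {c xs ok n : Var} {p : Env → ℕ → Prop}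

/-- The preparation of the counter and of the output bit. -/
noncomputable def prepOp (Γ : Ctx) (Ng : Ty) (ok n : Var) : Op Γ :=
  Op.at Γ [ok] (Ctx.consec 0 [boolTy]) (UOp.H.sem [boolTy]) *
    (pushOp Γ (fun e => Function.update e ok (1 - e ok)) *
      Op.at Γ [n] (Ctx.consec 0 [Ng]) ((UOp.unif Ng).sem [Ng]))

/-- The first `L` iterations of a run, for the controlled predicate `K`. -/
noncomputable def iterOp (Γ : Ctx) (N : Ty) (c xs n : Var) (K : Op Γ) : ℕ → Op Γ
  | 0 => 1
  | l + 1 => groverStep Γ N c xs n K (l + 1) * iterOp Γ N c xs n K l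

/-- The final evaluation of the predicate. -/
noncomputable def finalOp (Γ : Ctx) (c : Var) (K : Op Γ) : Op Γ :=
  pushOp Γ (fun e => Function.update e c (1 - e c)) *
    (K * pushOp Γ (fun e => Function.update e c (1 - e c)))

/-- One run of Grover search, for the controlled predicate `K`. -/
noncomputable def runOp (Γ : Ctx) (N Ng : Ty) (c xs ok n : Var) (K : Op Γ) : Op Γ :=
  finalOp Γ c K * ((prepOp Γ Ng ok n)ᴴ * (iterOp Γ N c xs n K (Ng - 1) *
    Op.at Γ [xs] (Ctx.consec 0 [N]) ((UOp.unif N).sem [N]) * prepOp Γ Ng ok n))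

/-- The environment without the variables of the run. -/
def baseEnv (xs ok n : Var) (e : Env) : Env := fun y => if y = xs ∨ y = ok ∨ y = n then 0 else e y

theorem baseEnv_update (xs ok n : Var) (e : Env) {y : Var} (hy : y ∈ [xs, ok, n]) (v : ℕ) :
    baseEnv xs ok n (Function.update e y v) = baseEnv xs ok n e := by
  funext z
  simp only [baseEnv]
  split_ifs with h
  · rfl
  · rw [Function.update_of_ne]
    rintro rfl
    simp only [List.mem_cons, List.not_mem_nil, or_false] at hy
    exact h hy

theorem baseEnv_eq (xs ok n : Var) {e : Env} (h1 : e xs = 0) (h2 : e ok = 0) (h3 : e n = 0) :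
    baseEnv xs ok n e = e := by
  funext y
  simp only [baseEnv]
  split_ifs with h
  · rcases h with rfl | rfl | rfl <;> simp [*]
  · rfl

theorem valid_baseEnv {e : Env} (he : Valid Γ e) : Valid Γ (baseEnv xs ok n e) := by
  intro y
  simp only [baseEnv]
  split_ifs
  · exact Ctx.dim_pos _ _
  · exact he y

/-- The common factor of the coefficients during a run on `ψ`. -/
noncomputable def baseAmp (Ng : Ty) (c xs ok n : Var) (ψ : State Γ → ℂ) (e : Env) : ℂ :=
  if e c = 0 then 1 / (Real.sqrt 2 : ℂ) * (1 / (Real.sqrt (Ng : ℕ) : ℂ)) *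
    ψ (State.ofEnv Γ (baseEnv xs ok n e)) else 0

theorem SearchVars.baseAmp_update (S : SearchVars Γ N Ng c xs ok n p) (ψ : State Γ → ℂ) (e : Env)
    (y : Var) (v : ℕ) (hy : y ∈ [xs, ok, n]) :
    baseAmp Ng c xs ok n ψ (Function.update e y v) = baseAmp Ng c xs ok n ψ e := by
  obtain ⟨hcx, hco, hcn, -, -, -⟩ := S.ne
  have : c ≠ y := by
    rintro rfl
    simp only [List.mem_cons, List.not_mem_nil, or_false] at hy
    tauto
  rw [baseAmp, baseAmp, baseEnv_update _ _ _ _ hy, Function.update_of_ne this]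

theorem ZeroOn.rep_eq_zero {ψ : State Γ → ℂ} {Z : Set Var} (hψ : ZeroOn Z ψ) {e : Env}
    (he : Valid Γ e) {z : Var} (hz : z ∈ Z) (h : e z ≠ 0) : ψ (State.ofEnv Γ e) = 0 := by
  by_contra h0
  have := hψ _ h0 z hz
  rw [State.ofEnv_val he] at this
  exact h this

/-- As the registers of `ψ` are zero, only the zero columns of the two Fourier transforms
contribute, and these are constant. `X` followed by `H` produces the sign `(-1)^ok` of the state
`|-⟩`. -/
theorem SearchVars.rep_start (S : SearchVars Γ N Ng c xs ok n p) {ψ : State Γ → ℂ}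
    (hψ : ZeroOn {c, xs, ok, n} ψ) :
    Rep ((Op.at Γ [xs] (Ctx.consec 0 [N]) ((UOp.unif N).sem [N]) * prepOp Γ Ng ok n) *ᵥ ψ)
      fun e => (-1) ^ e ok * (stageAmp N xs n p 0 e : ℂ) * baseAmp Ng c xs ok n ψ e := by
  classical
  obtain ⟨hcx, hco, hcn, hxo, hxn, hon⟩ := S.ne
  set f₀ : Env → ℂ := fun e => ψ (State.ofEnv Γ e) with hf₀
  have hz : ∀ z ∈ ({c, xs, ok, n} : Set Var), ∀ e, Valid Γ e → e z ≠ 0 → f₀ e = 0 :=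
    fun z hz e he h => hψ.rep_eq_zero he hz h
  set a : ℂ := 1 / (Real.sqrt (Ng : ℕ) : ℂ) with ha
  set b : ℂ := 1 / (Real.sqrt (N : ℕ) : ℂ) with hb
  set d : ℂ := 1 / (Real.sqrt 2 : ℂ) with hd
  rw [prepOp, ← mulVec_mulVec, ← mulVec_mulVec, ← mulVec_mulVec]
  have h1 : Rep (Op.at Γ [n] (Ctx.consec 0 [Ng]) ((UOp.unif Ng).sem [Ng]) *ᵥ ψ)
      fun e => a * f₀ (Function.update e n 0) := by
    refine ((rep_ofEnv ψ).gate S.get_n (m := fun x y => (1 / (Real.sqrt (Ng : ℕ) : ℂ)) *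
      Complex.exp (2 * Real.pi * Complex.I * (x : ℂ) * (y : ℂ) / ((Ng : ℕ) : ℂ)))
      fun τ σ => rfl).congr fun e he => ?_
    rw [Finset.sum_eq_single (⟨0, Ng.pos⟩ : Fin Ng)]
    · rw [unif_entry_zero]
    · intro v _ hv
      have hv0 : (v : ℕ) ≠ 0 := fun h => hv (Fin.ext h)
      change _ * f₀ _ = 0
      rw [hz n (by simp) _ (he.update (by rw [Ctx.dim_of_get S.get_n]; exact v.2))
        (by rwa [Function.update_self]), mul_zero]
    · simp
  have h2 := h1.push (invol_not S.get_ok)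
  have h3 := h2.gate S.get_ok (M := UOp.H.sem [boolTy])
    (m := fun x y => (1 / (Real.sqrt 2 : ℂ)) * (-1) ^ (x * y)) fun τ σ => rfl
  replace h3 := h3.congr (f' := fun e => d * (-1) ^ e ok *
      (a * f₀ (Function.update (Function.update e ok 0) n 0))) <| by
    intro e he
    change ∑ v : Fin 2, _ = _
    rw [Fin.sum_univ_two]
    simp only [Fin.val_zero, Fin.val_one, Function.update_self, Function.update_idem, mul_zero,
      pow_zero, mul_one, Nat.sub_zero, Nat.sub_self]
    rw [hz ok (by simp) (Function.update (Function.update e ok 1) n 0)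
      ((he.update (by rw [Ctx.dim_of_get S.get_ok]; decide)).update (Ctx.dim_pos _ _))
      (by rw [Function.update_of_ne hon, Function.update_self]; exact one_ne_zero)]
    ring
  refine (h3.gate S.get_xs (m := fun x y => (1 / (Real.sqrt (N : ℕ) : ℂ)) *
      Complex.exp (2 * Real.pi * Complex.I * (x : ℂ) * (y : ℂ) / ((N : ℕ) : ℂ)))
      fun τ σ => rfl).congr fun e he => ?_
  rw [Finset.sum_eq_single (⟨0, N.pos⟩ : Fin N)]
  · rw [unif_entry_zero]
    have hst : stageAmp N xs n p 0 e = 1 / √(N : ℕ) := by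
      rw [stageAmp, Nat.zero_sub]
      split_ifs <;> rfl
    have hbase : Function.update (Function.update (Function.update e xs 0) ok 0) n 0 =
        baseEnv xs ok n e := by
      funext y
      simp only [baseEnv, Function.update_apply]
      split_ifs <;> simp_all
    rw [hst, baseAmp, Function.update_of_ne hxo.symm, hbase]
    have hc : f₀ (baseEnv xs ok n e) = if e c = 0 then f₀ (baseEnv xs ok n e) else 0 := by
      split_ifs with h
      · rfl
      · apply hz c (by simp) _ (valid_baseEnv he)
        simpa [baseEnv, hcx, hco, hcn] using h
    rw [hc]
    split_ifs
    · push_cast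
      ring
    · simp
  · intro v _ hv
    have hv0 : (v : ℕ) ≠ 0 := fun h => hv (Fin.ext h)
    rw [hz xs (by simp) (Function.update (Function.update (Function.update e xs v) ok 0) n 0), mul_zero,
      mul_zero, mul_zero]
    · exact ((he.update (by rw [Ctx.dim_of_get S.get_xs]; exact v.2)).update
        (Ctx.dim_pos _ _)).update (Ctx.dim_pos _ _)
    · rwa [Function.update_of_ne hxn, Function.update_of_ne hxo, Function.update_self]
  · simp

theorem SearchVars.rep_iter (S : SearchVars Γ N Ng c xs ok n p) {ψ : State Γ → ℂ}
    (hψ : ZeroOn {c, xs, ok, n} ψ) (L : ℕ) :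
    Rep ((iterOp Γ N c xs n (pushOp Γ (oracle c xs ok p)) L *
      Op.at Γ [xs] (Ctx.consec 0 [N]) ((UOp.unif N).sem [N]) * prepOp Γ Ng ok n) *ᵥ ψ)
      fun e => (-1) ^ e ok * (stageAmp N xs n p L e : ℂ) * baseAmp Ng c xs ok n ψ e := by
  induction L with
  | zero => rw [iterOp, Matrix.one_mul]; exact S.rep_start hψ
  | succ L ih =>
    rw [iterOp, Matrix.mul_assoc, Matrix.mul_assoc, ← mulVec_mulVec, ← Matrix.mul_assoc]
    exact S.rep_step (fun e y v hy => S.baseAmp_update ψ e y v hy)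
      (fun e he => if_neg he) ih

theorem SearchVars.stageAmp_update_ok (S : SearchVars Γ N Ng c xs ok n p) (l : ℕ) (e : Env) (v : ℕ) :
    stageAmp N xs n p l (Function.update e ok v) = stageAmp N xs n p l e := by
  classical
  obtain ⟨-, -, -, hxo, -, hon⟩ := S.ne
  simp only [stageAmp, Function.update_of_ne hxo, Function.update_of_ne hon.symm, S.inv_ok, solCount]

/-- The state of a run after the iterations and the inverse preparation of the output bit. -/
theorem SearchVars.rep_unprep (S : SearchVars Γ N Ng c xs ok n p) {ψ : State Γ → ℂ}
    (hψ : ZeroOn {c, xs, ok, n} ψ) (L : ℕ) :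
    Rep ((pushOp Γ fun e => Function.update e ok (1 - e ok)) *ᵥ
        (Op.at Γ [ok] (Ctx.consec 0 [boolTy]) (UOp.H.sem [boolTy]))ᴴ *ᵥ
      (iterOp Γ N c xs n (pushOp Γ (oracle c xs ok p)) L *
      Op.at Γ [xs] (Ctx.consec 0 [N]) ((UOp.unif N).sem [N]) * prepOp Γ Ng ok n) *ᵥ ψ)
      fun e => if e ok = 0 then
        (Real.sqrt 2 : ℂ) * (stageAmp N xs n p L e : ℂ) * baseAmp Ng c xs ok n ψ e else 0 := by
  obtain ⟨hcx, hco, hcn, hxo, hxn, hon⟩ := S.ne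
  have h1 := S.rep_iter hψ L
  rw [← Op.at_conjTranspose]
  have h2 := h1.gate S.get_ok (M := (UOp.H.sem [boolTy])ᴴ)
    (m := fun x y => star ((1 / (Real.sqrt 2 : ℂ)) * (-1) ^ (y * x))) fun τ σ => rfl
  refine (h2.push (invol_not S.get_ok)).congr fun e he => ?_
  have hlt := he.lt_two S.get_ok
  change ∑ v : Fin 2, _ = _
  have h2 : ((Real.sqrt 2 : ℝ) : ℂ) * ((Real.sqrt 2 : ℝ) : ℂ) = 2 := by
    rw [← Complex.ofReal_mul, Real.mul_self_sqrt (by norm_num)]; simp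
  have h20 : ((Real.sqrt 2 : ℝ) : ℂ) ≠ 0 := by
    intro h; rw [h] at h2; norm_num at h2
  rw [Fin.sum_univ_two]
  simp only [Fin.val_zero, Fin.val_one, Function.update_self, S.stageAmp_update_ok, zero_mul,
    pow_zero, mul_one, one_mul, pow_one, Complex.star_def, map_div₀, map_one, Complex.conj_ofReal,
    S.baseAmp_update ψ _ ok _ (by simp), map_mul, map_pow, map_neg]
  interval_cases h : e ok
  · simp only [Nat.sub_zero, pow_one, if_true]
    -- The two values of `ok` contribute equally. The resulting factor `√2` cancels the `1/√2`
    -- inside `baseAmp`.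
    have h3 : (Real.sqrt 2 : ℂ) = 1 / (Real.sqrt 2 : ℂ) + 1 / (Real.sqrt 2 : ℂ) := by
      rw [← add_div, eq_div_iff h20, h2]; norm_num
    conv_rhs => rw [h3]
    ring
  · simp

/-- For a fixed input and a counter value `n`, the `N - t` non-solutions carry equal amplitudes
after `Ng - 1 - n` active iterations. Summing over `xs` and then over the uniform counter gives the
average in `grover_failure`, weighted by `‖ψ‖²` at the input. -/
theorem stageAmp_norm (S : SearchVars Γ N Ng c xs ok n p) (hNg : (Ng : ℕ) = groverIters N)
    {ψ : State Γ → ℂ}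
    (hQ : ∀ σ : State Γ, ψ σ ≠ 0 → ∃ v, v < (N : ℕ) ∧ p σ.1 v) {φ : State Γ → ℂ}
    (hφ : Rep φ fun e => if e ok = 0 then
        (Real.sqrt 2 : ℂ) * (stageAmp N xs n p (Ng - 1) e : ℂ) * baseAmp Ng c xs ok n ψ e else 0) :
    vn (projOp Γ (fun e => ¬ p e (e xs)) *ᵥ φ) ≤ √0.63 * vn ψ := by
  classical
  obtain ⟨hcx, hco, hcn, hxo, hxn, hon⟩ := S.ne
  apply vn_le_of_sq_le (mul_nonneg (Real.sqrt_nonneg _) (vn_nonneg _))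
  rw [mul_pow, Real.sq_sqrt (by norm_num), vn_sq]
  set f : Env → ℝ := fun e => ‖ψ (State.ofEnv Γ (baseEnv xs ok n e))‖ ^ 2 with hf
  have hfu : ∀ e y v, y ∈ [xs, ok, n] → f (Function.update e y v) = f e := fun e y v hy => by
    simp only [hf, baseEnv_update _ _ _ _ hy]
  have hf0 : ∀ e, 0 ≤ f e := fun e => by positivity
  have hNg0 : (0 : ℝ) < (Ng : ℕ) := by exact_mod_cast Ng.pos
  set B : Env → ℕ → ℝ := fun e m => (amp N (solCount N p e) m).2 ^ 2 with hB
  set G : Env → ℝ := fun e => if p e (e xs) then 0 else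
    (if e ok = 0 then 1 / (Ng : ℕ) * B e (Ng - 1 - e n) * f e else 0) with hG
  have h1 : ∀ τ : State Γ, ‖(projOp Γ (fun e => ¬ p e (e xs)) *ᵥ φ) τ‖ ^ 2 ≤ G τ.1 := by
    intro τ
    rw [projOp_mulVec, hφ]
    simp only [hG]
    by_cases hp : p τ.1 (τ.1 xs)
    · simp [hp]
    · rw [if_pos hp, if_neg hp]
      by_cases h0 : τ.1 ok = 0
      · rw [if_pos h0, if_pos h0, stageAmp, if_neg hp, baseAmp]
        by_cases hc : τ.1 c = 0
        · rw [if_pos hc]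
          apply le_of_eq
          simp only [norm_mul, norm_div, norm_one, mul_pow, div_pow, one_pow, Complex.norm_real,
            Real.norm_eq_abs, sq_abs, hf, hB]
          rw [Real.sq_sqrt (by norm_num), Real.sq_sqrt hNg0.le]
          field_simp
        · rw [if_neg hc, mul_zero, norm_zero]
          rw [zero_pow two_ne_zero]
          exact mul_nonneg (mul_nonneg (by positivity) (sq_nonneg _)) (hf0 _)
      · rw [if_neg h0, if_neg h0]; simp
  refine (Finset.sum_le_sum fun τ _ => h1 τ).trans ?_
  rw [sum_update S.get_xs G]
  have h2 : ∀ τ : Env, (if τ xs = 0 then ∑ v : Fin N, G (Function.update τ xs v) else 0) =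
      if τ xs = 0 then (if τ ok = 0 then 1 / (Ng : ℕ) * (((N : ℕ) : ℝ) - solCount N p τ) *
        B τ (Ng - 1 - τ n) * f τ else 0) else 0 := by
    intro τ
    congr 1
    have h3 : ∀ v : ℕ, G (Function.update τ xs v) = if p τ v then 0 else
        (if τ ok = 0 then 1 / (Ng : ℕ) * B τ (Ng - 1 - τ n) * f τ else 0) := by
      intro v
      simp only [hG, S.inv_xs, Function.update_self, Function.update_of_ne hxo.symm,
        Function.update_of_ne hxn.symm, hfu _ xs v (by simp), hB, solCount]
    simp only [h3]
    rw [sum_ite_solCount N p τ 0 (if τ ok = 0 then _ else _)]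
    split_ifs <;> ring
  simp only [h2]
  rw [sum_update S.get_n fun τ => if τ xs = 0 then (if τ ok = 0 then
    1 / (Ng : ℕ) * (((N : ℕ) : ℝ) - solCount N p τ) * B τ (Ng - 1 - τ n) * f τ else 0) else 0]
  rw [Finset.mul_sum]
  refine Finset.sum_le_sum fun τ _ => ?_
  by_cases hn0 : τ.1 n = 0
  swap
  · rw [if_neg hn0]; positivity
  rw [if_pos hn0]
  by_cases hx0 : τ.1 xs = 0
  swap
  · refine (Finset.sum_nonpos fun v _ => ?_).trans (by positivity)
    rw [Function.update_of_ne hxn, if_neg hx0]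
  by_cases ho0 : τ.1 ok = 0
  swap
  · refine (Finset.sum_nonpos fun v _ => ?_).trans (by positivity)
    rw [Function.update_of_ne hon, if_neg ho0, ite_self]
  have h4 : ∀ v : Fin Ng, (if Function.update τ.1 n v xs = 0 then (if Function.update τ.1 n v ok = 0 then
      1 / (Ng : ℕ) * (((N : ℕ) : ℝ) - solCount N p (Function.update τ.1 n v)) *
        B (Function.update τ.1 n v) (Ng - 1 - Function.update τ.1 n v n) *
        f (Function.update τ.1 n v) else 0) else 0) =
      1 / (Ng : ℕ) * f τ.1 * ((((N : ℕ) : ℝ) - solCount N p τ.1) * B τ.1 (Ng - 1 - v)) := by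
    intro v
    rw [Function.update_of_ne hxn, Function.update_of_ne hon, if_pos hx0, if_pos ho0,
      Function.update_self, hfu _ n v (by simp)]
    simp only [hB, solCount, S.inv_n]
    ring
  rw [Finset.sum_congr rfl fun v _ => h4 v, ← Finset.mul_sum]
  have hfτ : f τ.1 = ‖ψ τ‖ ^ 2 := by
    simp only [hf]
    rw [baseEnv_eq _ _ _ hx0 ho0 hn0, State.ofEnv_self]
  by_cases hψ0 : ψ τ = 0
  · rw [hfτ, hψ0]; simp
  have h5 := grover_failure (solCount_pos (hQ τ hψ0)) (solCount_le N p τ.1)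
  -- The counter value `n` leaves `Ng - 1 - n` active iterations, so the counts are met in reverse
  -- order.
  rw [← hNg, ← Finset.sum_range_reflect] at h5
  rw [Fin.sum_univ_eq_sum_range (fun v => (((N : ℕ) : ℝ) - solCount N p τ.1) * B τ.1 (Ng - 1 - v)), hfτ]
  calc _ ≤ 1 / (Ng : ℕ) * ‖ψ τ‖ ^ 2 * (0.63 * (Ng : ℕ)) := by gcongr
    _ = _ := by field_simp

end Run

/-! ### Success and failure of a run, and its stability under errors of the predicate -/

section Run
variable {Γ : Ctx} {N Ng : Ty} {c xs ok n : Var} {p : Env → ℕ → Prop}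

theorem SearchVars.local_prep (S : SearchVars Γ N Ng c xs ok n p) :
    Local Γ {c, xs, ok, n} (prepOp Γ Ng ok n) := by
  refine (Local.at (by simp)).mul ((Local.pushOp fun e x hx => ?_).mul (Local.at (by simp)))
  rw [Function.update_of_ne]
  rintro rfl
  simp at hx

theorem SearchVars.local_iter (S : SearchVars Γ N Ng c xs ok n p) {K : Op Γ}
    (hK : Local Γ {c, xs, ok, n} K) (L : ℕ) :
    Local Γ {c, xs, ok, n} (iterOp Γ N c xs n K L) := by
  have hg : ∀ l, Local Γ {c, xs, ok, n} (pushOp Γ (guardMap c n l)) := fun l =>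
    Local.pushOp fun e x hx => by
      rw [guardMap, Function.update_of_ne]
      rintro rfl
      simp at hx
  induction L with
  | zero => exact Local.one
  | succ L ih => exact ((hg _).mul ((Local.at (by simp)).mul (hK.mul (hg _)))).mul ih

theorem local_oracle : Local Γ {c, xs, ok, n} (pushOp Γ (oracle c xs ok p)) :=
  Local.pushOp fun e x hx => by
    rw [oracle, Function.update_of_ne]
    rintro rfl
    simp at hx

theorem SearchVars.local_run (S : SearchVars Γ N Ng c xs ok n p) {K : Op Γ}
    (hK : Local Γ {c, xs, ok, n} K) : Local Γ {c, xs, ok, n} (runOp Γ N Ng c xs ok n K) := by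
  have hx : Local Γ {c, xs, ok, n} (pushOp Γ (fun e => Function.update e c (1 - e c))) :=
    Local.pushOp fun e x hx => by
      rw [Function.update_of_ne]
      rintro rfl
      simp at hx
  exact (hx.mul (hK.mul hx)).mul (S.local_prep.conj.mul
    (((S.local_iter hK _).mul (Local.at (by simp))).mul S.local_prep))

/-- The state before the final evaluation of the predicate. -/
noncomputable def preState (Γ : Ctx) (N Ng : Ty) (c xs ok n : Var) (K : Op Γ) : Op Γ :=
  (prepOp Γ Ng ok n)ᴴ * (iterOp Γ N c xs n K (Ng - 1) *
    Op.at Γ [xs] (Ctx.consec 0 [N]) ((UOp.unif N).sem [N]) * prepOp Γ Ng ok n)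

/-- Of the inverse preparation, only the part on `ok` is evaluated. The inverse Fourier transform on
`n` stays in front as an unevaluated unitary, since the later projections do not look at `n`. -/
theorem SearchVars.preState_eq (S : SearchVars Γ N Ng c xs ok n p) {ψ : State Γ → ℂ}
    (hψ : ZeroOn {c, xs, ok, n} ψ) :
    ∃ φ, preState Γ N Ng c xs ok n (pushOp Γ (oracle c xs ok p)) *ᵥ ψ =
        Op.at Γ [n] (Ctx.consec 0 [Ng]) ((UOp.unif Ng).sem [Ng])ᴴ *ᵥ φ ∧
      Rep φ fun e => if e ok = 0 then
        (Real.sqrt 2 : ℂ) * (stageAmp N xs n p (Ng - 1) e : ℂ) * baseAmp Ng c xs ok n ψ e else 0 := by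
  refine ⟨_, ?_, S.rep_unprep hψ _⟩
  rw [preState, ← mulVec_mulVec]
  generalize (iterOp Γ N c xs n (pushOp Γ (oracle c xs ok p)) (Ng - 1) *
    Op.at Γ [xs] (Ctx.consec 0 [N]) ((UOp.unif N).sem [N]) * prepOp Γ Ng ok n) *ᵥ ψ = φ
  rw [prepOp, conjTranspose_mul, conjTranspose_mul, (invol_not S.get_ok).conjTranspose,
    ← Op.at_conjTranspose, ← Op.at_conjTranspose, ← mulVec_mulVec, ← mulVec_mulVec]

theorem SearchVars.preState_zeroOn (S : SearchVars Γ N Ng c xs ok n p) {ψ : State Γ → ℂ}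
    (hψ : ZeroOn {c, xs, ok, n} ψ) :
    ZeroOn {c, ok} (preState Γ N Ng c xs ok n (pushOp Γ (oracle c xs ok p)) *ᵥ ψ) := by
  obtain ⟨hcx, hco, hcn, hxo, hxn, hon⟩ := S.ne
  obtain ⟨φ, h1, h2⟩ := S.preState_eq hψ
  rw [h1]
  refine ZeroOn.at (match_one S.get_n) (by simp [hcn, hon]) _ ?_
  intro σ hσ z hz
  by_contra h0
  apply hσ
  rw [h2]
  beta_reduce
  rcases hz with rfl | rfl
  · rw [baseAmp, if_neg h0, mul_zero, ite_self]
  · rw [if_neg h0]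

/-- The projection does not depend on `n`, so the remaining unitary on `n` can be moved past it and
then disappears from the norm. The rest is `stageAmp_norm`. -/
theorem SearchVars.preState_norm (S : SearchVars Γ N Ng c xs ok n p)
    (hNg : (Ng : ℕ) = groverIters N) {ψ : State Γ → ℂ} (hψ : ZeroOn {c, xs, ok, n} ψ)
    (hQ : ∀ σ : State Γ, ψ σ ≠ 0 → ∃ v, v < (N : ℕ) ∧ p σ.1 v) :
    vn (projOp Γ (fun e => ¬ p e (e xs)) *ᵥ
      preState Γ N Ng c xs ok n (pushOp Γ (oracle c xs ok p)) *ᵥ ψ) ≤ √0.63 * vn ψ := by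
  obtain ⟨hcx, hco, hcn, hxo, hxn, hon⟩ := S.ne
  obtain ⟨φ, h1, h2⟩ := S.preState_eq hψ
  rw [h1, mulVec_mulVec, ← (match_one S.get_n).commute_projOp, ← mulVec_mulVec, vn_unitary]
  · exact stageAmp_norm S hNg hQ h2
  · exact (match_one S.get_n).at_unitary (conjTranspose_mem_unitaryGroup (UOp.unif_unitary Ng))
  · intro e e' _ _ h
    have h3 : e = Function.update e' n (e n) := by
      funext y
      by_cases hy : y = n
      · rw [hy, Function.update_self]
      · rw [Function.update_of_ne hy, h y (by simpa using hy)]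
    rw [h xs (by simpa using hxn), h3, S.inv_n]

/-- In the final evaluation the control is negated before and after the call, so the predicate is
active exactly for `c = 0`. -/
theorem SearchVars.run_apply (S : SearchVars Γ N Ng c xs ok n p) (ψ : State Γ → ℂ) :
    Rep (runOp Γ N Ng c xs ok n (pushOp Γ (oracle c xs ok p)) *ᵥ ψ) fun e =>
      (preState Γ N Ng c xs ok n (pushOp Γ (oracle c xs ok p)) *ᵥ ψ) (State.ofEnv Γ
        (Function.update e ok ((e ok + ind (e c = 0 ∧ p e (e xs))) % 2))) := by
  obtain ⟨hcx, hco, hcn, hxo, hxn, hon⟩ := S.ne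
  rw [show runOp Γ N Ng c xs ok n (pushOp Γ (oracle c xs ok p)) =
    finalOp Γ c (pushOp Γ (oracle c xs ok p)) *
      preState Γ N Ng c xs ok n (pushOp Γ (oracle c xs ok p)) from rfl,
    ← mulVec_mulVec, finalOp, ← mulVec_mulVec, ← mulVec_mulVec]
  refine ((((rep_ofEnv _).push (invol_not S.get_c)).push S.invol_oracle).push
    (invol_not S.get_c)).congr fun e he => ?_
  have hc := he.lt_two S.get_c
  congr 2
  funext y
  simp only [oracle, Function.update_self, Function.update_of_ne hco, Function.update_of_ne hco.symm,
    Function.update_of_ne hcx.symm, S.inv_c]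
  have hi : ind (1 - e c = 1 ∧ p e (e xs)) = ind (e c = 0 ∧ p e (e xs)) := by
    congr 2
    exact propext (by omega)
  rw [hi]
  by_cases hyc : y = c
  · rw [hyc, Function.update_self, Function.update_of_ne hco]
    omega
  · by_cases hyo : y = ok
    · rw [hyo, Function.update_of_ne hco.symm, Function.update_self, Function.update_self]
    · simp only [Function.update_of_ne hyc, Function.update_of_ne hyo]

theorem SearchVars.valid_flip (S : SearchVars Γ N Ng c xs ok n p) {e : Env} (he : Valid Γ e) (b : ℕ) :
    Valid Γ (Function.update e ok ((e ok + b) % 2)) :=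
  he.update (by rw [Ctx.dim_of_get S.get_ok]; exact Nat.mod_lt _ (by decide))

/-- The control qubit is restored. -/
theorem SearchVars.run_zeroOn (S : SearchVars Γ N Ng c xs ok n p) {ψ : State Γ → ℂ}
    (hψ : ZeroOn {c, xs, ok, n} ψ) :
    ZeroOn {c} (runOp Γ N Ng c xs ok n (pushOp Γ (oracle c xs ok p)) *ᵥ ψ) := by
  obtain ⟨hcx, hco, hcn, hxo, hxn, hon⟩ := S.ne
  intro τ hτ z hz
  rw [Set.mem_singleton_iff] at hz
  subst hz
  rw [S.run_apply ψ τ] at hτ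
  have := S.preState_zeroOn hψ _ hτ z (by simp)
  rwa [State.ofEnv_val (S.valid_flip τ.2 _), Function.update_of_ne hco] at this

/-- Before the final evaluation `ok` and `c` are zero, and the evaluation then writes the predicate
of `xs` to `ok`. Ending with `ok = 0` therefore means that `xs` was not a solution. -/
theorem SearchVars.run_failure (S : SearchVars Γ N Ng c xs ok n p)
    (hNg : (Ng : ℕ) = groverIters N) {ψ : State Γ → ℂ} (hψ : ZeroOn {c, xs, ok, n} ψ)
    (hQ : ∀ σ : State Γ, ψ σ ≠ 0 → ∃ v, v < (N : ℕ) ∧ p σ.1 v) :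
    vn (projOp Γ (fun e => e ok = 0) *ᵥ
      runOp Γ N Ng c xs ok n (pushOp Γ (oracle c xs ok p)) *ᵥ ψ) ≤ √0.63 * vn ψ := by
  obtain ⟨hcx, hco, hcn, hxo, hxn, hon⟩ := S.ne
  refine (vn_mono fun τ => ?_).trans (S.preState_norm hNg hψ hQ)
  rw [projOp_mulVec, projOp_mulVec]
  by_cases h0 : τ.1 ok = 0
  swap
  · rw [if_neg h0, norm_zero]; exact norm_nonneg _
  rw [if_pos h0, S.run_apply ψ τ]
  beta_reduce
  have hz := S.preState_zeroOn hψ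
  by_cases hp : p τ.1 (τ.1 xs)
  · have : (preState Γ N Ng c xs ok n (pushOp Γ (oracle c xs ok p)) *ᵥ ψ) (State.ofEnv Γ
        (Function.update τ.1 ok ((τ.1 ok + ind (τ.1 c = 0 ∧ p τ.1 (τ.1 xs))) % 2))) = 0 := by
      by_cases hc : τ.1 c = 0
      · refine hz.rep_eq_zero (S.valid_flip τ.2 _) (z := ok) (by simp) ?_
        rw [Function.update_self, h0, ind_of ⟨hc, hp⟩]
        decide
      · refine hz.rep_eq_zero (S.valid_flip τ.2 _) (z := c) (by simp) ?_
        rwa [Function.update_of_ne hco]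
    rw [this, norm_zero]; exact norm_nonneg _
  · rw [if_pos hp, ind_not (fun h => hp h.2), h0,
      show (0 + 0) % 2 = τ.1 ok from h0.symm, Function.update_eq_self, State.ofEnv_self]

theorem SearchVars.solvable_congr (S : SearchVars Γ N Ng c xs ok n p) {e e' : Env}
    (h : ∀ x, x ∉ ({c, xs, ok, n} : Set Var) → e x = e' x) (v : ℕ) : p e v ↔ p e' v := by
  have : e = Function.update (Function.update (Function.update (Function.update e' c (e c)) xs (e xs))
      ok (e ok)) n (e n) := by
    funext y
    simp only [Function.update_apply]
    split_ifs with h1 h2 h3 h4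
    · rw [h1]
    · rw [h2]
    · rw [h3]
    · rw [h4]
    · exact h y (by simp [h1, h2, h3, h4])
  rw [this, S.inv_n, S.inv_ok, S.inv_xs, S.inv_c]

/-- Solvability depends only on variables that the run leaves alone, so the run commutes with the
projection onto solvable inputs and cannot create amplitude there. On an unsolvable input the final
evaluation does not flip `ok`. -/
theorem SearchVars.run_unsolvable (S : SearchVars Γ N Ng c xs ok n p) {ψ : State Γ → ℂ}
    (hψ : ZeroOn {c, xs, ok, n} ψ)
    (hQ : ∀ σ : State Γ, ψ σ ≠ 0 → ¬ ∃ v, v < (N : ℕ) ∧ p σ.1 v) :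
    projOp Γ (fun e => ¬ e ok = 0) *ᵥ
      runOp Γ N Ng c xs ok n (pushOp Γ (oracle c xs ok p)) *ᵥ ψ = 0 := by
  obtain ⟨hcx, hco, hcn, hxo, hxn, hon⟩ := S.ne
  funext τ
  rw [projOp_mulVec]
  by_cases h0 : τ.1 ok = 0
  · rw [if_neg (not_not.2 h0)]; rfl
  rw [if_pos h0, S.run_apply ψ τ, Pi.zero_apply]
  beta_reduce
  have hz := S.preState_zeroOn hψ
  by_cases hp : ∃ v, v < (N : ℕ) ∧ p τ.1 v
  · have hl : Local Γ {c, xs, ok, n} (preState Γ N Ng c xs ok n (pushOp Γ (oracle c xs ok p))) :=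
      S.local_prep.conj.mul (((S.local_iter local_oracle _).mul (Local.at (by simp))).mul S.local_prep)
    set P : Env → Prop := fun e => ∃ v, v < (N : ℕ) ∧ p e v
    have h1 := hl.commute_projOp (P := P) fun e e' _ _ h => by
      simp only [P, S.solvable_congr h]
    have h2 : projOp Γ P *ᵥ ψ = 0 := by
      funext σ
      rw [projOp_mulVec]
      by_cases hσ : ψ σ = 0
      · rw [hσ, ite_self]; rfl
      · rw [if_neg (hQ σ hσ)]; rfl
    have h3 := congrArg (fun A => A *ᵥ ψ) h1
    simp only [← mulVec_mulVec, h2, mulVec_zero] at h3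
    set τ' := State.ofEnv Γ (Function.update τ.1 ok ((τ.1 ok + ind (τ.1 c = 0 ∧ p τ.1 (τ.1 xs))) % 2))
      with hτ'
    have h4 := congrFun h3 τ'
    rw [projOp_mulVec, if_pos] at h4
    · exact h4.symm
    · rw [hτ', State.ofEnv_val (S.valid_flip τ.2 _)]
      simp only [P, S.inv_ok]
      exact hp
  · rw [ind_not (fun h => hp ⟨_, τ.valid.lt S.get_xs, h.2⟩), add_zero,
      Nat.mod_eq_of_lt (τ.valid.lt_two S.get_ok), Function.update_eq_self]
    exact hz.rep_eq_zero τ.2 (z := ok) (by simp) h0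

/-! ## Replacing the predicate in a run -/

theorem SearchVars.unitary_prep (S : SearchVars Γ N Ng c xs ok n p) :
    prepOp Γ Ng ok n ∈ unitaryGroup (State Γ) ℂ :=
  mul_mem ((match_one S.get_ok).at_unitary (UOp.sem_unitary (U := .H) rfl))
    (mul_mem (invol_not S.get_ok).unitary ((match_one S.get_n).at_unitary (UOp.unif_unitary Ng)))

theorem SearchVars.unitary_diffusion (S : SearchVars Γ N Ng c xs ok n p) :
    diffusion Γ N xs ∈ unitaryGroup (State Γ) ℂ :=
  (match_one S.get_xs).at_unitary (mul_mem (UOp.unif_unitary N)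
    (mul_mem (UOp.sem_unitary (U := .refl0 N) rfl)
      (conjTranspose_mem_unitaryGroup (UOp.unif_unitary N))))

/-- The predicate is used in `Ng - 1` iterations and once at the end. All other gates are the same
on both sides and cost nothing. -/
theorem SearchVars.hyb_run (S : SearchVars Γ N Ng c xs ok n p) {Z : Set Var}
    (hZ : ∀ z ∈ Z, z ∉ ({c, xs, ok, n} : Set Var)) {K K' : Op Γ} {ε : ℝ} (hK : Hyb Γ Z K K' ε) :
    Hyb Γ Z (runOp Γ N Ng c xs ok n K) (runOp Γ N Ng c xs ok n K') (Ng * ε) := by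
  have hx : Hyb Γ Z (pushOp Γ (fun e => Function.update e c (1 - e c))) _ 0 :=
    Hyb.refl (invol_not S.get_c).unitary (Local.pushOp (V := {c, xs, ok, n}) fun e x hx => by
      rw [Function.update_of_ne]
      rintro rfl
      simp at hx) hZ
  have hg : ∀ l, Hyb Γ Z (pushOp Γ (guardMap c n l)) (pushOp Γ (guardMap c n l)) 0 := fun l =>
    Hyb.refl (S.invol_guard l).unitary (Local.pushOp (V := {c, xs, ok, n}) fun e x hx => by
      rw [guardMap, Function.update_of_ne]
      rintro rfl
      simp at hx) hZ
  have hd : Hyb Γ Z (diffusion Γ N xs) _ 0 :=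
    Hyb.refl S.unitary_diffusion (Local.at (V := {c, xs, ok, n}) (by simp)) hZ
  have hu : Hyb Γ Z (Op.at Γ [xs] (Ctx.consec 0 [N]) ((UOp.unif N).sem [N])) _ 0 :=
    Hyb.refl ((match_one S.get_xs).at_unitary (UOp.unif_unitary N))
      (Local.at (V := {c, xs, ok, n}) (by simp)) hZ
  have hp := Hyb.refl S.unitary_prep S.local_prep hZ
  have hp' := Hyb.refl (conjTranspose_mem_unitaryGroup S.unitary_prep) S.local_prep.conj hZ
  have hi : ∀ L : ℕ, Hyb Γ Z (iterOp Γ N c xs n K L) (iterOp Γ N c xs n K' L) (L * ε) := by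
    intro L
    induction L with
    | zero => exact (Hyb.one Γ Z).congr (by simp)
    | succ L ih =>
      exact (((hg (L + 1)).mul (hd.mul (hK.mul (hg (L + 1))))).mul ih).congr (by push_cast; ring)
  refine ((hx.mul (hK.mul hx)).mul (hp'.mul (((hi (Ng - 1)).mul hu).mul hp))).congr ?_
  rw [Nat.cast_sub (show 1 ≤ (Ng : ℕ) from Ng.pos), Nat.cast_one]
  ring

/-! ## The statement of a run -/

theorem eval_guard (Ng : Ty) (l a : ℕ) :
    Expr.eval ([0].zip [Ng]) (Env.set 0 [0] [a]) (.bin .lt (.var 0) (.const l Ng)) =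
      if a < l then 1 else 0 := by
  simp [Expr.eval, Env.set_cons]

theorem SearchVars.sem_guard (S : SearchVars Γ N Ng c xs ok n p)
    (ρ : PName → Option (Σ Ω : Ctx, Op Ω)) (l : ℕ) :
    UStmt.sem ρ Γ (.app [n, c] (.embed [0] (.bin .lt (.var 0) (.const l Ng)))) =
      pushOp Γ (guardMap c n l) := by
  obtain ⟨hcx, hco, hcn, hxo, hxn, hon⟩ := S.ne
  rw [show [n, c] = [n] ++ [c] from rfl,
    sem_app_embed ρ (Ts := [Ng]) (by simp [hcn.symm]) (by simp [S.get_n]) S.get_c rfl]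
  apply pushOp_congr
  intro e _
  rw [List.map_singleton, eval_guard]
  rfl

theorem SearchVars.sem_run (S : SearchVars Γ N Ng c xs ok n p)
    (ρ : PName → Option (Σ Ω : Ctx, Op Ω)) (cg : PName) (ins rest : List Var)
    (hNg : Ng = (groverIters N).toPNat') :
    UStmt.sem ρ Γ (searchRun cg ins rest N c xs ok n) = runOp Γ N Ng c xs ok n
      (UStmt.sem ρ Γ (.call cg ([c] ++ ins ++ [xs] ++ rest ++ [ok]))) := by
  rw [searchRun]
  simp only [← hNg]
  rw [UStmt.sem, sem_withDo, sem_withDo, sem_app_X ρ S.get_c, (invol_not S.get_c).conjTranspose]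
  rw [runOp, finalOp]
  congr 1
  have hprep : UStmt.sem ρ Γ (.seqs [.app [n] (.unif Ng), .app [ok] .X, .app [ok] .H]) =
      prepOp Γ Ng ok n := by
    rw [sem_seqs_cons, sem_seqs_cons, sem_seqs_cons, sem_seqs_nil, Matrix.one_mul, sem_app_X ρ S.get_ok,
      sem_app_one ρ S.get_ok, sem_app_one ρ S.get_n, prepOp, Matrix.mul_assoc]
  rw [hprep]
  congr 2
  rw [UStmt.sem, sem_app_one ρ S.get_xs]
  congr 1
  generalize hL : (Ng : ℕ) - 1 = L
  clear hL
  induction L with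
  | zero => rfl
  | succ L ih =>
    rw [List.range_succ, List.map_append, sem_seqs_append, ih, List.map_singleton, iterOp,
      sem_seqs_cons, sem_seqs_nil, Matrix.one_mul]
    congr 1
    simp only [sem_seqs_cons, sem_seqs_nil, S.sem_guard, sem_app_one ρ S.get_xs, groverStep,
      diffusion, (match_one S.get_xs).at_mul, Matrix.mul_assoc, Matrix.one_mul, UOp.sem]

theorem SearchVars.wt_run (S : SearchVars Γ N Ng c xs ok n p) {Q : ProcCtx} {cg : PName}
    {ins rest : List Var} (hNg : Ng = (groverIters N).toPNat')
    (hcg : UStmt.WT Q Γ (.call cg ([c] ++ ins ++ [xs] ++ rest ++ [ok]))) :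
    UStmt.WT Q Γ (searchRun cg ins rest N c xs ok n) := by
  obtain ⟨hcx, hco, hcn, hxo, hxn, hon⟩ := S.ne
  have h1 : ∀ {q : Var} {T : Ty} {U : UOp}, Ctx.get Γ q = some T → U.WT [T] →
      UStmt.WT Q Γ (.app [q] U) := fun hq hU => ⟨by simp, [_], by simp [hq], hU⟩
  have hguard : ∀ l, l < (Ng : ℕ) →
      UStmt.WT Q Γ (.app [n, c] (.embed [0] (.bin .lt (.var 0) (.const l Ng)))) := by
    intro l hl
    refine wt_app_embed (vs := [n]) (Ts := [Ng]) (by simp [hcn.symm]) (by simp [S.get_n]) S.get_c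
      rfl (by simp) ?_
    simp [Expr.type, hl, Ctx.get_cons]
  rw [searchRun]
  simp only [← hNg]
  refine ⟨wt_withDo (wt_seqs ?_) ⟨h1 S.get_xs rfl, wt_seqs ?_⟩, wt_withDo (h1 S.get_c rfl) hcg⟩
  · intro W hW
    simp only [List.mem_cons, List.not_mem_nil, or_false] at hW
    rcases hW with rfl | rfl | rfl
    · exact h1 S.get_n rfl
    · exact h1 S.get_ok rfl
    · exact h1 S.get_ok rfl
  · intro W hW
    obtain ⟨i, hi, rfl⟩ := List.mem_map.1 hW
    have hi' := List.mem_range.1 hi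
    refine wt_seqs fun W hW => ?_
    simp only [List.mem_cons, List.not_mem_nil, or_false] at hW
    rcases hW with rfl | rfl | rfl | rfl | rfl | rfl
    · exact hguard _ (by omega)
    · exact hcg
    · exact h1 S.get_xs rfl
    · exact h1 S.get_xs rfl
    · exact h1 S.get_xs rfl
    · exact hguard _ (by omega)

end Run

/-! ## Lists of values -/

/-- The values `vs` are of types `Ts`. -/
def HasTys (vs : List ℕ) (Ts : List Ty) : Prop := List.Forall₂ (fun v (T : Ty) => v < (T : ℕ)) vs Ts

theorem HasTys.length {vs : List ℕ} {Ts : List Ty} (h : HasTys vs Ts) : vs.length = Ts.length :=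
  List.Forall₂.length_eq h

theorem HasTys.eq_singleton {vs : List ℕ} {T : Ty} (h : HasTys vs [T]) : ∃ v, vs = [v] ∧ v < (T : ℕ) := by
  rcases h with _ | ⟨h, h'⟩
  cases h'
  exact ⟨_, rfl, h⟩

theorem Valid.hasTys {Γ : Ctx} {e : Env} (he : Valid Γ e) {xs : List Var} {Ts : List Ty}
    (hx : xs.map (Ctx.get Γ) = Ts.map some) : HasTys (xs.map e) Ts := by
  induction xs generalizing Ts with
  | nil => cases Ts with
    | nil => exact List.Forall₂.nil
    | cons => simp at hx
  | cons x xs ih => cases Ts with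
    | nil => simp at hx
    | cons T Ts =>
      simp only [List.map_cons, List.cons.injEq] at hx
      exact List.Forall₂.cons (he.lt hx.1) (ih hx.2)

theorem Valid.set {Γ : Ctx} {e : Env} (he : Valid Γ e) {xs : List Var} {vs : List ℕ} {Ts : List Ty}
    (hx : xs.map (Ctx.get Γ) = Ts.map some) (hv : HasTys vs Ts) : Valid Γ (Env.set e xs vs) := by
  induction xs generalizing Ts vs with
  | nil => rwa [Env.set_nil]
  | cons x xs ih => cases Ts with
    | nil => simp at hx
    | cons T Ts =>
      simp only [List.map_cons, List.cons.injEq] at hx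
      rcases hv with _ | ⟨h, h'⟩
      intro y
      rw [Env.set_cons]
      split_ifs with hy
      · rw [hy, Ctx.dim_of_get hx.1]; exact h
      · exact ih hx.2 h' y

/-! ## Compute, act, uncompute -/

/-- Here `h` is the ideal computation with garbage, `k` the copy and `t` the desired effect. The
hypothesis `hkt` says that copying after the computation on `e` gives what the computation gives on
`t e`. So the error of `A` enters once on `ψ` and once on the ideal result. -/
theorem uncompute_le {Γ : Ctx} {Z Z' : Set Var} {A : Op Γ} {h k t : Env → Env} {ε : ℝ} (hε : 0 ≤ ε)
    (hA : A ∈ unitaryGroup (State Γ) ℂ) (hC : pushOp Γ k ∈ unitaryGroup (State Γ) ℂ)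
    (hh : Only Γ Z h) (hAh : ApproxOp Γ Z A (pushOp Γ h) ε) (hZ : Z ⊆ Z') (ht : Pres Γ t)
    (hkt : ∀ e, Valid Γ e → (∀ z ∈ Z', e z = 0) → k (h e) = h (t e))
    {ψ : State Γ → ℂ} (hψ : ZeroOn Z' ψ) (hφ : ZeroOn Z (pushOp Γ t *ᵥ ψ))
    (hn : vn (pushOp Γ t *ᵥ ψ) ≤ vn ψ) :
    vn ((Aᴴ * (pushOp Γ k * A)) *ᵥ ψ - pushOp Γ t *ᵥ ψ) ≤ 2 * ε * vn ψ := by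
  have h2 : pushOp Γ k *ᵥ pushOp Γ h *ᵥ ψ = pushOp Γ h *ᵥ pushOp Γ t *ᵥ ψ := by
    rw [mulVec_mulVec, mulVec_mulVec, pushOp_mul hh.pres, pushOp_mul ht]
    exact pushOp_mulVec_congr hψ hkt
  refine (vn_conj_le hA hC (pushOp Γ h) ψ _ (hAh ψ (hψ.mono hZ)) (ε₂ := ε * vn ψ) ?_).trans
    (by linarith)
  rw [h2]
  exact (hAh _ hφ).trans (mul_le_mul_of_nonneg_left hn hε)

/-! ## Specification of compiled functions -/

/-- The compiled function `c` computes `s` with precision `δ`, up to garbage in its workspace. -/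
structure CFun.Spec (V : UInterp) (s : List ℕ → List ℕ) (c : CFun) (δ : ℝ) : Prop where
  nodup : (Ctx.keys (c.ins ++ c.rest)).Nodup
  outs_nodup : (Ctx.keys c.outs).Nodup
  outs_sub : Ctx.Sub c.outs c.rest
  lookup : ∃ G, c.procs.lookup c.name = some G ∧ G.args = c.ins ++ c.rest
  range : ∀ vs, HasTys vs (Ctx.tys c.ins) → HasTys (s vs) (Ctx.tys c.outs)
  exists_op : ∃ (U : Op (c.ins ++ c.rest)) (h : Env → Env),
    ProcCtx.sem V c.procs c.name = some ⟨c.ins ++ c.rest, U⟩ ∧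
    U ∈ unitaryGroup (State (c.ins ++ c.rest)) ℂ ∧
    Only (c.ins ++ c.rest) {x | x ∈ Ctx.keys c.rest} h ∧
    ApproxOp (c.ins ++ c.rest) {x | x ∈ Ctx.keys c.rest} U (pushOp (c.ins ++ c.rest) h) δ ∧
    ∀ e, Valid (c.ins ++ c.rest) e → (∀ z ∈ Ctx.keys c.rest, e z = 0) →
      (Ctx.keys c.outs).map (h e) = s ((Ctx.keys c.ins).map e)

theorem mem_zip_self {α : Type*} {l : List α} {a : α} (h : a ∈ l) : (a, a) ∈ l.zip l := by
  induction l with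
  | nil => simp at h
  | cons b l ih =>
    rcases List.mem_cons.1 h with rfl | h
    · simp
    · simp [ih h]

theorem pull_keys (Ω : Ctx) (σ : Env) (x : Var) :
    pull (Ctx.keys Ω) Ω σ x = if x ∈ Ctx.keys Ω then σ x else 0 :=
  Env.set_map 0 σ _ x

theorem put_keys (Ω : Ctx) (σ e : Env) (x : Var) :
    put (Ctx.keys Ω) Ω σ e x = if x ∈ Ctx.keys Ω then e x else σ x :=
  Env.set_map σ e _ x

namespace CFun.Spec

variable {V : UInterp} {s : List ℕ → List ℕ} {c : CFun} {δ : ℝ}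

theorem ins_nodup (h : c.Spec V s δ) : (Ctx.keys c.ins).Nodup :=
  (List.nodup_append'.1 (Ctx.keys_append _ _ ▸ h.nodup)).1

theorem rest_nodup (h : c.Spec V s δ) : (Ctx.keys c.rest).Nodup :=
  (List.nodup_append'.1 (Ctx.keys_append _ _ ▸ h.nodup)).2.1

theorem not_mem_ins (h : c.Spec V s δ) {x : Var} (hx : x ∈ Ctx.keys c.rest) : x ∉ Ctx.keys c.ins :=
  fun h' => (List.nodup_append'.1 (Ctx.keys_append _ _ ▸ h.nodup)).2.2 h' hx

theorem sub_rest (h : c.Spec V s δ) : Ctx.Sub c.rest (c.ins ++ c.rest) :=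
  Ctx.sub_append_right fun _ hx => h.not_mem_ins hx

/-- A call of the compiled function in a larger context. -/
theorem lift (h : c.Spec V s δ) (hδ : 0 ≤ δ) {Γ : Ctx} (hΓ : Ctx.Sub (c.ins ++ c.rest) Γ) :
    ∃ (A : Op Γ) (k : Env → Env),
      UStmt.sem (ProcCtx.sem V c.procs) Γ (.call c.name (Ctx.keys (c.ins ++ c.rest))) = A ∧
      UStmt.sem (ProcCtx.sem V c.procs) Γ (.callAdj c.name (Ctx.keys (c.ins ++ c.rest))) = Aᴴ ∧
      A ∈ unitaryGroup (State Γ) ℂ ∧ Only Γ {x | x ∈ Ctx.keys c.rest} k ∧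
      ApproxOp Γ {x | x ∈ Ctx.keys c.rest} A (pushOp Γ k) δ ∧
      (∀ e, Valid Γ e → (∀ z ∈ Ctx.keys c.rest, e z = 0) →
        (Ctx.keys c.outs).map (k e) = s ((Ctx.keys c.ins).map e)) ∧
      ∀ e e', (∀ x ∈ Ctx.keys (c.ins ++ c.rest), e x = e' x) →
        ∀ x ∈ Ctx.keys (c.ins ++ c.rest), k e x = k e' x := by
  obtain ⟨U, g, hs, hU, hg, hUg, hout⟩ := h.exists_op
  have hm : Match Γ (Ctx.keys (c.ins ++ c.rest)) (c.ins ++ c.rest) := Match.keys hΓ h.nodup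
  have hr : ∀ z ∈ Ctx.keys c.rest, z ∈ Ctx.keys (c.ins ++ c.rest) := fun z hz => by
    rw [Ctx.keys_append]; exact List.mem_append_right _ hz
  have hi : ∀ z ∈ Ctx.keys c.ins, z ∈ Ctx.keys (c.ins ++ c.rest) := fun z hz => by
    rw [Ctx.keys_append]; exact List.mem_append_left _ hz
  have ho : ∀ z ∈ Ctx.keys c.outs, z ∈ Ctx.keys c.rest := fun z hz => by
    obtain ⟨T, hT⟩ := Ctx.exists_get hz
    exact Ctx.mem_keys_of_get (h.outs_sub _ _ hT)
  refine ⟨_, fun σ => put (Ctx.keys (c.ins ++ c.rest)) (c.ins ++ c.rest) σ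
    (g (pull (Ctx.keys (c.ins ++ c.rest)) (c.ins ++ c.rest) σ)), sem_call hs Γ _, sem_callAdj hs Γ _,
    hm.at_unitary hU, ?_, ?_, ?_, ?_⟩
  · refine ⟨hm.pres_put hg.pres, fun e x hx => ?_⟩
    rw [put_keys]
    split_ifs with h1
    · rw [hg.eq _ _ hx, pull_keys, if_pos h1]
    · rfl
  · rw [← hm.at_pushOp hg.pres]
    refine hm.at_approx hδ hUg fun z hz => ⟨z, hz, mem_zip_self (hr z hz)⟩
  · intro e he hz
    have h1 := hout (pull (Ctx.keys (c.ins ++ c.rest)) (c.ins ++ c.rest) e) (hm.valid_pull he)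
        fun z hz' => by rw [pull_keys, if_pos (hr z hz'), hz z hz']
    rw [List.map_congr_left (f := fun x => put (Ctx.keys (c.ins ++ c.rest)) (c.ins ++ c.rest) e
          (g (pull (Ctx.keys (c.ins ++ c.rest)) (c.ins ++ c.rest) e)) x)
        (fun x hx => by rw [put_keys, if_pos (hr x (ho x hx))]), h1]
    congr 1
    exact List.map_congr_left fun x hx => by rw [pull_keys, if_pos (hi x hx)]
  · intro e e' he x hx
    have h2 : pull (Ctx.keys (c.ins ++ c.rest)) (c.ins ++ c.rest) e =
        pull (Ctx.keys (c.ins ++ c.rest)) (c.ins ++ c.rest) e' := by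
      funext y
      rw [pull_keys, pull_keys]
      split_ifs with hy
      · exact he y hy
      · rfl
    beta_reduce
    rw [put_keys, put_keys, if_pos hx, if_pos hx, h2]

end CFun.Spec

/-! ## Copying outputs -/

/-- The copies are made one at a time. Sources and targets are disjoint, so a copy does not disturb
later sources. Since targets start at zero, adding a value to them amounts to overwriting them. -/
theorem sem_copies (ρ : PName → Option (Σ Ω : Ctx, Op Ω)) {Γ : Ctx} {as bs : List Var} {Ts : List Ty}
    (ha : as.map (Ctx.get Γ) = Ts.map some) (hb : bs.map (Ctx.get Γ) = Ts.map some)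
    (hab : ∀ a ∈ as, a ∉ bs) (hn : bs.Nodup) :
    ∃ k, UStmt.sem ρ Γ (.seqs ((as.zip bs).map fun p => .app [p.1, p.2] (.embed [0] (.var 0)))) =
        pushOp Γ k ∧ Pres Γ k ∧
      ∀ e, Valid Γ e → (∀ b ∈ bs, e b = 0) → k e = Env.set e bs (as.map e) := by
  induction as generalizing bs Ts with
  | nil =>
    have : bs = [] := by
      have h1 := length_eq_of_map_get ha
      have h2 := length_eq_of_map_get hb
      rw [← h1] at h2
      exact List.length_eq_zero_iff.1 h2
    subst this
    exact ⟨fun e => e, by rw [pushOp_id]; rfl, fun e he => he, fun e _ _ => (Env.set_nil _ _).symm⟩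
  | cons a as ih =>
    cases Ts with
    | nil => simp at ha
    | cons T Ts =>
      cases bs with
      | nil => simp at hb
      | cons b bs =>
        simp only [List.map_cons, List.cons.injEq] at ha hb
        simp only [List.mem_cons, forall_eq_or_imp, not_or] at hab
        rw [List.nodup_cons] at hn
        obtain ⟨k, hk, hkp, hke⟩ := ih ha.2 hb.2 (fun x hx => (hab.2 x hx).2) hn.2
        have hp : Pres Γ fun σ => Function.update σ b ((σ b + σ a) % (T : ℕ)) := fun e he =>
          he.update (by rw [Ctx.dim_of_get hb.1]; exact Nat.mod_lt _ T.pos)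
        have h1 : UStmt.sem ρ Γ (.app [a, b] (.embed [0] (.var 0))) =
            pushOp Γ fun σ => Function.update σ b ((σ b + σ a) % (T : ℕ)) := by
          rw [show [a, b] = [a] ++ [b] from rfl, sem_app_embed ρ (Ts := [T])
            (by simpa using hab.1.1) (by simp [ha.1]) hb.1 rfl]
          apply pushOp_congr
          intro e _
          simp [Expr.eval, Env.set_cons]
        refine ⟨_, ?_, fun e he => hkp _ (hp e he), fun e he hz => ?_⟩
        · rw [List.zip_cons_cons, List.map_cons, sem_seqs_cons, hk, h1, pushOp_mul hp]
        · have hz0 : e b = 0 := hz b (by simp)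
          have ha0 : (e b + e a) % (T : ℕ) = e a := by
            rw [hz0, zero_add, Nat.mod_eq_of_lt (he.lt ha.1)]
          have hv : Valid Γ (Function.update e b (e a)) := by simpa only [ha0] using hp e he
          rw [ha0, hke _ hv fun x hx => by
            rw [Function.update_of_ne (by rintro rfl; exact hn.1 hx), hz x (by simp [hx])]]
          have h2 : as.map (Function.update e b (e a)) = as.map e :=
            List.map_congr_left fun x hx => Function.update_of_ne (hab.2 x hx).1 _ _
          rw [h2]
          funext y
          rw [List.map_cons, Env.set_cons]
          split_ifs with hy
          · rw [hy, Env.set_of_not_mem _ _ hn.1, Function.update_self]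
          · by_cases hyb : y ∈ bs
            · exact Env.set_mem_congr _ _ (by
                rw [List.length_map, length_eq_of_map_get ha.2, length_eq_of_map_get hb.2]) hyb
            · rw [Env.set_of_not_mem _ _ hyb, Env.set_of_not_mem _ _ hyb, Function.update_of_ne hy]

theorem Ctx.keys_append_nodup {Γ Δ : Ctx} (hΓ : (Ctx.keys Γ).Nodup) (hΔ : (Ctx.keys Δ).Nodup)
    (h : ∀ x ∈ Ctx.keys Δ, x ∉ Ctx.keys Γ) : (Ctx.keys (Γ ++ Δ)).Nodup := by
  rw [Ctx.keys_append]
  exact List.Nodup.append hΓ hΔ fun x hx hx' => h x hx' hx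

theorem Ctx.not_mem_of_fresh_le {Γ : Ctx} {x : Var} (h : Ctx.fresh Γ ≤ x) : x ∉ Ctx.keys Γ :=
  fun hx => absurd (Ctx.lt_fresh hx) (by lia)

namespace CFun.Spec

variable {V : UInterp} {s : List ℕ → List ℕ} {c : CFun} {δ : ℝ}

theorem outs_mem (h : c.Spec V s δ) {x : Var} (hx : x ∈ Ctx.keys c.outs) : x ∈ Ctx.keys c.rest := by
  obtain ⟨T, hT⟩ := Ctx.exists_get hx
  exact Ctx.mem_keys_of_get (h.outs_sub _ _ hT)

theorem wt_call (h : c.Spec V s δ) {Γ : Ctx} (hΓ : Ctx.Sub (c.ins ++ c.rest) Γ) :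
    UStmt.WT c.procs Γ (.call c.name (Ctx.keys (c.ins ++ c.rest))) := by
  obtain ⟨G, hG, ha⟩ := h.lookup
  exact ⟨h.nodup, G, hG, by rw [ha]; exact hΓ.map_keys h.nodup⟩

theorem wt_copies {Q : ProcCtx} {Γ : Ctx} {as bs : List Var} {Ts : List Ty}
    (ha : as.map (Ctx.get Γ) = Ts.map some) (hb : bs.map (Ctx.get Γ) = Ts.map some)
    (hab : ∀ a ∈ as, a ∉ bs) :
    UStmt.WT Q Γ (.seqs ((as.zip bs).map fun p => .app [p.1, p.2] (.embed [0] (.var 0)))) := by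
  refine wt_seqs fun W hW => ?_
  obtain ⟨⟨a, b⟩, hp, rfl⟩ := List.mem_map.1 hW
  have h1 := List.of_mem_zip hp
  have hne : a ≠ b := by rintro rfl; exact hab a h1.1 h1.2
  have h2 : Ctx.get Γ a = Ctx.get Γ b :=
    Match.zip_map (f := Ctx.get Γ) (g := Ctx.get Γ) (ha.trans hb.symm) hp
  obtain ⟨T, hT⟩ := Ctx.exists_get (mem_keys_of_map_get ha h1.1)
  exact wt_app_embed (vs := [a]) (Ts := [T]) (by simpa using hne) (by simp [hT]) (h2 ▸ hT) rfl
    (by simp) (by simp [Expr.type, Ctx.get_cons])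

/-- Apply `uncompute_le` to the call. The ideal computation reads and writes only the arguments of
the function, so it commutes with writing the result to the separate copies. This returns the
workspace to zero, at twice the error. -/
theorem clean (h : c.Spec V s δ) (hδ : 0 ≤ δ) (hS : Sound (ProcCtx.sem V c.procs) c.procs)
    {Γ Ω' : Ctx} (hΩ' : Ω' = copyCtx (Ctx.fresh (c.ins ++ c.rest)) c.outs)
    (hΓ : Γ = c.ins ++ c.rest ++ Ω') :
    ∃ W, cleanProc c = .defn Γ W ∧ W.WT c.procs Γ ∧ (Ctx.keys Γ).Nodup ∧
      ApproxOp Γ {x | x ∈ Ctx.keys c.rest ∨ x ∈ Ctx.keys Ω'} (W.sem (ProcCtx.sem V c.procs) Γ)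
        (pushOp Γ fun e => Env.set e (Ctx.keys Ω') (s ((Ctx.keys c.ins).map e))) (2 * δ) := by
  have hk : ∀ x ∈ Ctx.keys Ω', x ∉ Ctx.keys (c.ins ++ c.rest) := fun x hx => by
    rw [hΩ', copyCtx, Ctx.mem_keys_consec] at hx
    exact Ctx.not_mem_of_fresh_le hx.1
  have hn' : (Ctx.keys Ω').Nodup := by rw [hΩ']; exact Ctx.nodup_consec _ _
  have ht' : Ctx.tys Ω' = Ctx.tys c.outs := by rw [hΩ']; exact Ctx.tys_consec _ _
  have hsub : Ctx.Sub (c.ins ++ c.rest) Γ := hΓ ▸ Ctx.sub_append_left _ _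
  have hsub' : Ctx.Sub Ω' Γ := hΓ ▸ Ctx.sub_append_right hk
  have hnΓ : (Ctx.keys Γ).Nodup := hΓ ▸ Ctx.keys_append_nodup h.nodup hn' hk
  have hmem : ∀ x ∈ Ctx.keys c.rest, x ∈ Ctx.keys (c.ins ++ c.rest) := fun x hx => by
    rw [Ctx.keys_append]; exact List.mem_append_right _ hx
  have hmem' : ∀ x ∈ Ctx.keys c.ins, x ∈ Ctx.keys (c.ins ++ c.rest) := fun x hx => by
    rw [Ctx.keys_append]; exact List.mem_append_left _ hx
  have hga : (Ctx.keys c.outs).map (Ctx.get Γ) = (Ctx.tys c.outs).map some :=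
    ((h.outs_sub.trans h.sub_rest).trans hsub).map_keys h.outs_nodup
  have hgb : (Ctx.keys Ω').map (Ctx.get Γ) = (Ctx.tys c.outs).map some :=
    ht' ▸ hsub'.map_keys hn'
  have hgi : (Ctx.keys c.ins).map (Ctx.get Γ) = (Ctx.tys c.ins).map some :=
    ((Ctx.sub_append_left _ _).trans hsub).map_keys h.ins_nodup
  have hab : ∀ a ∈ Ctx.keys c.outs, a ∉ Ctx.keys Ω' := fun a ha ha' =>
    hk a ha' (hmem a (h.outs_mem ha))
  obtain ⟨A, g, hA, hA', hAu, hg, hAg, hout, hloc⟩ := h.lift hδ hsub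
  obtain ⟨k, hC, hkp, hke⟩ := sem_copies (ProcCtx.sem V c.procs) hga hgb hab hn'
  have hwt := wt_copies (Q := c.procs) hga hgb hab
  have hlen : ∀ e, Valid Γ e → (Ctx.keys Ω').length = (s ((Ctx.keys c.ins).map e)).length :=
    fun e he => by
      rw [(h.range _ (he.hasTys hgi)).length, ← ht', Ctx.length_tys, Ctx.length_keys]
  have hset : Only Γ {x | x ∈ Ctx.keys c.rest ∨ x ∈ Ctx.keys Ω'}
      fun e => Env.set e (Ctx.keys Ω') (s ((Ctx.keys c.ins).map e)) :=
    ⟨fun e he => he.set hgb (h.range _ (he.hasTys hgi)),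
      fun e x hx => Env.set_of_not_mem _ _ fun hx' => hx (Or.inr hx')⟩
  refine ⟨.seq (.call c.name (Ctx.keys (c.ins ++ c.rest)))
    (.seq (.seqs (((Ctx.keys c.outs).zip (Ctx.keys Ω')).map fun p =>
      .app [p.1, p.2] (.embed [0] (.var 0)))) (.callAdj c.name (Ctx.keys (c.ins ++ c.rest)))),
    by rw [hΓ, hΩ']; rfl, ⟨h.wt_call hsub, hwt, h.wt_call hsub⟩, hnΓ, fun ψ hψ => ?_⟩
  rw [UStmt.sem, UStmt.sem, hA, hA', hC, Matrix.mul_assoc]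
  refine uncompute_le hδ hAu (hC ▸ hS.sem_unitary hwt) hg hAg (fun x hx => Or.inl hx) hset.pres ?_ hψ
    (hψ.pushOp fun e _ he z hz => ?_) (hset.vn hψ).le
  · intro e he hz
    have hz1 : ∀ z ∈ Ctx.keys c.rest, e z = 0 := fun z hz' => hz z (Or.inl hz')
    have hgΩ' : ∀ z ∈ Ctx.keys Ω', g e z = e z := fun z hz' =>
      hg.eq e z fun hz'' => hk z hz' (hmem z hz'')
    rw [hke _ (hg.pres e he) fun b hb => by rw [hgΩ' b hb, hz b (Or.inr hb)], hout e he hz1]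
    -- `e'` is the desired final environment. It agrees with `e` on the arguments of the function,
    -- so the garbage is the same in both.
    set e' := Env.set e (Ctx.keys Ω') (s ((Ctx.keys c.ins).map e)) with he'
    have hee : ∀ x ∈ Ctx.keys (c.ins ++ c.rest), e x = e' x := fun x hx =>
      (Env.set_of_not_mem _ _ fun hx' => hk x hx' hx).symm
    funext x
    by_cases hx : x ∈ Ctx.keys Ω'
    · rw [hg.eq e' x fun hx' => hk x hx (hmem x hx')]
      exact Env.set_mem_congr _ _ (hlen e he) hx
    · rw [Env.set_of_not_mem _ _ hx]
      by_cases hx' : x ∈ Ctx.keys (c.ins ++ c.rest)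
      · exact hloc e e' hee x hx'
      · rw [hg.eq e x fun h' => hx' (hmem x h'), hg.eq e' x fun h' => hx' (hmem x h'), he',
          Env.set_of_not_mem _ _ hx]
  · rw [Env.set_of_not_mem _ _ fun hx' => hk z hx' (hmem z hz)]
    exact he z (Or.inl hz)

/-- The action of `CtrlClean` on its arguments. -/
noncomputable def ctrlMap (s : List ℕ → List ℕ) (ins : List Var) (q b : Var) (e : Env) : Env :=
  Function.update e b ((e b + ind (e q = 1 ∧ s (ins.map e) = [1])) % 2)

/-- In contrast to `clean`, the target is not assumed to be zero, because phase kickback needs it in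
the state `|-⟩`. For a single output bit the desired effect is an involution on all environments, so
only the workspace must start at zero. -/
theorem ctrlClean (h : c.Spec V s δ) (hδ : 0 ≤ δ) (hS : Sound (ProcCtx.sem V c.procs) c.procs)
    (ho : Ctx.tys c.outs = [boolTy]) {Γ : Ctx} {q : Var} (hq : q = Ctx.fresh (c.ins ++ c.rest))
    (hΓ : Γ = (q, boolTy) :: (c.ins ++ c.rest ++ [(q + 1, boolTy)])) :
    ∃ W, ctrlCleanProc c = .defn Γ W ∧ W.WT c.procs Γ ∧ (Ctx.keys Γ).Nodup ∧
      Hyb Γ {x | x ∈ Ctx.keys c.rest} (W.sem (ProcCtx.sem V c.procs) Γ)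
        (pushOp Γ (ctrlMap s (Ctx.keys c.ins) q (q + 1))) (2 * δ) ∧
      Invol Γ (ctrlMap s (Ctx.keys c.ins) q (q + 1)) := by
  obtain ⟨o, ho'⟩ : ∃ o, c.outs = [(o, boolTy)] := by
    rcases hc : c.outs with _ | ⟨⟨o, T⟩, _ | _⟩ <;> rw [hc] at ho <;> simp [Ctx.tys] at ho
    exact ⟨o, by rw [ho]⟩
  have hk : ∀ x, q ≤ x → x ∉ Ctx.keys (c.ins ++ c.rest) := fun x hx =>
    Ctx.not_mem_of_fresh_le (hq ▸ hx)
  have hkeys : Ctx.keys Γ = q :: (Ctx.keys (c.ins ++ c.rest) ++ [q + 1]) := by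
    rw [hΓ, Ctx.keys_cons, Ctx.keys_append]; rfl
  have hgq : Ctx.get Γ q = some boolTy := by rw [hΓ, Ctx.get_cons, if_pos rfl]
  have hqq : q + 1 ≠ q := by lia
  have hgb : Ctx.get Γ (q + 1) = some boolTy := by
    rw [hΓ, Ctx.get_cons, if_neg hqq, Ctx.get_append, if_neg (hk _ (by lia)), Ctx.get_cons, if_pos rfl]
  have hsub : Ctx.Sub (c.ins ++ c.rest) Γ := fun x T hx => by
    have hx' := Ctx.mem_keys_of_get hx
    rw [hΓ, Ctx.get_cons, if_neg (by rintro rfl; exact hk _ le_rfl hx'), Ctx.get_append, if_pos hx', hx]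
  have hnΓ : (Ctx.keys Γ).Nodup := by
    rw [hkeys, List.nodup_cons]
    refine ⟨?_, List.Nodup.append h.nodup (by simp) fun x hx hx' => ?_⟩
    · rw [List.mem_append, not_or]
      exact ⟨hk _ le_rfl, by simp⟩
    · rw [List.mem_singleton] at hx'
      subst hx'
      exact hk _ (by lia) hx
  have hmem : ∀ x ∈ Ctx.keys c.rest, x ∈ Ctx.keys (c.ins ++ c.rest) := fun x hx => by
    rw [Ctx.keys_append]; exact List.mem_append_right _ hx
  have hmem' : ∀ x ∈ Ctx.keys c.ins, x ∈ Ctx.keys (c.ins ++ c.rest) := fun x hx => by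
    rw [Ctx.keys_append]; exact List.mem_append_left _ hx
  have hom : o ∈ Ctx.keys c.rest := h.outs_mem (by rw [ho']; simp [Ctx.keys])
  have hgo : Ctx.get Γ o = some boolTy :=
    (h.outs_sub.trans (h.sub_rest.trans hsub)) _ _ (by rw [ho', Ctx.get_cons, if_pos rfl])
  have hqr : q ∉ Ctx.keys c.rest := fun h' => hk q le_rfl (hmem q h')
  have hbr : q + 1 ∉ Ctx.keys c.rest := fun h' => hk (q + 1) (by lia) (hmem _ h')
  have hoq : o ≠ q := by rintro rfl; exact hqr hom
  have hob : o ≠ q + 1 := by intro h'; exact hbr (h' ▸ hom)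
  have hgi : (Ctx.keys c.ins).map (Ctx.get Γ) = (Ctx.tys c.ins).map some :=
    ((Ctx.sub_append_left _ _).trans hsub).map_keys h.ins_nodup
  have hmap : ∀ (e : Env) v, (Ctx.keys c.ins).map (Function.update e (q + 1) v) =
      (Ctx.keys c.ins).map e := fun e v => List.map_congr_left fun x hx =>
    Function.update_of_ne (by rintro rfl; exact hk _ (by lia) (hmem' _ hx)) _ _
  have hinv : Invol Γ (ctrlMap s (Ctx.keys c.ins) q (q + 1)) :=
    invol_flip hgb fun e v => by rw [hmap, Function.update_of_ne hqq.symm]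
  obtain ⟨A, g, hA, hA', hAu, hg, hAg, hout, hloc⟩ := h.lift hδ hsub
  have hC : UStmt.sem (ProcCtx.sem V c.procs) Γ
      (.seqs [.app [q, o, q + 1] (.ctrl (.embed [0] (.var 0)))]) = pushOp Γ (fun σ =>
        Function.update σ (q + 1) ((σ (q + 1) + if σ q = 1 then σ o else 0) % 2)) := by
    rw [sem_seqs_cons, sem_seqs_nil, Matrix.one_mul,
      sem_app_ctrl_copy _ (by simp [hoq.symm, hob]) hgq hgo hgb]
    rfl
  have hwt : UStmt.WT c.procs Γ (.seqs [.app [q, o, q + 1] (.ctrl (.embed [0] (.var 0)))]) := by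
    refine wt_seqs fun W hW => ?_
    rw [List.mem_singleton.1 hW]
    refine ⟨by simp [hoq.symm, hob], [boolTy, boolTy, boolTy], by simp [hgq, hgo, hgb],
      [boolTy, boolTy], rfl, by simp, [boolTy], boolTy, rfl, rfl, ?_⟩
    simp [Expr.type, Ctx.get_cons]
  have hwt' : UStmt.WT c.procs Γ (.seq (.call c.name (Ctx.keys (c.ins ++ c.rest)))
      (.seq (.seqs [.app [q, o, q + 1] (.ctrl (.embed [0] (.var 0)))])
        (.callAdj c.name (Ctx.keys (c.ins ++ c.rest))))) := ⟨h.wt_call hsub, hwt, h.wt_call hsub⟩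
  have hzero : ∀ ψ : State Γ → ℂ, ZeroOn {x | x ∈ Ctx.keys c.rest} ψ →
      ZeroOn {x | x ∈ Ctx.keys c.rest} (pushOp Γ (ctrlMap s (Ctx.keys c.ins) q (q + 1)) *ᵥ ψ) :=
    fun ψ hψ => hψ.pushOp fun e _ he z hz => by
      rw [ctrlMap, Function.update_of_ne (by rintro rfl; exact hbr hz)]
      exact he z hz
  refine ⟨_, ?_, hwt', hnΓ, ⟨hS.sem_unitary hwt', hinv.unitary, hzero, fun ψ hψ => ?_⟩, hinv⟩
  · rw [hΓ, ctrlCleanProc]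
    simp only [← hq, ho']
    rfl
  rw [UStmt.sem, UStmt.sem, hA, hA', hC, Matrix.mul_assoc]
  refine uncompute_le hδ hAu (hC ▸ hS.sem_unitary hwt) hg hAg subset_rfl hinv.pres ?_ hψ
    (hzero ψ hψ) (vn_unitary hinv.unitary ψ).le
  intro e he hz
  have hgq' : g e q = e q := hg.eq e q hqr
  have hgb' : g e (q + 1) = e (q + 1) := hg.eq e _ hbr
  have hge : g e o = if s ((Ctx.keys c.ins).map e) = [1] then 1 else 0 := by
    have h1 := hout e he hz
    obtain ⟨v, hv, hv2⟩ := (ho ▸ h.range _ (he.hasTys hgi) : HasTys _ [boolTy]).eq_singleton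
    rw [hv] at h1 ⊢
    simp only [ho', Ctx.keys, List.map_cons, List.map_nil, List.cons.injEq, and_true] at h1 ⊢
    rw [h1]
    have : v < 2 := hv2
    split_ifs <;> omega
  set e' := ctrlMap s (Ctx.keys c.ins) q (q + 1) e with he'
  have hne : ∀ x, x ≠ q + 1 → e' x = e x := fun x hx => Function.update_of_ne hx _ _
  have hee : ∀ x ∈ Ctx.keys (c.ins ++ c.rest), e x = e' x := fun x hx =>
    (hne x (by rintro rfl; exact hk _ (by lia) hx)).symm
  have hadd : (if g e q = 1 then g e o else 0) =
      ind (e q = 1 ∧ s ((Ctx.keys c.ins).map e) = [1]) := by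
    rw [hgq', hge]
    by_cases h1 : e q = 1 <;> by_cases h2 : s ((Ctx.keys c.ins).map e) = [1] <;>
      simp [h1, h2, ind]
  rw [hadd, hgb']
  funext x
  by_cases hx : x = q + 1
  · rw [hx, Function.update_self, hg.eq e' _ hbr, he', ctrlMap, Function.update_self]
  · rw [Function.update_of_ne hx]
    by_cases hx' : x ∈ Ctx.keys (c.ins ++ c.rest)
    · exact hloc e e' hee x hx'
    · rw [hg.eq e x fun h' => hx' (hmem x h'), hg.eq e' x fun h' => hx' (hmem x h'), hne x hx]

end CFun.Spec

/-! ## Repeated search -/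

theorem Local.exists_of_ne_zero {Γ : Ctx} {V : Set Var} {A : Op Γ} (hA : Local Γ V A)
    {ψ : State Γ → ℂ} {τ : State Γ} (h : (A *ᵥ ψ) τ ≠ 0) :
    ∃ σ, ψ σ ≠ 0 ∧ ∀ x, x ∉ V → τ.1 x = σ.1 x := by
  obtain ⟨σ, -, hσ⟩ := Finset.exists_ne_zero_of_sum_ne_zero h
  exact ⟨σ, right_ne_zero_of_mul hσ, hA τ σ (left_ne_zero_of_mul hσ)⟩

/-- `j` runs of the search, with consecutive registers from `m + 1` on, and control `m`. -/
noncomputable def runsOp (Γ : Ctx) (N Ng : Ty) (m : Var) (K : ℕ → Op Γ) : ℕ → Op Γ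
  | 0 => 1
  | j + 1 => runOp Γ N Ng m (m + 1 + 3 * j) (m + 2 + 3 * j) (m + 3 + 3 * j) (K j) *
      runsOp Γ N Ng m K j

section Runs

variable {Γ : Ctx} {N Ng : Ty} {m : Var} {R : ℕ} {p : Env → ℕ → Prop}

/-- The ideal predicate for the registers of run `j`. -/
noncomputable def runOracle (Γ : Ctx) (m : Var) (p : Env → ℕ → Prop) (j : ℕ) : Op Γ :=
  pushOp Γ (oracle m (m + 1 + 3 * j) (m + 2 + 3 * j) p)

/-- The assignment of registers to runs. -/
abbrev RunVars (Γ : Ctx) (N Ng : Ty) (m : Var) (R : ℕ) (p : Env → ℕ → Prop) : Prop :=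
  ∀ j, j < R → SearchVars Γ N Ng m (m + 1 + 3 * j) (m + 2 + 3 * j) (m + 3 + 3 * j) p

theorem RunVars.local_runs (S : RunVars Γ N Ng m R p) {j : ℕ} (hj : j ≤ R) :
    Local Γ {x | m ≤ x} (runsOp Γ N Ng m (runOracle Γ m p) j) := by
  induction j with
  | zero => exact Local.one
  | succ j ih =>
    refine Local.mul ?_ (ih (by omega))
    have h := (S j hj).local_run (local_oracle (p := p))
    intro τ σ h0 x hx
    refine h τ σ h0 x fun hx' => hx ?_
    simp only [Set.mem_insert_iff, Set.mem_singleton_iff, Set.mem_ofPred_eq] at hx' ⊢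
    lia

/-- Each run restores the common control and does not touch the registers of later runs, so the next
run starts with the zeros it needs. -/
theorem RunVars.runs_zeroOn (S : RunVars Γ N Ng m R p) {ψ : State Γ → ℂ}
    (hψ : ZeroOn {x | m ≤ x} ψ) {j : ℕ} (hj : j ≤ R) :
    ZeroOn {x | x = m ∨ m + 1 + 3 * j ≤ x} (runsOp Γ N Ng m (runOracle Γ m p) j *ᵥ ψ) := by
  induction j with
  | zero =>
    rw [runsOp, one_mulVec]
    exact hψ.mono fun x hx => by simp only [Set.mem_ofPred_eq] at hx ⊢; lia
  | succ j ih =>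
    have ih' := ih (by omega)
    rw [runsOp, ← mulVec_mulVec]
    set φ := runsOp Γ N Ng m (runOracle Γ m p) j *ᵥ ψ
    have h1 := (S j hj).run_zeroOn (ψ := φ) (ih'.mono fun x hx => by
      simp only [Set.mem_insert_iff, Set.mem_singleton_iff, Set.mem_ofPred_eq] at hx ⊢; lia)
    have h2 := ((S j hj).local_run (local_oracle (p := p))).zeroOn (Z := {x | m + 1 + 3 * (j + 1) ≤ x})
      (fun z hz => by
        simp only [Set.mem_insert_iff, Set.mem_singleton_iff, Set.mem_ofPred_eq] at hz ⊢; lia)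
      (ψ := φ) (ih'.mono fun x hx => by simp only [Set.mem_ofPred_eq] at hx ⊢; lia)
    rintro τ hτ z (rfl | hz)
    · exact h1 τ hτ z rfl
    · exact h2 τ hτ z hz

/-- The runs only change variables on which the predicate does not depend. An arbitrary property `P`
of the predicate is allowed in order to cover solvable and unsolvable inputs alike. -/
theorem RunVars.solvable_congr (S : RunVars Γ N Ng m R p)
    (hp : ∀ e e' : Env, (∀ x, x < m → e x = e' x) → ∀ v, p e v ↔ p e' v) {ψ : State Γ → ℂ}
    {j : ℕ} (hj : j ≤ R) {P : (ℕ → Prop) → Prop} (hQ : ∀ σ : State Γ, ψ σ ≠ 0 → P (p σ.1)) :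
    ∀ σ : State Γ, (runsOp Γ N Ng m (runOracle Γ m p) j *ᵥ ψ) σ ≠ 0 → P (p σ.1) := by
  intro τ hτ
  obtain ⟨σ, hσ, h⟩ := (S.local_runs hj).exists_of_ne_zero hτ
  have : p τ.1 = p σ.1 := funext fun v => propext (hp _ _ (fun x hx => h x (by simpa using hx)) v)
  rw [this]
  exact hQ σ hσ

/-- By induction, each further run multiplies the amplitude of total failure by at most `√0.63`. The
estimate of a single run holds for arbitrary superpositions, in particular for the projected result
of the earlier runs. -/
theorem RunVars.runs_failure (S : RunVars Γ N Ng m R p) (hNg : (Ng : ℕ) = groverIters N)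
    (hp : ∀ e e' : Env, (∀ x, x < m → e x = e' x) → ∀ v, p e v ↔ p e' v)
    {ψ : State Γ → ℂ} (hψ : ZeroOn {x | m ≤ x} ψ)
    (hQ : ∀ σ : State Γ, ψ σ ≠ 0 → ∃ v, v < (N : ℕ) ∧ p σ.1 v) {j : ℕ} (hj : j ≤ R) :
    vn (projOp Γ (fun e => ∀ i < j, e (m + 2 + 3 * i) = 0) *ᵥ
      runsOp Γ N Ng m (runOracle Γ m p) j *ᵥ ψ) ≤ √0.63 ^ j * vn ψ := by
  induction j with
  | zero =>
    rw [runsOp, one_mulVec, pow_zero, one_mul]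
    exact vn_projOp_le _ _
  | succ j ih =>
    have ih' := ih (by omega)
    have hz := S.runs_zeroOn hψ (j := j) (by omega)
    have hs := S.solvable_congr hp (j := j) (by omega)
      (P := fun P => ∃ v, v < (N : ℕ) ∧ P v) hQ
    set P : ℕ → Env → Prop := fun j e => ∀ i < j, e (m + 2 + 3 * i) = 0 with hP
    rw [runsOp, ← mulVec_mulVec]
    set φ := runsOp Γ N Ng m (runOracle Γ m p) j *ᵥ ψ
    -- Run `j` uses different output bits from the earlier runs, so the condition that those failed
    -- can be imposed before it.
    have h1 : projOp Γ (P (j + 1)) *ᵥ runOp Γ N Ng m (m + 1 + 3 * j) (m + 2 + 3 * j) (m + 3 + 3 * j)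
        (runOracle Γ m p j) *ᵥ φ = projOp Γ (fun e => e (m + 2 + 3 * j) = 0) *ᵥ
          runOp Γ N Ng m (m + 1 + 3 * j) (m + 2 + 3 * j) (m + 3 + 3 * j) (runOracle Γ m p j) *ᵥ
            projOp Γ (P j) *ᵥ φ := by
      have hc := ((S j hj).local_run (local_oracle (p := p))).commute_projOp (P := P j) fun e e' _ _ h => by
        refine forall₂_congr fun i hi => ?_
        rw [h]
        simp only [Set.mem_insert_iff, Set.mem_singleton_iff]
        lia
      have hc' := congrArg (fun A => A *ᵥ φ) hc
      simp only [← mulVec_mulVec] at hc'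
      rw [show runOracle Γ m p j = pushOp Γ (oracle m (m + 1 + 3 * j) (m + 2 + 3 * j) p) from rfl, hc']
      funext τ
      simp only [projOp_mulVec, hP, Nat.lt_succ_iff_lt_or_eq, or_imp, forall_and, forall_eq]
      split_ifs <;> tauto
    rw [h1]
    refine ((S j hj).run_failure hNg ((hz.mono fun x hx => ?_).projOp _) fun σ hσ => ?_).trans ?_
    · simp only [Set.mem_insert_iff, Set.mem_singleton_iff, Set.mem_ofPred_eq] at hx ⊢
      lia
    · rw [projOp_mulVec] at hσ
      exact hs σ fun h0 => hσ (by rw [h0, ite_self])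
    · rw [pow_succ', mul_assoc]
      exact mul_le_mul_of_nonneg_left ih' (Real.sqrt_nonneg _)

/-- The error is one-sided: without a solution no output bit is ever set, by `run_unsolvable` for
the new run and by locality for the old bits. -/
theorem RunVars.runs_unsolvable (S : RunVars Γ N Ng m R p)
    (hp : ∀ e e' : Env, (∀ x, x < m → e x = e' x) → ∀ v, p e v ↔ p e' v)
    {ψ : State Γ → ℂ} (hψ : ZeroOn {x | m ≤ x} ψ)
    (hQ : ∀ σ : State Γ, ψ σ ≠ 0 → ¬ ∃ v, v < (N : ℕ) ∧ p σ.1 v) {j : ℕ} (hj : j ≤ R) :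
    ZeroOn {x | ∃ i < j, x = m + 2 + 3 * i} (runsOp Γ N Ng m (runOracle Γ m p) j *ᵥ ψ) := by
  induction j with
  | zero => rintro τ - z ⟨i, hi, -⟩; omega
  | succ j ih =>
    have ih' := ih (by omega)
    have hz := S.runs_zeroOn hψ (j := j) (by omega)
    have hs := S.solvable_congr hp (j := j) (by omega)
      (P := fun P => ¬ ∃ v, v < (N : ℕ) ∧ P v) hQ
    rw [runsOp, ← mulVec_mulVec]
    set φ := runsOp Γ N Ng m (runOracle Γ m p) j *ᵥ ψ
    have h1 := (S j hj).run_unsolvable (ψ := φ) (hz.mono fun x hx => by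
      simp only [Set.mem_insert_iff, Set.mem_singleton_iff, Set.mem_ofPred_eq] at hx ⊢; lia) hs
    have h2 := ((S j hj).local_run (local_oracle (p := p))).zeroOn (Z := {x | ∃ i < j, x = m + 2 + 3 * i})
      (fun z hz => by
        simp only [Set.mem_insert_iff, Set.mem_singleton_iff, Set.mem_ofPred_eq] at hz ⊢
        obtain ⟨i, hi, rfl⟩ := hz
        lia) ih'
    rintro τ hτ z ⟨i, hi, rfl⟩
    rcases Nat.lt_succ_iff_lt_or_eq.1 hi with hi | rfl
    · exact h2 τ hτ _ ⟨i, hi, rfl⟩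
    · by_contra h0
      have := congrFun h1 τ
      rw [projOp_mulVec, if_pos h0] at this
      exact hτ this

theorem RunVars.hyb_runs (S : RunVars Γ N Ng m R p) {Z : Set Var} (hZ : ∀ z ∈ Z, z < m)
    {K : ℕ → Op Γ} {ε : ℝ} (hK : ∀ j < R, Hyb Γ Z (K j) (runOracle Γ m p j) ε) {j : ℕ} (hj : j ≤ R) :
    Hyb Γ Z (runsOp Γ N Ng m K j) (runsOp Γ N Ng m (runOracle Γ m p) j) (j * (Ng * ε)) := by
  induction j with
  | zero => exact (Hyb.one Γ Z).congr (by simp)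
  | succ j ih =>
    refine (((S j hj).hyb_run (fun z hz hz' => ?_) (hK j hj)).mul (ih (by omega))).congr
      (by push_cast; ring)
    have := hZ z hz
    simp only [Set.mem_insert_iff, Set.mem_singleton_iff] at hz'
    lia

/-! ## The disjunction of the results -/

theorem eval_orExpr (Δ : Ctx) (σ : Env) (n : ℕ) :
    (orExpr n).eval Δ σ = ind (∃ i < n, σ i = 1) := by
  have : ∀ l : List ℕ, (l.foldr (fun i E => Expr.bin .or (.var i) E) (.const 0 boolTy)).eval Δ σ =
      ind (∃ i ∈ l, σ i = 1) := by
    intro l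
    induction l with
    | nil => simp [Expr.eval, ind]
    | cons a l ih =>
      rw [List.foldr_cons, Expr.eval, ih]
      by_cases h1 : σ a = 1 <;> by_cases h2 : ∃ i ∈ l, σ i = 1 <;> simp [Expr.eval, ind, h1, h2]
  rw [orExpr, this]
  simp

theorem type_orExpr {Δ : Ctx} {n : ℕ} (h : ∀ i < n, Ctx.get Δ i = some boolTy) :
    (orExpr n).type Δ = some boolTy := by
  have : ∀ l : List ℕ, (∀ i ∈ l, Ctx.get Δ i = some boolTy) →
      (l.foldr (fun i E => Expr.bin .or (.var i) E) (.const 0 boolTy)).type Δ = some boolTy := by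
    intro l hl
    induction l with
    | nil => rfl
    | cons a l ih =>
      rw [List.foldr_cons, Expr.type, ih fun i hi => hl i (by simp [hi])]
      simp [Expr.type, hl]
  exact this _ (by simpa using h)

/-- The action of the gate that adds the disjunction of the results to `b`. -/
noncomputable def orMap (m R : ℕ) (b : Var) (e : Env) : Env :=
  Function.update e b ((e b + ind (∃ i < R, e (m + 2 + 3 * i) = 1)) % 2)

theorem get_zip_range {n : ℕ} {T : Ty} {i : ℕ} (hi : i < n) :
    Ctx.get ((List.range n).zip (List.replicate n T)) i = some T := by
  have h := Ctx.get_zip_of_map_get (Γ := (List.range n).map fun i => (i, T)) (xs := List.range n)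
    (Ts := List.replicate n T) ?_ (List.mem_range.2 hi)
  · rw [h]
    have : i ∈ Ctx.keys ((List.range n).map fun i => (i, T)) := by simpa [Ctx.keys] using hi
    obtain ⟨T', hT'⟩ := Ctx.exists_get this
    have h2 := mem_of_lookup hT'
    simp only [List.mem_map, Prod.mk.injEq] at h2
    obtain ⟨_, _, _, rfl⟩ := h2
    exact hT'
  · have h1 : Ctx.keys ((List.range n).map fun i => (i, T)) = List.range n := by
      rw [Ctx.keys, List.map_map]; exact List.map_id _
    have h2 : Ctx.tys ((List.range n).map fun i => (i, T)) = List.replicate n T := by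
      rw [Ctx.tys, List.map_map]
      exact List.map_const.trans (by rw [List.length_range])
    have h3 := Ctx.map_get_keys (Γ := (List.range n).map fun i => (i, T)) (by rw [h1]; exact List.nodup_range)
    rwa [h1, h2] at h3

theorem RunVars.map_get_ok (S : RunVars Γ N Ng m R p) :
    ((List.range R).map fun j => m + 2 + 3 * j).map (Ctx.get Γ) =
      (List.replicate R boolTy).map some := by
  rw [List.map_map, List.map_replicate]
  refine List.eq_replicate_iff.2 ⟨by simp, fun b hb => ?_⟩
  obtain ⟨j, hj, rfl⟩ := List.mem_map.1 hb
  exact (S j (List.mem_range.1 hj)).get_ok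

theorem nodup_ok_append {m R : ℕ} {b : Var} (hb : b < m) :
    ((List.range R).map (fun j => m + 2 + 3 * j) ++ [b]).Nodup := by
  refine List.Nodup.append (List.nodup_range.map fun i j h => by simpa using h) (by simp) ?_
  intro x hx hx'
  obtain ⟨j, _, rfl⟩ := List.mem_map.1 hx
  rw [List.mem_singleton] at hx'
  lia

theorem RunVars.sem_or (S : RunVars Γ N Ng m R p) (ρ : PName → Option (Σ Ω : Ctx, Op Ω)) {b : Var}
    (hb : b < m) (hg : Ctx.get Γ b = some boolTy) :
    UStmt.sem ρ Γ (.app ((List.range R).map (fun j => m + 2 + 3 * j) ++ [b])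
      (.embed (List.range R) (orExpr R))) = pushOp Γ (orMap m R b) := by
  rw [sem_app_embed ρ (nodup_ok_append hb) S.map_get_ok hg (by simp)]
  refine pushOp_congr fun e _ => ?_
  rw [eval_orExpr, orMap]
  have : ∀ i < R, Env.set 0 (List.range R) (((List.range R).map fun j => m + 2 + 3 * j).map e) i =
      e (m + 2 + 3 * i) := fun i hi => by
    rw [List.map_map]
    exact (Env.set_map 0 (e ∘ fun j => m + 2 + 3 * j) (List.range R) i).trans
      (if_pos (List.mem_range.2 hi))
  congr 4
  refine propext (exists_congr fun i => and_congr_right fun hi => ?_)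
  rw [this i hi]

theorem RunVars.wt_or (S : RunVars Γ N Ng m R p) {Q : ProcCtx} {b : Var} (hb : b < m)
    (hg : Ctx.get Γ b = some boolTy) :
    UStmt.WT Q Γ (.app ((List.range R).map (fun j => m + 2 + 3 * j) ++ [b])
      (.embed (List.range R) (orExpr R))) :=
  wt_app_embed (nodup_ok_append hb) S.map_get_ok hg (by simp) List.nodup_range
    (type_orExpr fun _ hi => get_zip_range hi)

theorem invol_orMap {b : Var} (hb : b < m) (hg : Ctx.get Γ b = some boolTy) :
    Invol Γ (orMap m R b) :=
  invol_flip hg fun e v => by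
    congr 1
    refine propext (exists_congr fun i => and_congr_right fun hi => ?_)
    rw [Function.update_of_ne (by lia)]

/-- After the ideal runs, the disjunction of the results is nearly always correct. -/
theorem RunVars.search_approx (S : RunVars Γ N Ng m R p) (hNg : (Ng : ℕ) = groverIters N) {b : Var}
    (hp : ∀ e e' : Env, (∀ x, x < m → x ≠ b → e x = e' x) → ∀ v, p e v ↔ p e' v)
    (hb : b < m) (hg : Ctx.get Γ b = some boolTy) :
    ApproxOp Γ {x | x = b ∨ m ≤ x}
      (projOp Γ (fun e => e b = 1) *
        (pushOp Γ (orMap m R b) * runsOp Γ N Ng m (runOracle Γ m p) R))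
      (projOp Γ (fun e => ∃ v, v < (N : ℕ) ∧ p e v) *
        (pushOp Γ (orMap m R b) * runsOp Γ N Ng m (runOracle Γ m p) R)) (√0.63 ^ R) := by
  classical
  intro ψ hψ
  have hp' : ∀ e e' : Env, (∀ x, x < m → e x = e' x) → ∀ v, p e v ↔ p e' v :=
    fun e e' h => hp e e' fun x hx _ => h x hx
  set Q : Env → Prop := fun e => ∃ v, v < (N : ℕ) ∧ p e v with hQdef
  have hQb : ∀ e v, Q (Function.update e b v) ↔ Q e := fun e v =>
    exists_congr fun v' => and_congr_right fun _ =>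
      hp _ _ (fun x _ hx => Function.update_of_ne hx _ _) v'
  set D := runsOp Γ N Ng m (runOracle Γ m p) R with hD
  have hl : Local Γ {x | m ≤ x} D := S.local_runs le_rfl
  have hQc : ∀ e e', (∀ x, x ∉ {x | m ≤ x} → e x = e' x) → (Q e ↔ Q e') := fun e e' h =>
    exists_congr fun v => and_congr_right fun _ => hp' e e' (fun x hx => h x (by simpa using hx)) v
  have hψm : ZeroOn {x | m ≤ x} ψ := hψ.mono fun x hx => Or.inr hx
  have hDb : ZeroOn {x | x = b} (D *ᵥ ψ) :=
    hl.zeroOn (fun z hz => by rw [Set.mem_ofPred_eq] at hz; simpa [hz] using hb)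
      (hψ.mono fun x hx => Or.inl hx)
  -- The runs commute with projections onto solvable or unsolvable inputs, so a coefficient at such
  -- a state only sees the part of `ψ` of the same kind.
  have hsplit : ∀ P : Env → Prop, (∀ e e', (∀ x, x ∉ {x | m ≤ x} → e x = e' x) → (P e ↔ P e')) →
      ∀ τ : State Γ, P τ.1 → (D *ᵥ ψ) τ = (D *ᵥ projOp Γ P *ᵥ ψ) τ := by
    intro P hP τ hτ
    have := congrFun (congrArg (fun A => A *ᵥ ψ) (hl.commute_projOp (P := P)
      fun e e' _ _ h => hP e e' h)) τ
    simp only [← mulVec_mulVec] at this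
    rw [this, projOp_mulVec, if_pos hτ]
  have hfail := S.runs_failure hNg hp' (hψm.projOp Q) (fun σ hσ => by
    rw [projOp_mulVec] at hσ
    by_contra h0
    exact hσ (if_neg h0)) (le_refl R)
  have huns := S.runs_unsolvable hp' (hψm.projOp fun e => ¬ Q e) (fun σ hσ => by
    rw [projOp_mulVec] at hσ
    by_contra h0
    exact hσ (if_neg (not_not.2 h0))) (le_refl R)
  have hfail' : vn (projOp Γ (fun e => ∀ i < R, e (m + 2 + 3 * i) = 0) *ᵥ D *ᵥ projOp Γ Q *ᵥ ψ) ≤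
      √0.63 ^ R * vn ψ :=
    hfail.trans (mul_le_mul_of_nonneg_left (vn_projOp_le _ _) (pow_nonneg (Real.sqrt_nonneg _) _))
  -- Coefficientwise, the two projections differ only where the input is solvable and every run
  -- failed. The result is bounded by that failing part, permuted by the disjunction gate.
  refine le_trans (vn_mono fun τ => ?_) ((vn_unitary (invol_orMap (R := R) hb hg).unitary _).trans_le
    hfail')
  have hP : ∀ P : Env → Prop, ((projOp Γ P * (pushOp Γ (orMap m R b) * D)) *ᵥ ψ) τ =
      if P τ.1 then (D *ᵥ ψ) (State.ofEnv Γ (orMap m R b τ.1)) else 0 := fun P => by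
    rw [← mulVec_mulVec, ← mulVec_mulVec, projOp_mulVec, (invol_orMap hb hg).mulVec]
  rw [Pi.sub_apply, hP, hP, (invol_orMap hb hg).mulVec]
  have hτ' : Valid Γ (orMap m R b τ.1) := (invol_orMap hb hg).pres _ τ.2
  have hQτ : Q (orMap m R b τ.1) ↔ Q τ.1 := hQb _ _
  have hok : ∀ i, orMap m R b τ.1 (m + 2 + 3 * i) = τ.1 (m + 2 + 3 * i) := fun i =>
    Function.update_of_ne (by lia) _ _
  set τ' : State Γ := State.ofEnv Γ (orMap m R b τ.1) with hτ'def
  have hv : τ'.1 = orMap m R b τ.1 := State.ofEnv_val hτ'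
  by_cases h0 : (D *ᵥ ψ) τ' = 0
  · rw [h0, ite_self, ite_self, sub_zero, norm_zero]
    exact norm_nonneg _
  have hb0 : (τ.1 b + ind (∃ i < R, τ.1 (m + 2 + 3 * i) = 1)) % 2 = 0 := by
    have := hDb τ' h0 b rfl
    rwa [hv, orMap, Function.update_self] at this
  have hb2 := τ.valid.lt_two hg
  by_cases hO : ∃ i < R, τ.1 (m + 2 + 3 * i) = 1
  · rw [ind_of hO] at hb0
    by_cases hQ' : Q τ.1
    · rw [if_pos (by omega), if_pos hQ', sub_self, norm_zero]
      exact norm_nonneg _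
    -- A set bit on an unsolvable input would contradict `runs_unsolvable`.
    · exfalso
      rw [hsplit (fun e => ¬ Q e) (fun e e' h => not_congr (hQc e e' h)) τ' (by rwa [hv, hQτ])] at h0
      obtain ⟨i, hi, h1⟩ := hO
      have := huns τ' h0 _ ⟨i, hi, rfl⟩
      rw [hv, hok, h1] at this
      exact one_ne_zero this
  · rw [ind_not hO] at hb0
    rw [if_neg (by omega)]
    by_cases hQ' : Q τ.1
    · rw [if_pos hQ', projOp_mulVec, if_pos, zero_sub, norm_neg,
        hsplit Q hQc τ' (by rwa [hv, hQτ])]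
      intro i hi
      have h1 := τ'.valid.lt_two (S i hi).get_ok
      have h2 : τ'.1 (m + 2 + 3 * i) ≠ 1 := fun h => hO ⟨i, hi, by rwa [hv, hok] at h⟩
      omega
    · rw [if_neg hQ', sub_zero, norm_zero]
      exact norm_nonneg _

end Runs

/-! ## Matching registers -/

theorem Match.zip_inj_left {Γ Ω : Ctx} {qs : List Var} (h : Match Γ qs Ω) {a b x : Var}
    (ha : (a, x) ∈ qs.zip (Ctx.keys Ω)) (hb : (b, x) ∈ qs.zip (Ctx.keys Ω)) : a = b := by
  have h1 := h.pull_of_zip (fun y => if y = a then 1 else 0) ha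
  rw [h.pull_of_zip _ hb] at h1
  by_contra hne
  simp [Ne.symm hne] at h1

theorem Match.zip_inj_right {Γ Ω : Ctx} {qs : List Var} (h : Match Γ qs Ω) {a x y : Var}
    (hx : (a, x) ∈ qs.zip (Ctx.keys Ω)) (hy : (a, y) ∈ qs.zip (Ctx.keys Ω)) : x = y := by
  have h1 := h.put_of_zip 0 (fun z => if z = x then 1 else 0) hx
  rw [h.put_of_zip _ _ hy] at h1
  by_contra hne
  simp [Ne.symm hne] at h1

theorem Match.put_update {Γ Ω : Ctx} {qs : List Var} (h : Match Γ qs Ω) (σ e : Env) {a x : Var}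
    (ha : (a, x) ∈ qs.zip (Ctx.keys Ω)) (v : ℕ) :
    put qs Ω σ (Function.update e x v) = Function.update (put qs Ω σ e) a v := by
  funext y
  by_cases hy : y ∈ qs
  · obtain ⟨z, hz⟩ := h.exists_zip_left hy
    rw [h.put_of_zip _ _ hz]
    by_cases hyz : y = a
    · subst hyz
      rw [h.zip_inj_right hz ha, Function.update_self, Function.update_self]
    · rw [Function.update_of_ne hyz, Function.update_of_ne (fun h' => hyz ?_), h.put_of_zip _ _ hz]
      subst h'
      exact h.zip_inj_left hz ha
  · rw [put_of_not_mem _ _ hy, Function.update_of_ne, put_of_not_mem _ _ hy]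
    rintro rfl
    exact hy (List.of_mem_zip ha).1

theorem zip_frame {α : Type*} (a b x y z w : α) (l l' : List α) :
    ([a] ++ l ++ [x] ++ l' ++ [z]).zip ([b] ++ l ++ [y] ++ l' ++ [w]) =
      [(a, b)] ++ l.zip l ++ [(x, y)] ++ l'.zip l' ++ [(z, w)] := by
  rw [List.zip_append (by simp), List.zip_append (by simp), List.zip_append (by simp),
    List.zip_append (by simp)]
  rfl

theorem Ctx.get_of_mem {Γ : Ctx} (hn : (Ctx.keys Γ).Nodup) {x : Var} {T : Ty} (h : (x, T) ∈ Γ) :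
    Ctx.get Γ x = some T := by
  induction Γ with
  | nil => simp at h
  | cons p Γ ih =>
    rw [Ctx.keys_cons, List.nodup_cons] at hn
    rw [Ctx.get_cons]
    rcases List.mem_cons.1 h with rfl | h
    · rw [if_pos rfl]
    · rw [if_neg, ih hn.2 h]
      rintro rfl
      exact hn.1 (List.mem_map.2 ⟨_, h, rfl⟩)

theorem Ctx.sub_of_subset {Γ Δ : Ctx} (hn : (Ctx.keys Γ).Nodup) (h : ∀ p ∈ Δ, p ∈ Γ) : Ctx.Sub Δ Γ :=
  fun _ _ hx => Ctx.get_of_mem hn (h _ (mem_of_lookup hx))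

/-- Names outside of the context are zero in every state, so demanding zeros there is no
restriction. -/
theorem ApproxOp.inter_keys {Γ : Ctx} {Z : Set Var} {A B : Op Γ} {ε : ℝ} (h : ApproxOp Γ Z A B ε) :
    ApproxOp Γ {x | x ∈ Z ∧ x ∈ Ctx.keys Γ} A B ε := fun ψ hψ => h ψ fun σ hσ z hz => by
  by_cases hz' : z ∈ Ctx.keys Γ
  · exact hψ σ hσ z ⟨hz, hz'⟩
  · exact σ.valid.eq_zero hz'

/-! ## Procedure contexts with sound declarations -/

/-- Well-typed procedure contexts in which all declared procedures are unitary. -/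
structure Good (V : UInterp) (Q : ProcCtx) : Prop where
  wt : ProcCtx.WT Q
  decl : ∀ g Ω t, (g, UProc.decl Ω t) ∈ Q → V g Ω ∈ unitaryGroup (State Ω) ℂ

theorem Good.sound {V : UInterp} {Q : ProcCtx} (h : Good V Q) : Sound (ProcCtx.sem V Q) Q :=
  ProcCtx.sound h.wt h.decl

theorem Good.cons {V : UInterp} {Q : ProcCtx} (h : Good V Q) (g : PName) {Ω : Ctx} {W : UStmt}
    (hn : (Ctx.keys Ω).Nodup) (hW : W.WT Q Ω) : Good V ((g, .defn Ω W) :: Q) where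
  wt := ⟨hn, hW, h.wt⟩
  decl g' Ω' t hm := by
    rcases List.mem_cons.1 hm with h' | h'
    · simp at h'
    · exact h.decl _ _ _ h'

/-! ## The search registers -/

/-- The registers of `R` runs, named from `m` on. -/
def runRegs (N Ng : Ty) (m : Var) (R : ℕ) : Ctx :=
  (List.range R).flatMap fun j => [(m + 3 * j, N), (m + 1 + 3 * j, boolTy), (m + 2 + 3 * j, Ng)]

theorem keys_runRegs (N Ng : Ty) (m : Var) (R : ℕ) :
    Ctx.keys (runRegs N Ng m R) = List.range' m (3 * R) := by
  induction R with
  | zero => rfl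
  | succ R ih =>
    have : runRegs N Ng m (R + 1) = runRegs N Ng m R ++
        [(m + 3 * R, N), (m + 1 + 3 * R, boolTy), (m + 2 + 3 * R, Ng)] := by
      simp [runRegs, List.range_succ]
    rw [this, Ctx.keys_append, ih, Nat.mul_succ, ← List.range'_append_1]
    congr 1
    simp only [Ctx.keys, List.map_cons, List.map_nil, List.range'_succ, List.range'_zero]
    congr 2 <;> [skip; congr 1] <;> lia

theorem mem_keys_runRegs {N Ng : Ty} {m : Var} {R : ℕ} {x : Var} :
    x ∈ Ctx.keys (runRegs N Ng m R) ↔ m ≤ x ∧ x < m + 3 * R := by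
  rw [keys_runRegs, List.mem_range'_1]

theorem mem_runRegs {N Ng : Ty} {m : Var} {R j : ℕ} (hj : j < R) :
    (m + 3 * j, N) ∈ runRegs N Ng m R ∧ (m + 1 + 3 * j, boolTy) ∈ runRegs N Ng m R ∧
      (m + 2 + 3 * j, Ng) ∈ runRegs N Ng m R := by
  refine ⟨?_, ?_, ?_⟩ <;> exact List.mem_flatMap.2 ⟨j, List.mem_range.2 hj, by simp⟩

/-! ## The predicate in the search -/

/-- The predicate that the search evaluates. -/
def searchPred (s : List ℕ → List ℕ) (ins : List Var) (e : Env) (v : ℕ) : Prop :=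
  s (ins.map e ++ [v]) = [1]

theorem searchPred_congr {s : List ℕ → List ℕ} {ins : List Var} {e e' : Env}
    (h : ∀ x ∈ ins, e x = e' x) (v : ℕ) : searchPred s ins e v ↔ searchPred s ins e' v := by
  rw [searchPred, searchPred, List.map_congr_left h]

/-- Substituting `c` for the control, `xs` for the last input and `ok` for the target, and keeping
`ins` and `rest`, turns the ideal `CtrlClean` into the oracle of the search. `Match.at_approx`
carries the error over. -/
theorem hyb_oracle {Γ Ω ins rest : Ctx} {N Ng : Ty} {y q c xs ok n : Var} {s : List ℕ → List ℕ}
    {M : Op Ω} {ε : ℝ} (hε : 0 ≤ ε)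
    (S : SearchVars Γ N Ng c xs ok n (searchPred s (Ctx.keys ins)))
    (hΩ : Ω = (q, boolTy) :: (ins ++ [(y, N)] ++ rest ++ [(q + 1, boolTy)]))
    (hn : (Ctx.keys Ω).Nodup) (hsub : Ctx.Sub (ins ++ rest) Γ)
    (hc : ∀ x ∈ [c, xs, ok], x ∉ Ctx.keys (ins ++ rest))
    (hI : Invol Ω (CFun.Spec.ctrlMap s (Ctx.keys (ins ++ [(y, N)])) q (q + 1)))
    (hM : Hyb Ω {x | x ∈ Ctx.keys rest} M
      (pushOp Ω (CFun.Spec.ctrlMap s (Ctx.keys (ins ++ [(y, N)])) q (q + 1))) ε) :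
    Match Γ ([c] ++ Ctx.keys ins ++ [xs] ++ Ctx.keys rest ++ [ok]) Ω ∧
    Hyb Γ {x | x ∈ Ctx.keys rest}
      (Op.at Γ ([c] ++ Ctx.keys ins ++ [xs] ++ Ctx.keys rest ++ [ok]) Ω M)
      (pushOp Γ (oracle c xs ok (searchPred s (Ctx.keys ins)))) ε := by
  obtain ⟨hcx, hco, hcn, hxo, hxn, hon⟩ := S.ne
  have hkeys : Ctx.keys Ω = [q] ++ Ctx.keys ins ++ [y] ++ Ctx.keys rest ++ [q + 1] := by
    rw [hΩ, Ctx.keys_cons, Ctx.keys_append, Ctx.keys_append, Ctx.keys_append]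
    simp [Ctx.keys]
  have htys : Ctx.tys Ω = [boolTy] ++ Ctx.tys ins ++ [N] ++ Ctx.tys rest ++ [boolTy] := by
    rw [hΩ, Ctx.tys_cons, Ctx.tys_append, Ctx.tys_append, Ctx.tys_append]
    simp [Ctx.tys]
  have hnir : (Ctx.keys ins ++ Ctx.keys rest).Nodup := by
    have h1 : (Ctx.keys ins ++ Ctx.keys rest).Sublist (Ctx.keys Ω) := by
      rw [hkeys]
      simp only [List.append_assoc, List.singleton_append]
      refine (List.Sublist.append_left ?_ _).cons _
      exact (List.sublist_append_left _ _).cons _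
    exact hn.sublist h1
  simp only [Ctx.keys_append, List.mem_append, List.mem_cons, List.not_mem_nil, or_false,
    forall_eq_or_imp, forall_eq, not_or] at hc
  obtain ⟨⟨hc1, hc2⟩, ⟨hx1, hx2⟩, ho1, ho2⟩ := hc
  have hgi : (Ctx.keys ins).map (Ctx.get Γ) = (Ctx.tys ins).map some :=
    ((Ctx.sub_append_left _ _).trans hsub).map_keys hnir.of_append_left
  have hgr : (Ctx.keys rest).map (Ctx.get Γ) = (Ctx.tys rest).map some :=
    ((Ctx.sub_append_right fun x hx hx' => (List.nodup_append'.1 hnir).2.2 hx' hx).trans hsub).map_keys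
      hnir.of_append_right
  have hm : Match Γ ([c] ++ Ctx.keys ins ++ [xs] ++ Ctx.keys rest ++ [ok]) Ω := by
    refine ⟨?_, hn, ?_⟩
    · have hd := (List.nodup_append'.1 hnir).2.2
      have hii := hnir.of_append_left
      have hrr := hnir.of_append_right
      rw [List.disjoint_iff_ne] at hd
      simp only [List.nodup_append, List.nodup_cons, List.mem_append, List.mem_singleton,
        List.not_mem_nil, not_false_iff, List.nodup_nil, and_true, true_and]
      refine ⟨⟨⟨⟨hii, ?_⟩, ?_⟩, hrr, ?_⟩, ?_⟩ <;> grind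
    · rw [htys]
      simp only [List.map_append, List.map_singleton, hgi, hgr, S.get_c, S.get_xs, S.get_ok]
  have hzip := zip_frame c q xs y ok (q + 1) (Ctx.keys ins) (Ctx.keys rest)
  rw [← hkeys] at hzip
  have hzc : (c, q) ∈ ([c] ++ Ctx.keys ins ++ [xs] ++ Ctx.keys rest ++ [ok]).zip (Ctx.keys Ω) := by
    rw [hzip]; simp
  have hzx : (xs, y) ∈ ([c] ++ Ctx.keys ins ++ [xs] ++ Ctx.keys rest ++ [ok]).zip (Ctx.keys Ω) := by
    rw [hzip]; simp
  have hzo : (ok, q + 1) ∈ ([c] ++ Ctx.keys ins ++ [xs] ++ Ctx.keys rest ++ [ok]).zip (Ctx.keys Ω) := by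
    rw [hzip]; simp
  have hzi : ∀ x ∈ Ctx.keys ins,
      (x, x) ∈ ([c] ++ Ctx.keys ins ++ [xs] ++ Ctx.keys rest ++ [ok]).zip (Ctx.keys Ω) := fun x hx => by
    rw [hzip]; simp [mem_zip_self hx]
  have hzr : ∀ x ∈ Ctx.keys rest,
      (x, x) ∈ ([c] ++ Ctx.keys ins ++ [xs] ++ Ctx.keys rest ++ [ok]).zip (Ctx.keys Ω) := fun x hx => by
    rw [hzip]; simp [mem_zip_self hx]
  refine ⟨hm, hm.at_unitary hM.left, S.invol_oracle.unitary, fun ψ hψ => ?_, ?_⟩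
  · refine hψ.pushOp fun e _ he z hz => ?_
    rw [oracle, Function.update_of_ne (by rintro rfl; exact ho2 hz)]
    exact he z hz
  · have h1 := hm.at_approx hε hM.approx (Z' := {x | x ∈ Ctx.keys rest}) fun z hz => ⟨z, hz, hzr z hz⟩
    rw [hm.at_pushOp hI.pres] at h1
    refine h1.congr_right fun e _ _ => ?_
    rw [CFun.Spec.ctrlMap, hm.put_update e _ hzo, hm.put_pull, hm.pull_of_zip e hzo, hm.pull_of_zip e hzc, oracle,
      searchPred, Ctx.keys_append, List.map_append,
      List.map_congr_left fun x hx => hm.pull_of_zip e (hzi x hx)]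
    rw [show (Ctx.keys [(y, N)]).map (pull ([c] ++ Ctx.keys ins ++ [xs] ++ Ctx.keys rest ++ [ok]) Ω e) =
      [e xs] from by rw [← hm.pull_of_zip e hzx]; rfl]

/-! ## Reading off the result -/

/-- Commuting with a permutation of the basis means that the entries are invariant under permuting
rows and columns simultaneously. The condition is needed only where `U` has nonzero entries, which
allows `t` to depend on variables that `U` acts on but does not change. -/
theorem Op.at_commute_push {Γ Ω : Ctx} {qs : List Var} {U : Op Ω}
    {t : Env → Env} (ht : Invol Γ t) (hp : ∀ e, Valid Γ e → pull qs Ω (t e) = pull qs Ω e)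
    (hl : ∀ e e', Valid Γ e → Valid Γ e' →
      U (State.ofEnv Ω (pull qs Ω e)) (State.ofEnv Ω (pull qs Ω e')) ≠ 0 →
      ((∀ x, x ∉ qs → t e x = t e' x) ↔ ∀ x, x ∉ qs → e x = e' x)) :
    Op.at Γ qs Ω U * pushOp Γ t = pushOp Γ t * Op.at Γ qs Ω U := by
  classical
  have hentry : ∀ τ σ : State Γ, Op.at Γ qs Ω U (State.ofEnv Γ (t τ.1)) (State.ofEnv Γ (t σ.1)) =
      Op.at Γ qs Ω U τ σ := by
    intro τ σ
    have h1 := State.ofEnv_val (ht.pres _ τ.2)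
    have h2 := State.ofEnv_val (ht.pres _ σ.2)
    have h3 := hp _ τ.2
    have h4 := hp _ σ.2
    simp only [pull] at h3 h4
    simp only [Op.at, Matrix.of_apply]
    rw [h1, h2, h3, h4]
    by_cases h0 : U (State.ofEnv Ω (pull qs Ω τ.1)) (State.ofEnv Ω (pull qs Ω σ.1)) = 0
    · simp only [pull] at h0
      rw [h0, ite_self, ite_self]
    · exact if_congr (hl _ _ τ.2 σ.2 h0) rfl rfl
  have hinv : ∀ τ : State Γ, State.ofEnv Γ (t (State.ofEnv Γ (t τ.1)).1) = τ := fun τ => by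
    rw [State.ofEnv_val (ht.pres _ τ.2), ht.invol _ τ.2, State.ofEnv_self]
  refine Op.ext_mulVec fun ψ τ => ?_
  rw [← mulVec_mulVec, ← mulVec_mulVec, ht.mulVec]
  simp only [mulVec, dotProduct]
  rw [← Equiv.sum_comp (Function.Involutive.toPerm (fun σ : State Γ => State.ofEnv Γ (t σ.1)) hinv)]
  refine Finset.sum_congr rfl fun σ _ => ?_
  have h1 := ht.mulVec ψ (State.ofEnv Γ (t σ.1))
  simp only [mulVec, dotProduct] at h1
  refine (congrArg (Op.at Γ qs Ω U τ (State.ofEnv Γ (t σ.1)) * ·) h1).trans ?_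
  rw [hinv, ← hentry τ, hinv]

/-- A conditional flip is `X P + (1 - P)`, so the two flips differ by `(1 - X)(P' - P)`. The factor
`2` bounds the norm of `1 - X`. -/
theorem vn_flip_sub_le {Γ : Ctx} {b : Var} (hb : Ctx.get Γ b = some boolTy) {P P' : Env → Prop}
    (hP : ∀ e v, P (Function.update e b v) ↔ P e) (hP' : ∀ e v, P' (Function.update e b v) ↔ P' e)
    (φ : State Γ → ℂ) :
    vn (pushOp Γ (fun e => Function.update e b ((e b + ind (P e)) % 2)) *ᵥ φ -
      pushOp Γ (fun e => Function.update e b ((e b + ind (P' e)) % 2)) *ᵥ φ) ≤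
      2 * vn (projOp Γ P' *ᵥ φ - projOp Γ P *ᵥ φ) := by
  set Δ := projOp Γ P' *ᵥ φ - projOp Γ P *ᵥ φ with hΔ
  have hX := invol_not hb
  have hI : ∀ {P : Env → Prop}, (∀ e v, P (Function.update e b v) ↔ P e) →
      Invol Γ fun e => Function.update e b ((e b + ind (P e)) % 2) := fun h =>
    invol_flip hb fun e v => by rw [show _ = _ from propext (h e v)]
  have hval : ∀ {P : Env → Prop} (h : ∀ e v, P (Function.update e b v) ↔ P e) (τ : State Γ),
      (pushOp Γ (fun e => Function.update e b ((e b + ind (P e)) % 2)) *ᵥ φ) τ =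
        (pushOp Γ (fun e => Function.update e b (1 - e b)) *ᵥ projOp Γ P *ᵥ φ) τ +
          (φ τ - (projOp Γ P *ᵥ φ) τ) := by
    intro P h τ
    have h2 := τ.valid.lt_two hb
    rw [(hI h).mulVec, hX.mulVec, projOp_mulVec, projOp_mulVec, State.ofEnv_val (hX.pres _ τ.2)]
    by_cases hp : P τ.1
    · rw [if_pos ((h _ _).2 hp), if_pos hp, ind_of hp, sub_self, add_zero,
        show (τ.1 b + 1) % 2 = 1 - τ.1 b by omega]
    · rw [if_neg (fun h' => hp ((h _ _).1 h')), if_neg hp, ind_not hp, sub_zero, zero_add, add_zero,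
        Nat.mod_eq_of_lt h2, Function.update_eq_self, State.ofEnv_self]
  have heq : pushOp Γ (fun e => Function.update e b ((e b + ind (P e)) % 2)) *ᵥ φ -
      pushOp Γ (fun e => Function.update e b ((e b + ind (P' e)) % 2)) *ᵥ φ =
      Δ - pushOp Γ (fun e => Function.update e b (1 - e b)) *ᵥ Δ := by
    funext τ
    rw [Pi.sub_apply, hval hP, hval hP', hΔ, mulVec_sub]
    simp only [Pi.sub_apply]
    ring
  rw [heq]
  refine (vn_sub_le _ _).trans ?_
  rw [vn_unitary hX.unitary]
  linarith

/-- The number of runs suffices for the error. -/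
theorem sqrt_pow_groverRuns_le {δ : ℝ} (h0 : 0 < δ) :
    √0.63 ^ groverRuns δ ≤ δ / 2 := by
  have h1 : Real.log (1 - 0.37) < 0 := Real.log_neg (by norm_num) (by norm_num)
  have h2 : Real.log (δ ^ 2 / 4) / Real.log (1 - 0.37) ≤ groverRuns δ := Nat.le_ceil _
  rw [div_le_iff_of_neg h1] at h2
  have h3 : (0.63 : ℝ) ^ groverRuns δ ≤ δ ^ 2 / 4 := by
    rw [← Real.log_le_log_iff (by positivity) (by positivity), Real.log_pow]
    norm_num at h2 ⊢
    exact h2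
  refine le_of_sq_le_sq ?_ (by positivity)
  rw [← pow_mul, mul_comm, pow_mul, Real.sq_sqrt (by norm_num)]
  linarith [h3]

theorem groverRuns_pos {δ : ℝ} (h0 : 0 < δ) (h1 : δ ≤ 1) : 0 < groverRuns δ := by
  refine Nat.ceil_pos.2 (div_pos_of_neg_of_neg (Real.log_neg (by positivity) (by nlinarith))
    (Real.log_neg (by norm_num) (by norm_num)))

section Runs

variable {Γ : Ctx} {N Ng : Ty} {m : Var} {R : ℕ} {p : Env → ℕ → Prop}

theorem RunVars.sem_runs (S : RunVars Γ N Ng m R p) (ρ : PName → Option (Σ Ω : Ctx, Op Ω)) (cg : PName)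
    (ins rest : List Var) (hNg : Ng = (groverIters N).toPNat') {j : ℕ} (hj : j ≤ R) :
    UStmt.sem ρ Γ (.seqs ((List.range j).map fun j =>
      searchRun cg ins rest N m (m + 1 + 3 * j) (m + 2 + 3 * j) (m + 3 + 3 * j))) =
    runsOp Γ N Ng m (fun j => UStmt.sem ρ Γ
      (.call cg ([m] ++ ins ++ [m + 1 + 3 * j] ++ rest ++ [m + 2 + 3 * j]))) j := by
  induction j with
  | zero => rfl
  | succ j ih =>
    rw [List.range_succ, List.map_append, sem_seqs_append, ih (by omega), List.map_singleton,
      sem_seqs_cons, sem_seqs_nil, Matrix.one_mul, (S j hj).sem_run ρ cg ins rest hNg, runsOp]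

theorem RunVars.wt_runs (S : RunVars Γ N Ng m R p) {Q : ProcCtx} {cg : PName}
    {ins rest : List Var} (hNg : Ng = (groverIters N).toPNat')
    (hcg : ∀ j < R, UStmt.WT Q Γ (.call cg ([m] ++ ins ++ [m + 1 + 3 * j] ++ rest ++ [m + 2 + 3 * j]))) :
    UStmt.WT Q Γ (.seqs ((List.range R).map fun j =>
      searchRun cg ins rest N m (m + 1 + 3 * j) (m + 2 + 3 * j) (m + 3 + 3 * j))) := by
  refine wt_seqs fun W hW => ?_
  obtain ⟨j, hj, rfl⟩ := List.mem_map.1 hW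
  have hj' := List.mem_range.1 hj
  exact (S j hj').wt_run hNg (hcg j hj')

end Runs

/-- The compute-copy-uncompute pattern around an operator that computes the predicate `P` to `a`,
approximately. -/
theorem search_clean {Γ Δ : Ctx} {a b : Var} {D D' : Op Δ} {V : Set Var} {P : Env → Prop} {η ε : ℝ}
    (hη : 0 ≤ η) (hε : 0 ≤ ε) (hsub : Ctx.Sub Δ Γ) (hn : (Ctx.keys Δ).Nodup)
    (hb : Ctx.get Γ b = some boolTy) (hbΔ : b ∉ Ctx.keys Δ) (ha : Ctx.get Γ a = some boolTy)
    (haΔ : a ∈ Ctx.keys Δ) {Z Z' : Set Var} (hD : Hyb Δ Z D D' η)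
    (hT : ApproxOp Δ Z' (projOp Δ (fun e => e a = 1) * D') (projOp Δ P * D') ε)
    (hZ : ∀ z ∈ Z, z ∈ Ctx.keys Δ) (hZ' : ∀ z ∈ Z', z ∈ Ctx.keys Δ)
    (hl : Local Δ V D') (hP : ∀ e e' : Env, (∀ x ∈ Ctx.keys Δ, x ∉ V → e x = e' x) → (P e ↔ P e'))  :
    ApproxOp Γ (Z ∪ Z') ((Op.at Γ (Ctx.keys Δ) Δ D)ᴴ *
        (pushOp Γ (fun e => Function.update e b ((e b + e a) % 2)) * Op.at Γ (Ctx.keys Δ) Δ D))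
      (pushOp Γ fun e => Function.update e b ((e b + ind (P e)) % 2)) (2 * (η + ε)) := by
  have hm : Match Γ (Ctx.keys Δ) Δ := Match.keys hsub hn
  have hab : a ≠ b := by rintro rfl; exact hbΔ haΔ
  have hPb : ∀ e v, P (Function.update e b v) ↔ P e := fun e v =>
    hP _ _ fun x hx _ => Function.update_of_ne (by rintro rfl; exact hbΔ hx) _ _
  have hpullP : ∀ e, P (pull (Ctx.keys Δ) Δ e) ↔ P e := fun e =>
    hP _ _ fun x hx _ => by rw [pull_keys, if_pos hx]
  have hC : Invol Γ fun e => Function.update e b ((e b + e a) % 2) :=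
    invol_flip hb fun e v => Function.update_of_ne hab _ _
  have hE : Invol Γ fun e => Function.update e b ((e b + ind (P e)) % 2) :=
    invol_flip hb fun e v => by rw [show _ = _ from propext (hPb e v)]
  have hCa : pushOp Γ (fun e => Function.update e b ((e b + e a) % 2)) =
      pushOp Γ (fun e => Function.update e b ((e b + ind (e a = 1)) % 2)) :=
    pushOp_congr fun e he => by
      have := he.lt_two ha
      by_cases h1 : e a = 1
      · rw [ind_of h1, h1]
      · rw [ind_not h1, show e a = 0 by omega]
  have hA := hm.at_unitary hD.left
  have happ : ApproxOp Γ Z (Op.at Γ (Ctx.keys Δ) Δ D) (Op.at Γ (Ctx.keys Δ) Δ D') η :=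
    hm.at_approx hη hD.approx fun z hz => ⟨z, hz, mem_zip_self (hZ z hz)⟩
  have hT' := hm.at_approx hε hT fun z hz => ⟨z, hz, mem_zip_self (hZ' z hz)⟩
  rw [hm.at_mul, hm.at_mul, hm.at_projOp, hm.at_projOp] at hT'
  -- The ideal search changes neither `b` nor any variable that `P` depends on, so the ideal output
  -- can be written before or after it.
  have hcomm := Op.at_commute_push (qs := Ctx.keys Δ) (U := D') hE
    (fun e _ => by
      funext x
      rw [pull_keys, pull_keys]
      split_ifs with hx
      · rw [Function.update_of_ne (by rintro rfl; exact hbΔ hx)]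
      · rfl) (fun e e' he he' h0 => by
    have h1 := hl _ _ h0
    rw [State.ofEnv_val (hm.valid_pull he), State.ofEnv_val (hm.valid_pull he')] at h1
    have h2 : P e ↔ P e' := hP _ _ fun x hx hxV => by
      have := h1 x hxV
      rwa [pull_keys, pull_keys, if_pos hx, if_pos hx] at this
    have h3 := he.lt_two hb
    have h4 := he'.lt_two hb
    refine forall₂_congr fun x hx => ?_
    by_cases hxb : x = b
    · subst hxb
      rw [Function.update_self, Function.update_self, show P e = P e' from propext h2]
      omega
    · rw [Function.update_of_ne hxb, Function.update_of_ne hxb])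
  intro ψ hψ
  have hψ1 : ZeroOn Z ψ := hψ.mono Set.subset_union_left
  have hψ2 : ZeroOn Z' ψ := hψ.mono Set.subset_union_right
  have hEψ : ZeroOn Z (pushOp Γ (fun e => Function.update e b ((e b + ind (P e)) % 2)) *ᵥ ψ) :=
    hψ1.pushOp fun e _ he z hz => by
      rw [Function.update_of_ne (by rintro rfl; exact hbΔ (hZ _ hz))]
      exact he z hz
  have hnE := vn_unitary hE.unitary ψ
  -- Replacing `D` by `D'` costs `η` on the initial vector and again on the ideal result. Reading
  -- the computed bit in place of `P` costs `2ε`.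
  refine (vn_conj_le hA hC.unitary (Op.at Γ (Ctx.keys Δ) Δ D') ψ _ (happ ψ hψ1)
    (ε₂ := η * vn ψ + 2 * (ε * vn ψ)) ?_).trans (by linarith)
  refine (vn_sub_le_sub_add_sub _ (Op.at Γ (Ctx.keys Δ) Δ D' *ᵥ
    pushOp Γ (fun e => Function.update e b ((e b + ind (P e)) % 2)) *ᵥ ψ) _).trans
      (add_le_add ((happ _ hEψ).trans_eq (by rw [hnE])) ?_)
  rw [mulVec_mulVec, hcomm, ← mulVec_mulVec, hCa]
  refine (vn_flip_sub_le hb hPb (fun e v => by rw [Function.update_of_ne hab]) _).trans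
    (mul_le_mul_of_nonneg_left ?_ (by norm_num))
  have h5 := hT' ψ hψ2
  rw [← mulVec_mulVec, ← mulVec_mulVec] at h5
  refine le_trans (le_of_eq ?_) h5
  congr 2
  · congr 2
    funext e
    rw [pull_keys, if_pos haΔ]
  · congr 2
    funext e
    exact (propext (hpullP e)).symm

theorem toPNat'_groverIters (N : Ty) : ((groverIters N).toPNat' : ℕ) = groverIters N := by
  have : 0 < groverIters N := groverIters_pos N.pos
  rw [Nat.toPNat'_coe, if_pos this]

/-- The context of the registers of the search, after the inputs. -/
noncomputable def anyAux (c : CFun) (N : Ty) (δ : ℝ) : Ctx :=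
  let k := Ctx.fresh (c.ins ++ c.rest)
  c.rest ++ runRegs N (groverIters N).toPNat' (k + 3) (groverRuns δ) ++ [(k + 2, boolTy)]

/-- The specification of the search procedure. -/
theorem CFun.Spec.uAny {V : UInterp} {s : List ℕ → List ℕ} {c : CFun} {ε : ℝ} (h : c.Spec V s ε)
    (hε : 0 ≤ ε) (hQ : Good V c.procs) (ho : Ctx.tys c.outs = [boolTy]) {ins : Ctx} {y : Var} {N : Ty}
    (hins : c.ins = ins ++ [(y, N)])
    {δ : ℝ} (hδ : 0 < δ) {k : Var} (hk : k = Ctx.fresh (c.ins ++ c.rest)) :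
    ∃ (Γ₁ Γ₂ Γ : Ctx) (W₁ W₂ W : UStmt) (Q₁ Q₂ : ProcCtx),
      Q₁ = (.gen c.procs.length, .defn Γ₁ W₁) :: c.procs ∧
      Q₂ = (.gen (c.procs.length + 1), .defn Γ₂ W₂) :: Q₁ ∧
      Traq.uAny c N δ = (.gen (c.procs.length + 2), (k + 1, boolTy) :: anyAux c N δ,
        (.gen (c.procs.length + 2), .defn Γ W) :: Q₂) ∧
      Γ = ins ++ [(k, boolTy)] ++ (k + 1, boolTy) :: anyAux c N δ ∧
      (Ctx.keys Γ₁).Nodup ∧ W₁.WT c.procs Γ₁ ∧ (Ctx.keys Γ₂).Nodup ∧ W₂.WT Q₁ Γ₂ ∧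
      (Ctx.keys Γ).Nodup ∧ W.WT Q₂ Γ ∧
      ApproxOp Γ {x | x ∈ Ctx.keys ((k + 1, boolTy) :: anyAux c N δ)} (W.sem (ProcCtx.sem V Q₂) Γ)
        (pushOp Γ fun e => Function.update e k
          ((e k + ind (∃ v, v < (N : ℕ) ∧ searchPred s (Ctx.keys ins) e v)) % 2))
        (anyQueries N δ * (2 * ε) + δ) := by
  obtain ⟨W₁, hc1, hW₁, hn₁, hyb₁, hI⟩ := h.ctrlClean hε hQ.sound ho hk rfl
  set Γ₁ : Ctx := (k, boolTy) :: (c.ins ++ c.rest ++ [(k + 1, boolTy)]) with hΓ₁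
  set R := groverRuns δ with hR
  set Ng : Ty := (groverIters N).toPNat' with hNg
  set aux := anyAux c N δ with haux
  have haux' : aux = c.rest ++ runRegs N Ng (k + 3) R ++ [(k + 2, boolTy)] := by
    rw [haux, anyAux, hk]
  set Γ₂ : Ctx := ins ++ [(k + 1, boolTy)] ++ aux with hΓ₂
  set Γ : Ctx := ins ++ [(k, boolTy)] ++ (k + 1, boolTy) :: aux with hΓ
  set Q₁ : ProcCtx := (.gen c.procs.length, .defn Γ₁ W₁) :: c.procs with hQ₁
  have hGood₁ : Good V Q₁ := hQ.cons _ hn₁ hW₁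
  have hlt : ∀ x ∈ Ctx.keys (c.ins ++ c.rest), x < k := fun x hx => hk ▸ Ctx.lt_fresh hx
  have hlti : ∀ x ∈ Ctx.keys ins, x < k := fun x hx => hlt x (by
    rw [hins, Ctx.keys_append, Ctx.keys_append]; simp [hx])
  have hltr : ∀ x ∈ Ctx.keys c.rest, x < k := fun x hx => hlt x (by
    rw [Ctx.keys_append]; simp [hx])
  have hdisj : ∀ x ∈ Ctx.keys c.rest, x ∉ Ctx.keys ins := fun x hx hx' =>
    h.not_mem_ins hx (by rw [hins, Ctx.keys_append]; simp [hx'])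
  have hni : (Ctx.keys ins).Nodup := by
    have := h.ins_nodup
    rw [hins, Ctx.keys_append] at this
    exact this.of_append_left
  have hmaux : ∀ x, x ∈ Ctx.keys aux ↔ x ∈ Ctx.keys c.rest ∨ (k + 3 ≤ x ∧ x < k + 3 + 3 * R) ∨
      x = k + 2 := fun x => by
    rw [haux', Ctx.keys_append, Ctx.keys_append, List.mem_append, List.mem_append, mem_keys_runRegs,
      or_assoc]
    simp [Ctx.keys]
  have hnaux : (Ctx.keys aux).Nodup := by
    rw [haux']
    refine Ctx.keys_append_nodup (Ctx.keys_append_nodup h.rest_nodup ?_ fun x hx hx' => ?_)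
      (by simp [Ctx.keys]) fun x hx hx' => ?_
    · rw [keys_runRegs]; exact List.nodup_range'
    · have := mem_keys_runRegs.1 hx
      have := hltr x hx'
      lia
    · rw [show x = k + 2 by simpa [Ctx.keys] using hx, Ctx.keys_append, List.mem_append,
        mem_keys_runRegs] at hx'
      rcases hx' with hx' | hx'
      · have := hltr _ hx'
        lia
      · lia
  have hn₂ : (Ctx.keys Γ₂).Nodup := by
    refine Ctx.keys_append_nodup (Ctx.keys_append_nodup hni (by simp [Ctx.keys]) fun x hx hx' => ?_)
      hnaux fun x hx hx' => ?_
    · rw [show x = k + 1 by simpa [Ctx.keys] using hx] at hx'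
      have := hlti _ hx'
      lia
    · rw [Ctx.keys_append, List.mem_append] at hx'
      rw [hmaux] at hx
      rcases hx' with hx' | hx'
      · have h1 := hlti _ hx'
        rcases hx with hx | hx | hx
        · exact hdisj x hx hx'
        · lia
        · lia
      · have h1 : x = k + 1 := by simpa [Ctx.keys] using hx'
        rcases hx with hx | hx | hx
        · have := hltr _ hx; lia
        · lia
        · lia
  have hm₂ : ∀ x, x ∈ Ctx.keys Γ₂ ↔ x ∈ Ctx.keys ins ∨ x = k + 1 ∨ x ∈ Ctx.keys aux := fun x => by
    rw [hΓ₂, Ctx.keys_append, Ctx.keys_append]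
    simp [Ctx.keys]
  have hk₂ : k ∉ Ctx.keys Γ₂ := fun hk' => by
    rw [hm₂, hmaux] at hk'
    rcases hk' with h1 | h1 | h1 | h1 | h1
    · exact lt_irrefl _ (hlti _ h1)
    · lia
    · exact lt_irrefl _ (hltr _ h1)
    · lia
    · lia
  have hperm : (Ctx.keys Γ).Perm (k :: Ctx.keys Γ₂) := by
    rw [hΓ, hΓ₂]
    simp only [Ctx.keys_append, Ctx.keys_cons, List.append_assoc]
    exact List.perm_middle
  have hnΓ : (Ctx.keys Γ).Nodup := by
    rw [hperm.nodup_iff, List.nodup_cons]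
    exact ⟨hk₂, hn₂⟩
  have hsub : Ctx.Sub Γ₂ Γ := Ctx.sub_of_subset hnΓ fun p hp => by
    simp only [hΓ₂, hΓ, List.mem_append, List.mem_cons, List.not_mem_nil, or_false] at hp ⊢
    tauto
  have hgk : Ctx.get Γ k = some boolTy := Ctx.get_of_mem hnΓ (by simp [hΓ])
  have hgb : Ctx.get Γ₂ (k + 1) = some boolTy := Ctx.get_of_mem hn₂ (by simp [hΓ₂])
  have hsub₂ : Ctx.Sub (ins ++ c.rest) Γ₂ := Ctx.sub_of_subset hn₂ fun p hp => by
    simp only [hΓ₂, haux', List.mem_append] at hp ⊢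
    tauto
  have hpc : ∀ e e' : Env, (∀ x, x < k → e x = e' x) → ∀ v,
      searchPred s (Ctx.keys ins) e v ↔ searchPred s (Ctx.keys ins) e' v := fun e e' he v =>
    searchPred_congr (fun x hx => he x (hlti x hx)) v
  -- The control is `k + 2`, so the registers of run `j`, from `k + 3 + 3 * j` on, have the form
  -- that `RunVars` expects.
  have S : RunVars Γ₂ N Ng (k + 2) R (searchPred s (Ctx.keys ins)) := fun j hj => by
    obtain ⟨m1, m2, m3⟩ := mem_runRegs (N := N) (Ng := Ng) (m := k + 3) hj
    refine ⟨Ctx.get_of_mem hn₂ (by simp [hΓ₂, haux']), Ctx.get_of_mem hn₂ ?_,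
      Ctx.get_of_mem hn₂ ?_, Ctx.get_of_mem hn₂ ?_, ?_, fun e z hz v w => hpc _ _ (fun x hx => ?_) v⟩
    · simp only [hΓ₂, haux', List.mem_append]
      exact Or.inr (Or.inl (Or.inr m1))
    · simp only [hΓ₂, haux', List.mem_append]
      exact Or.inr (Or.inl (Or.inr m2))
    · simp only [hΓ₂, haux', List.mem_append]
      exact Or.inr (Or.inl (Or.inr m3))
    · simp only [List.nodup_cons, List.mem_cons, List.not_mem_nil, or_false, not_or, not_false_iff,
        List.nodup_nil, and_true]
      refine ⟨⟨?_, ?_, ?_⟩, ⟨?_, ?_⟩, ?_⟩ <;> lia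
    · refine Function.update_of_ne ?_ _ _
      simp only [List.mem_cons, List.not_mem_nil, or_false] at hz
      rintro rfl
      rcases hz with hz | hz | hz | hz <;> lia
  have hcall : ∀ j, j < R → Match Γ₂ ([k + 2] ++ Ctx.keys ins ++ [k + 2 + 1 + 3 * j] ++
        Ctx.keys c.rest ++ [k + 2 + 2 + 3 * j]) Γ₁ ∧
      Hyb Γ₂ {x | x ∈ Ctx.keys c.rest} (UStmt.sem (ProcCtx.sem V Q₁) Γ₂ (.call (.gen c.procs.length)
        ([k + 2] ++ Ctx.keys ins ++ [k + 2 + 1 + 3 * j] ++ Ctx.keys c.rest ++ [k + 2 + 2 + 3 * j])))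
        (runOracle Γ₂ (k + 2) (searchPred s (Ctx.keys ins)) j) (2 * ε) := fun j hj => by
    rw [sem_call (ProcCtx.sem_cons_self V _ Γ₁ W₁ _)]
    rw [hins] at hI hyb₁
    refine hyb_oracle (by positivity) (S j hj) (by rw [hΓ₁, hins]) hn₁ hsub₂ ?_ hI hyb₁
    intro x hx hx'
    rw [Ctx.keys_append, List.mem_append] at hx'
    have h1 : x < k := hx'.elim (hlti x) (hltr x)
    simp only [List.mem_cons, List.not_mem_nil, or_false] at hx
    lia
  have hwtcall : ∀ j < R, UStmt.WT Q₁ Γ₂ (.call (.gen c.procs.length)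
      ([k + 2] ++ Ctx.keys ins ++ [k + 2 + 1 + 3 * j] ++ Ctx.keys c.rest ++ [k + 2 + 2 + 3 * j])) :=
    fun j hj => ⟨(hcall j hj).1.nodup, .defn Γ₁ W₁, by rw [hQ₁, lookup_cons, if_pos rfl],
      (hcall j hj).1.types⟩
  set W₂ : UStmt := .seq
    (.seqs ((List.range R).map fun j => searchRun (.gen c.procs.length) (Ctx.keys ins)
      (Ctx.keys c.rest) N (k + 2) (k + 2 + 1 + 3 * j) (k + 2 + 2 + 3 * j) (k + 2 + 3 + 3 * j)))
    (.app ((List.range R).map (fun j => k + 2 + 2 + 3 * j) ++ [k + 1])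
      (.embed (List.range R) (orExpr R))) with hW₂
  have hwt₂ : W₂.WT Q₁ Γ₂ := ⟨S.wt_runs hNg hwtcall, S.wt_or (by lia) hgb⟩
  set D' := pushOp Γ₂ (orMap (k + 2) R (k + 1)) *
    runsOp Γ₂ N Ng (k + 2) (runOracle Γ₂ (k + 2) (searchPred s (Ctx.keys ins))) R with hD'
  have hD : Hyb Γ₂ {x | x ∈ Ctx.keys c.rest} (W₂.sem (ProcCtx.sem V Q₁) Γ₂) D'
      (R * (Ng * (2 * ε))) := by
    rw [hW₂, UStmt.sem, S.sem_runs _ _ _ _ hNg le_rfl, S.sem_or _ (by lia) hgb]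
    refine ((Hyb.refl (V := {k + 1}) (invol_orMap (by lia) hgb).unitary (Local.pushOp fun e x hx =>
      Function.update_of_ne hx _ _) fun z hz hz' => ?_).mul (S.hyb_runs (fun z hz => ?_)
        (fun j hj => (hcall j hj).2) le_rfl)).congr (zero_add _)
    · rw [Set.mem_singleton_iff] at hz'
      have := hltr z hz
      lia
    · have := hltr z hz
      lia
  -- The zeros used here concern all names from `k + 2` on. They are cut down to the context, where
  -- they are covered by the workspace of the search.
  have hT := (S.search_approx ((toPNat'_groverIters N)) (b := k + 1)
    (fun e e' he => hpc e e' fun x hx => he x (by lia) (by lia)) (by lia) hgb).inter_keys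
  set Q₂ : ProcCtx := (.gen (c.procs.length + 1), .defn Γ₂ W₂) :: Q₁ with hQ₂
  have hcallD : UStmt.WT Q₂ Γ (.call (.gen (c.procs.length + 1)) (Ctx.keys Γ₂)) :=
    ⟨hn₂, .defn Γ₂ W₂, by rw [hQ₂, lookup_cons, if_pos rfl], hsub.map_keys hn₂⟩
  have hgb' : Ctx.get Γ (k + 1) = some boolTy := hsub _ _ hgb
  refine ⟨Γ₁, Γ₂, Γ, W₁, W₂, .withDo (.call (.gen (c.procs.length + 1)) (Ctx.keys Γ₂))
    (.app [k + 1, k] .CNOT), Q₁, Q₂, rfl, rfl, ?_, rfl, hn₁, hW₁, hn₂, hwt₂, hnΓ,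
    wt_withDo hcallD ⟨by simp, [boolTy, boolTy], by simp [hgb', hgk], rfl⟩, ?_⟩
  · have hdl : c.ins.dropLast = ins := by rw [hins, List.dropLast_concat]
    have hregs : runRegs N Ng (k + 3) R = (List.range R).flatMap fun j =>
        [(k + 3 + 3 * j, N), (k + 4 + 3 * j, boolTy), (k + 5 + 3 * j, Ng)] := rfl
    rw [Traq.uAny]
    simp only [← hk, hdl, hc1, ← hR, ← hNg, ← hregs, ← haux']
    refine congrArg₂ Prod.mk rfl (congrArg₂ Prod.mk rfl ?_)
    have hkΓ₂ : Ctx.keys ins ++ [k + 1] ++ Ctx.keys aux = Ctx.keys Γ₂ := by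
      rw [hΓ₂, Ctx.keys_append, Ctx.keys_append]; rfl
    rw [hkΓ₂, show ins ++ [(k, boolTy)] ++ [(k + 1, boolTy)] ++ aux = Γ by rw [hΓ]; simp]
  · rw [sem_withDo, sem_app_CNOT _ (by lia) hgb' hgk, sem_call (ProcCtx.sem_cons_self V _ Γ₂ W₂ _)]
    have hVs : Local Γ₂ {x | k + 1 ≤ x} D' := by
      refine Local.mul (Local.pushOp fun e x hx => Function.update_of_ne ?_ _ _) ?_
      · rintro rfl
        exact hx (show k + 1 ≤ k + 1 from le_rfl)
      · intro τ σ h0 x hx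
        refine S.local_runs le_rfl τ σ h0 x fun hx' => hx ?_
        simp only [Set.mem_ofPred_eq] at hx' ⊢
        lia
    refine (search_clean (by positivity) (pow_nonneg (Real.sqrt_nonneg _) _) hsub hn₂ hgk hk₂ hgb'
      ((hm₂ _).2 (Or.inr (Or.inl rfl))) hD hT (fun z hz => (hm₂ z).2 (Or.inr (Or.inr
        ((hmaux z).2 (Or.inl hz))))) (fun z hz => hz.2) hVs fun e e' he => ?_).mono ?_ ?_
    · refine exists_congr fun v => and_congr_right fun _ => searchPred_congr (fun x hx => ?_) v
      refine he x ((hm₂ x).2 (Or.inl hx)) fun hx' => ?_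
      have := hlti x hx
      simp only [Set.mem_ofPred_eq] at hx'
      lia
    · rintro z (hz | ⟨hz, hz'⟩)
      · rw [Set.mem_ofPred_eq, Ctx.keys_cons]
        exact List.mem_cons_of_mem _ ((hmaux z).2 (Or.inl hz))
      · rw [Set.mem_ofPred_eq, Ctx.keys_cons]
        rw [hm₂] at hz'
        rcases hz' with hz' | hz' | hz'
        · have := hlti z hz'
          rcases hz with hz | (hz : k + 2 ≤ z) <;> lia
        · rw [hz']; exact List.mem_cons_self
        · exact List.mem_cons_of_mem _ hz'
    -- The error is `2(R · Ng · 2ε + √0.63 ^ R)`. The first part is the number of queries times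
    -- `2ε`, and the second is at most `δ`.
    · have h1 := sqrt_pow_groverRuns_le hδ
      have h2 : ((Ng : ℕ) : ℝ) = groverIters N := by rw [hNg, toPNat'_groverIters]
      rw [h2, anyQueries]
      push_cast
      linarith

/-! ## Type soundness of the source language -/

theorem Env.set_cons_update (σ : Env) (x : Var) (xs : List Var) (v : ℕ) (vs : List ℕ) :
    Env.set σ (x :: xs) (v :: vs) = Function.update (Env.set σ xs vs) x v := by
  funext y
  rw [Env.set_cons, Function.update_apply]

theorem Match.put_set {Γ Ω : Ctx} {qs : List Var} (h : Match Γ qs Ω) (σ : Env) {ys zs : List Var}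
    {vs : List ℕ} (hl : ys.length = zs.length) (hv : vs.length = zs.length)
    (hyz : ∀ p ∈ ys.zip zs, p ∈ qs.zip (Ctx.keys Ω)) :
    put qs Ω σ (Env.set (pull qs Ω σ) zs vs) = Env.set σ ys vs := by
  induction zs generalizing ys vs with
  | nil =>
    rw [List.length_nil, List.length_eq_zero_iff] at hl
    rw [hl, Env.set_nil, Env.set_nil, h.put_pull]
  | cons z zs ih =>
    rcases ys with _ | ⟨y, ys⟩
    · simp at hl
    rcases vs with _ | ⟨v, vs⟩
    · simp at hv
    simp only [List.zip_cons_cons, List.mem_cons, forall_eq_or_imp] at hyz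
    rw [Env.set_cons_update, h.put_update _ _ hyz.1, ih (by simpa using hl) (by simpa using hv) hyz.2,
      Env.set_cons_update]

theorem Stmt.type_append {Φ : FunCtx} {S : Stmt} {Γ Γ' : Ctx} (h : S.type Φ Γ = some Γ')
    (hn : (Ctx.keys Γ).Nodup) : ∃ Δ, Γ' = Γ ++ Δ ∧ (Ctx.keys Γ').Nodup := by
  induction S generalizing Γ Γ' with
  | assign x E =>
    rw [Stmt.type] at h
    split_ifs at h with hx
    obtain ⟨T, -, rfl⟩ := Option.map_eq_some_iff.1 h
    exact ⟨_, rfl, Ctx.keys_append_nodup hn (by simp [Ctx.keys]) fun y hy => by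
      rw [show y = x by simpa [Ctx.keys] using hy]; exact hx⟩
  | seq S₁ S₂ ih₁ ih₂ =>
    rw [Stmt.type] at h
    obtain ⟨Γ₁, h1, h2⟩ := Option.bind_eq_some_iff.1 h
    obtain ⟨Δ₁, rfl, hn₁⟩ := ih₁ h1 hn
    obtain ⟨Δ₂, rfl, hn₂⟩ := ih₂ h2 hn₁
    exact ⟨Δ₁ ++ Δ₂, by rw [List.append_assoc], hn₂⟩
  | call ys f xs =>
    rw [Stmt.type] at h
    obtain ⟨G, -, h2⟩ := Option.bind_eq_some_iff.1 h
    split_ifs at h2 with hx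
    obtain ⟨h3, h4, h5, -⟩ := hx
    cases h2
    have hk : Ctx.keys (ys.zip G.outTys) = ys := Ctx.keys_zip h5.le
    exact ⟨_, rfl, Ctx.keys_append_nodup hn (by rwa [hk]) (by rwa [hk])⟩
  | any b f xs =>
    rw [Stmt.type] at h
    obtain ⟨G, -, h2⟩ := Option.bind_eq_some_iff.1 h
    split_ifs at h2 with hx
    cases h2
    exact ⟨_, rfl, Ctx.keys_append_nodup hn (by simp [Ctx.keys]) fun y hy => by
      rw [show y = b by simpa [Ctx.keys] using hy]; exact hx.1⟩

/-- The semantics of functions respects their types. -/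
def RespectsTys (Φ : FunCtx) (ρ : FName → List ℕ → List ℕ) : Prop :=
  ∀ f G, Φ.lookup f = some G → ∀ vs, HasTys vs G.inTys → HasTys (ρ f vs) G.outTys

/-- Type soundness together with a frame property: results have the declared types and only new
variables are written. It is stated for every larger context `Θ`, because compiled code runs next to
auxiliary variables. -/
theorem Stmt.exec_only {Φ : FunCtx} {ρ : FName → List ℕ → List ℕ} (hρ : RespectsTys Φ ρ) {S : Stmt}
    {Γ Δ : Ctx} (h : S.type Φ Γ = some (Γ ++ Δ)) (hn : (Ctx.keys Γ).Nodup) {Θ : Ctx}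
    (hΘ : Ctx.Sub (Γ ++ Δ) Θ) : Only Θ {x | x ∈ Ctx.keys Δ} (S.exec Φ ρ Γ) := by
  induction S generalizing Γ Δ with
  | assign x E =>
    rw [Stmt.type] at h
    split_ifs at h with hx
    obtain ⟨T, hT, h⟩ := Option.map_eq_some_iff.1 h
    obtain rfl := List.append_cancel_left h
    have hgx : Ctx.get Θ x = some T := hΘ _ _ (by
      rw [Ctx.get_append, if_neg hx, Ctx.get_cons, if_pos rfl])
    have hsub := (Ctx.sub_append_left Γ [(x, T)]).trans hΘ
    have hE : E.type Θ = some T := by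
      rw [← hT]
      refine Expr.type_congr fun y hy => ?_
      obtain ⟨T', hT'⟩ := Ctx.exists_get (Expr.get_of_type hT y hy)
      rw [hT', hsub _ _ hT']
    refine ⟨fun e he => ?_, fun e y hy => ?_⟩
    · rw [Stmt.exec]
      refine he.set (Ts := [T]) (by simp [hgx]) (List.Forall₂.cons ?_ List.Forall₂.nil)
      rw [Expr.eval_congr (Γ' := Θ) (σ' := e) (fun y hy => ?_) fun _ _ => rfl]
      · exact Expr.eval_lt he hE
      · obtain ⟨T', hT'⟩ := Ctx.exists_get (Expr.get_of_type hT y hy)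
        rw [hT', hsub _ _ hT']
    · rw [Stmt.exec]
      exact Env.set_of_not_mem _ _ hy
  | seq S₁ S₂ ih₁ ih₂ =>
    rw [Stmt.type] at h
    obtain ⟨Γ₁, h1, h2⟩ := Option.bind_eq_some_iff.1 h
    obtain ⟨Δ₁, rfl, hn₁⟩ := Stmt.type_append h1 hn
    obtain ⟨Δ₂, hΔ, hn₂⟩ := Stmt.type_append h2 hn₁
    rw [List.append_assoc] at hΔ
    obtain rfl := List.append_cancel_left hΔ
    rw [← List.append_assoc] at h2 hΘ
    have o1 := ih₁ h1 hn ((Ctx.sub_append_left _ _).trans hΘ)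
    have o2 := ih₂ h2 hn₁ hΘ
    refine ⟨fun e he => ?_, fun e y hy => ?_⟩
    · rw [Stmt.exec, h1]
      exact o2.pres _ (o1.pres _ he)
    · rw [Set.mem_ofPred_eq, Ctx.keys_append, List.mem_append, not_or] at hy
      rw [Stmt.exec, h1]
      exact (o2.eq _ _ hy.2).trans (o1.eq _ _ hy.1)
  | call ys f xs =>
    rw [Stmt.type] at h
    obtain ⟨G, hG, h2⟩ := Option.bind_eq_some_iff.1 h
    split_ifs at h2 with hx
    obtain ⟨h3, h4, h5, h6, h7⟩ := hx
    obtain rfl := List.append_cancel_left (Option.some.inj h2)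
    have hk : Ctx.keys (ys.zip G.outTys) = ys := Ctx.keys_zip h5.le
    have hys : ys.map (Ctx.get Θ) = G.outTys.map some := by
      have h8 : Ctx.Sub (ys.zip G.outTys) Θ := (Ctx.sub_append_right (by rwa [hk])).trans hΘ
      have := h8.map_keys (by rwa [hk])
      rwa [hk, Ctx.tys_zip h5.ge] at this
    refine ⟨fun e he => ?_, fun e y hy => ?_⟩
    · rw [Stmt.exec]
      exact he.set hys (hρ f G hG _ (he.hasTys (((Ctx.sub_append_left _ _).trans hΘ).map_get h7)))
    · rw [Stmt.exec]
      exact Env.set_of_not_mem _ _ (by rwa [Set.mem_ofPred_eq, hk] at hy)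
  | any b f xs =>
    rw [Stmt.type] at h
    obtain ⟨G, hG, h2⟩ := Option.bind_eq_some_iff.1 h
    split_ifs at h2 with hx
    obtain rfl := List.append_cancel_left (Option.some.inj h2)
    have hgb : Ctx.get Θ b = some boolTy := hΘ _ _ (by
      rw [Ctx.get_append, if_neg hx.1, Ctx.get_cons, if_pos rfl])
    refine ⟨fun e he => ?_, fun e y hy => ?_⟩
    · rw [Stmt.exec]
      refine he.set (Ts := [boolTy]) (by simp [hgb]) (List.Forall₂.cons ?_ List.Forall₂.nil)
      change _ < 2
      split_ifs <;> decide
    · rw [Stmt.exec]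
      exact Env.set_of_not_mem _ _ hy

/-! ## Invariants of compilation -/

/-- The invariants of the procedure contexts that arise in compilation: they are well typed with
unitary declarations, generated names are smaller than their length, and source names are declarations
of functions in `Φ`. -/
structure Inv (V : UInterp) (tick : FName → ℕ) (Φ : FunCtx) (Q : ProcCtx) : Prop extends Good V Q where
  gen : ∀ i, Q.length ≤ i → Q.lookup (.gen i) = none
  source : ∀ f G, Q.lookup (.source f) = some G →
    ∃ inTys outTys, Φ.lookup f = some (.decl inTys outTys) ∧
      G = .decl ((Fun.decl inTys outTys).inCtx ++ (Fun.decl inTys outTys).outCtx) (tick f)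

section Inv
variable {V : UInterp} {tick : FName → ℕ} {Φ : FunCtx} {Q : ProcCtx}

theorem Inv.nil : Inv V tick Φ [] where
  wt := trivial
  decl _ _ _ h := by simp at h
  gen _ _ := rfl
  source _ _ h := by simp at h

/-- Generated names are numbered by the length of the context, so the current length is unused. -/
theorem Inv.cons_gen (h : Inv V tick Φ Q) {i : ℕ} (hi : i = Q.length) {Ω : Ctx} {W : UStmt}
    (hn : (Ctx.keys Ω).Nodup) (hW : W.WT Q Ω) :
    Inv V tick Φ ((.gen i, .defn Ω W) :: Q) ∧ Ext V Q ((.gen i, .defn Ω W) :: Q) := by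
  refine ⟨⟨h.toGood.cons _ hn hW, fun j hj => ?_, fun f G hG => ?_⟩, Ext.cons (h.gen _ hi.ge) _⟩
  · rw [List.length_cons] at hj
    rw [lookup_cons, if_neg (by rintro ⟨⟩; omega)]
    exact h.gen _ (by omega)
  · rw [lookup_cons, if_neg (by rintro ⟨⟩)] at hG
    exact h.source f G hG

/-- A declared function is added at each of its uses, so its name may already be present. By the
invariant `source` the old entry is the same declaration, and shadowing it changes no meaning. -/
theorem Inv.cons_source (h : Inv V tick Φ Q) {f : FName} {inTys outTys : List Ty}
    (hf : Φ.lookup f = some (.decl inTys outTys)) {Ω : Ctx}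
    (hΩ : Ω = (Fun.decl inTys outTys).inCtx ++ (Fun.decl inTys outTys).outCtx)
    (hn : (Ctx.keys Ω).Nodup) (hV : V (.source f) Ω ∈ unitaryGroup (State Ω) ℂ) :
    Inv V tick Φ ((.source f, .decl Ω (tick f)) :: Q) ∧
      Ext V Q ((.source f, .decl Ω (tick f)) :: Q) := by
  refine ⟨⟨⟨⟨hn, trivial, h.wt⟩, fun g Ω' t hm => ?_⟩, fun j hj => ?_, fun f' G hG => ?_⟩,
    fun g G hG => ?_⟩
  · rcases List.mem_cons.1 hm with h' | h'
    · cases h'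
      exact hV
    · exact h.decl _ _ _ h'
  · rw [List.length_cons] at hj
    rw [lookup_cons, if_neg (by rintro ⟨⟩)]
    exact h.gen _ (by omega)
  · rw [lookup_cons] at hG
    split_ifs at hG with hff
    · cases hff
      cases hG
      exact ⟨_, _, hf, by rw [hΩ]⟩
    · exact h.source f' G hG
  · by_cases hg : g = .source f
    · subst hg
      obtain ⟨i, o, hio, rfl⟩ := h.source f G hG
      rw [hf] at hio
      cases hio
      rw [lookup_cons, if_pos rfl, ← hΩ]
      refine ⟨rfl, ?_⟩
      rw [← hΩ] at hG
      rw [ProcCtx.sem_of_decl V hG, ProcCtx.sem_of_decl V (t := tick f) (Ω := Ω)]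
      rw [lookup_cons, if_pos rfl]
    · rw [lookup_cons, if_neg hg, ProcCtx.sem_cons_ne V hg]
      exact ⟨hG, rfl⟩

end Inv

/-- The compilation `cf` of the functions in `Φ` is correct for their semantics `s`. -/
def CompilesFuns (V : UInterp) (tick : FName → ℕ) (Φ₀ Φ : FunCtx) (s : FName → List ℕ → List ℕ)
    (cf : FName → ℝ → ProcCtx → Option CFun) : Prop :=
  ∀ f G, Φ.lookup f = some G → ∀ δ : ℝ, 0 < δ → δ ≤ 1 → ∀ Q, Inv V tick Φ₀ Q →
    ∃ c, cf f δ Q = some c ∧ Ctx.tys c.ins = G.inTys ∧ Ctx.tys c.outs = G.outTys ∧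
      Inv V tick Φ₀ c.procs ∧ Ext V Q c.procs ∧ c.Spec V (s f) δ

/-- The compiled statement `W` computes `h`, with outputs `Δ` and auxiliary variables `aux`. -/
structure Compiled (V : UInterp) (tick : FName → ℕ) (Φ₀ : FunCtx) (Q Q' : ProcCtx) (Γ Δ aux : Ctx)
    (W : UStmt) (h : Env → Env) (δ : ℝ) : Prop where
  inv : Inv V tick Φ₀ Q'
  ext : Ext V Q Q'
  wt : ∀ Θ, Ctx.Sub (Γ ++ Δ) Θ → Ctx.Sub aux Θ → W.WT Q' Θ
  approx : ∀ Θ, Ctx.Sub (Γ ++ Δ) Θ → Ctx.Sub aux Θ →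
    ApproxOp Θ {x | x ∈ Ctx.keys Δ ∨ x ∈ Ctx.keys aux} (W.sem (ProcCtx.sem V Q') Θ) (pushOp Θ h) δ

theorem Fun.getLast_inTys {G : Fun} {c : CFun} (hc : Ctx.tys c.ins = G.inTys) (h0 : G.inTys ≠ []) :
    ∃ ins y N, c.ins = ins ++ [(y, N)] ∧ G.inTys.getLast? = some N ∧
      Ctx.tys ins = G.inTys.dropLast := by
  have h1 : c.ins ≠ [] := by
    intro h
    rw [h] at hc
    exact h0 hc.symm
  obtain ⟨ins, ⟨y, N⟩, h2⟩ : ∃ l a, c.ins = l ++ [a] :=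
    ⟨_, _, (List.dropLast_append_getLast h1).symm⟩
  have h3 : G.inTys = Ctx.tys ins ++ [N] := by
    rw [← hc, h2, Ctx.tys_append]; rfl
  exact ⟨ins, y, N, h2, by rw [h3, List.getLast?_concat], by rw [h3, List.dropLast_concat]⟩

/-! ### Compiled assignments, sequences and calls -/

section Compile

variable {V : UInterp} {tick : FName → ℕ} {Φ₀ Φ : FunCtx} {s : FName → List ℕ → List ℕ}
  {cf : FName → ℝ → ProcCtx → Option CFun}

/-- The embedding adds the value of `E` to `x`. Since `x` starts at zero and the value is in range,
this is the assignment without any error. -/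
theorem compiled_assign {Γ Δ : Ctx} {x : Var} {E : Expr} {Q : ProcCtx} (hQ : Inv V tick Φ₀ Q)
    (h : (Stmt.assign x E).type Φ Γ = some (Γ ++ Δ)) {δ : ℝ} (hδ : 0 ≤ δ) :
    Compiled V tick Φ₀ Q Q Γ Δ [] (.app (E.vars ++ [x]) (.embed E.vars E))
      ((Stmt.assign x E).exec Φ s Γ) δ := by
  rw [Stmt.type] at h
  split_ifs at h with hx
  obtain ⟨T, hT, h⟩ := Option.map_eq_some_iff.1 h
  obtain rfl := List.append_cancel_left h
  have hv : ∀ y ∈ E.vars, y ∈ Ctx.keys Γ := Expr.get_of_type hT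
  have hn : (E.vars ++ [x]).Nodup :=
    List.Nodup.append E.vars_nodup (by simp) fun y hy hy' => hx (List.mem_singleton.1 hy' ▸ hv y hy)
  obtain ⟨Ts, hTs⟩ : ∃ Ts : List Ty, E.vars.map (Ctx.get Γ) = Ts.map some :=
    ⟨E.vars.map fun y => (Ctx.get Γ y).getD 1, by
      rw [List.map_map]
      refine List.map_congr_left fun y hy => ?_
      obtain ⟨T', hT'⟩ := Ctx.exists_get (hv y hy)
      simp [hT']⟩
  have hE : E.type (E.vars.zip Ts) = some T := by
    rw [← hT]
    exact Expr.type_congr fun y hy => Ctx.get_zip_of_map_get hTs hy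
  have hlen := length_eq_of_map_get hTs
  have hgx : Ctx.get (Γ ++ [(x, T)]) x = some T := by
    rw [Ctx.get_append, if_neg hx, Ctx.get_cons, if_pos rfl]
  refine ⟨hQ, Ext.refl _ _, fun Θ hΘ _ => ?_, fun Θ hΘ _ => ?_⟩
  · exact wt_app_embed hn (((Ctx.sub_append_left _ _).trans hΘ).map_get hTs) (hΘ _ _ hgx) hlen
      E.vars_nodup hE
  · rw [sem_app_embed _ hn (((Ctx.sub_append_left _ _).trans hΘ).map_get hTs) (hΘ _ _ hgx) hlen]
    refine (ApproxOp.refl hδ).congr_right fun e he hz => ?_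
    have hx0 : e x = 0 := hz x (Or.inl (by simp [Ctx.keys]))
    have h1 : E.eval (E.vars.zip Ts) (Env.set 0 E.vars (E.vars.map e)) = E.eval Γ e :=
      Expr.eval_congr (fun y hy => Ctx.get_zip_of_map_get hTs hy) fun y hy => by
        rw [Env.set_map, if_pos hy]
    have hET : E.type Θ = some T := by
      rw [← hT]
      refine Expr.type_congr fun y hy => ?_
      obtain ⟨T', hT'⟩ := Ctx.exists_get (hv y hy)
      rw [hT', hΘ _ _ (Ctx.sub_append_left _ _ _ _ hT')]
    have h2 : E.eval Γ e < (T : ℕ) := by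
      rw [Expr.eval_congr (Γ' := Θ) (σ' := e) (fun y hy => ?_) fun _ _ => rfl]
      · exact Expr.eval_lt he hET
      · obtain ⟨T', hT'⟩ := Ctx.exists_get (hv y hy)
        rw [hT', hΘ _ _ (Ctx.sub_append_left _ _ _ _ hT')]
    rw [h1, hx0, zero_add, Nat.mod_eq_of_lt h2, Stmt.exec, Env.set_singleton]

/-- Insert `W₂` after the ideal first statement. That ideal map is isometric on vectors with zeros
in `Δ₁`, and its result still has the zeros required by `W₂`, so the errors `δ / 2` add up. -/
theorem Compiled.seq {Γ Δ₁ Δ₂ aux₁ aux₂ : Ctx} {Q Q₁ Q₂ : ProcCtx} {W₁ W₂ : UStmt} {h₁ h₂ : Env → Env}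
    {δ : ℝ} (hn : (Ctx.keys (Γ ++ Δ₁ ++ Δ₂)).Nodup)
    (ha : ∀ x ∈ Ctx.keys aux₂, x ∉ Ctx.keys Δ₁)
    (H₁ : Compiled V tick Φ₀ Q Q₁ Γ Δ₁ aux₁ W₁ h₁ (δ / 2))
    (H₂ : Compiled V tick Φ₀ Q₁ Q₂ (Γ ++ Δ₁) Δ₂ aux₂ W₂ h₂ (δ / 2))
    (hdj : ∀ x ∈ Ctx.keys aux₂, x ∉ Ctx.keys aux₁)
    (ho : ∀ Θ, Ctx.Sub (Γ ++ Δ₁) Θ → Only Θ {x | x ∈ Ctx.keys Δ₁} h₁) :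
    Compiled V tick Φ₀ Q Q₂ Γ (Δ₁ ++ Δ₂) (aux₁ ++ aux₂) (.seq W₁ W₂) (fun e => h₂ (h₁ e)) δ := by
  have hs1 : ∀ {Θ}, Ctx.Sub (Γ ++ (Δ₁ ++ Δ₂)) Θ → Ctx.Sub (Γ ++ Δ₁) Θ := fun h => by
    rw [← List.append_assoc] at h
    exact (Ctx.sub_append_left _ _).trans h
  have hs2 : ∀ {Θ}, Ctx.Sub (Γ ++ (Δ₁ ++ Δ₂)) Θ → Ctx.Sub (Γ ++ Δ₁ ++ Δ₂) Θ := fun h => by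
    rwa [← List.append_assoc] at h
  have hs3 : ∀ {Θ}, Ctx.Sub (aux₁ ++ aux₂) Θ → Ctx.Sub aux₁ Θ := fun h =>
    (Ctx.sub_append_left _ _).trans h
  have hs4 : ∀ {Θ}, Ctx.Sub (aux₁ ++ aux₂) Θ → Ctx.Sub aux₂ Θ := fun h =>
    (Ctx.sub_append_right hdj).trans h
  have hd : ∀ x ∈ Ctx.keys Δ₂, x ∉ Ctx.keys Δ₁ := fun x hx hx' => by
    rw [Ctx.keys_append, Ctx.keys_append] at hn
    exact (List.nodup_append'.1 hn).2.2 (List.mem_append_right _ hx') hx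
  refine ⟨H₂.inv, H₁.ext.trans H₂.ext, fun Θ hΘ hA =>
    ⟨H₂.ext.wt (H₁.wt Θ (hs1 hΘ) (hs3 hA)), H₂.wt Θ (hs2 hΘ) (hs4 hA)⟩, fun Θ hΘ hA ψ hψ => ?_⟩
  have h1 := ho Θ (hs1 hΘ)
  have hU := H₂.inv.toGood.sound.sem_unitary (H₂.wt Θ (hs2 hΘ) (hs4 hA))
  rw [UStmt.sem, H₂.ext.sem (H₁.wt Θ (hs1 hΘ) (hs3 hA)), ← pushOp_mul h1.pres, ← mulVec_mulVec,
    ← mulVec_mulVec]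
  simp only [Ctx.keys_append, List.mem_append] at hψ
  have hψ1 : ZeroOn {x | x ∈ Ctx.keys Δ₁ ∨ x ∈ Ctx.keys aux₁} ψ := hψ.mono fun x hx => by
    simp only [Set.mem_ofPred_eq] at hx ⊢; tauto
  have hφ : ZeroOn {x | x ∈ Ctx.keys Δ₂ ∨ x ∈ Ctx.keys aux₂} (pushOp Θ h₁ *ᵥ ψ) := by
    refine hψ.pushOp fun e _ he z hz => ?_
    rw [h1.eq _ _ fun hz' => ?_, he z (by simp only [Set.mem_ofPred_eq] at hz ⊢; tauto)]
    rcases hz with hz | hz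
    · exact hd z hz hz'
    · exact ha z hz hz'
  refine (vn_sub_le_sub_add_sub _ (W₂.sem (ProcCtx.sem V Q₂) Θ *ᵥ pushOp Θ h₁ *ᵥ ψ) _).trans ?_
  have e1 := H₁.approx Θ (hs1 hΘ) (hs3 hA) ψ hψ1
  have e2 := H₂.approx Θ (hs2 hΘ) (hs4 hA) _ hφ
  rw [h1.vn (hψ1.mono fun x hx => Or.inl hx)] at e2
  rw [← mulVec_sub, vn_unitary hU]
  linarith

theorem zip_append₃ {α : Type*} {a b c a' b' c' : List α} (h1 : a.length = a'.length)
    (h2 : b.length = b'.length) {p : α × α} :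
    p ∈ (a ++ b ++ c).zip (a' ++ b' ++ c') ↔ p ∈ a.zip a' ∨ p ∈ b.zip b' ∨ p ∈ c.zip c' := by
  rw [List.zip_append (by simp [h1, h2]), List.zip_append h1, List.mem_append, List.mem_append,
    or_assoc]

theorem exists_zip_right_of_length {α : Type*} {a b : List α} (h : a.length = b.length) {y : α}
    (hy : y ∈ b) : ∃ x, (x, y) ∈ a.zip b := by
  obtain ⟨i, hi, rfl⟩ := List.mem_iff_getElem.1 hy
  exact ⟨a[i], List.mem_iff_getElem.2 ⟨i, by simp; omega, by simp⟩⟩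

theorem map_eq_of_zip {α β : Type*} {a b : List α} (h : a.length = b.length) {f g : α → β}
    (hfg : ∀ p ∈ a.zip b, f p.1 = g p.2) : a.map f = b.map g := by
  refine List.ext_getElem (by simpa using h) fun i h1 h2 => ?_
  rw [List.getElem_map, List.getElem_map]
  simp only [List.length_map] at h1 h2
  exact hfg (a[i], b[i]) (List.mem_iff_getElem.2 ⟨i, by simp; omega, by simp⟩)

/-- The function is compiled with precision `δ / 2` and `Clean` doubles its error. Substituting
arguments, auxiliary variables and results for the parameters of the procedure turns its ideal map
into the call. -/
theorem compiled_call (hcf : CompilesFuns V tick Φ₀ Φ s cf) {Γ Δ : Ctx} {ys xs : List Var} {f : FName}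
    {Q : ProcCtx} (hQ : Inv V tick Φ₀ Q) (h : (Stmt.call ys f xs).type Φ Γ = some (Γ ++ Δ))
    {δ : ℝ} (hδ : 0 < δ) (hδ1 : δ ≤ 1) {k : ℕ} (hk : ∀ x ∈ Ctx.keys (Γ ++ Δ), x < k) :
    ∃ W Ts Q', (Stmt.call ys f xs).compile Φ cf δ k Q = some (W, Ctx.consec k Ts, Q') ∧
      Compiled V tick Φ₀ Q Q' Γ Δ (Ctx.consec k Ts) W ((Stmt.call ys f xs).exec Φ s Γ) δ := by
  rw [Stmt.type] at h
  obtain ⟨G, hG, h2⟩ := Option.bind_eq_some_iff.1 h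
  split_ifs at h2 with hx
  obtain ⟨h3, h4, h5, h6, h7⟩ := hx
  obtain rfl := List.append_cancel_left (Option.some.inj h2)
  have hky : Ctx.keys (ys.zip G.outTys) = ys := Ctx.keys_zip h5.le
  obtain ⟨c, hc, hci, hco, hinv, hext, hspec⟩ := hcf f G hG (δ / 2) (by linarith) (by linarith) Q hQ
  obtain ⟨W, hW, hwt, hnW, happ⟩ := hspec.clean (by linarith) hinv.toGood.sound rfl rfl
  set Ω := c.ins ++ c.rest with hΩ
  set Ω' := copyCtx (Ctx.fresh Ω) c.outs with hΩ'
  set aux := Ctx.consec k (Ctx.tys c.rest) with haux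
  obtain ⟨hinv', hext'⟩ := hinv.cons_gen rfl hnW hwt
  have hkeys : Ctx.keys (Ω ++ Ω') = Ctx.keys c.ins ++ Ctx.keys c.rest ++ Ctx.keys Ω' := by
    rw [hΩ, Ctx.keys_append, Ctx.keys_append]
  have htys : Ctx.tys (Ω ++ Ω') = Ctx.tys c.ins ++ Ctx.tys c.rest ++ Ctx.tys c.outs := by
    rw [hΩ, Ctx.tys_append, Ctx.tys_append, hΩ', copyCtx, Ctx.tys_consec]
  have hxk : ∀ x ∈ xs, x ∈ Ctx.keys Γ := fun x hx => mem_keys_of_map_get h7 hx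
  have hauxk : ∀ x ∈ Ctx.keys aux, k ≤ x := fun x hx => (Ctx.mem_keys_consec.1 hx).1
  have hyk : ∀ y ∈ ys, y < k := fun y hy => hk y (by
    rw [Ctx.keys_append, hky]; exact List.mem_append_right _ hy)
  have hxlt : ∀ x ∈ xs, x < k := fun x hx => hk x (by
    rw [Ctx.keys_append]; exact List.mem_append_left _ (hxk x hx))
  have hm : ∀ {Θ}, Ctx.Sub (Γ ++ ys.zip G.outTys) Θ → Ctx.Sub aux Θ →
      Match Θ (xs ++ Ctx.keys aux ++ ys) (Ω ++ Ω') := fun {Θ} hΘ hA => by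
    refine ⟨List.Nodup.append (List.Nodup.append h6 (Ctx.nodup_consec _ _) fun x hx hx' => ?_) h3
      fun x hx hx' => ?_, hnW, ?_⟩
    · have := hxlt x hx
      have := hauxk x hx'
      lia
    · rcases List.mem_append.1 hx with hx | hx
      · exact h4 x hx' (hxk x hx)
      · have := hyk x hx'
        have := hauxk x hx
        lia
    · have hy : ys.map (Ctx.get Θ) = G.outTys.map some := by
        have h8 : Ctx.Sub (ys.zip G.outTys) Θ := (Ctx.sub_append_right (by rwa [hky])).trans hΘ
        have := h8.map_keys (by rwa [hky])
        rwa [hky, Ctx.tys_zip h5.ge] at this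
      rw [htys, List.map_append, List.map_append, hy, hA.map_keys (Ctx.nodup_consec _ _), haux,
        Ctx.tys_consec, ((Ctx.sub_append_left _ _).trans hΘ).map_get h7, hci, hco]
      simp
  have hl1 : xs.length = (Ctx.keys c.ins).length := by
    rw [length_eq_of_map_get h7, ← hci, Ctx.length_keys, Ctx.length_tys]
  have hl2 : (Ctx.keys aux).length = (Ctx.keys c.rest).length := by
    rw [haux, Ctx.length_keys, Ctx.length_keys, Ctx.length_consec, Ctx.length_tys]
  have hl3 : ys.length = (Ctx.keys Ω').length := by
    rw [h5, ← hco, hΩ', copyCtx, Ctx.length_keys, Ctx.length_consec]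
  refine ⟨.call (.gen c.procs.length) (xs ++ Ctx.keys aux ++ ys), Ctx.tys c.rest,
    (.gen c.procs.length, .defn (Ω ++ Ω') W) :: c.procs, ?_, hinv', hext.trans hext',
    fun Θ hΘ hA => ⟨(hm hΘ hA).nodup, .defn (Ω ++ Ω') W, by rw [lookup_cons, if_pos rfl], (hm hΘ hA).types⟩,
    fun Θ hΘ hA => ?_⟩
  · rw [Stmt.compile, hc, ← hW]
    rfl
  · have hM := hm hΘ hA
    rw [sem_call (ProcCtx.sem_cons_self V _ _ W _)]
    have hpres : Pres (Ω ++ Ω') fun e => Env.set e (Ctx.keys Ω') (s f ((Ctx.keys c.ins).map e)) :=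
      fun e he => by
        have hd : ∀ x ∈ Ctx.keys Ω', x ∉ Ctx.keys Ω := fun x hx hx' => by
          rw [Ctx.keys_append] at hnW
          exact (List.nodup_append'.1 hnW).2.2 hx' hx
        have g1 : (Ctx.keys Ω').map (Ctx.get (Ω ++ Ω')) = (Ctx.tys c.outs).map some := by
          have := (Ctx.sub_append_right hd).map_keys (Ctx.nodup_consec _ _)
          rwa [hΩ', copyCtx, Ctx.tys_consec] at this
        have g2 : (Ctx.keys c.ins).map (Ctx.get (Ω ++ Ω')) = (Ctx.tys c.ins).map some :=
          ((Ctx.sub_append_left _ _).trans (Ctx.sub_append_left _ _)).map_keys hspec.ins_nodup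
        exact he.set g1 (hspec.range _ (he.hasTys g2))
    have h1 := hM.at_approx (by linarith) happ
      (Z' := {x | x ∈ Ctx.keys (ys.zip G.outTys) ∨ x ∈ Ctx.keys aux}) fun z hz => by
        rw [hkeys]
        simp only [zip_append₃ hl1 hl2, hky]
        rcases hz with hz | hz
        · obtain ⟨x, hx⟩ := exists_zip_right_of_length hl2 hz
          exact ⟨x, Or.inr (List.of_mem_zip hx).1, Or.inr (Or.inl hx)⟩
        · obtain ⟨x, hx⟩ := exists_zip_right_of_length hl3 hz
          exact ⟨x, Or.inl (List.of_mem_zip hx).1, Or.inr (Or.inr hx)⟩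
    rw [hM.at_pushOp hpres] at h1
    refine (h1.mono subset_rfl (by linarith)).congr_right fun e he _ => ?_
    have hin : (Ctx.keys c.ins).map (pull (xs ++ Ctx.keys aux ++ ys) (Ω ++ Ω') e) = xs.map e :=
      (map_eq_of_zip hl1 fun p hp => (hM.pull_of_zip e (by
        rw [hkeys, zip_append₃ hl1 hl2]; exact Or.inl hp)).symm).symm
    have hvs : HasTys (s f (xs.map e)) (Ctx.tys c.outs) := hspec.range _ (hci ▸
      he.hasTys (((Ctx.sub_append_left _ _).trans hΘ).map_get h7))
    rw [hin, hM.put_set e hl3 (by rw [hvs.length, hco, ← h5, hl3]) fun p hp => by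
      rw [hkeys, zip_append₃ hl1 hl2]; exact Or.inr (Or.inr hp)]
    rw [Stmt.exec]

end Compile

/-! ### Compiled search, and the induction over statements -/

section Compile

variable {V : UInterp} {tick : FName → ℕ} {Φ₀ Φ : FunCtx} {s : FName → List ℕ → List ℕ}
  {cf : FName → ℝ → ProcCtx → Option CFun}

theorem anyQueries_pos (N : Ty) {δ : ℝ} (h0 : 0 < δ) (h1 : δ ≤ 1) : 2 ≤ anyQueries N δ := by
  have h2 : 0 < groverIters N := groverIters_pos N.pos
  have h3 := groverRuns_pos h0 h1
  have := Nat.mul_pos h2 h3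
  rw [anyQueries]
  omega

/-- With a predicate of precision `δp / 2`, the bound for the search is `Q · δp + δ / 2`, and `δp`
is chosen such that `Q · δp = δ / 2`. The output bit starts at zero, so adding the result to it is
the assignment. -/
theorem compiled_any (hcf : CompilesFuns V tick Φ₀ Φ s cf) {Γ Δ : Ctx} {b : Var} {xs : List Var}
    {f : FName} {Q : ProcCtx} (hQ : Inv V tick Φ₀ Q)
    (h : (Stmt.any b f xs).type Φ Γ = some (Γ ++ Δ)) {δ : ℝ} (hδ : 0 < δ) (hδ1 : δ ≤ 1) {k : ℕ}
    (hk : ∀ x ∈ Ctx.keys (Γ ++ Δ), x < k) :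
    ∃ W Ts Q', (Stmt.any b f xs).compile Φ cf δ k Q = some (W, Ctx.consec k Ts, Q') ∧
      Compiled V tick Φ₀ Q Q' Γ Δ (Ctx.consec k Ts) W ((Stmt.any b f xs).exec Φ s Γ) δ := by
  rw [Stmt.type] at h
  obtain ⟨G, hG, h2⟩ := Option.bind_eq_some_iff.1 h
  split_ifs at h2 with hx
  obtain ⟨hb, hGo, hGi, h6, h7⟩ := hx
  obtain rfl := List.append_cancel_left (Option.some.inj h2)
  obtain ⟨N, hN⟩ : ∃ N, G.inTys.getLast? = some N := ⟨_, List.getLast?_eq_some_getLast hGi⟩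
  -- There is at least one run because `δ / 2 ≤ 1`, hence `Q ≥ 2`. This makes the division
  -- meaningful and keeps `δp / 2` in the range where functions are known to compile correctly.
  have hq := anyQueries_pos N (half_pos hδ) (by linarith)
  have hqr : (2 : ℝ) ≤ anyQueries N (δ / 2) := by exact_mod_cast hq
  set δp := (δ - δ / 2) / anyQueries N (δ / 2) with hδp
  have hp0 : 0 < δp := div_pos (by linarith) (by linarith)
  have hp1 : anyQueries N (δ / 2) * δp = δ - δ / 2 := by
    rw [hδp, mul_div_cancel₀ _ (by linarith)]
  obtain ⟨c, hc, hci, hco, hinv, hext, hspec⟩ := hcf f G hG (δp / 2) (by linarith) (by nlinarith) Q hQ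
  obtain ⟨ins, y, N', hins, hN', hti⟩ := Fun.getLast_inTys hci hGi
  obtain rfl : N = N' := Option.some.inj (hN.symm.trans hN')
  obtain ⟨Γ₁, Γ₂, Γ', W₁, W₂, W, Q₁, Q₂, hQ₁, hQ₂, hany, hΓ', hn₁, hw₁, hn₂, hw₂, hn, hw, happ⟩ :=
    hspec.uAny (by linarith) hinv.toGood (hco.trans hGo) hins (half_pos hδ) rfl
  set m := Ctx.fresh (c.ins ++ c.rest) with hmdef
  set rest := (m + 1, boolTy) :: anyAux c N (δ / 2) with hrest
  obtain ⟨i₁, e₁⟩ := hinv.cons_gen rfl hn₁ hw₁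
  rw [← hQ₁] at i₁ e₁
  obtain ⟨i₂, e₂⟩ := i₁.cons_gen (i := c.procs.length + 1) (by rw [hQ₁]; rfl) hn₂ hw₂
  rw [← hQ₂] at i₂ e₂
  obtain ⟨i₃, e₃⟩ := i₂.cons_gen (i := c.procs.length + 2) (by rw [hQ₂, hQ₁]; rfl) hn hw
  set aux := Ctx.consec k (Ctx.tys rest) with haux
  have hkeys : Ctx.keys Γ' = Ctx.keys ins ++ [m] ++ Ctx.keys rest := by
    rw [hΓ', Ctx.keys_append, Ctx.keys_append]; rfl
  have htys : Ctx.tys Γ' = Ctx.tys ins ++ [boolTy] ++ Ctx.tys rest := by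
    rw [hΓ', Ctx.tys_append, Ctx.tys_append]; rfl
  have hxk : ∀ x ∈ xs, x ∈ Ctx.keys Γ := fun x hx => mem_keys_of_map_get h7 hx
  have hauxk : ∀ x ∈ Ctx.keys aux, k ≤ x := fun x hx => (Ctx.mem_keys_consec.1 hx).1
  have hbk : b < k := hk b (by rw [Ctx.keys_append]; simp [Ctx.keys])
  have hxlt : ∀ x ∈ xs, x < k := fun x hx => hk x (by
    rw [Ctx.keys_append]; exact List.mem_append_left _ (hxk x hx))
  have hgb : ∀ {Θ}, Ctx.Sub (Γ ++ [(b, boolTy)]) Θ → Ctx.get Θ b = some boolTy := fun hΘ => hΘ _ _ (by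
    rw [Ctx.get_append, if_neg hb, Ctx.get_cons, if_pos rfl])
  have hM : ∀ {Θ}, Ctx.Sub (Γ ++ [(b, boolTy)]) Θ → Ctx.Sub aux Θ →
      Match Θ (xs ++ [b] ++ Ctx.keys aux) Γ' := fun {Θ} hΘ hA => by
    refine ⟨List.Nodup.append (List.Nodup.append h6 (by simp) fun x hx hx' => ?_)
      (Ctx.nodup_consec _ _) fun x hx hx' => ?_, hn, ?_⟩
    · exact hb (List.mem_singleton.1 hx' ▸ hxk x hx)
    · have := hauxk x hx'
      rcases List.mem_append.1 hx with hx | hx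
      · have := hxlt x hx
        lia
      · rw [List.mem_singleton] at hx
        lia
    · rw [htys, List.map_append, List.map_append, hA.map_keys (Ctx.nodup_consec _ _), haux,
        Ctx.tys_consec, ((Ctx.sub_append_left _ _).trans hΘ).map_get h7, hti]
      simp [hgb hΘ]
  have hl1 : xs.length = (Ctx.keys ins).length := by
    rw [length_eq_of_map_get h7, ← hti, Ctx.length_keys, Ctx.length_tys]
  have hl2 : (Ctx.keys aux).length = (Ctx.keys rest).length := by
    rw [haux, Ctx.length_keys, Ctx.length_keys, Ctx.length_consec, Ctx.length_tys]
  refine ⟨.call (.gen (c.procs.length + 2)) (xs ++ [b] ++ Ctx.keys aux), Ctx.tys rest,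
    (.gen (c.procs.length + 2), .defn Γ' W) :: Q₂, ?_, i₃, hext.trans (e₁.trans (e₂.trans e₃)),
    fun Θ hΘ hA => ⟨(hM hΘ hA).nodup, .defn Γ' W, by rw [lookup_cons, if_pos rfl], (hM hΘ hA).types⟩,
    fun Θ hΘ hA => ?_⟩
  · rw [Stmt.compile, hG, Option.bind_some, hN, Option.bind_some]
    simp only [← hδp, hc, Option.bind_some, hany]
    rfl
  · have hm := hM hΘ hA
    rw [sem_call (ProcCtx.sem_cons_self V _ _ W _)]
    have hzip : ∀ {p}, p ∈ (xs ++ [b] ++ Ctx.keys aux).zip (Ctx.keys Γ') ↔ p ∈ xs.zip (Ctx.keys ins) ∨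
        p ∈ [b].zip [m] ∨ p ∈ (Ctx.keys aux).zip (Ctx.keys rest) := fun {p} => by
      rw [hkeys, zip_append₃ hl1 (show [b].length = [m].length from rfl)]
    have hbm : (b, m) ∈ (xs ++ [b] ++ Ctx.keys aux).zip (Ctx.keys Γ') := hzip.2 (Or.inr (Or.inl (by simp)))
    have hpres : Pres Γ' fun e => Function.update e m
        ((e m + ind (∃ v, v < (N : ℕ) ∧ searchPred (s f) (Ctx.keys ins) e v)) % 2) := fun e he =>
      he.update (by
        rw [Ctx.dim_of_get (Ctx.get_of_mem hn (x := m) (T := boolTy) (by rw [hΓ']; simp))]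
        exact Nat.mod_lt _ (by decide))
    have h1 := hm.at_approx (by nlinarith) happ
      (Z' := {x | x ∈ Ctx.keys [(b, boolTy)] ∨ x ∈ Ctx.keys aux}) fun z hz => by
        obtain ⟨x, hx⟩ := exists_zip_right_of_length hl2 hz
        exact ⟨x, Or.inr (List.of_mem_zip hx).1, hzip.2 (Or.inr (Or.inr hx))⟩
    rw [hm.at_pushOp hpres] at h1
    refine (h1.mono subset_rfl (by linarith)).congr_right fun e he hz => ?_
    have hb0 : e b = 0 := hz b (Or.inl (by simp [Ctx.keys]))
    have hin : (Ctx.keys ins).map (pull (xs ++ [b] ++ Ctx.keys aux) Γ' e) = xs.map e :=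
      (map_eq_of_zip hl1 fun p hp => (hm.pull_of_zip e (hzip.2 (Or.inl hp))).symm).symm
    rw [hm.put_update e _ hbm, hm.put_pull, hm.pull_of_zip e hbm, hb0, zero_add,
      Nat.mod_eq_of_lt (ind_lt_two _), Stmt.exec, Env.set_singleton]
    simp only [searchPred, hin, hG, Option.bind_some, hN, Option.getD_some, ind]

/-- The auxiliary variables form a block of consecutive names from `k` on, above all program
variables, so freshness in the induction is a comparison of numbers. -/
theorem Stmt.compiled (hcf : CompilesFuns V tick Φ₀ Φ s cf) (hs : RespectsTys Φ s) {S : Stmt}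
    {Γ Δ : Ctx} {Q : ProcCtx} (hQ : Inv V tick Φ₀ Q) (hn : (Ctx.keys Γ).Nodup)
    (h : S.type Φ Γ = some (Γ ++ Δ)) {δ : ℝ} (hδ : 0 < δ) (hδ1 : δ ≤ 1) {k : ℕ}
    (hk : ∀ x ∈ Ctx.keys (Γ ++ Δ), x < k) :
    ∃ W Ts Q', S.compile Φ cf δ k Q = some (W, Ctx.consec k Ts, Q') ∧
      Compiled V tick Φ₀ Q Q' Γ Δ (Ctx.consec k Ts) W (S.exec Φ s Γ) δ := by
  induction S generalizing Γ Δ Q δ k with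
  | assign x E => exact ⟨_, [], _, rfl, compiled_assign hQ h hδ.le⟩
  | call ys f xs => exact compiled_call hcf hQ h hδ hδ1 hk
  | any b f xs => exact compiled_any hcf hQ h hδ hδ1 hk
  | seq S₁ S₂ ih₁ ih₂ =>
    rw [Stmt.type] at h
    obtain ⟨Γ₁, h1, h2⟩ := Option.bind_eq_some_iff.1 h
    obtain ⟨Δ₁, rfl, hn₁⟩ := Stmt.type_append h1 hn
    obtain ⟨Δ₂, hΔ, hn₂⟩ := Stmt.type_append h2 hn₁
    rw [List.append_assoc] at hΔ
    obtain rfl := List.append_cancel_left hΔ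
    rw [← List.append_assoc] at h2 hk hn₂
    have hk₁ : ∀ x ∈ Ctx.keys (Γ ++ Δ₁), x < k := fun x hx => hk x (by
      rw [Ctx.keys_append]; exact List.mem_append_left _ hx)
    obtain ⟨W₁, Ts₁, Q₁, hc₁, H₁⟩ := ih₁ hQ hn h1 (half_pos hδ) (by linarith) hk₁
    -- The second statement takes its auxiliary names after the block of the first, so the two
    -- workspaces are disjoint.
    obtain ⟨W₂, Ts₂, Q₂, hc₂, H₂⟩ := ih₂ H₁.inv hn₁ h2 (half_pos hδ) (by linarith)
      (k := k + Ts₁.length) fun x hx => (hk x hx).trans_le (Nat.le_add_right _ _)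
    refine ⟨.seq W₁ W₂, Ts₁ ++ Ts₂, Q₂, ?_, ?_⟩
    · rw [Stmt.compile, hc₁, Option.bind_some]
      simp only [Ctx.length_consec, hc₂, Option.bind_some, Ctx.consec_append]
    · have he : (Stmt.seq S₁ S₂).exec Φ s Γ = fun e => S₂.exec Φ s (Γ ++ Δ₁) (S₁.exec Φ s Γ e) := by
        funext e
        rw [Stmt.exec, h1]
        rfl
      rw [he, Ctx.consec_append]
      refine H₁.seq hn₂ (fun x hx hx' => ?_) H₂ (fun x hx hx' => ?_) fun Θ hΘ =>
        Stmt.exec_only hs h1 hn hΘ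
      · have h3 := (Ctx.mem_keys_consec.1 hx).1
        have h4 := hk₁ x (by rw [Ctx.keys_append]; exact List.mem_append_right _ hx')
        lia
      · have h3 := (Ctx.mem_keys_consec.1 hx).1
        have h4 := (Ctx.mem_keys_consec.1 hx').2
        lia

end Compile

/-! ## Embeddings as permutations of the basis -/

/-- The action of `Embed[f]` on the basis. -/
def embedMap (Γin Γout : Ctx) (f : State Γin → State Γout) (e : Env) : Env := fun x =>
  if x ∈ Ctx.keys Γout then (e x + (f (State.ofEnv Γin e)).1 x) % Ctx.dim Γout x else e x

theorem Op.embed_eq (Γ Γin Γout : Ctx) (f : State Γin → State Γout) :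
    Op.embed Γ Γin Γout f = pushOp Γ (embedMap Γin Γout f) := by
  ext τ σ
  simp only [Op.embed, pushOp, Matrix.of_apply]
  rfl

section Embed
variable {Γ Γin Γout : Ctx} {f : State Γin → State Γout}

theorem embedMap_only (h : Ctx.Sub Γout Γ) : Only Γ {x | x ∈ Ctx.keys Γout} (embedMap Γin Γout f) := by
  refine ⟨fun e he x => ?_, fun e x hx => if_neg hx⟩
  rw [embedMap]
  split_ifs with hx
  · rw [h.dim hx]; exact Nat.mod_lt _ (Ctx.dim_pos _ _)
  · exact he x

theorem State.ofEnv_congr {e e' : Env} (h : ∀ x ∈ Ctx.keys Γ, e x = e' x) :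
    State.ofEnv Γ e = State.ofEnv Γ e' := by
  rw [State.eq_iff]
  funext x
  change e x % Ctx.dim Γ x = e' x % Ctx.dim Γ x
  by_cases hx : x ∈ Ctx.keys Γ
  · rw [h x hx]
  · rw [Ctx.dim_of_not_mem Γ x hx, Nat.mod_one, Nat.mod_one]

/-- The inputs of `f` lie outside of `Γout` and are unchanged, so the shift of the outputs is known
and can be undone. -/
theorem embed_unitary (h : Ctx.Sub Γout Γ) (hd : ∀ x ∈ Ctx.keys Γin, x ∉ Ctx.keys Γout) :
    Op.embed Γ Γin Γout f ∈ unitaryGroup (State Γ) ℂ := by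
  rw [Op.embed_eq]
  refine pushOp_unitary (embedMap_only h).pres fun e e' he he' heq => ?_
  have hout : ∀ x, x ∉ Ctx.keys Γout → e x = e' x := fun x hx => by
    have := congrFun heq x
    rwa [embedMap, embedMap, if_neg hx, if_neg hx] at this
  have hst : State.ofEnv Γin e = State.ofEnv Γin e' := State.ofEnv_congr fun x hx => hout x (hd x hx)
  funext x
  by_cases hx : x ∈ Ctx.keys Γout
  · have h1 := congrFun heq x
    rw [embedMap, embedMap, if_pos hx, if_pos hx, hst] at h1
    have h2 : e x ≡ e' x [MOD Ctx.dim Γout x] := Nat.ModEq.add_right_cancel' _ h1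
    have h3 := he x
    have h4 := he' x
    rw [h.dim hx] at h3 h4
    exact Nat.ModEq.eq_of_lt_of_lt h2 h3 h4
  · exact hout x hx

theorem embedMap_of_zero {e : Env} {x : Var} (hx : x ∈ Ctx.keys Γout) (h0 : e x = 0) :
    embedMap Γin Γout f e x = (f (State.ofEnv Γin e)).1 x := by
  rw [embedMap, if_pos hx, h0, zero_add, Nat.mod_eq_of_lt ((f _).2 x)]

end Embed

/-! ## Compilation of functions -/

theorem FunCtx.sem_cons (F : Interp) (h : FName) (G : Fun) (Φ : FunCtx) (f : FName) :
    FunCtx.sem F ((h, G) :: Φ) f = fun vs =>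
      if f = h then
        match G with
        | .defn params _ body rets =>
            rets.map (body.exec Φ (FunCtx.sem F Φ) params (Env.set 0 (Ctx.keys params) vs))
        | .decl _ _ =>
            (Ctx.keys G.outCtx).map
              (F f G.inCtx G.outCtx (State.ofEnv _ (Env.set 0 (Ctx.keys G.inCtx) vs))).1
      else FunCtx.sem F Φ f vs := by
  rfl

theorem Fun.decl_disjoint (inTys outTys : List Ty) :
    ∀ x ∈ Ctx.keys (Fun.decl inTys outTys).inCtx, x ∉ Ctx.keys (Fun.decl inTys outTys).outCtx := by
  intro x hx hx'
  rw [Fun.inCtx, Ctx.mem_keys_consec] at hx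
  rw [Fun.outCtx, Ctx.mem_keys_consec] at hx'
  lia

theorem set_zero_map {Ω : Ctx} {e : Env} (he : ∀ x, x ∉ Ctx.keys Ω → e x = 0) :
    Env.set 0 (Ctx.keys Ω) ((Ctx.keys Ω).map e) = e := by
  funext x
  rw [Env.set_map]
  split_ifs with hx
  · rfl
  · exact (he x hx).symm

/-- The functions in a suffix `Φ` of the function context are compiled correctly. -/
structure FunsCorrect (tick : FName → ℕ) (Φ₀ : FunCtx) (F : Interp) (Φ : FunCtx) : Prop where
  respects : RespectsTys Φ (FunCtx.sem F Φ)
  compiles : CompilesFuns (unitaryInterp Φ₀ F) tick Φ₀ Φ (FunCtx.sem F Φ) (FunCtx.compile tick Φ)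

/-- A declared function is interpreted by its embedding, which is an exact basis map. Any positive
precision is met with no error. -/
theorem compile_decl {tick : FName → ℕ} {Φ₀ Φ : FunCtx} {F : Interp} {f : FName} {inTys outTys : List Ty}
    (hf : Φ₀.lookup f = some (.decl inTys outTys)) {δ : ℝ} (hδ : 0 < δ) {Q : ProcCtx}
    (hQ : Inv (unitaryInterp Φ₀ F) tick Φ₀ Q) :
    ∃ c, FunCtx.compile tick ((f, .decl inTys outTys) :: Φ) f δ Q = some c ∧
      Ctx.tys c.ins = (Fun.decl inTys outTys).inTys ∧ Ctx.tys c.outs = (Fun.decl inTys outTys).outTys ∧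
      Inv (unitaryInterp Φ₀ F) tick Φ₀ c.procs ∧ Ext (unitaryInterp Φ₀ F) Q c.procs ∧
      c.Spec (unitaryInterp Φ₀ F) (FunCtx.sem F ((f, .decl inTys outTys) :: Φ) f) δ := by
  set G : Fun := .decl inTys outTys with hG
  have hd := Fun.decl_disjoint inTys outTys
  rw [← hG] at hd
  have hni : (Ctx.keys G.inCtx).Nodup := Ctx.nodup_consec _ _
  have hno : (Ctx.keys G.outCtx).Nodup := Ctx.nodup_consec _ _
  have hn : (Ctx.keys (G.inCtx ++ G.outCtx)).Nodup :=
    Ctx.keys_append_nodup hni hno fun x hx hx' => hd x hx' hx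
  have hsub : Ctx.Sub G.outCtx (G.inCtx ++ G.outCtx) :=
    Ctx.sub_append_right fun x hx hx' => hd x hx' hx
  have hV : unitaryInterp Φ₀ F (.source f) (G.inCtx ++ G.outCtx) =
      Op.embed (G.inCtx ++ G.outCtx) G.inCtx G.outCtx (F f G.inCtx G.outCtx) := by
    simp only [unitaryInterp, hf]
  have hU : Op.embed (G.inCtx ++ G.outCtx) G.inCtx G.outCtx (F f G.inCtx G.outCtx) ∈
      unitaryGroup (State (G.inCtx ++ G.outCtx)) ℂ := embed_unitary hsub hd
  obtain ⟨hI, hE⟩ := hQ.cons_source hf rfl hn (hV ▸ hU)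
  have hsem : FunCtx.sem F ((f, G) :: Φ) f = fun vs => (Ctx.keys G.outCtx).map
      (F f G.inCtx G.outCtx (State.ofEnv _ (Env.set 0 (Ctx.keys G.inCtx) vs))).1 := by
    rw [FunCtx.sem_cons]
    funext vs
    rw [if_pos rfl]
  have hrange : ∀ vs, HasTys vs (Ctx.tys G.inCtx) →
      HasTys (FunCtx.sem F ((f, G) :: Φ) f vs) (Ctx.tys G.outCtx) := fun vs _ => by
    rw [hsem]
    exact (F f G.inCtx G.outCtx _).valid.hasTys (Ctx.map_get_keys hno)
  refine ⟨⟨.source f, G.inCtx, G.outCtx, G.outCtx,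
    (.source f, .decl (G.inCtx ++ G.outCtx) (tick f)) :: Q⟩, ?_, rfl, rfl, hI, hE,
    ⟨hn, hno, Ctx.Sub.refl _, ⟨_, by rw [lookup_cons, if_pos rfl], rfl⟩, hrange,
      _, embedMap G.inCtx G.outCtx (F f G.inCtx G.outCtx), ?_, hU, embedMap_only hsub, ?_, ?_⟩⟩
  · rw [FunCtx.compile, if_pos rfl]
  · rw [ProcCtx.sem_of_decl (t := tick f) (Ω := G.inCtx ++ G.outCtx), hV]
    rw [lookup_cons, if_pos rfl]
  · rw [← Op.embed_eq]
    exact ApproxOp.refl hδ.le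
  · intro e he hz
    have hst : State.ofEnv G.inCtx (Env.set 0 (Ctx.keys G.inCtx) ((Ctx.keys G.inCtx).map e)) =
        State.ofEnv G.inCtx e := State.ofEnv_congr fun y hy => by rw [Env.set_map, if_pos hy]
    rw [hsem]
    beta_reduce
    rw [hst]
    exact List.map_congr_left fun x hx => embedMap_of_zero hx (hz x hx)

/-- The ideal map with garbage is the execution of the body itself: all variables assigned in the
body stay in the workspace, and the outputs are some of them. -/
theorem compile_defn {tick : FName → ℕ} {Φ₀ Φ : FunCtx} {F : Interp} (hΦ : FunsCorrect tick Φ₀ F Φ)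
    {f : FName} {params : Ctx} {retTys : List Ty} {body : Stmt} {rets : List Var}
    (hwf : (Fun.defn params retTys body rets).WF Φ) :
    (∀ vs, HasTys vs (Fun.defn params retTys body rets).inTys →
      HasTys (FunCtx.sem F ((f, .defn params retTys body rets) :: Φ) f vs)
        (Fun.defn params retTys body rets).outTys) ∧
    ∀ δ : ℝ, 0 < δ → δ ≤ 1 → ∀ Q, Inv (unitaryInterp Φ₀ F) tick Φ₀ Q →
      ∃ c, FunCtx.compile tick ((f, .defn params retTys body rets) :: Φ) f δ Q = some c ∧
        Ctx.tys c.ins = (Fun.defn params retTys body rets).inTys ∧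
        Ctx.tys c.outs = (Fun.defn params retTys body rets).outTys ∧
        Inv (unitaryInterp Φ₀ F) tick Φ₀ c.procs ∧ Ext (unitaryInterp Φ₀ F) Q c.procs ∧
        c.Spec (unitaryInterp Φ₀ F) (FunCtx.sem F ((f, .defn params retTys body rets) :: Φ) f) δ := by
  obtain ⟨hnp, hnr, hrp, Γ', hty, hret⟩ := hwf
  obtain ⟨Δ, rfl, hn'⟩ := Stmt.type_append hty hnp
  have hlen := length_eq_of_map_get hret
  have hok : Ctx.keys (rets.zip retTys) = rets := Ctx.keys_zip hlen.le
  have hot : Ctx.tys (rets.zip retTys) = retTys := Ctx.tys_zip hlen.ge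
  have hsem : FunCtx.sem F ((f, .defn params retTys body rets) :: Φ) f = fun vs =>
      rets.map (body.exec Φ (FunCtx.sem F Φ) params (Env.set 0 (Ctx.keys params) vs)) := by
    rw [FunCtx.sem_cons]
    funext vs
    rw [if_pos rfl]
  have hrange : ∀ vs, HasTys vs (Ctx.tys params) →
      HasTys (FunCtx.sem F ((f, .defn params retTys body rets) :: Φ) f vs)
        (Ctx.tys (rets.zip retTys)) := fun vs hvs => by
    rw [hsem, hot]
    have h1 : Valid (params ++ Δ) (Env.set 0 (Ctx.keys params) vs) :=
      (valid_zero _).set ((Ctx.sub_append_left _ _).map_keys hnp) hvs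
    exact ((Stmt.exec_only hΦ.respects hty hnp (Ctx.Sub.refl _)).pres _ h1).hasTys hret
  refine ⟨hrange, fun δ hδ hδ1 Q hQ => ?_⟩
  obtain ⟨W, Ts, Q', hc, H⟩ := Stmt.compiled hΦ.compiles hΦ.respects hQ hnp hty hδ hδ1
    (k := Ctx.fresh (params ++ Δ)) fun x hx => Ctx.lt_fresh hx
  set aux := Ctx.consec (Ctx.fresh (params ++ Δ)) Ts with haux
  have hauxn : ∀ x ∈ Ctx.keys aux, x ∉ Ctx.keys (params ++ Δ) := fun x hx =>
    Ctx.not_mem_of_fresh_le (Ctx.mem_keys_consec.1 hx).1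
  have hn : (Ctx.keys (params ++ Δ ++ aux)).Nodup :=
    Ctx.keys_append_nodup hn' (Ctx.nodup_consec _ _) hauxn
  have hs1 : Ctx.Sub (params ++ Δ) (params ++ Δ ++ aux) := Ctx.sub_append_left _ _
  have hs2 : Ctx.Sub aux (params ++ Δ ++ aux) := Ctx.sub_append_right hauxn
  have hwt := H.wt _ hs1 hs2
  obtain ⟨hI, hE⟩ := H.inv.cons_gen rfl hn hwt
  have hassoc : params ++ (Δ ++ aux) = params ++ Δ ++ aux := (List.append_assoc _ _ _).symm
  have hkr : {x | x ∈ Ctx.keys (Δ ++ aux)} = {x | x ∈ Ctx.keys Δ ∨ x ∈ Ctx.keys aux} := by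
    ext x
    rw [Set.mem_ofPred_eq, Ctx.keys_append, List.mem_append]
    rfl
  have ho := Stmt.exec_only hΦ.respects hty hnp hs1
  refine ⟨⟨.gen Q'.length, params, rets.zip retTys, Δ ++ aux,
    (.gen Q'.length, .defn (params ++ Δ ++ aux) W) :: Q'⟩, ?_, rfl, rfl, hI, H.ext.trans hE, ?_⟩
  · rw [FunCtx.compile, if_pos rfl]
    simp only [hty, Option.bind_some, hc]
    refine congrArg some ?_
    rw [List.drop_left]
    rfl
  refine ⟨?_, by rw [hok]; exact hnr, ?_, ⟨.defn (params ++ Δ ++ aux) W, ?_, ?_⟩, hrange, ?_⟩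
  · rw [hassoc]; exact hn
  · intro x T hx
    have hx' : x ∈ rets := hok ▸ Ctx.mem_keys_of_get hx
    rw [Ctx.get_zip_of_map_get hret hx', Ctx.get_append, if_neg (hrp x hx')] at hx
    exact Ctx.sub_append_left _ _ _ _ hx
  · rw [lookup_cons, if_pos rfl]
  · exact hassoc.symm
  -- The context of the specification and that of the generated procedure differ by associativity of
  -- `++`. Operators are indexed by contexts, so the claim is generalised to a variable context that
  -- can be substituted.
  · suffices key : ∀ Θ, Θ = params ++ Δ ++ aux → ∃ (U : Op Θ) (h : Env → Env),
        ProcCtx.sem (unitaryInterp Φ₀ F) ((.gen Q'.length, .defn (params ++ Δ ++ aux) W) :: Q')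
          (.gen Q'.length) = some ⟨Θ, U⟩ ∧ U ∈ unitaryGroup (State Θ) ℂ ∧
        Only Θ {x | x ∈ Ctx.keys (Δ ++ aux)} h ∧
        ApproxOp Θ {x | x ∈ Ctx.keys (Δ ++ aux)} U (pushOp Θ h) δ ∧
        ∀ e, Valid Θ e → (∀ z ∈ Ctx.keys (Δ ++ aux), e z = 0) →
          (Ctx.keys (rets.zip retTys)).map (h e) =
            FunCtx.sem F ((f, .defn params retTys body rets) :: Φ) f ((Ctx.keys params).map e) from
      key _ hassoc
    rintro _ rfl
    refine ⟨_, body.exec Φ (FunCtx.sem F Φ) params, ProcCtx.sem_cons_self _ _ _ W _,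
      H.inv.toGood.sound.sem_unitary hwt, ⟨ho.pres, fun e x hx => ho.eq e x fun h => hx ?_⟩,
      hkr ▸ H.approx _ hs1 hs2, fun e he hz => ?_⟩
    · rw [hkr]; exact Or.inl h
    rw [hok, hsem]
    beta_reduce
    rw [set_zero_map]
    intro x hx
    by_cases hx' : x ∈ Ctx.keys (Δ ++ aux)
    · exact hz x hx'
    · refine he.eq_zero ?_
      rw [← hassoc, Ctx.keys_append, List.mem_append, not_or]
      exact ⟨hx, hx'⟩

theorem lookup_of_wf {Φ : FunCtx} {f : FName} (h : f ∉ Φ.map Prod.fst) : Φ.lookup f = none := by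
  rw [List.lookup_eq_none_iff]
  intro p hp
  rw [bne_iff_ne]
  rintro rfl
  exact h (List.mem_map_of_mem hp)

/-- The induction runs over suffixes `Φ`, since functions call only earlier ones. The whole program
`Φ₀` stays fixed, because it determines the interpretation of declared procedures. -/
theorem FunCtx.correct (tick : FName → ℕ) (Φ₀ : FunCtx) (F : Interp) {Φ : FunCtx} (hΦ : FunCtx.WF Φ)
    (hsub : ∀ f G, Φ.lookup f = some G → Φ₀.lookup f = some G) : FunsCorrect tick Φ₀ F Φ := by
  induction Φ with
  | nil => exact ⟨fun f G h => by simp at h, fun f G h => by simp at h⟩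
  | cons p Φ ih =>
    obtain ⟨h, G⟩ := p
    obtain ⟨hh, hG, hwf⟩ := hΦ
    have ih' := ih hwf fun f G' hf => hsub f G' (by
      rw [lookup_cons, if_neg, hf]
      rintro rfl
      rw [lookup_of_wf hh] at hf
      simp at hf)
    have hself := hsub h G (by rw [lookup_cons, if_pos rfl])
    refine ⟨fun f G' hf => ?_, fun f G' hf => ?_⟩ <;> rw [lookup_cons] at hf <;> split_ifs at hf with hfh
    · subst hfh
      cases hf
      cases G with
      | defn params retTys body rets => exact (compile_defn ih' hG).1
      | decl inTys outTys =>
        -- That results have the declared types is part of the specification of the compiled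
        -- function; the precision `1` is an arbitrary choice.
        obtain ⟨c, -, hi, ho, -, -, hs⟩ := compile_decl (Φ := Φ) (δ := 1) hself one_pos
          (Inv.nil (V := unitaryInterp Φ₀ F) (tick := tick))
        intro vs hvs
        rw [← ho]
        exact hs.range vs (hi ▸ hvs)
    · rw [FunCtx.sem_cons]
      simp only [if_neg hfh]
      exact ih'.respects f G' hf
    · subst hfh
      cases hf
      cases G with
      | defn params retTys body rets => exact (compile_defn ih' hG).2
      | decl inTys outTys => exact fun δ hδ _ Q hQ => compile_decl hself hδ hQ
    · rw [FunCtx.sem_cons]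
      simp only [if_neg hfh]
      have h1 : FunCtx.compile tick ((h, G) :: Φ) f = FunCtx.compile tick Φ f := by
        funext δ Q
        exact if_neg hfh
      rw [h1]
      exact ih'.compiles f G' hf

/-! ## The distance -/

open scoped Matrix.Norms.L2Operator in
theorem l2_opNorm_le_of_vn_le {ι κ : Type*} [Fintype ι] [Fintype κ] [DecidableEq κ]
    {A : Matrix ι κ ℂ} {ε : ℝ} (hε : 0 ≤ ε) (h : ∀ φ : κ → ℂ, vn (A *ᵥ φ) ≤ ε * vn φ) : ‖A‖ ≤ ε := by
  rw [Matrix.l2_opNorm_def]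
  exact ContinuousLinearMap.opNorm_le_bound _ hε fun φ => h φ.ofLp

/-! ### From vectors with zeros to the operator norm -/

section ZeroInit
variable {Γ Γ₀ : Ctx}

theorem Valid.of_sub (h : Ctx.Sub Γ₀ Γ) {e : Env} (he : Valid Γ₀ e) : Valid Γ e := fun x => by
  by_cases hx : x ∈ Ctx.keys Γ₀
  · rw [h.dim hx]; exact he x
  · rw [he.eq_zero hx]; exact Ctx.dim_pos _ _

theorem zeroInit_zeroOn {Z : Set Var} (hZ : ∀ z ∈ Z, z ∉ Ctx.keys Γ₀) (φ : State Γ₀ → ℂ) :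
    ZeroOn Z (zeroInit Γ Γ₀ *ᵥ φ) := by
  intro τ hτ z hz
  obtain ⟨σ, -, hσ⟩ := Finset.exists_ne_zero_of_sum_ne_zero hτ
  have h1 : τ.1 = σ.1 := by
    by_contra h
    simp [zeroInit, h] at hσ
  rw [h1]
  exact σ.valid.eq_zero (hZ z hz)

theorem vn_zeroInit (h : Ctx.Sub Γ₀ Γ) (φ : State Γ₀ → ℂ) : vn (zeroInit Γ Γ₀ *ᵥ φ) ≤ vn φ := by
  classical
  refine vn_le_vn (le_of_eq ?_)
  have hv : ∀ σ : State Γ₀, (State.ofEnv Γ σ.1).1 = σ.1 := fun σ =>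
    State.ofEnv_val (σ.valid.of_sub h)
  refine (Fintype.sum_of_injective (fun σ : State Γ₀ => State.ofEnv Γ σ.1) (fun σ σ' hs => ?_) _ _
    (fun τ hτ => ?_) fun σ => ?_).symm
  · rw [State.eq_iff, ← hv σ, ← hv σ']
    exact congrArg _ hs
  · have : (zeroInit Γ Γ₀ *ᵥ φ) τ = 0 := by
      by_contra h0
      obtain ⟨σ, -, hσ⟩ := Finset.exists_ne_zero_of_sum_ne_zero h0
      refine hτ ⟨σ, State.eq_iff.2 ?_⟩
      by_contra h1
      rw [hv] at h1
      simp [zeroInit, Ne.symm h1] at hσ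
    rw [this]
    simp
  · have : (zeroInit Γ Γ₀ *ᵥ φ) (State.ofEnv Γ σ.1) = φ σ := by
      simp only [mulVec, dotProduct, zeroInit, Matrix.of_apply, hv, ← State.eq_iff, ite_mul, one_mul,
        zero_mul]
      simp
    rw [this]

/-- The initialisation does not increase norms, and its image consists of vectors in which all
variables outside of `Γ₀` are zero. On these the approximation applies. -/
theorem unitaryDist_le {U U' : Op Γ} {ε : ℝ} (hε : 0 ≤ ε) (h : Ctx.Sub Γ₀ Γ) {Z : Set Var}
    (hZ : ∀ z ∈ Z, z ∉ Ctx.keys Γ₀) (hU : ApproxOp Γ Z U U' ε) : unitaryDist Γ Γ₀ U U' ≤ ε := by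
  refine l2_opNorm_le_of_vn_le hε fun φ => ?_
  rw [sub_mulVec, ← mulVec_mulVec, ← mulVec_mulVec]
  exact (hU _ (zeroInit_zeroOn hZ φ)).trans (mul_le_mul_of_nonneg_left (vn_zeroInit h φ) hε)

end ZeroInit

/-- On zero outputs, adding the result modulo the sizes of the types is the same as overwriting.
This connects the ideal map of the induction with the embedding of the semantics. -/
theorem embedMap_den {Φ : FunCtx} {F : Interp} (hs : RespectsTys Φ (FunCtx.sem F Φ)) {Γin Γout aux : Ctx}
    (hn : (Ctx.keys Γin).Nodup) {S : Stmt} (hS : S.type Φ Γin = some (Γin ++ Γout)) {e : Env}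
    (hsub : Ctx.Sub Γout (Γin ++ Γout ++ aux)) (he : Valid (Γin ++ Γout ++ aux) e)
    (hz : ∀ z, z ∈ Ctx.keys Γout ∨ z ∈ Ctx.keys aux → e z = 0) :
    embedMap Γin Γout (S.den Φ F Γin Γout) e = S.exec Φ (FunCtx.sem F Φ) Γin e := by
  have ho := Stmt.exec_only hs hS hn (Ctx.sub_append_left (Γin ++ Γout) aux)
  have hin : Valid Γin e := fun x => by
    by_cases hx : x ∈ Ctx.keys Γin
    · rw [← ((Ctx.sub_append_left _ _).trans (Ctx.sub_append_left (Γin ++ Γout) aux)).dim hx]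
      exact he x
    · have h0 : e x = 0 := by
        by_cases hx' : x ∈ Ctx.keys Γout ∨ x ∈ Ctx.keys aux
        · exact hz x hx'
        · refine he.eq_zero fun h => hx' ?_
          simp only [Ctx.keys_append, List.mem_append] at h
          tauto
      rw [h0]
      exact Ctx.dim_pos _ _
  funext x
  by_cases hx : x ∈ Ctx.keys Γout
  · rw [embedMap_of_zero hx (hz x (Or.inl hx)), Stmt.den, State.ofEnv_val hin]
    have := ho.pres e he x
    rw [hsub.dim hx] at this
    exact Nat.mod_eq_of_lt this
  · rw [embedMap, if_neg hx, ho.eq e x hx]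

end Traq

theorem mainTheorem3
    (tick : Traq.FName → ℕ) (Φ : Traq.FunCtx) (hΦ : Traq.FunCtx.WF Φ) (F : Traq.Interp)
    (Γin Γout : Traq.Ctx) (hΓ : (Traq.Ctx.keys Γin).Nodup)
    (S : Traq.Stmt) (hS : Traq.Stmt.type Φ Γin S = some (Γin ++ Γout))
    (δ : ℝ) (hδ₀ : 0 < δ) (hδ₁ : δ ≤ 1) :
    ∃ (W : Traq.UStmt) (Γaux : Traq.Ctx) (Q : Traq.ProcCtx),
      Traq.UCompile tick Φ Γin δ S = some (W, Γaux, Q) ∧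
      (Traq.Ctx.keys (Γin ++ Γout ++ Γaux)).Nodup ∧
      Traq.ProcCtx.WT Q ∧
      Traq.UStmt.WT Q (Γin ++ Γout ++ Γaux) W ∧
      Traq.UStmt.sem (Traq.ProcCtx.sem (Traq.unitaryInterp Φ F) Q) (Γin ++ Γout ++ Γaux) W ∈
        Matrix.unitaryGroup (Traq.State (Γin ++ Γout ++ Γaux)) ℂ ∧
      Traq.unitaryDist (Γin ++ Γout ++ Γaux) Γin
        (Traq.UStmt.sem (Traq.ProcCtx.sem (Traq.unitaryInterp Φ F) Q) (Γin ++ Γout ++ Γaux) W)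
        (Traq.Op.embed (Γin ++ Γout ++ Γaux) Γin Γout (Traq.Stmt.den Φ F Γin Γout S)) ≤ δ := by
  have hc := Traq.FunCtx.correct tick Φ F hΦ fun _ _ h => h
  obtain ⟨Δ, hΔ, hn⟩ := Traq.Stmt.type_append hS hΓ
  obtain ⟨W, Ts, Q, hW, H⟩ := Traq.Stmt.compiled hc.compiles hc.respects Traq.Inv.nil hΓ hS hδ₀ hδ₁
    (k := Traq.Ctx.fresh (Γin ++ Γout)) fun x hx => Traq.Ctx.lt_fresh hx
  have haux : ∀ x ∈ Traq.Ctx.keys (Traq.Ctx.consec (Traq.Ctx.fresh (Γin ++ Γout)) Ts),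
      x ∉ Traq.Ctx.keys (Γin ++ Γout) := fun x hx =>
    Traq.Ctx.not_mem_of_fresh_le (Traq.Ctx.mem_keys_consec.1 hx).1
  have hout : ∀ x ∈ Traq.Ctx.keys Γout, x ∉ Traq.Ctx.keys Γin := fun x hx hx' => by
    rw [Traq.Ctx.keys_append] at hn
    exact (List.nodup_append'.1 hn).2.2 hx' hx
  have hs1 := Traq.Ctx.sub_append_left (Γin ++ Γout)
    (Traq.Ctx.consec (Traq.Ctx.fresh (Γin ++ Γout)) Ts)
  have hs2 := Traq.Ctx.sub_append_right haux
  have hwt := H.wt _ hs1 hs2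
  refine ⟨W, _, Q, ?_, Traq.Ctx.keys_append_nodup hn (Traq.Ctx.nodup_consec _ _) haux, H.inv.wt, hwt,
    H.inv.toGood.sound.sem_unitary hwt, Traq.unitaryDist_le hδ₀.le
      ((Traq.Ctx.sub_append_left _ _).trans hs1) ?_ (Traq.Op.embed_eq _ _ _ _ ▸
        (H.approx _ hs1 hs2).congr_right fun e he hz => (Traq.embedMap_den hc.respects hΓ hS
          ((Traq.Ctx.sub_append_right hout).trans hs1) he hz).symm)⟩
  · rw [Traq.UCompile, hS, Option.bind_some, hW]
  · rintro z (hz | hz) hz'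
    · exact hout z hz hz'
    · exact haux z hz (by rw [Traq.Ctx.keys_append]; exact List.mem_append_left _ hz')
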